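/- Let $M$ be a smooth manifold (finite-dimensional, Hausdorff, second countable, without boundary) and $n\in\mathbb Z$. **Modular forms.** Let $\mathfrak H\subset\mathbb C$ be the upper half plane. For $k,l\in\mathbb Z$ let $\mathrm{mf}^{k,l}$ be the space of smooth $f:\mathfrak H\times\mathbb R_{>0}\to\mathbb C$ with $$f\Big(\tfrac{a\tau+b}{c\tau+d},\,|c\tau+d|\,\ell\Big)=\epsilon^{-k}\bar\epsilon^{-l}f(\tau,\ell)\qquad\text{for all }\begin{pmatrix}a&b\\c&d\end{pmatrix}\in \mathrm{SL}_2(\mathbb Z)\text{ and all }\epsilon\in\mathbb C\text{ with }\epsilon^2=c\tau+d .$$ Here $(\tau,\ell)$ stands for the based lattice $(\ell\tau,\ell)$, of volume $v=\ell^2\,\mathrm{im}\,\tau$; $\partial_v$ is taken at fixed $\tau$, and $\partial_{\bar\tau}$ at fixed $v$. Let $(\mathrm{MF}^\omega)^k$ be the space of holomorphic functions on $\mathfrak H$ (with no growth condition) that transform under $\mathrm{SL}_2(\mathbb Z)$ with weight $-k/2$ if $k$ is even, and let it be $0$ if $k$ is odd; pullback along $\mathfrak H\times\mathbb R_{>0}\to\mathfrak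 H$ embeds it in $\mathrm{mf}^{k,0}$. For a graded space $C$ of functions of this kind, $\Omega^j(M;C^k)$ is the space of smooth families of complex-valued $j$-forms on $M$ whose values on tangent vectors lie in $C^k$, $d$ is the exterior derivative along $M$, and $\mathrm H^n(M;C)=\bigoplus_{j+k=n}\mathrm H^j(\Omega^\bullet(M;C^k))$. **Sections.** Let $\mathrm{Lat}$ be the space of $(\ell_1,\ell_2)\in\mathbb C^2$ with $\ell_1/\ell_2\in\mathfrak H$, let $s\mathrm{Lat}$ be the space of based super lattices $\langle(\ell_i,\bar\ell_i,\lambda_i)\rangle_{i=1,2}$ in the super translation group $\mathbb E^{2|1}$, whose product is $(z,\bar z,\theta)(z',\bar z',\theta')=(z+z',\bar z+\bar z'+\theta\theta',\theta+\theta')$, so that $C^\infty(s\mathrm{Lat})=C^\infty(\mathrm{Lat})[\lambda_1,\lambda_2]/(\lambda_1\lambda_2)$, and let $\mathcal L_0^{2|1}(M)=\mathrm{Map}(\mathbb R^{0|1},M)\times s\mathrm{Lat}$ be the space of nearly constant supertori in $M$. As $C^\infty(\mathrm{Map}(\mathbb R^{0|1},M))=\Omega^\bullet(M)$, functions on it have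 the form $\omega=\omega_0+\lambda_1\omega_1+\lambda_2\omega_2$ with $\omega_i$ smooth families of forms on $M$ over $\mathrm{Lat}$. An element $g\in\mathbb E^{2|1}$ takes a map $\mathbb R^{2|1}/\Lambda\to M$ to its composite with $g^{-1}:\mathbb R^{2|1}/g\Lambda g^{-1}\to\mathbb R^{2|1}/\Lambda$; $\mathrm{SL}_2(\mathbb Z)$ acts by change of basis on $(\ell_1,\ell_2)$ and $(\lambda_1,\lambda_2)$; and $u\in\mathrm{Spin}(2)=\mathrm U(1)$ acts by $\ell_i\mapsto u^2\ell_i$, $\lambda_i\mapsto\bar u\lambda_i$, and $\alpha\mapsto\bar u^{-j}\alpha$ for $\alpha\in\Omega^j(M)$. Let $\Gamma(\mathcal L_0^{2|1}(M);\mathrm{Pf}^{\otimes-n})$ be the space of sections of the tensor power $\mathrm{Pf}^{\otimes -n}$ of the Pfaffian line over $\mathcal L_0^{2|1}(M)/\!\!/(\mathbb E^{2|1}\rtimes\mathrm{Spin}(2)\times\mathrm{SL}_2(\mathbb Z))$, i.e. the space of functions $\omega$ that are invariant under $\mathbb E^{2|1}$ and $\mathrm{SL}_2(\mathbb Z)$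 and on which $u\in\mathrm{Spin}(2)$ acts by $u^n$. **Proposition.** (a) The linear map $\omega\mapsto(Z,Z_v,Z_{\bar\tau})$ given, at the lattice $(\ell\tau,\ell)$ and in form degree $j$, by $$Z=\ell^{-\frac{n+j}2}(2\,\mathrm{im}\,\tau)^{-\frac j2}\,\omega_0,\quad Z_v=-\ell^{-\frac{n+j+3}2}(2\,\mathrm{im}\,\tau)^{-\frac{j+3}2}(\bar\tau\omega_1+\omega_2),\quad Z_{\bar\tau}=\tfrac i2\,\ell^{-\frac{n+j-1}2}(2\,\mathrm{im}\,\tau)^{-\frac{j+3}2}(\tau\omega_1+\omega_2)$$ is a bijection of $\Gamma(\mathcal L_0^{2|1}(M);\mathrm{Pf}^{\otimes-n})$ onto the set of triples $$Z\in\bigoplus_{j+k=n}\Omega^j(M;\mathrm{mf}^{k,0}),\qquad Z_v\in\bigoplus_{j+k=n-1}\Omega^j(M;\mathrm{mf}^{k,0}),\qquad Z_{\bar\tau}\in\bigoplus_{j+k=n-1}\Omega^j(M;\mathrm{mf}^{k,-4})$$ that satisfy $$dZ=0,\qquad \partial_vZ=dZ_v,\qquad \partial_{\bar\tau}Z=dZ_{\bar\tau}.$$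 (b) For every section $\omega$ as above (in particular for the section determined by a degree $n$ field theory over $M$), the form $Z$ is closed, and $[\partial_vZ]=0$ in $\mathrm H^n(M;\mathrm{mf}^{\bullet,0})$ and $[\partial_{\bar\tau}Z]=0$ in $\mathrm H^n(M;\mathrm{mf}^{\bullet,-4})$. Moreover $[Z]\in\mathrm H^n(M;\mathrm{MF}^\omega)$: there is exactly one class in $\mathrm H^n(M;\mathrm{MF}^\omega)$ whose image in $\mathrm H^n(M;\mathrm{mf}^{\bullet,0})$ is $[Z]$. -/

import Mathlib

open scoped Manifold ContDiff ComplexConjugate TensorProduct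

noncomputable section

namespace SuperTori

/-! ### Differential forms on a manifold, depending on parameters -/

section Forms

variable {E : Type*} [NormedAddCommGroup E] [NormedSpace ℝ E]
  {M : Type*} [TopologicalSpace M] [ChartedSpace E M]
  {V : Type*} [NormedAddCommGroup V] [NormedSpace ℝ V]

/-- Continuous alternating `j`-linear forms on `E` with values in `F`. -/
abbrev Alt (E : Type*) [NormedAddCommGroup E] [NormedSpace ℝ E]
    (F : Type*) [NormedAddCommGroup F] [NormedSpace ℝ F] (j : ℕ) : Type _ :=
  E [⋀^Fin j]→L[ℝ] F

/-- A (not necessarily smooth) field of complex-valued alternating `j`-forms on the tangent spaces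
of `M`; the tangent space `TangentSpace 𝓘(ℝ, E) x` is, by definition, a copy of `E`. -/
abbrev FormField (E M : Type*) [NormedAddCommGroup E] [NormedSpace ℝ E] (j : ℕ) : Type _ :=
  M → Alt E ℂ j

/-- Families of fields of `j`-forms on `M`, parametrised by points of `V`. -/
abbrev FormFamily (E M V : Type*) [NormedAddCommGroup E] [NormedSpace ℝ E] (j : ℕ) : Type _ :=
  V → FormField E M j

/-- Inhomogeneous families of forms, given by their components in each degree. (The components of
degree larger than `dim M` vanish automatically, so that this is a direct sum.) -/
abbrev TotalFamily (E M V : Type*) [NormedAddCommGroup E] [NormedSpace ℝ E] : Type _ :=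
  (j : ℕ) → FormFamily E M V j

/-- The derivative of a chart `e : M → E`, as a map `TangentSpace 𝓘(ℝ, E) x → E`. -/
def chartDeriv (e : OpenPartialHomeomorph M E) (x : M) : E →L[ℝ] E :=
  (mfderiv 𝓘(ℝ, E) 𝓘(ℝ, E) e x :)

/-- The derivative of an inverse chart, as a map `E → TangentSpace 𝓘(ℝ, E) (e.symm y)`. -/
def chartSymmDeriv (e : OpenPartialHomeomorph M E) (y : E) : E →L[ℝ] E :=
  (mfderiv 𝓘(ℝ, E) 𝓘(ℝ, E) e.symm y :)

/-- The local representative of a field of forms in a chart `e`: its pullback along `e.symm`. -/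
def localRep {j : ℕ} (e : OpenPartialHomeomorph M E) (α : FormField E M j) :
    E → Alt E ℂ j := fun y =>
  (α (e.symm y)).compContinuousLinearMap (chartSymmDeriv e y)

/-- The exterior derivative, computed in charts. -/
def extD {j : ℕ} (α : FormField E M j) : FormField E M (j + 1) := fun x =>
  (extDeriv (localRep (chartAt E x) α) (chartAt E x x)).compContinuousLinearMap
    (chartDeriv (chartAt E x) x)

/-- The exterior derivative (along `M`) of an inhomogeneous family of forms. -/
def dTotal (Z : TotalFamily E M V) : TotalFamily E M V
  | 0 => 0
  | j + 1 => fun p => extD (Z j p)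

variable (E M) in
/-- `Ω^j(M; C^∞(P))` for `P` an open subset of the vector space `V`: families of `j`-forms on `M`
that are jointly smooth in the parameter `p ∈ P` and the point of `M`. As a normalisation, the
family is extended by zero to parameters outside of `P`. -/
def smoothForms (P : Set V) (j : ℕ) :
    Submodule ℂ (FormFamily E M V j) where
  carrier := {α | (∀ p ∉ P, α p = 0) ∧ ∀ x₀ : M,
    ContDiffOn ℝ ∞ (fun q : V × E => localRep (chartAt E x₀) (α q.1) q.2)
      (P ×ˢ (chartAt E x₀).target)}
  add_mem' := by
    rintro α β ⟨h1, h2⟩ ⟨h3, h4⟩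
    refine ⟨fun p hp => ?_, fun x₀ => ?_⟩
    · simp [h1 p hp, h3 p hp]
    · exact (h2 x₀).add (h4 x₀)
  zero_mem' := ⟨fun p _ => rfl, fun x₀ => by
    have : (fun q : V × E => localRep (chartAt E x₀) ((0 : FormFamily E M V j) q.1) q.2)
      = fun _ => 0 := by
        funext q; ext v; simp [localRep]
    rw [this]; exact contDiffOn_const⟩
  smul_mem' := by
    rintro c α ⟨h1, h2⟩
    refine ⟨fun p hp => ?_, fun x₀ => ?_⟩
    · simp [h1 p hp]
    · exact (h2 x₀).const_smul c

variable (E M) in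
/-- `Ω^j(M; C)` for a space `C` of functions on `P`: smooth families of forms all of whose
values on tangent vectors of `M` are, as functions of the parameter, in `C`. -/
def formsIn (P : Set V) (C : Submodule ℂ (V → ℂ)) (j : ℕ) :
    Submodule ℂ (FormFamily E M V j) where
  carrier := {α | α ∈ smoothForms E M P j ∧
    ∀ (x : M) (v : Fin j → E), (fun p => α p x v) ∈ C}
  add_mem' := by
    rintro α β ⟨h1, h2⟩ ⟨h3, h4⟩
    exact ⟨add_mem h1 h3, fun x v => C.add_mem (h2 x v) (h4 x v)⟩
  zero_mem' := ⟨zero_mem _, fun x v => C.zero_mem⟩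
  smul_mem' := by
    rintro c α ⟨h1, h2⟩
    exact ⟨Submodule.smul_mem _ c h1, fun x v => C.smul_mem c (h2 x v)⟩

variable (E M) in
/-- For a `ℤ`-graded space `C` of functions on `P`, the space
`⨁_{j + k = n} Ω^j(M; C^k)` of total degree `n`. -/
def totalForms (P : Set V) (C : ℤ → Submodule ℂ (V → ℂ)) (n : ℤ) :
    Submodule ℂ (TotalFamily E M V) where
  carrier := {Z | ∀ j : ℕ, Z j ∈ formsIn E M P (C (n - j)) j}
  add_mem' := fun h1 h2 j => add_mem (h1 j) (h2 j)
  zero_mem' := fun _ => zero_mem _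
  smul_mem' := fun c _ h j => Submodule.smul_mem _ c (h j)

theorem differentiableAt_localRep {P : Set V} {j : ℕ} {α : FormFamily E M V j}
    (h : α ∈ smoothForms E M P j) (p : V) (x : M) :
    DifferentiableAt ℝ (localRep (chartAt E x) (α p)) (chartAt E x x) := by
  by_cases hp : p ∈ P
  · have h1 : ContDiffOn ℝ ∞ (fun y : E => localRep (chartAt E x) (α p) y)
        (chartAt E x).target :=
      (h.2 x).comp (f := fun y : E => (p, y)) (by fun_prop) (fun y hy => ⟨hp, hy⟩)
    exact (h1.contDiffAt ((chartAt E x).open_target.mem_nhds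
      (mem_chart_target E x))).differentiableAt (by simp)
  · have : localRep (chartAt E x) (α p) = fun _ => 0 := by
      funext y; ext v; simp [localRep, h.1 p hp]
    rw [this]; exact differentiableAt_const _

theorem extD_add {j : ℕ} {α β : FormField E M j}
    (hα : ∀ x, DifferentiableAt ℝ (localRep (chartAt E x) α) (chartAt E x x))
    (hβ : ∀ x, DifferentiableAt ℝ (localRep (chartAt E x) β) (chartAt E x x)) :
    extD (α + β) = extD α + extD β := by
  funext x
  have : localRep (chartAt E x) (α + β)
      = localRep (chartAt E x) α + localRep (chartAt E x) β := by
    funext y; ext v; simp [localRep]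
  ext v
  simp [extD, this, extDeriv_add (hα x) (hβ x)]

theorem extD_smul {j : ℕ} (c : ℂ) {α : FormField E M j}
    (hα : ∀ x, DifferentiableAt ℝ (localRep (chartAt E x) α) (chartAt E x x)) :
    extD (c • α) = c • extD α := by
  funext x
  have : localRep (chartAt E x) (c • α) = c • localRep (chartAt E x) α := by
    funext y; ext v; simp [localRep]
  ext v
  simp only [extD, this, extDeriv, fderiv_const_smul (hα x)]
  simp [ContinuousAlternatingMap.alternatizeUncurryFin_apply]
  left
  simp [extD, extDeriv, ContinuousAlternatingMap.alternatizeUncurryFin_apply]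

theorem dTotal_add {P : Set V} {C C' : ℤ → Submodule ℂ (V → ℂ)} {n m : ℤ}
    {Z W : TotalFamily E M V} (hZ : Z ∈ totalForms E M P C n) (hW : W ∈ totalForms E M P C' m) :
    dTotal (Z + W) = dTotal Z + dTotal W := by
  funext j p
  cases j with
  | zero => simp [dTotal]
  | succ j =>
    exact extD_add (differentiableAt_localRep (hZ j).1 p) (differentiableAt_localRep (hW j).1 p)

theorem dTotal_smul {P : Set V} {C : ℤ → Submodule ℂ (V → ℂ)} {n : ℤ} (c : ℂ)
    {Z : TotalFamily E M V} (hZ : Z ∈ totalForms E M P C n) :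
    dTotal (c • Z) = c • dTotal Z := by
  funext j p
  cases j with
  | zero => simp [dTotal]
  | succ j => exact extD_smul c (differentiableAt_localRep (hZ j).1 p)

theorem dTotal_zero : dTotal (0 : TotalFamily E M V) = 0 := by
  have h := dTotal_smul (E := E) (M := M) (V := V) (P := ∅) (C := fun _ => ⊤) (n := 0) 0
    (zero_mem _)
  simpa using h

variable (E M) in
/-- The closed forms in `⨁_{j + k = n} Ω^j(M; C^k)`. -/
def closedForms (P : Set V) (C : ℤ → Submodule ℂ (V → ℂ)) (n : ℤ) :
    Submodule ℂ (TotalFamily E M V) where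
  carrier := {Z | Z ∈ totalForms E M P C n ∧ dTotal Z = 0}
  add_mem' := by
    rintro Z W ⟨h1, h2⟩ ⟨h3, h4⟩
    exact ⟨add_mem h1 h3, by rw [dTotal_add h1 h3, h2, h4, add_zero]⟩
  zero_mem' := ⟨zero_mem _, dTotal_zero⟩
  smul_mem' := by
    rintro c Z ⟨h1, h2⟩
    exact ⟨Submodule.smul_mem _ c h1, by rw [dTotal_smul c h1, h2, smul_zero]⟩

variable (E M) in
/-- The differentials of forms in `⨁_{j + k = n - 1} Ω^j(M; C^k)`. -/
def exactForms (P : Set V) (C : ℤ → Submodule ℂ (V → ℂ)) (n : ℤ) :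
    Submodule ℂ (TotalFamily E M V) where
  carrier := {Z | ∃ T ∈ totalForms E M P C (n - 1), Z = dTotal T}
  add_mem' := by
    rintro _ _ ⟨T, hT, rfl⟩ ⟨S, hS, rfl⟩
    exact ⟨T + S, add_mem hT hS, (dTotal_add hT hS).symm⟩
  zero_mem' := ⟨0, zero_mem _, dTotal_zero.symm⟩
  smul_mem' := by
    rintro c _ ⟨T, hT, rfl⟩
    exact ⟨c • T, Submodule.smul_mem _ c hT, (dTotal_smul c hT).symm⟩

variable (E M) in
/-- The de Rham cohomology `H^n(M; C) = ⨁_{j + k = n} H^j(M; C^k)`. -/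
abbrev DeRham (P : Set V) (C : ℤ → Submodule ℂ (V → ℂ)) (n : ℤ) :
    Type _ :=
  closedForms E M P C n ⧸ (exactForms E M P C n).comap (closedForms E M P C n).subtype

/-- The Wirtinger derivative `∂/∂z̄ = (∂/∂x + i ∂/∂y) / 2` of a function of `z = x + i y`. -/
def dbar {F : Type*} [NormedAddCommGroup F] [NormedSpace ℝ F] [Module ℂ F] (f : ℂ → F) (z : ℂ) :
    F :=
  (1 / 2 : ℂ) • (fderiv ℝ f z 1 + Complex.I • fderiv ℝ f z Complex.I)

end Forms

/-! ### Lattices, tori, and modular forms -/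

/-- Based oriented lattices `(ℓ₁, ℓ₂)` in `ℂ`, with `ℓ₁ / ℓ₂` in the upper half plane. -/
def latSet : Set (Fin 2 → ℂ) := {p | 0 < (p 0 * conj (p 1)).im}

/-- Pairs `(τ, ℓ)` in `ℍ × ℝ_{>0}`, standing for the based lattice `(ℓ τ, ℓ)`. -/
def torSet : Set (ℂ × ℝ) := {q | 0 < q.1.im ∧ 0 < q.2}

/-- The upper half plane. -/
def upperHalf : Set ℂ := {τ | 0 < τ.im}

/-- The automorphy factor `c τ + d`. -/
def cocycle (γ : Matrix.SpecialLinearGroup (Fin 2) ℤ) (τ : ℂ) : ℂ := (γ 1 0 : ℂ) * τ + (γ 1 1 : ℂ)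

/-- The Möbius action `(a τ + b) / (c τ + d)`. -/
def moebius (γ : Matrix.SpecialLinearGroup (Fin 2) ℤ) (τ : ℂ) : ℂ :=
  ((γ 0 0 : ℂ) * τ + (γ 0 1 : ℂ)) / cocycle γ τ

/-- The space `mf^{k,l}` of smooth functions `f` on `ℍ × ℝ_{>0}` that transform with weight
`(-k/2, -l/2)`, that is, `f (γ τ, |c τ + d| ℓ) = ε ^ (-k) * (conj ε) ^ (-l) * f (τ, ℓ)` for both
square roots `ε` of `c τ + d`. (Functions are extended by zero outside of `ℍ × ℝ_{>0}`.) -/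
def mf (k l : ℤ) : Submodule ℂ (ℂ × ℝ → ℂ) where
  carrier := {f | (∀ q ∉ torSet, f q = 0) ∧ ContDiffOn ℝ ∞ f torSet ∧
    ∀ q ∈ torSet, ∀ (γ : Matrix.SpecialLinearGroup (Fin 2) ℤ) (ε : ℂ), ε ^ 2 = cocycle γ q.1 →
      f (moebius γ q.1, ‖cocycle γ q.1‖ * q.2) = ε ^ (-k) * conj ε ^ (-l) * f q}
  add_mem' := by
    rintro f g ⟨h1, h2, h3⟩ ⟨h4, h5, h6⟩
    refine ⟨fun q hq => by simp [h1 q hq, h4 q hq], h2.add h5, fun q hq γ ε hε => ?_⟩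
    simp only [Pi.add_apply, h3 q hq γ ε hε, h6 q hq γ ε hε]
    ring
  zero_mem' := ⟨fun _ _ => rfl, contDiffOn_const, fun _ _ _ _ _ => by simp⟩
  smul_mem' := by
    rintro c f ⟨h1, h2, h3⟩
    refine ⟨fun q hq => by simp [h1 q hq], contDiffOn_const.mul h2, fun q hq γ ε hε => ?_⟩
    simp only [Pi.smul_apply, smul_eq_mul, h3 q hq γ ε hε]
    ring

/-- Weak modular forms of weight `w`: holomorphic functions on the upper half plane with the
transformation property of weight `w`, without growth conditions. -/
def weakMF (w : ℤ) : Submodule ℂ (ℂ → ℂ) where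
  carrier := {f | (∀ τ ∉ upperHalf, f τ = 0) ∧ DifferentiableOn ℂ f upperHalf ∧
    ∀ τ ∈ upperHalf, ∀ γ : Matrix.SpecialLinearGroup (Fin 2) ℤ,
      f (moebius γ τ) = cocycle γ τ ^ w * f τ}
  add_mem' := by
    rintro f g ⟨h1, h2, h3⟩ ⟨h4, h5, h6⟩
    refine ⟨fun q hq => by simp [h1 q hq, h4 q hq], h2.add h5, fun q hq γ => ?_⟩
    simp only [Pi.add_apply, h3 q hq γ, h6 q hq γ]
    ring
  zero_mem' := ⟨fun _ _ => rfl, differentiableOn_const _, fun _ _ _ => by simp⟩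
  smul_mem' := by
    rintro c f ⟨h1, h2, h3⟩
    refine ⟨fun q hq => by simp [h1 q hq], h2.const_smul c, fun q hq γ => ?_⟩
    simp only [Pi.smul_apply, smul_eq_mul, h3 q hq γ]
    ring

/-- The graded ring `MF^ω` of weak modular forms: `(MF^ω)^k` consists of the forms of weight
`-k/2` if `k` is even, and vanishes if `k` is odd. -/
def MFgraded (k : ℤ) : Submodule ℂ (ℂ → ℂ) := if Even k then weakMF (-(k / 2)) else ⊥

/-! ### The super translation group and its action on nearly constant supertori -/

/-- The superalgebra `ℂ[η, λ₁, λ₂] / (λ₁ λ₂)` on odd generators `η, λ₁, λ₂`. An element is written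
as `c + e η + l₁ λ₁ + l₂ λ₂ + e₁ η λ₁ + e₂ η λ₂`. Here `η` is the odd coordinate of the super
translation group, and `λ₁, λ₂` are those of the space of super lattices. -/
@[ext]
structure Coeff where
  c : ℂ
  e : ℂ
  l₁ : ℂ
  l₂ : ℂ
  e₁ : ℂ
  e₂ : ℂ

namespace Coeff

instance : Zero Coeff := ⟨⟨0, 0, 0, 0, 0, 0⟩⟩
instance : One Coeff := ⟨⟨1, 0, 0, 0, 0, 0⟩⟩
instance : Add Coeff :=
  ⟨fun x y => ⟨x.c + y.c, x.e + y.e, x.l₁ + y.l₁, x.l₂ + y.l₂, x.e₁ + y.e₁, x.e₂ + y.e₂⟩⟩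
instance : Neg Coeff := ⟨fun x => ⟨-x.c, -x.e, -x.l₁, -x.l₂, -x.e₁, -x.e₂⟩⟩
instance : SMul ℂ Coeff :=
  ⟨fun r x => ⟨r * x.c, r * x.e, r * x.l₁, r * x.l₂, r * x.e₁, r * x.e₂⟩⟩
instance : Mul Coeff :=
  ⟨fun x y => ⟨x.c * y.c, x.c * y.e + x.e * y.c, x.c * y.l₁ + x.l₁ * y.c,
    x.c * y.l₂ + x.l₂ * y.c, x.c * y.e₁ + x.e₁ * y.c + x.e * y.l₁ - x.l₁ * y.e,
    x.c * y.e₂ + x.e₂ * y.c + x.e * y.l₂ - x.l₂ * y.e⟩⟩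

theorem zero_def : (0 : Coeff) = ⟨0, 0, 0, 0, 0, 0⟩ := rfl
theorem one_def : (1 : Coeff) = ⟨1, 0, 0, 0, 0, 0⟩ := rfl
theorem add_def (x y : Coeff) : x + y =
    ⟨x.c + y.c, x.e + y.e, x.l₁ + y.l₁, x.l₂ + y.l₂, x.e₁ + y.e₁, x.e₂ + y.e₂⟩ := rfl
theorem neg_def (x : Coeff) : -x = ⟨-x.c, -x.e, -x.l₁, -x.l₂, -x.e₁, -x.e₂⟩ := rfl
theorem smul_def (r : ℂ) (x : Coeff) : r • x =
    ⟨r * x.c, r * x.e, r * x.l₁, r * x.l₂, r * x.e₁, r * x.e₂⟩ := rfl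
theorem mul_def (x y : Coeff) : x * y =
    ⟨x.c * y.c, x.c * y.e + x.e * y.c, x.c * y.l₁ + x.l₁ * y.c,
    x.c * y.l₂ + x.l₂ * y.c, x.c * y.e₁ + x.e₁ * y.c + x.e * y.l₁ - x.l₁ * y.e,
    x.c * y.e₂ + x.e₂ * y.c + x.e * y.l₂ - x.l₂ * y.e⟩ := rfl

instance : Ring Coeff where
  add_assoc x y z := by ext <;> simp only [add_def] <;> ring
  zero_add x := by ext <;> simp [add_def, zero_def]
  add_zero x := by ext <;> simp [add_def, zero_def]
  add_comm x y := by ext <;> simp only [add_def] <;> ring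
  neg_add_cancel x := by ext <;> simp [add_def, zero_def, neg_def]
  nsmul := nsmulRec
  zsmul := zsmulRec
  mul_assoc x y z := by ext <;> simp only [mul_def] <;> ring
  one_mul x := by ext <;> simp [mul_def, one_def]
  mul_one x := by ext <;> simp [mul_def, one_def]
  zero_mul x := by ext <;> simp [mul_def, zero_def]
  mul_zero x := by ext <;> simp [mul_def, zero_def]
  left_distrib x y z := by ext <;> simp only [mul_def, add_def] <;> ring
  right_distrib x y z := by ext <;> simp only [mul_def, add_def] <;> ring

instance : Module ℂ Coeff where
  one_smul x := by ext <;> simp [smul_def]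
  mul_smul r s x := by ext <;> simp only [smul_def] <;> ring
  smul_zero r := by ext <;> simp [smul_def, zero_def]
  smul_add r x y := by ext <;> simp only [smul_def, add_def] <;> ring
  add_smul r s x := by ext <;> simp only [smul_def, add_def] <;> ring
  zero_smul x := by ext <;> simp [smul_def, zero_def]

instance : Algebra ℂ Coeff :=
  Algebra.ofModule (fun r x y => by ext <;> simp only [smul_def, mul_def] <;> ring)
    (fun r x y => by ext <;> simp only [smul_def, mul_def] <;> ring)

/-- The odd generator `η`. -/
def η : Coeff := ⟨0, 1, 0, 0, 0, 0⟩

/-- The odd generators `λ₁, λ₂`. -/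
def lam (i : Fin 2) : Coeff := ![⟨0, 0, 1, 0, 0, 0⟩, ⟨0, 0, 0, 1, 0, 0⟩] i

end Coeff

/-- Points `(z, z̄, θ)` of `ℝ^{2|1}` (equivalently, elements of the super translation group) with
coordinates in `Coeff`. -/
@[ext]
structure SuperPt where
  z : Coeff
  zb : Coeff
  θ : Coeff

namespace SuperPt

/-- The group law `(z, z̄, θ) (z', z̄', θ') = (z + z', z̄ + z̄' + θ θ', θ + θ')` of `𝔼^{2|1}`. -/
instance : Mul SuperPt := ⟨fun g h => ⟨g.z + h.z, g.zb + h.zb + g.θ * h.θ, g.θ + h.θ⟩⟩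

/-- Inversion in `𝔼^{2|1}` (odd elements square to zero). -/
instance : Inv SuperPt := ⟨fun g => ⟨-g.z, -g.zb, -g.θ⟩⟩

end SuperPt

open Coeff in
/-- The universal super translation `(w, w̄, η)` over `w ∈ ℂ`. -/
def superTranslation (w : ℂ) : SuperPt := ⟨algebraMap ℂ Coeff w, algebraMap ℂ Coeff (conj w), η⟩

open Coeff in
/-- The generators `(ℓᵢ, ℓ̄ᵢ, λᵢ)` of the universal super lattice over `(ℓ₁, ℓ₂) = p`. -/
def superLattice (p : Fin 2 → ℂ) (i : Fin 2) : SuperPt :=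
  ⟨algebraMap ℂ Coeff (p i), algebraMap ℂ Coeff (conj (p i)), lam i⟩

/-- A super translation `g` moves the super lattice `Λ` to `g Λ g⁻¹`. This leaves `ℓᵢ` and `λᵢ`
unchanged, and it moves the coordinate `ℓ̄ᵢ` by this (nilpotent) increment. -/
def latticeShift (w : ℂ) (p : Fin 2 → ℂ) (i : Fin 2) : Coeff :=
  (superTranslation w * superLattice p i * (superTranslation w)⁻¹).zb - (superLattice p i).zb

/-- `ℓ₁ ℓ̄₂ - ℓ̄₁ ℓ₂`, that is, `2 i` times the area of the torus. -/
def latDisc (p : Fin 2 → ℂ) : ℂ := p 0 * conj (p 1) - conj (p 0) * p 1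

open Coeff in
/-- The element `ν = (ℓ₁ λ₂ - ℓ₂ λ₁) / (ℓ₁ ℓ̄₂ - ℓ̄₁ ℓ₂)`. -/
def nuC (p : Fin 2 → ℂ) : Coeff := (latDisc p)⁻¹ • (p 0 • lam 1 - p 1 • lam 0)

open Coeff in
/-- The element `κ = (ℓ̄₂ λ₁ - ℓ̄₁ λ₂) / (ℓ₁ ℓ̄₂ - ℓ̄₁ ℓ₂)`. -/
def kappaC (p : Fin 2 → ℂ) : Coeff :=
  (latDisc p)⁻¹ • (conj (p 1) • lam 0 - conj (p 0) • lam 1)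

/-- A super lattice `Λ` trivialises the supertorus `ℝ^{2|1} / Λ` as `ℝ^{2|1} / ℤ²` through
`triv_Λ (x, y, θ) = (ℓ₁ x + ℓ₂ y, (ℓ̄₁ + λ₁ θ) x + (ℓ̄₂ + λ₂ θ) y, θ + λ₁ x + λ₂ y)`.
In these trivialisations, left multiplication by `g⁻¹`, as a map `ℝ^{2|1} / g Λ g⁻¹ → ℝ^{2|1} / Λ`,
is a translation of `(x, y)` (depending on `θ`) together with `θ ↦ a θ + b`, where
`a = 1 - η ν` and `b = -η + w κ + w̄ ν`. Therefore `g` sends a nearly constant supertorus, given by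
`Λ` and `φ : ℝ^{0|1} → M`, to the one given by `g Λ g⁻¹` and `θ ↦ φ (a θ + b)`. -/
def scaleC (p : Fin 2 → ℂ) : Coeff := 1 - Coeff.η * nuC p

/-- The element `b` of the map `θ ↦ a θ + b` of `scaleC`. -/
def shiftC (w : ℂ) (p : Fin 2 → ℂ) : Coeff := -Coeff.η + w • kappaC p + conj w • nuC p

/-! ### Sections of powers of the Pfaffian line -/

section Sections

variable {E : Type*} [NormedAddCommGroup E] [NormedSpace ℝ E]
  {M : Type*} [TopologicalSpace M] [ChartedSpace E M]

/-- Functions on `Map(ℝ^{0|1}, M) × sLat`. Since functions on `Map(ℝ^{0|1}, M)` are differential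
forms on `M`, and functions on `sLat` are `C^∞(Lat)[λ₁, λ₂] / (λ₁ λ₂)`, such a function is
`F = F₀ + λ₁ F₁ + λ₂ F₂`, stored as `(F₀, (F₁, F₂))`, for families `Fᵢ` of forms on `M`
parametrised by `Lat`. -/
abbrev SuperFun (E M : Type*) [NormedAddCommGroup E] [NormedSpace ℝ E] : Type _ :=
  TotalFamily E M (Fin 2 → ℂ) × (Fin 2 → TotalFamily E M (Fin 2 → ℂ))

/-- The derivative `∂ / ∂ℓ̄ᵢ` of a family of forms parametrised by lattices. -/
def dbarLat (i : Fin 2) (α : TotalFamily E M (Fin 2 → ℂ)) : TotalFamily E M (Fin 2 → ℂ) :=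
  fun j p x => dbar (fun z : ℂ => α j (Function.update p i z) x) (p i)

/-- The contribution of `c α` (with `c` a coefficient and `α` a family of forms) to the pullback of
a function along the action map of `𝔼^{2|1}`, at the translation `w` and the lattice `p`, in form
degree `j` and at the point `x` of `M`. The map `φ ↦ (θ ↦ φ (a θ + b))` acts on a form of degree
`k` by `α ↦ a ^ k (α + b dα)`, and the dependence on `ℓ̄ᵢ` is Taylor expanded. -/
def pullForm (w : ℂ) (p : Fin 2 → ℂ) (c : Coeff) (α : TotalFamily E M (Fin 2 → ℂ)) (j : ℕ) (x : M) :
    Coeff ⊗[ℂ] Alt E ℂ j :=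
  (c * scaleC p ^ j) ⊗ₜ[ℂ] α j p x
    + ∑ i, (c * latticeShift w p i * scaleC p ^ j) ⊗ₜ[ℂ] dbarLat i α j p x
    + (c * scaleC p ^ (j - 1) * shiftC w p) ⊗ₜ[ℂ] dTotal α j p x
    + ∑ i, (c * latticeShift w p i * scaleC p ^ (j - 1) * shiftC w p) ⊗ₜ[ℂ]
        dTotal (dbarLat i α) j p x

/-- The pullback of `F` along the action map of `𝔼^{2|1}` on `Map(ℝ^{0|1}, M) × sLat`. -/
def pullAct (w : ℂ) (p : Fin 2 → ℂ) (F : SuperFun E M) (j : ℕ) (x : M) : Coeff ⊗[ℂ] Alt E ℂ j :=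
  pullForm w p 1 F.1 j x + ∑ i, pullForm w p (Coeff.lam i) (F.2 i) j x

/-- The pullback of `F` along the projection of `𝔼^{2|1} × Map(ℝ^{0|1}, M) × sLat` to the last two
factors. -/
def pullProj (p : Fin 2 → ℂ) (F : SuperFun E M) (j : ℕ) (x : M) : Coeff ⊗[ℂ] Alt E ℂ j :=
  1 ⊗ₜ[ℂ] F.1 j p x + ∑ i, Coeff.lam i ⊗ₜ[ℂ] F.2 i j p x

/-- Change of basis of a lattice. -/
def baseChange (γ : Matrix.SpecialLinearGroup (Fin 2) ℤ) (p : Fin 2 → ℂ) : Fin 2 → ℂ :=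
  fun i => ∑ k, (γ i k : ℂ) * p k

/-- Sections of `Pf^{⊗ -n}` over the stack of nearly constant supertori
`(Map(ℝ^{0|1}, M) × sLat) // (𝔼^{2|1} ⋊ Spin(2) × SL₂(ℤ))`: smooth functions `F` that are
invariant under `𝔼^{2|1}` and `SL₂(ℤ)`, and on which `u ∈ Spin(2) = U(1)` acts by `u ^ n`.
The group `SL₂(ℤ)` acts on `(ℓ₁, ℓ₂)` and on `(λ₁, λ₂)` by change of basis. The element `u` sends
`ℓᵢ` to `u² ℓᵢ` and `λᵢ` to `ū λᵢ`, and it multiplies forms of degree `j` by `ū ^ (-j)`. -/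
structure IsPfaffianSection (n : ℤ) (F : SuperFun E M) : Prop where
  smooth₀ : ∀ j, F.1 j ∈ smoothForms E M latSet j
  smooth : ∀ i j, F.2 i j ∈ smoothForms E M latSet j
  translation_invariant : ∀ w : ℂ, ∀ p ∈ latSet, ∀ j x, pullAct w p F j x = pullProj p F j x
  sl_invariant₀ : ∀ (γ : Matrix.SpecialLinearGroup (Fin 2) ℤ), ∀ p ∈ latSet, ∀ j,
    F.1 j (baseChange γ p) = F.1 j p
  sl_invariant : ∀ (γ : Matrix.SpecialLinearGroup (Fin 2) ℤ), ∀ p ∈ latSet, ∀ k j,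
    ∑ i, (γ i k : ℂ) • F.2 i j (baseChange γ p) = F.2 k j p
  spin_weight₀ : ∀ (u : Circle), ∀ p ∈ latSet, ∀ j : ℕ,
    (conj (u : ℂ)) ^ (-(j : ℤ)) • F.1 j (fun i => (u : ℂ) ^ 2 * p i) = (u : ℂ) ^ n • F.1 j p
  spin_weight : ∀ (u : Circle), ∀ p ∈ latSet, ∀ i, ∀ j : ℕ,
    (conj (u : ℂ) * conj (u : ℂ) ^ (-(j : ℤ))) • F.2 i j (fun i => (u : ℂ) ^ 2 * p i)
      = (u : ℂ) ^ n • F.2 i j p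

/-! ### The data attached to a section -/

/-- The derivative `∂_v` with respect to the volume `v = ℓ² Im τ` of the torus, at fixed `τ`. -/
def dVol (Z : TotalFamily E M (ℂ × ℝ)) : TotalFamily E M (ℂ × ℝ) := fun j q x =>
  open Classical in
  if q ∈ torSet then
    deriv (fun v : ℝ => Z j (q.1, √(v / q.1.im)) x) (q.2 ^ 2 * q.1.im)
  else 0

/-- The derivative `∂_{τ̄}` at fixed volume `v = ℓ² Im τ`. -/
def dTauBar (Z : TotalFamily E M (ℂ × ℝ)) : TotalFamily E M (ℂ × ℝ) := fun j q x =>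
  open Classical in
  if q ∈ torSet then
    dbar (fun t : ℂ => Z j (t, √(q.2 ^ 2 * q.1.im / t.im)) x) q.1
  else 0

/-- The value of a family of forms at the based lattice `(ℓ τ, ℓ)`, zero outside `ℍ × ℝ_{>0}`. -/
def atTorus (α : TotalFamily E M (Fin 2 → ℂ)) : TotalFamily E M (ℂ × ℝ) := fun j q x =>
  open Classical in if q ∈ torSet then α j ![q.2 * q.1, q.2] x else 0

set_option linter.unusedSectionVars false in
theorem atTorus_add (α β : TotalFamily E M (Fin 2 → ℂ)) :
    atTorus (α + β) = atTorus α + atTorus β := by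
  funext j q x
  by_cases h : q ∈ torSet <;> simp [atTorus, h]

set_option linter.unusedSectionVars false in
theorem atTorus_smul (c : ℂ) (α : TotalFamily E M (Fin 2 → ℂ)) :
    atTorus (c • α) = c • atTorus α := by
  funext j q x
  by_cases h : q ∈ torSet <;> simp [atTorus, h]

/-- The form `Z = ℓ^{-(n + deg)/2} (2 Im τ)^{-deg/2} F₀`. -/
def formZ (n : ℤ) (F : SuperFun E M) : TotalFamily E M (ℂ × ℝ) := fun j q x =>
  ((q.2 ^ (-((n : ℝ) + j) / 2) * (2 * q.1.im) ^ (-(j : ℝ) / 2) : ℝ) : ℂ) • atTorus F.1 j q x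

/-- The form `Z_v = -ℓ^{-(n + deg + 3)/2} (2 Im τ)^{-(deg + 3)/2} (τ̄ F₁ + F₂)`. -/
def formZv (n : ℤ) (F : SuperFun E M) : TotalFamily E M (ℂ × ℝ) := fun j q x =>
  (-(q.2 ^ (-((n : ℝ) + j + 3) / 2) * (2 * q.1.im) ^ (-((j : ℝ) + 3) / 2) : ℝ) : ℂ) •
    (conj q.1 • atTorus (F.2 0) j q x + atTorus (F.2 1) j q x)

/-- The form `Z_{τ̄} = (i/2) ℓ^{-(n + deg - 1)/2} (2 Im τ)^{-(deg + 3)/2} (τ F₁ + F₂)`. -/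
def formZτ (n : ℤ) (F : SuperFun E M) : TotalFamily E M (ℂ × ℝ) := fun j q x =>
  (Complex.I / 2 *
    ((q.2 ^ (-((n : ℝ) + j - 1) / 2) * (2 * q.1.im) ^ (-((j : ℝ) + 3) / 2) : ℝ) : ℂ)) •
    (q.1 • atTorus (F.2 0) j q x + atTorus (F.2 1) j q x)

/-- Triples `(Z, Z_v, Z_{τ̄})` of families of forms. -/
abbrev Triple (E M : Type*) [NormedAddCommGroup E] [NormedSpace ℝ E] : Type _ :=
  TotalFamily E M (ℂ × ℝ) × TotalFamily E M (ℂ × ℝ) × TotalFamily E M (ℂ × ℝ)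

/-- The linear map that sends a function to the triple `(Z, Z_v, Z_{τ̄})`. -/
def torusData (n : ℤ) : SuperFun E M →ₗ[ℂ] Triple E M where
  toFun F := (formZ n F, formZv n F, formZτ n F)
  map_add' F F' := by
    refine Prod.ext ?_ (Prod.ext ?_ ?_) <;> funext j q x
    · simp only [formZ, Prod.fst_add, Pi.add_apply, atTorus_add, smul_add]
    · simp only [formZv, Prod.fst_add, Prod.snd_add, Pi.add_apply, atTorus_add, smul_add]
      abel
    · simp only [formZτ, Prod.snd_add, Pi.add_apply, atTorus_add, smul_add]
      abel
  map_smul' c F := by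
    refine Prod.ext ?_ (Prod.ext ?_ ?_) <;> funext j q x
    · simp only [formZ, Prod.smul_fst, Pi.smul_apply, atTorus_smul, RingHom.id_apply,
        smul_smul, mul_comm c]
    · simp only [formZv, Prod.smul_fst, Prod.smul_snd, Pi.smul_apply, atTorus_smul,
        RingHom.id_apply, smul_smul, smul_add, mul_comm c, mul_assoc]
    · simp only [formZτ, Prod.smul_snd, Pi.smul_apply, atTorus_smul,
        RingHom.id_apply, smul_smul, smul_add, mul_comm c, mul_assoc]

/-- Triples of forms valued in `mf` of total degrees `n`, `n - 1`, `n - 1` that satisfy `dZ = 0`,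
`∂_v Z = dZ_v`, `∂_{τ̄} Z = dZ_{τ̄}`. -/
structure IsTorusTriple (n : ℤ) (t : Triple E M) : Prop where
  mem_Z : t.1 ∈ totalForms E M torSet (fun k => mf k 0) n
  mem_Zv : t.2.1 ∈ totalForms E M torSet (fun k => mf k 0) (n - 1)
  mem_Zτ : t.2.2 ∈ totalForms E M torSet (fun k => mf k (-4)) (n - 1)
  closed : dTotal t.1 = 0
  dVol_eq : dVol t.1 = dTotal t.2.1
  dTauBar_eq : dTauBar t.1 = dTotal t.2.2

/-- Pullback along the projection `ℍ × ℝ_{>0} → ℍ`, through which `(MF^ω)^k ⊆ mf^{k,0}`. -/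
def pullTau (W : TotalFamily E M ℂ) : TotalFamily E M (ℂ × ℝ) := fun j q =>
  open Classical in if q ∈ torSet then W j q.1 else 0

end Sections

end SuperTori

end

/-!
Part (a) is a matter of expanding the action map of the super translation group in the generators of
its coefficient ring (`pullAct_eq`). A function `F₀ + λ₁ F₁ + λ₂ F₂` is translation invariant at a
lattice if and only if `d F₀ = 0` and two residuals vanish, the `i`-th of which is the sum of
`d Fᵢ`, of twice the Wirtinger derivative `∂F₀/∂ℓ̄ᵢ`, and of a multiple of `F₀` proportional to the
form degree (`pullAct_eq_pullProj_iff`). Every lattice is a rotation of a lattice `(ℓ τ, ℓ)`, so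
that a function of the right spin is determined by its values there. The action of `Spin(2)`
prescribes the derivative of `F₀` along rotations; hence the derivatives of `Z` with respect to the
volume and to `τ̄` can be expressed by the two Wirtinger derivatives of `F₀` (`dVol_formZ`,
`dTauBar_formZ`). It turns out that `∂_v Z - d Z_v` and `∂_τ̄ Z - d Z_τ̄` are, up to nonzero
factors, the residuals contracted with the vectors `(τ̄, 1)` and `(τ, 1)`. These are linearly
independent, and translation invariance is equivalent to the three equations
(`translation_invariant_iff`). By the same independence, `F₁` and `F₂` can be recovered from `Z_v`
and `Z_τ̄` (`exists_isSpinFun`), and invariance under `SL₂(ℤ)` is equivalent to the modular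
transformation laws (`sl_invariant₀_iff`, `sl_invariant_iff`).

In part (b), only the class in the cohomology with values in weak modular forms needs an argument.
Integrating `∂_v Z = d Z_v` along the volume shows that `Z` is cohomologous to the pullback of its
restriction to volume `1` (`eq_pullTau_unitVol_add`). On this restriction, `∂_τ̄ Z = d Z_τ̄`. If `T`
is a family of forms of the same weights as `Z_v` with `∂_τ̄ T = Z_τ̄`, then `Z - d T` is closed and
holomorphic in `τ` (`exists_closedForms_MFgraded`). For uniqueness, let the pullback of a closed
holomorphic form `W` be `d T`. At volume `1`, the form `∂_τ̄ T` is closed as `W` is holomorphic. If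
it equals `∂_τ̄ U` for a *closed* form `U` of the same weights, then `T - U` is holomorphic and
`W = d (T - U)` (`mem_exactForms_MFgraded`).

Both arguments rest on an operator that solves `∂f/∂τ̄ = g` for functions on the upper half plane
that transform under `SL₂(ℤ)`, with values in a vector space and depending on parameters, and that
commutes with linear maps of the values and with derivatives in the parameters, hence preserves
closed forms (`sol`, `extD_solForm_eq_zero`). It is a Poincaré series. Take functions `φ_m`,
supported in the rectangles `|re τ| ≤ 1`, `m + 1/4 ≤ im τ ≤ m + 7/4`, whose translates under
`SL₂(ℤ)` form a locally finite partition of unity. The Cauchy transform of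
`φ_m Δ ^ N (ζ + i) ^ (12 N + w) g`, pulled back by `γ` and divided by the automorphy factor
`Δ(τ) ^ N ((c τ + d) (γ τ + i)) ^ (12 N + w)`, solves the equation with right hand side
`φ_m(γ τ) g(τ)` (`dbar_solTerm`), and the sum over all `m` and `γ` is the solution. The series over
`γ` converges since `|(c τ + d) (γ τ + i)|²` dominates the product of the norms of the rows of `γ`.
No growth of `g` at the cusp is assumed; the series over `m` converges because the exponents
`N = N m` are chosen in terms of `g`, and `Δ(ζ) (ζ + i) ^ 12` tends to zero at the cusp
(`exists_admissible`). Near a given point, all but finitely many terms are holomorphic in `τ`, so by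
Cauchy's estimates the sum is smooth once the derivatives in the parameters converge locally
uniformly (`LocallySummable.contDiffOn_tsum`).
-/


namespace SuperTori
open Set Filter Topology MeasureTheory

/-! ### The Cauchy transform -/

section CauchyTransform

universe u
variable {F : Type u} [NormedAddCommGroup F] [NormedSpace ℝ F] [NormedSpace ℂ F]
  [IsScalarTower ℝ ℂ F]

theorem ofReal_smul_eq {F : Type*} [AddCommGroup F] [Module ℝ F] [Module ℂ F] [IsScalarTower ℝ ℂ F]
    (r : ℝ) (x : F) : (r : ℂ) • x = r • x := algebraMap_smul ℂ r x

/-- The fundamental solution `1 / (π z)` of the operator `∂/∂z̄` on `ℂ`. -/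
noncomputable def cauchyKernel (z : ℂ) : ℂ := ((Real.pi : ℂ) * z)⁻¹

/-- The Cauchy transform `σ ↦ ∫ ψ(ζ) / (π (σ - ζ)) dA(ζ)`, as a convolution. -/
noncomputable def cauchyTransform (ψ : ℂ → F) (σ : ℂ) : F :=
  ∫ z, cauchyKernel z • ψ (σ - z)

theorem locallyIntegrable_cauchyKernel : LocallyIntegrable cauchyKernel (volume : Measure ℂ) := by
  refine locallyIntegrable_of_norm_le_rpow (C := 1) (α := 1) (by simp) (by simp) ?_ ?_
  rotate_left
  · have : Measurable cauchyKernel := by unfold cauchyKernel; fun_prop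
    exact this.aestronglyMeasurable
  · refine Eventually.of_forall fun z => ?_
    simp only [cauchyKernel, mul_inv, norm_mul, norm_inv, Complex.norm_real, Real.norm_eq_abs,
      abs_of_pos Real.pi_pos, Real.rpow_neg_one]
    have : Real.pi⁻¹ ≤ 1 := inv_le_one_of_one_le₀ (by linarith [Real.two_le_pi])
    gcongr

/-- In polar coordinates `e^{-iθ} ∂g/∂z̄ = (∂g/∂r + (i/r) ∂g/∂θ) / 2`; the first term integrates to
`-g(0)` along each ray, and the second to zero along each circle. -/
theorem integral_cauchyKernel_smul_dbar [CompleteSpace F] {g : ℂ → F} (hg : ContDiff ℝ 1 g)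
    (hc : HasCompactSupport g) : ∫ z, cauchyKernel z • dbar g z = - g 0 := by
  rw [← Complex.integral_comp_polarCoord_symm]
  have hdiff : Differentiable ℝ g := hg.differentiable one_ne_zero
  have hcont : Continuous (fderiv ℝ g) := hg.continuous_fderiv one_ne_zero
  obtain ⟨R, hR⟩ := (hc.fderiv (𝕜 := ℝ)).isCompact.isBounded.subset_closedBall 0
  obtain ⟨R', hR'⟩ := hc.isCompact.isBounded.subset_closedBall 0
  have hz : ∀ z, R < ‖z‖ → fderiv ℝ g z = 0 := fun z hz => by
    by_contra h
    have := hR (subset_tsupport _ h)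
    simp at this; linarith
  have hz' : ∀ z, R' < ‖z‖ → g z = 0 := fun z hz => by
    by_contra h
    have := hR' (subset_tsupport _ h)
    simp at this; linarith
  have hnorm : ∀ r θ : ℝ, ‖(r : ℂ) * Complex.exp (θ * Complex.I)‖ = |r| := fun r θ => by simp
  -- the radial and the angular derivative
  set A : ℝ → ℝ → F := fun r θ =>
    fderiv ℝ g (r * Complex.exp (θ * Complex.I)) (Complex.exp (θ * Complex.I)) with hA
  set B : ℝ → ℝ → F := fun r θ =>
    fderiv ℝ g (r * Complex.exp (θ * Complex.I)) (Complex.I * Complex.exp (θ * Complex.I)) with hB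
  have hAc : Continuous fun p : ℝ × ℝ => A p.1 p.2 :=
    (hcont.comp (by fun_prop)).clm_apply (by fun_prop)
  have hBc : Continuous fun p : ℝ × ℝ => B p.1 p.2 :=
    (hcont.comp (by fun_prop)).clm_apply (by fun_prop)
  have hint : ∀ C : ℝ → ℝ → F, Continuous (fun p : ℝ × ℝ => C p.1 p.2) →
      (∀ r θ, R < |r| → C r θ = 0) →
      Integrable (fun p : ℝ × ℝ => C p.1 p.2)
        ((volume.restrict (Ioi 0)).prod (volume.restrict (Ioo (-Real.pi) Real.pi))) := by
    intro C hC h0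
    rw [Measure.prod_restrict]
    have h1 : IntegrableOn (fun p : ℝ × ℝ => C p.1 p.2)
        (Icc 0 R ×ˢ Icc (-Real.pi) Real.pi) (volume.prod volume) :=
      hC.continuousOn.integrableOn_compact (isCompact_Icc.prod isCompact_Icc)
    have h2 : IntegrableOn (fun p : ℝ × ℝ => C p.1 p.2)
        (Icc 0 R ×ˢ Ioo (-Real.pi) Real.pi) (volume.prod volume) :=
      h1.mono_set (prod_mono le_rfl Ioo_subset_Icc_self)
    refine h2.of_forall_sdiff_eq_zero (measurableSet_Ioi.prod measurableSet_Ioo) ?_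
    rintro ⟨r, θ⟩ ⟨⟨hr, hθ⟩, hn⟩
    refine h0 r θ ?_
    have hr' : 0 < r := hr
    rw [abs_of_pos hr']
    by_contra hle
    exact hn ⟨⟨hr'.le, not_lt.1 hle⟩, hθ⟩
  have hA0 : ∀ r θ, R < |r| → A r θ = 0 := fun r θ h => by
    simp only [hA]; rw [hz _ (by rwa [hnorm])]; rfl
  have hB0 : ∀ r θ, R < |r| → B r θ = 0 := fun r θ h => by
    simp only [hB]; rw [hz _ (by rwa [hnorm])]; rfl
  have hAi := hint A hAc hA0
  have hBi := hint B hBc hB0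
  have hrad : ∀ θ, ∫ r in Ioi (0 : ℝ), A r θ = - g 0 := by
    intro θ
    have hd : ∀ r : ℝ, HasDerivAt (fun r : ℝ => g (r * Complex.exp (θ * Complex.I))) (A r θ) r := by
      intro r
      have h1 : HasDerivAt (fun r : ℝ => (r : ℂ) * Complex.exp (θ * Complex.I))
          (Complex.exp (θ * Complex.I)) r := by
        simpa using (Complex.ofRealCLM.hasDerivAt (x := r)).mul_const
          (Complex.exp (θ * Complex.I))
      exact ((hdiff _).hasFDerivAt.comp_hasDerivAt r h1)
    have := integral_Ioi_of_hasDerivAt_of_tendsto (m := 0)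
      (hd 0).continuousAt.continuousWithinAt (fun r _ => hd r) ?_ ?_
    · simpa using this
    · have hAcθ : Continuous fun r => A r θ := hAc.comp (by fun_prop : Continuous fun r => (r, θ))
      refine IntegrableOn.of_forall_sdiff_eq_zero
        (hAcθ.continuousOn.integrableOn_compact (isCompact_Icc (a := 0) (b := R)))
        measurableSet_Ioi ?_
      rintro r ⟨hr, hn⟩
      have hr' : 0 < r := hr
      refine hA0 r θ ?_
      rw [abs_of_pos hr']
      by_contra hle
      exact hn ⟨hr'.le, not_lt.1 hle⟩
    · refine tendsto_const_nhds.congr' ?_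
      filter_upwards [eventually_gt_atTop (max R' 0)] with r hr
      rw [hz']
      rw [hnorm]
      exact (le_max_left _ _).trans_lt (hr.trans_le (le_abs_self r))
  have hang : ∀ r ∈ Ioi (0 : ℝ), ∫ θ in Ioo (-Real.pi) Real.pi, B r θ = 0 := by
    intro r hr
    have hr0 : (r : ℝ) ≠ 0 := (show (0 : ℝ) < r from hr).ne'
    have hd : ∀ θ : ℝ, HasDerivAt (fun θ : ℝ => g (r * Complex.exp (θ * Complex.I)))
        (r • B r θ) θ := by
      intro θ
      have h1 : HasDerivAt (fun θ : ℝ => (r : ℂ) * Complex.exp (θ * Complex.I))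
          (r • (Complex.I * Complex.exp (θ * Complex.I))) θ := by
        have h2 := ((Complex.ofRealCLM.hasDerivAt (x := θ)).mul_const Complex.I).cexp.const_mul
          (r : ℂ)
        simp only [Complex.ofRealCLM_apply, Complex.ofReal_one, one_mul] at h2
        convert! h2 using 1
        simp only [Complex.real_smul]; ring
      have := ((hdiff _).hasFDerivAt.comp_hasDerivAt θ h1)
      rw [map_smul] at this
      exact this
    have hcB : Continuous fun θ => r • B r θ :=
      (hBc.comp (by fun_prop : Continuous fun θ => (r, θ))).const_smul r
    have h3 := intervalIntegral.integral_eq_sub_of_hasDerivAt (a := -Real.pi) (b := Real.pi)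
      (fun θ _ => hd θ) (hcB.intervalIntegrable _ _)
    rw [intervalIntegral.integral_smul, intervalIntegral.integral_of_le (by linarith [Real.pi_pos]),
      integral_Ioc_eq_integral_Ioo] at h3
    have h4 : Complex.exp ((-Real.pi : ℝ) * Complex.I) = Complex.exp
        ((Real.pi : ℝ) * Complex.I) := by
      rw [Complex.exp_pi_mul_I]
      push_cast
      rw [neg_mul, Complex.exp_neg, Complex.exp_pi_mul_I]; norm_num
    rw [h4, sub_self] at h3
    exact (smul_eq_zero.1 h3).resolve_left hr0
  have key : ∀ p ∈ polarCoord.target,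
      p.1 • (cauchyKernel (Complex.polarCoord.symm p) • dbar g (Complex.polarCoord.symm p))
        = ((2 * Real.pi : ℂ)⁻¹) • (A p.1 p.2 + Complex.I • B p.1 p.2) := by
    rintro ⟨r, θ⟩ ⟨hr, hθ⟩
    have hr0 : (r : ℂ) ≠ 0 := by exact_mod_cast (show (0 : ℝ) < r from hr).ne'
    have hp : Complex.polarCoord.symm (r, θ) = r * Complex.exp (θ * Complex.I) := by
      rw [Complex.polarCoord_symm_apply, Complex.exp_mul_I]
      push_cast; rfl
    rw [hp]
    simp only [hA, hB, dbar, cauchyKernel]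
    set D := fderiv ℝ g (r * Complex.exp (θ * Complex.I))
    have hD : ∀ z : ℂ, D z = (z.re : ℂ) • D 1 + (z.im : ℂ) • D Complex.I := fun z => by
      conv_lhs => rw [← Complex.re_add_im z, show (z.re : ℂ) + z.im * Complex.I
        = z.re • (1 : ℂ) + z.im • Complex.I by simp, map_add, map_smul, map_smul]
      simp only [ofReal_smul_eq]
    have he : (Complex.exp (θ * Complex.I))⁻¹ = Complex.cos θ - Complex.sin θ * Complex.I := by
      rw [← Complex.exp_neg, ← neg_mul, Complex.exp_mul_I]; simp; ring
    have hre : (Complex.exp (θ * Complex.I)).re = Real.cos θ := Complex.exp_ofReal_mul_I_re θ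
    have him : (Complex.exp (θ * Complex.I)).im = Real.sin θ := Complex.exp_ofReal_mul_I_im θ
    rw [hD (Complex.exp _), hD (Complex.I * _)]
    simp only [Complex.mul_re, Complex.mul_im, hre, him, Complex.I_re, Complex.I_im, mul_inv, he]
    rw [← ofReal_smul_eq]
    have hpi : (Real.pi : ℂ) ≠ 0 := by exact_mod_cast Real.pi_ne_zero
    simp only [smul_add, smul_smul]
    push_cast
    have hI : Complex.I ^ 2 = -1 := Complex.I_sq
    match_scalars <;> field_simp <;> ring_nf <;> simp only [hI] <;> ring
  rw [show polarCoord.target = Ioi (0 : ℝ) ×ˢ Ioo (-Real.pi) Real.pi from rfl,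
    setIntegral_congr_fun (measurableSet_Ioi.prod measurableSet_Ioo) key, integral_smul,
    Measure.volume_eq_prod, ← Measure.prod_restrict,
    integral_add hAi (show Integrable (fun p : ℝ × ℝ => Complex.I • B p.1 p.2) _ from
      hBi.smul Complex.I),
    integral_smul, integral_prod _ hBi, integral_prod_symm _ hAi]
  rw [setIntegral_congr_fun measurableSet_Ioi hang]
  simp only [hrad, integral_zero, smul_zero, add_zero, integral_const]
  have hv : (volume.restrict (Ioo (-Real.pi) Real.pi)).real univ = 2 * Real.pi := by
    simp [Measure.real, Real.volume_Ioo]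
    rw [ENNReal.toReal_ofReal (by linarith [Real.pi_pos])]; ring
  rw [hv, ← ofReal_smul_eq, smul_smul]
  have hpi : (Real.pi : ℂ) ≠ 0 := by exact_mod_cast Real.pi_ne_zero
  push_cast
  rw [inv_mul_cancel₀ (by simp [hpi]), one_smul]

theorem cauchyTransform_eq_convolution (ψ : ℂ → F) :
    cauchyTransform ψ = convolution cauchyKernel ψ (ContinuousLinearMap.lsmul ℝ ℂ) volume := rfl

/-- The Cauchy transform inverts `∂/∂z̄` on compactly supported functions. -/
theorem dbar_cauchyTransform [CompleteSpace F] {ψ : ℂ → F} (hψ : ContDiff ℝ 1 ψ)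
    (hc : HasCompactSupport ψ) (σ : ℂ) : dbar (cauchyTransform ψ) σ = ψ σ := by
  have h1 := hc.hasFDerivAt_convolution_right (ContinuousLinearMap.lsmul ℝ ℂ)
    locallyIntegrable_cauchyKernel hψ σ
  have hconv := (hc.fderiv (𝕜 := ℝ))
  have hcont : Continuous (fderiv ℝ ψ) := hψ.continuous_fderiv one_ne_zero
  have hv : ∀ v, fderiv ℝ (cauchyTransform ψ) σ v
      = ∫ z, cauchyKernel z • fderiv ℝ ψ (σ - z) v := by
    intro v
    rw [cauchyTransform_eq_convolution, h1.fderiv, convolution_precompR_apply _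
      locallyIntegrable_cauchyKernel hconv hcont]
    rfl
  have hint : ∀ v, Integrable fun z => cauchyKernel z • fderiv ℝ ψ (σ - z) v := by
    intro v
    have := (HasCompactSupport.convolutionExists_right (L := ContinuousLinearMap.lsmul ℝ ℂ (E := F))
      (f := cauchyKernel) (g := fun z => fderiv ℝ ψ z v) (μ := volume)
      (hconv.comp_left (g := fun A : ℂ →L[ℝ] F => A v) rfl) locallyIntegrable_cauchyKernel
      (by fun_prop)) σ
    exact this
  have h2 := integral_cauchyKernel_smul_dbar (g := fun z => ψ (σ - z)) (hψ.comp (by fun_prop))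
    (hc.comp_homeomorph (Homeomorph.subLeft σ))
  simp only [sub_zero] at h2
  rw [← neg_eq_iff_eq_neg] at h2
  rw [← h2, dbar, hv, hv, ← integral_smul, ← integral_add (hint _)
    (show Integrable (fun z => Complex.I • cauchyKernel z • fderiv ℝ ψ (σ - z) Complex.I) from
      (hint _).smul _),
    ← integral_smul, ← integral_neg]
  congr 1
  funext z
  have h3 : fderiv ℝ (fun z => ψ (σ - z)) z = - fderiv ℝ ψ (σ - z) := by
    have h4 : HasFDerivAt (fun z : ℂ => σ - z) (-ContinuousLinearMap.id ℝ ℂ) z :=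
      (hasFDerivAt_id z).const_sub σ
    have := ((hψ.differentiable one_ne_zero (σ - z)).hasFDerivAt.comp z h4).fderiv
    rw [show (fun z => ψ (σ - z)) = ψ ∘ fun z => σ - z from rfl, this]
    ext v; simp
  simp only [dbar, h3, neg_apply]
  simp only [smul_add, smul_smul, smul_neg]
  module

/-- A constant `C` such that `C * sup ‖ψ‖` bounds the Cauchy transform of any `ψ` supported in `k`:
the kernel is integrable on the unit disc and at most `1` in absolute value outside of it. -/
noncomputable def cauchyConst (k : Set ℂ) : ℝ :=
  (∫ z in Metric.closedBall (0 : ℂ) 1, ‖cauchyKernel z‖) + (volume k).toReal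

theorem cauchyConst_nonneg (k : Set ℂ) : 0 ≤ cauchyConst k := by unfold cauchyConst; positivity

omit [IsScalarTower ℝ ℂ F] in
theorem norm_cauchyTransform_le {k : Set ℂ} (hk : IsCompact k) {ψ : ℂ → F} {b : ℝ}
    (hb : ∀ z, ‖ψ z‖ ≤ b) (h0 : ∀ z ∉ k, ψ z = 0) (σ : ℂ) :
    ‖cauchyTransform ψ σ‖ ≤ cauchyConst k * b := by
  have hb0 : 0 ≤ b := (norm_nonneg _).trans (hb 0)
  have hi1 : Integrable (fun z => (Metric.closedBall (0 : ℂ) 1).indicator (‖cauchyKernel ·‖) z) :=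
    IntegrableOn.integrable_indicator (locallyIntegrable_cauchyKernel.integrableOn_isCompact
      (isCompact_closedBall 0 1)).norm Metric.isClosed_closedBall.measurableSet
  have hi2 : Integrable (fun z => k.indicator (fun _ => (1 : ℝ)) (σ - z)) := by
    have : Integrable (k.indicator (fun _ => (1 : ℝ))) :=
      (integrableOn_const hk.measure_lt_top.ne).integrable_indicator hk.measurableSet
    exact this.comp_sub_left σ
  refine (norm_integral_le_of_norm_le ((hi1.add hi2).const_mul b)
    (Eventually.of_forall fun z => ?_)).trans_eq ?_
  · rw [norm_smul]
    by_cases hz : σ - z ∈ k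
    · simp only [Pi.add_apply, indicator_of_mem hz]
      rw [mul_comm]
      refine mul_le_mul (hb _) ?_ (norm_nonneg _) hb0
      by_cases hz1 : z ∈ Metric.closedBall (0 : ℂ) 1
      · rw [indicator_of_mem hz1]; linarith
      · rw [indicator_of_notMem hz1, zero_add]
        simp only [Metric.mem_closedBall, dist_zero_right, not_le] at hz1
        simp only [cauchyKernel, norm_inv, norm_mul, Complex.norm_real, Real.norm_eq_abs,
          abs_of_pos Real.pi_pos]
        exact inv_le_one_of_one_le₀ (by nlinarith [Real.two_le_pi])
    · rw [h0 _ hz, norm_zero, mul_zero]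
      have : 0 ≤ (Metric.closedBall (0 : ℂ) 1).indicator (‖cauchyKernel ·‖) z :=
        indicator_nonneg (fun _ _ => norm_nonneg _) _
      simp only [Pi.add_apply, indicator_of_notMem hz]
      positivity
  · have hi2' : ∫ z, k.indicator (fun _ => (1 : ℝ)) (σ - z) = (volume k).toReal := by
      rw [integral_sub_left_eq_self (k.indicator fun _ => (1 : ℝ)),
          integral_indicator_const _ hk.measurableSet]
      simp [Measure.real]
    rw [integral_const_mul, cauchyConst]
    simp only [Pi.add_apply]
    rw [integral_add hi1 hi2, hi2', integral_indicator Metric.isClosed_closedBall.measurableSet]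
    ring

variable {E : Type u} [NormedAddCommGroup E] [NormedSpace ℝ E]

/-- The Cauchy transform of a smooth family is a smooth family. -/
theorem contDiffOn_cauchyTransform [CompleteSpace F] {U : Set E} (hU : IsOpen U) {k : Set ℂ}
    (hk : IsCompact k) {f : ℂ × E → F} (hf : ContDiffOn ℝ ∞ f (univ ×ˢ U))
    (h0 : ∀ z, z ∉ k → ∀ x ∈ U, f (z, x) = 0) :
    ContDiffOn ℝ ∞ (fun q : ℂ × E => cauchyTransform (fun z => f (z, q.2)) q.1) (univ ×ˢ U) := by
  have h := contDiffOn_convolution_right_with_param (μ := volume) (n := ⊤)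
    (ContinuousLinearMap.lsmul ℝ ℂ (E := F))
    (g := fun (x : E) (z : ℂ) => f (z, x)) hU hk (fun x z hx hz => h0 z hz x hx)
    locallyIntegrable_cauchyKernel
    (hf.comp (f := fun q : E × ℂ => (q.2, q.1)) (s := U ×ˢ univ) (by fun_prop) fun q hq => ⟨trivial,
        hq.1⟩)
  exact h.comp (f := fun q : ℂ × E => (q.2, q.1)) (s := univ ×ˢ U) (by fun_prop) fun q hq => ⟨hq.2,
      trivial⟩

/-- The Cauchy transform commutes with differentiation in the parameter. -/
theorem hasFDerivAt_cauchyTransform [CompleteSpace F] {U : Set E} (hU : IsOpen U) {k : Set ℂ}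
    (hk : IsCompact k) {f : ℂ × E → F} (hf : ContDiffOn ℝ ∞ f (univ ×ˢ U))
    (h0 : ∀ z, z ∉ k → ∀ x ∈ U, f (z, x) = 0) (σ : ℂ) {x : E} (hx : x ∈ U) :
    HasFDerivAt (fun y => cauchyTransform (fun z => f (z, y)) σ)
      (cauchyTransform (fun z => fderiv ℝ (fun y => f (z, y)) x) σ) x := by
  have hg : ContDiffOn ℝ ∞ (↿(fun (x : E) (z : ℂ) => f (z, x))) (U ×ˢ univ) :=
    hf.comp (f := fun q : E × ℂ => (q.2, q.1)) (s := U ×ˢ univ) (by fun_prop) fun q hq => ⟨trivial,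
        hq.1⟩
  have hopen : IsOpen (U ×ˢ (univ : Set ℂ)) := hU.prod isOpen_univ
  have h := hasFDerivAt_convolution_right_with_param (μ := volume)
    (ContinuousLinearMap.lsmul ℝ ℂ (E := F))
    (g := fun (x : E) (z : ℂ) => f (z, x)) hU hk (fun x z hx hz => h0 z hz x hx)
    locallyIntegrable_cauchyKernel (hg.of_le (by simp)) (x, σ) hx
  have h1 := h.comp x ((hasFDerivAt_prodMk_left (𝕜 := ℝ) x σ))
  convert! h1 using 1
  have hgc : Continuous fun z : ℂ => fderiv ℝ (↿(fun (x : E) (z : ℂ) => f (z, x))) (x, z) := by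
    have := (hg.continuousOn_fderiv_of_isOpen hopen (by simp))
    exact this.comp_continuous (by fun_prop) fun z => ⟨hx, trivial⟩
  have hslice : ∀ z, fderiv ℝ (fun y => f (z, y)) x
      = (fderiv ℝ (↿(fun (x : E) (z : ℂ) => f (z, x))) (x, z)).comp
          (ContinuousLinearMap.inl ℝ E ℂ) := by
    intro z
    have hd : DifferentiableAt ℝ (↿(fun (x : E) (z : ℂ) => f (z, x))) (x, z) :=
      (hg.contDiffAt (hopen.mem_nhds ⟨hx, trivial⟩)).differentiableAt (by simp)
    exact (hd.hasFDerivAt.comp x (hasFDerivAt_prodMk_left (𝕜 := ℝ) x z)).fderiv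
  have hsupp : HasCompactSupport fun z : ℂ =>
      fderiv ℝ (↿(fun (x : E) (z : ℂ) => f (z, x))) (x, z) := by
    refine HasCompactSupport.intro hk fun z hz => ?_
    refine (hasFDerivAt_zero_of_eventually_const 0 ?_).fderiv
    filter_upwards [(hU.prod hk.isClosed.isOpen_compl).mem_nhds ⟨hx, hz⟩] with q hq
    exact h0 q.2 hq.2 q.1 hq.1
  ext v
  rw [ContinuousLinearMap.comp_apply, convolution_precompR_apply _ locallyIntegrable_cauchyKernel
    hsupp hgc]
  have hc2 : Continuous fun z => fderiv ℝ (fun y => f (z, y)) x := by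
    simp_rw [hslice]; fun_prop
  have hs2 : HasCompactSupport fun z => fderiv ℝ (fun y => f (z, y)) x := by
    simp_rw [hslice]
    exact hsupp.comp_left (g := fun A => ContinuousLinearMap.comp A (ContinuousLinearMap.inl ℝ E ℂ))
      (by simp)
  have hi := (HasCompactSupport.convolutionExists_right
      (L := ContinuousLinearMap.lsmul ℝ ℂ (E := E →L[ℝ] F)) (μ := volume)
      (f := cauchyKernel) (g := fun z => fderiv ℝ (fun y => f (z, y)) x)
      hs2 locallyIntegrable_cauchyKernel hc2) σ
  have hi' : Integrable fun z => cauchyKernel z • fderiv ℝ (fun y => f (σ - z, y)) x := hi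
  rw [cauchyTransform, ContinuousLinearMap.integral_apply hi']
  simp only [hslice]
  rfl

/-- The Cauchy transform commutes with continuous linear maps of the values. -/
theorem map_cauchyTransform [CompleteSpace F] {G : Type*} [NormedAddCommGroup G] [NormedSpace ℝ G]
    [NormedSpace ℂ G] [IsScalarTower ℝ ℂ G] [CompleteSpace G] (Λ : F →L[ℂ] G) {ψ : ℂ → F}
        (hψ : Continuous ψ) (hc : HasCompactSupport ψ)
    (σ : ℂ) : Λ (cauchyTransform ψ σ) = cauchyTransform (fun z => Λ (ψ z)) σ := by
  have hi := (HasCompactSupport.convolutionExists_right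
      (L := ContinuousLinearMap.lsmul ℝ ℂ (E := F)) (μ := volume)
      (f := cauchyKernel) (g := ψ) hc locallyIntegrable_cauchyKernel hψ) σ
  have hi' : Integrable fun z => cauchyKernel z • ψ (σ - z) := hi
  rw [cauchyTransform, ← ContinuousLinearMap.integral_comp_comm Λ hi', cauchyTransform]
  congr 1
  funext z
  simp

end CauchyTransform

/-! ### Series of smooth families that are holomorphic in the base variable -/

section HolomorphicFamilies

universe u
variable {E : Type u} [NormedAddCommGroup E] [NormedSpace ℝ E]
  {F : Type u} [NormedAddCommGroup F] [NormedSpace ℝ F] [NormedSpace ℂ F] [IsScalarTower ℝ ℂ F]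
  {V : Set ℂ} {U : Set E}

/-- The partial derivative of a family along the parameter space `E`. -/
noncomputable def paramDeriv (t : ℂ × E → F) (z : ℂ × E) : E →L[ℝ] F :=
  fderiv ℝ (fun y => t (z.1, y)) z.2

/-- The partial derivative of a family in the real direction of the base `ℂ`. -/
noncomputable def baseDeriv (t : ℂ × E → F) (z : ℂ × E) : F := fderiv ℝ t z (1, 0)

/-- Smooth families on `V × U` that are holomorphic in the first variable, expressed by the
Cauchy–Riemann equation. -/
structure IsHolFamily (V : Set ℂ) (U : Set E) (t : ℂ × E → F) : Prop where
  smooth : ContDiffOn ℝ ∞ t (V ×ˢ U)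
  hol : ∀ z ∈ V ×ˢ U, fderiv ℝ t z (Complex.I, 0) = Complex.I • fderiv ℝ t z (1, 0)

variable (hV : IsOpen V) (hU : IsOpen U)
include hV hU

omit [NormedSpace ℂ F] [IsScalarTower ℝ ℂ F] in
theorem differentiableAt_of_smooth {t : ℂ × E → F} (ht : ContDiffOn ℝ ∞ t (V ×ˢ U)) {z : ℂ × E}
    (hz : z ∈ V ×ˢ U) : DifferentiableAt ℝ t z :=
  (ht.contDiffAt ((hV.prod hU).mem_nhds hz)).differentiableAt (by simp)

omit [NormedSpace ℂ F] [IsScalarTower ℝ ℂ F] in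
theorem contDiffOn_fderiv {t : ℂ × E → F} (ht : ContDiffOn ℝ ∞ t (V ×ˢ U)) :
    ContDiffOn ℝ ∞ (fderiv ℝ t) (V ×ˢ U) :=
  ht.fderiv_of_isOpen (hV.prod hU) (by simp)

omit [NormedSpace ℂ F] [IsScalarTower ℝ ℂ F] in
theorem paramDeriv_eq {t : ℂ × E → F} (ht : ContDiffOn ℝ ∞ t (V ×ˢ U)) {z : ℂ × E}
    (hz : z ∈ V ×ˢ U) : paramDeriv t z = (fderiv ℝ t z).comp (ContinuousLinearMap.inr ℝ ℂ E) :=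
  ((differentiableAt_of_smooth hV hU ht hz).hasFDerivAt.comp z.2
    (hasFDerivAt_prodMk_right (𝕜 := ℝ) z.1 z.2)).fderiv

omit [NormedSpace ℂ F] [IsScalarTower ℝ ℂ F] in
theorem contDiffOn_paramDeriv {t : ℂ × E → F} (ht : ContDiffOn ℝ ∞ t (V ×ˢ U)) :
    ContDiffOn ℝ ∞ (paramDeriv t) (V ×ˢ U) :=
  ((contDiffOn_fderiv hV hU ht).clm_comp contDiffOn_const).congr fun _ hz =>
    paramDeriv_eq hV hU ht hz

omit [NormedSpace ℂ F] [IsScalarTower ℝ ℂ F] in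
theorem contDiffOn_baseDeriv {t : ℂ × E → F} (ht : ContDiffOn ℝ ∞ t (V ×ˢ U)) :
    ContDiffOn ℝ ∞ (baseDeriv t) (V ×ˢ U) :=
  (contDiffOn_fderiv hV hU ht).clm_apply contDiffOn_const

omit [NormedSpace ℂ F] [IsScalarTower ℝ ℂ F] in
theorem fderiv_fderiv_comm {t : ℂ × E → F} (ht : ContDiffOn ℝ ∞ t (V ×ˢ U)) {z : ℂ × E}
    (hz : z ∈ V ×ˢ U) (a b : ℂ × E) :
    fderiv ℝ (fderiv ℝ t) z a b = fderiv ℝ (fderiv ℝ t) z b a :=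
  ((ht.contDiffAt ((hV.prod hU).mem_nhds hz)).isSymmSndFDerivAt (by
    simpa using (WithTop.coe_le_coe.2 le_top : ((2 : ℕ∞) : WithTop ℕ∞) ≤ ∞))).eq a b

omit [NormedSpace ℂ F] [IsScalarTower ℝ ℂ F] in
theorem fderiv_paramDeriv {t : ℂ × E → F} (ht : ContDiffOn ℝ ∞ t (V ×ˢ U)) {z : ℂ × E}
    (hz : z ∈ V ×ˢ U) (a : ℂ × E) (v : E) :
    fderiv ℝ (paramDeriv t) z a v = fderiv ℝ (fderiv ℝ t) z a (0, v) := by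
  have h1 : paramDeriv t =ᶠ[𝓝 z] fun z => (fderiv ℝ t z).comp (ContinuousLinearMap.inr ℝ ℂ E) := by
    filter_upwards [(hV.prod hU).mem_nhds hz] with y hy using paramDeriv_eq hV hU ht hy
  have h2 : DifferentiableAt ℝ (fderiv ℝ t) z :=
    differentiableAt_of_smooth hV hU (contDiffOn_fderiv hV hU ht) hz
  rw [h1.fderiv_eq, (h2.hasFDerivAt.clm_comp (hasFDerivAt_const _ _)).fderiv]
  simp

omit [NormedSpace ℂ F] [IsScalarTower ℝ ℂ F] in
theorem fderiv_fderiv_apply {t : ℂ × E → F} (ht : ContDiffOn ℝ ∞ t (V ×ˢ U)) {z : ℂ × E}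
    (hz : z ∈ V ×ˢ U) (a b : ℂ × E) :
    fderiv ℝ (fun z => fderiv ℝ t z b) z a = fderiv ℝ (fderiv ℝ t) z a b := by
  have h2 : DifferentiableAt ℝ (fderiv ℝ t) z :=
    differentiableAt_of_smooth hV hU (contDiffOn_fderiv hV hU ht) hz
  rw [(h2.hasFDerivAt.clm_apply (hasFDerivAt_const _ _)).fderiv]
  simp

omit [NormedSpace ℂ F] [IsScalarTower ℝ ℂ F] in
theorem paramDeriv_baseDeriv {t : ℂ × E → F} (ht : ContDiffOn ℝ ∞ t (V ×ˢ U)) {z : ℂ × E}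
    (hz : z ∈ V ×ˢ U) : paramDeriv (baseDeriv t) z = baseDeriv (paramDeriv t) z := by
  ext v
  rw [paramDeriv_eq hV hU (contDiffOn_baseDeriv hV hU ht) hz, baseDeriv,
    fderiv_paramDeriv hV hU ht hz, fderiv_fderiv_comm hV hU ht hz,
    ← fderiv_fderiv_apply hV hU ht hz]
  rfl

theorem IsHolFamily.fderiv_hol {t : ℂ × E → F} (ht : IsHolFamily V U t) {z : ℂ × E}
    (hz : z ∈ V ×ˢ U) (a : ℂ × E) : fderiv ℝ (fderiv ℝ t) z a (Complex.I, 0)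
      = Complex.I • fderiv ℝ (fderiv ℝ t) z a (1, 0) := by
  rw [← fderiv_fderiv_apply hV hU ht.smooth hz, ← fderiv_fderiv_apply hV hU ht.smooth hz]
  have h1 : (fun z => fderiv ℝ t z (Complex.I, 0)) =ᶠ[𝓝 z]
      fun z => Complex.I • fderiv ℝ t z (1, 0) := by
    filter_upwards [(hV.prod hU).mem_nhds hz] with y hy using ht.hol y hy
  have h2 : DifferentiableAt ℝ (fun z => fderiv ℝ t z (1, 0)) z :=
    differentiableAt_of_smooth hV hU (contDiffOn_baseDeriv hV hU ht.smooth) hz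
  rw [h1.fderiv_eq]
  exact congrArg (· a) (h2.hasFDerivAt.const_smul Complex.I).fderiv

theorem IsHolFamily.paramDeriv {t : ℂ × E → F} (ht : IsHolFamily V U t) :
    IsHolFamily V U (paramDeriv t) where
  smooth := contDiffOn_paramDeriv hV hU ht.smooth
  hol z hz := by
    ext v
    rw [smul_apply, fderiv_paramDeriv hV hU ht.smooth hz,
      fderiv_paramDeriv hV hU ht.smooth hz, fderiv_fderiv_comm hV hU ht.smooth hz,
      ht.fderiv_hol hV hU hz, fderiv_fderiv_comm hV hU ht.smooth hz]

theorem IsHolFamily.baseDeriv {t : ℂ × E → F} (ht : IsHolFamily V U t) :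
    IsHolFamily V U (baseDeriv t) where
  smooth := contDiffOn_baseDeriv hV hU ht.smooth
  hol z hz := by
    have h := fun a => fderiv_fderiv_apply hV hU ht.smooth hz a (1, 0)
    unfold SuperTori.baseDeriv
    rw [h, h, fderiv_fderiv_comm hV hU ht.smooth hz, ht.fderiv_hol hV hU hz]

omit hV hU in
theorem differentiableAt_complex_of_real {f : ℂ → F} {a : ℂ} (hf : DifferentiableAt ℝ f a)
    (h : fderiv ℝ f a Complex.I = Complex.I • fderiv ℝ f a 1) :
    DifferentiableAt ℂ f a ∧ deriv f a = fderiv ℝ f a 1 := by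
  set D := fderiv ℝ f a
  have hD : D = ((ContinuousLinearMap.toSpanSingleton ℂ (D 1) : ℂ →L[ℂ] F).restrictScalars ℝ) := by
    refine ContinuousLinearMap.ext fun z => ?_
    have hz : z = z.re • (1 : ℂ) + z.im • Complex.I := by simp
    conv_lhs => rw [hz, map_add, map_smul, map_smul, h]
    rw [ContinuousLinearMap.coe_restrictScalars', ContinuousLinearMap.toSpanSingleton_apply]
    conv_rhs => rw [← Complex.re_add_im z, add_smul, mul_smul, ofReal_smul_eq, ofReal_smul_eq]
  have h1 : HasDerivAt f (D 1) a := by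
    rw [hasDerivAt_iff_hasFDerivAt]
    exact hasFDerivAt_of_restrictScalars ℝ hf.hasFDerivAt hD.symm
  exact ⟨h1.differentiableAt, h1.deriv⟩

/-- Cauchy's estimate for the base derivative of a holomorphic family. -/
theorem IsHolFamily.norm_baseDeriv_le {t : ℂ × E → F} (ht : IsHolFamily V U t) {a : ℂ} {R b : ℝ}
    (hR : 0 < R) (ha : Metric.closedBall a R ⊆ V) {x : E} (hx : x ∈ U)
    (hb : ∀ ζ ∈ Metric.closedBall a R, ‖t (ζ, x)‖ ≤ b) :
    ‖SuperTori.baseDeriv t (a, x)‖ ≤ b / R := by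
  have key : ∀ ζ ∈ V, DifferentiableAt ℂ (fun ζ => t (ζ, x)) ζ ∧
      deriv (fun ζ => t (ζ, x)) ζ = SuperTori.baseDeriv t (ζ, x) := by
    intro ζ hζ
    have h1 := (differentiableAt_of_smooth hV hU ht.smooth (z := (ζ, x)) ⟨hζ,
        hx⟩).hasFDerivAt.comp ζ
      (hasFDerivAt_prodMk_left (𝕜 := ℝ) ζ x)
    have h2 := differentiableAt_complex_of_real h1.differentiableAt (by
      rw [h1.fderiv]; simpa using ht.hol _ ⟨hζ, hx⟩)
    refine ⟨h2.1, h2.2.trans ?_⟩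
    rw [h1.fderiv]; simp [SuperTori.baseDeriv]
  rw [← (key a (ha (Metric.mem_closedBall_self hR.le))).2]
  refine Complex.norm_deriv_le_of_forall_mem_sphere_norm_le hR ?_
    fun ζ hζ => hb ζ (Metric.sphere_subset_closedBall hζ)
  refine DifferentiableOn.diffContOnCl fun ζ hζ => (key ζ (ha ?_)).1.differentiableWithinAt
  exact Metric.closure_ball_subset_closedBall hζ

/-- Cauchy's estimate for the base derivative, at the level of the parameter derivatives. -/
theorem IsHolFamily.norm_iteratedFDeriv_baseDeriv_le (r : ℕ) {a : ℂ} {R b : ℝ}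
    (hR : 0 < R) (ha : Metric.closedBall a R ⊆ V) {x : E} (hx : x ∈ U)
    {t : ℂ × E → F} (ht : IsHolFamily V U t)
    (hb : ∀ ζ ∈ Metric.closedBall a R, ‖iteratedFDeriv ℝ r (fun y => t (ζ, y)) x‖ ≤ b) :
    ‖iteratedFDeriv ℝ r (fun y => SuperTori.baseDeriv t (a, y)) x‖ ≤ b / R := by
  induction r generalizing F with
  | zero =>
    simp only [norm_iteratedFDeriv_zero] at hb ⊢
    exact ht.norm_baseDeriv_le hV hU hR ha hx hb
  | succ r ih =>
    rw [← norm_iteratedFDeriv_fderiv]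
    have h1 : fderiv ℝ (fun y => SuperTori.baseDeriv t (a, y)) =ᶠ[𝓝 x]
        fun y => SuperTori.baseDeriv (SuperTori.paramDeriv t) (a, y) := by
      filter_upwards [hU.mem_nhds hx] with y hy
      exact paramDeriv_baseDeriv hV hU ht.smooth
        (z := (a, y)) ⟨ha (Metric.mem_closedBall_self hR.le), hy⟩
    rw [h1.iteratedFDeriv ℝ r |>.eq_of_nhds]
    refine ih (ht.paramDeriv hV hU) fun ζ hζ => ?_
    have := hb ζ hζ
    rwa [← norm_iteratedFDeriv_fderiv] at this

omit hV hU in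
variable (E F) in
/-- The real linear map of `ℂ × E` that is complex linear on `ℂ`, with given restrictions to
`1 ∈ ℂ` and to `E`. -/
noncomputable def assembleDeriv : F × (E →L[ℝ] F) →L[ℝ] (ℂ × E →L[ℝ] F) :=
  (((ContinuousLinearMap.compL ℝ (ℂ × E) ℂ F).flip (ContinuousLinearMap.fst ℝ ℂ E)).comp
    (ContinuousLinearMap.smulRightL ℝ ℂ F Complex.reCLM +
      (ContinuousLinearMap.smulRightL ℝ ℂ F Complex.imCLM).comp
        (Complex.I • ContinuousLinearMap.id ℝ F))).comp (ContinuousLinearMap.fst ℝ F (E →L[ℝ] F)) +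
  ((ContinuousLinearMap.compL ℝ (ℂ × E) E F).flip (ContinuousLinearMap.snd ℝ ℂ E)).comp
    (ContinuousLinearMap.snd ℝ F (E →L[ℝ] F))

omit hV hU in
theorem assembleDeriv_apply (p : F) (q : E →L[ℝ] F) (z : ℂ × E) :
    assembleDeriv E F (p, q) z = z.1.re • p + z.1.im • Complex.I • p + q z.2 := by
  simp [assembleDeriv]

theorem IsHolFamily.fderiv_eq {t : ℂ × E → F} (ht : IsHolFamily V U t) {z : ℂ × E}
    (hz : z ∈ V ×ˢ U) :
    fderiv ℝ t z = assembleDeriv E F (SuperTori.baseDeriv t z, SuperTori.paramDeriv t z) := by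
  refine ContinuousLinearMap.ext fun a => ?_
  rw [assembleDeriv_apply, paramDeriv_eq hV hU ht.smooth hz]
  have : a = a.1.re • ((1, 0) : ℂ × E) + a.1.im • ((Complex.I, 0) : ℂ × E) + (0, a.2) := by
    ext <;> simp
  conv_lhs => rw [this, map_add, map_add, map_smul, map_smul, ht.hol z hz]
  rfl

omit hV hU in
/-- Local uniform summability of all parameter derivatives of a series of families. Derivatives
along `ℂ` need no separate condition for holomorphic families, by Cauchy's estimate. -/
def LocallySummable {ι : Type*} (V : Set ℂ) (U : Set E) (t : ι → ℂ × E → F) : Prop :=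
  ∀ r : ℕ, ∀ z ∈ V ×ˢ U, ∃ ρ > 0, ∃ b : ι → ℝ, Summable b ∧ ∀ i, ∀ z' ∈ Metric.closedBall z ρ,
    ‖iteratedFDeriv ℝ r (fun y => t i (z'.1, y)) z'.2‖ ≤ b i

omit hV hU [NormedSpace ℂ F] [IsScalarTower ℝ ℂ F] in
theorem LocallySummable.paramDeriv {ι : Type*} {t : ι → ℂ × E → F} (h : LocallySummable V U t) :
    LocallySummable V U fun i => paramDeriv (t i) := by
  intro r z hz
  obtain ⟨ρ, hρ, b, hb, hle⟩ := h (r + 1) z hz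
  refine ⟨ρ, hρ, b, hb, fun i z' hz' => ?_⟩
  have := hle i z' hz'
  rwa [← norm_iteratedFDeriv_fderiv] at this

theorem LocallySummable.baseDeriv {ι : Type*} {t : ι → ℂ × E → F} (h : LocallySummable V U t)
    (ht : ∀ i, IsHolFamily V U (t i)) : LocallySummable V U fun i => baseDeriv (t i) := by
  intro r z hz
  obtain ⟨ρ, hρ, b, hb, hle⟩ := h r z hz
  obtain ⟨ρ', hρ', hsub⟩ := Metric.nhds_basis_closedBall.mem_iff.1 ((hV.prod hU).mem_nhds hz)
  set R := min ρ ρ' / 2 with hRdef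
  have hR : 0 < R := by positivity
  have h2R : R + R ≤ ρ := by rw [hRdef]; linarith [min_le_left ρ ρ']
  have h2R' : R + R ≤ ρ' := by rw [hRdef]; linarith [min_le_right ρ ρ']
  refine ⟨R, hR, fun i => b i / R, hb.div_const R, fun i z' hz' => ?_⟩
  have hmem : ∀ ζ ∈ Metric.closedBall z'.1 R, dist (ζ, z'.2) z ≤ R + R := by
    intro ζ hζ
    have h1 : dist (ζ, z'.2) z' ≤ R := by
      rw [Prod.dist_eq]; simpa [hR.le] using hζ
    linarith [dist_triangle (ζ, z'.2) z' z, Metric.mem_closedBall.1 hz']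
  refine (ht i).norm_iteratedFDeriv_baseDeriv_le hV hU r hR (fun ζ hζ => ?_) ?_ fun ζ hζ => ?_
  · exact (hsub (Metric.mem_closedBall.2 ((hmem ζ hζ).trans h2R'))).1
  · exact (hsub (Metric.mem_closedBall.2 ((Metric.mem_closedBall.1 hz').trans
      (by linarith)))).2
  · exact hle i (ζ, z'.2) (Metric.mem_closedBall.2 ((hmem ζ hζ).trans h2R))

omit hV hU [NormedSpace ℂ F] [IsScalarTower ℝ ℂ F] in
theorem LocallySummable.summable [CompleteSpace F] {ι : Type*} {t : ι → ℂ × E → F}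
    (h : LocallySummable V U t) {z : ℂ × E} (hz : z ∈ V ×ˢ U) : Summable fun i => t i z := by
  obtain ⟨ρ, hρ, b, hb, hle⟩ := h 0 z hz
  refine Summable.of_norm_bounded hb fun i => ?_
  simpa using hle i z (Metric.mem_closedBall_self hρ.le)

theorem LocallySummable.hasFDerivAt_tsum [CompleteSpace F] {ι : Type*} {t : ι → ℂ × E → F}
    (h : LocallySummable V U t) (ht : ∀ i, IsHolFamily V U (t i)) {z : ℂ × E} (hz : z ∈ V ×ˢ U) :
    HasFDerivAt (fun z => ∑' i, t i z) (assembleDeriv E F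
      (∑' i, SuperTori.baseDeriv (t i) z, ∑' i, SuperTori.paramDeriv (t i) z)) z := by
  obtain ⟨ρ₁, hρ₁, b₁, hb₁, hle₁⟩ := h.baseDeriv hV hU ht 0 z hz
  obtain ⟨ρ₂, hρ₂, b₂, hb₂, hle₂⟩ := h.paramDeriv 0 z hz
  obtain ⟨ρ', hρ', hsub⟩ := Metric.nhds_basis_closedBall.mem_iff.1 ((hV.prod hU).mem_nhds hz)
  set ρ := min (min ρ₁ ρ₂) ρ'
  have hρ : 0 < ρ := by positivity
  have hsub' : Metric.ball z ρ ⊆ V ×ˢ U := (Metric.ball_subset_closedBall.trans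
    (Metric.closedBall_subset_closedBall (min_le_right _ _))).trans hsub
  have hsub₁ : Metric.ball z ρ ⊆ Metric.closedBall z ρ₁ := Metric.ball_subset_closedBall.trans
    (Metric.closedBall_subset_closedBall ((min_le_left _ _).trans (min_le_left _ _)))
  have hsub₂ : Metric.ball z ρ ⊆ Metric.closedBall z ρ₂ := Metric.ball_subset_closedBall.trans
    (Metric.closedBall_subset_closedBall ((min_le_left _ _).trans (min_le_right _ _)))
  have hzb : z ∈ Metric.ball z ρ := Metric.mem_ball_self hρ
  have hmain := hasFDerivAt_tsum_of_isPreconnected (𝕜 := ℝ) (f := t) (f' := fun i => fderiv ℝ (t i))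
    (u := fun i => ‖assembleDeriv E F‖ * (b₁ i + b₂ i))
    ((hb₁.add hb₂).mul_left _) Metric.isOpen_ball (convex_ball z ρ).isPreconnected
    (fun i z' hz' => (differentiableAt_of_smooth hV hU (ht i).smooth (hsub' hz')).hasFDerivAt)
    (fun i z' hz' => ?_) hzb (h.summable hz) hzb
  · convert! hmain using 1
    simp_rw [fun i => (ht i).fderiv_eq hV hU hz]
    have s1 := (h.baseDeriv hV hU ht).summable hz
    have s2 := h.paramDeriv.summable hz
    exact ((s1.hasSum.prodMk s2.hasSum).mapL (assembleDeriv E F)).tsum_eq.symm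
  · rw [(ht i).fderiv_eq hV hU (hsub' hz')]
    refine ((assembleDeriv E F).le_opNorm _).trans ?_
    gcongr
    have h1 := hle₁ i z' (hsub₁ hz')
    have h2 := hle₂ i z' (hsub₂ hz')
    simp only [norm_iteratedFDeriv_zero] at h1 h2
    rw [Prod.norm_def]
    exact max_le (h1.trans (le_add_of_nonneg_right ((norm_nonneg _).trans h2)))
      (h2.trans (le_add_of_nonneg_left ((norm_nonneg _).trans h1)))

/-- By induction on the order of differentiability: both partial derivatives of the series are again
locally summable series of holomorphic families. -/
theorem LocallySummable.contDiffOn_tsum [CompleteSpace F] {ι : Type*} {t : ι → ℂ × E → F}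
    (h : LocallySummable V U t) (ht : ∀ i, IsHolFamily V U (t i)) :
    ContDiffOn ℝ ∞ (fun z => ∑' i, t i z) (V ×ˢ U) := by
  rw [contDiffOn_infty]
  intro n
  induction n generalizing F with
  | zero =>
    refine contDiffOn_zero.2 fun z hz => ?_
    exact (h.hasFDerivAt_tsum hV hU ht hz).continuousAt.continuousWithinAt
  | succ n ih =>
    have hd := fun z (hz : z ∈ V ×ˢ U) => h.hasFDerivAt_tsum hV hU ht hz
    push_cast
    rw [contDiffOn_succ_iff_fderiv_of_isOpen (hV.prod hU)]
    refine ⟨fun z hz => (hd z hz).differentiableAt.differentiableWithinAt, by simp, ?_⟩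
    refine ContDiffOn.congr ((assembleDeriv E F).contDiff.comp_contDiffOn
      ((ih (h.baseDeriv hV hU ht) fun i => (ht i).baseDeriv hV hU).prodMk
        (ih h.paramDeriv fun i => (ht i).paramDeriv hV hU))) fun z hz => (hd z hz).fderiv

/-- A locally summable series of holomorphic families is a holomorphic family. -/
theorem LocallySummable.isHolFamily_tsum [CompleteSpace F] {ι : Type*} {t : ι → ℂ × E → F}
    (h : LocallySummable V U t) (ht : ∀ i, IsHolFamily V U (t i)) :
    IsHolFamily V U (fun z => ∑' i, t i z) where
  smooth := h.contDiffOn_tsum hV hU ht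
  hol z hz := by
    rw [(h.hasFDerivAt_tsum hV hU ht hz).fderiv]
    simp [assembleDeriv_apply]

theorem LocallySummable.paramDeriv_tsum [CompleteSpace F] {ι : Type*} {t : ι → ℂ × E → F}
    (h : LocallySummable V U t) (ht : ∀ i, IsHolFamily V U (t i)) {z : ℂ × E} (hz : z ∈ V ×ˢ U) :
    SuperTori.paramDeriv (fun z => ∑' i, t i z) z = ∑' i, SuperTori.paramDeriv (t i) z := by
  rw [paramDeriv_eq hV hU (h.contDiffOn_tsum hV hU ht) hz, (h.hasFDerivAt_tsum hV hU ht hz).fderiv]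
  ext v
  simp [assembleDeriv_apply]

end HolomorphicFamilies

/-! ### The modular group and the discriminant -/

section Modular

open Matrix

theorem det_eq (γ : SpecialLinearGroup (Fin 2) ℤ) :
    (γ 0 0 : ℂ) * γ 1 1 - γ 0 1 * γ 1 0 = 1 := by
  have := γ.det_coe
  rw [Matrix.det_fin_two] at this
  exact_mod_cast this

theorem cocycle_ne_zero (γ : SpecialLinearGroup (Fin 2) ℤ) {τ : ℂ} (hτ : τ ∈ upperHalf) :
    cocycle γ τ ≠ 0 := by
  intro h
  have hτ' : 0 < τ.im := hτ
  have him := congrArg Complex.im h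
  have hre := congrArg Complex.re h
  simp [cocycle] at him hre
  have hc : γ 1 0 = 0 := him.resolve_right hτ'.ne'
  rw [hc] at hre
  have hd := det_eq γ
  simp only [hc] at hd
  simp only [Int.cast_zero, zero_mul, zero_add, Int.cast_eq_zero] at hre
  simp [hre] at hd

theorem moebius_mul_cocycle (γ : SpecialLinearGroup (Fin 2) ℤ) {τ : ℂ} (hτ : τ ∈ upperHalf) :
    moebius γ τ * cocycle γ τ = γ 0 0 * τ + γ 0 1 :=
  div_mul_cancel₀ _ (cocycle_ne_zero γ hτ)

theorem moebius_im (γ : SpecialLinearGroup (Fin 2) ℤ) (τ : ℂ) :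
    (moebius γ τ).im = τ.im / Complex.normSq (cocycle γ τ) := by
  have h := congrArg Complex.re (det_eq γ)
  simp at h
  rw [moebius, Complex.div_im]
  simp only [cocycle, Complex.add_re, Complex.add_im, Complex.mul_re, Complex.mul_im,
    Complex.intCast_re, Complex.intCast_im]
  rw [← sub_div]
  congr 1
  linear_combination τ.im * h

theorem moebius_mem (γ : SpecialLinearGroup (Fin 2) ℤ) {τ : ℂ} (hτ : τ ∈ upperHalf) :
    moebius γ τ ∈ upperHalf := by
  change 0 < (moebius γ τ).im
  rw [moebius_im]
  exact div_pos hτ (Complex.normSq_pos.2 (cocycle_ne_zero γ hτ))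

@[simp] theorem cocycle_one (τ : ℂ) : cocycle 1 τ = 1 := by simp [cocycle]

@[simp] theorem moebius_one (τ : ℂ) : moebius 1 τ = τ := by simp [moebius]

theorem mul_entry (γ δ : SpecialLinearGroup (Fin 2) ℤ) (i j : Fin 2) :
    (γ * δ) i j = γ i 0 * δ 0 j + γ i 1 * δ 1 j := by
  change (γ.1 * δ.1) i j = _
  rw [Matrix.mul_apply, Fin.sum_univ_two]

theorem cocycle_mul (γ δ : SpecialLinearGroup (Fin 2) ℤ) {τ : ℂ} (hτ : τ ∈ upperHalf) :
    cocycle (γ * δ) τ = cocycle γ (moebius δ τ) * cocycle δ τ := by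
  have h := moebius_mul_cocycle δ hτ
  rw [cocycle, cocycle, add_mul, mul_assoc, h, cocycle, mul_entry, mul_entry]
  push_cast
  ring

theorem moebius_mul (γ δ : SpecialLinearGroup (Fin 2) ℤ) {τ : ℂ} (hτ : τ ∈ upperHalf) :
    moebius (γ * δ) τ = moebius γ (moebius δ τ) := by
  have h := moebius_mul_cocycle δ hτ
  rw [moebius, cocycle_mul γ δ hτ, mul_entry, mul_entry]
  generalize moebius δ τ = σ at h ⊢
  rw [moebius, ← mul_div_mul_right _ (cocycle γ σ) (cocycle_ne_zero δ hτ), add_mul, mul_assoc, h,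
    cocycle, cocycle]
  congr 1
  push_cast
  ring

theorem isOpen_upperHalf : IsOpen upperHalf := isOpen_lt continuous_const Complex.continuous_im

theorem hasDerivAt_moebius (γ : SpecialLinearGroup (Fin 2) ℤ) {τ : ℂ} (hτ : τ ∈ upperHalf) :
    HasDerivAt (moebius γ) ((cocycle γ τ ^ 2)⁻¹) τ := by
  have h0 := cocycle_ne_zero γ hτ
  have h1 : HasDerivAt (fun τ : ℂ => (γ 0 0 : ℂ) * τ + γ 0 1) (γ 0 0 : ℂ) τ := by
    simpa using ((hasDerivAt_id τ).const_mul (γ 0 0 : ℂ)).add_const (γ 0 1 : ℂ)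
  have h2 : HasDerivAt (fun τ : ℂ => cocycle γ τ) (γ 1 0 : ℂ) τ := by
    unfold cocycle
    simpa using ((hasDerivAt_id τ).const_mul (γ 1 0 : ℂ)).add_const (γ 1 1 : ℂ)
  convert! h1.div h2 h0 using 1
  rw [inv_eq_one_div]
  congr 1
  rw [← det_eq γ]
  simp only [cocycle]; ring

theorem coe_smul_eq_moebius (γ : SpecialLinearGroup (Fin 2) ℤ) (z : UpperHalfPlane) :
    ((γ • z : UpperHalfPlane) : ℂ) = moebius γ z := by
  rw [UpperHalfPlane.specialLinearGroup_apply]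
  simp [moebius, cocycle]

/-- The modular discriminant, as a function on `ℂ` (only its values on the upper half plane
matter). -/
noncomputable def discr (τ : ℂ) : ℂ := ModularForm.discriminant (UpperHalfPlane.ofComplex τ)

theorem discr_coe (z : UpperHalfPlane) : discr z = ModularForm.discriminant z := by
  simp [discr]

theorem differentiableOn_discr : DifferentiableOn ℂ discr upperHalf :=
  UpperHalfPlane.mdifferentiable_iff.1 CuspForm.discriminant.holo'

theorem discr_ne_zero (τ : ℂ) : discr τ ≠ 0 := ModularForm.discriminant_ne_zero _

theorem discr_moebius (γ : SpecialLinearGroup (Fin 2) ℤ) {τ : ℂ} (hτ : τ ∈ upperHalf) :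
    discr (moebius γ τ) = cocycle γ τ ^ 12 * discr τ := by
  have h := SlashInvariantForm.slash_action_eqn' CuspForm.discriminant
    (γ := SpecialLinearGroup.mapGL ℝ γ) (MonoidHom.mem_range.2 ⟨γ, rfl⟩) (⟨τ, hτ⟩ : UpperHalfPlane)
  have h1 : moebius γ τ = ((γ • (⟨τ, hτ⟩ : UpperHalfPlane) : UpperHalfPlane) : ℂ) :=
    (coe_smul_eq_moebius γ ⟨τ, hτ⟩).symm
  have h2 : discr τ = CuspForm.discriminant ⟨τ, hτ⟩ := discr_coe ⟨τ, hτ⟩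
  rw [h1, discr_coe, h2]
  refine Eq.trans h ?_
  simp [cocycle]

/-- The exponential decay of `Δ` at the cusp beats the polynomial factor. -/
theorem exists_norm_discr_le {ε : ℝ} (hε : 0 < ε) : ∃ Y : ℝ, ∀ ζ : ℂ, 0 < ζ.im → Y ≤ ζ.im →
    |ζ.re| ≤ 1 → ‖discr ζ * (ζ + Complex.I) ^ 12‖ ≤ ε := by
  have h := CuspFormClass.exp_decay_atImInfty (h := 1) CuspForm.discriminant one_pos
    one_mem_strictPeriods_SL
  obtain ⟨C, hC⟩ := h.bound
  rw [UpperHalfPlane.atImInfty, eventually_comap] at hC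
  obtain ⟨Y, hY⟩ := eventually_atTop.1 hC
  have ht : Tendsto (fun y : ℝ => |C| * ((3 * y) ^ 12 * Real.exp (-(2 * Real.pi) * y))) atTop
      (𝓝 0) := by
    have h1 := tendsto_rpow_mul_exp_neg_mul_atTop_nhds_zero 12 (2 * Real.pi) (by positivity)
    have := (h1.const_mul (|C| * 3 ^ 12))
    simp only [mul_zero] at this
    refine this.congr fun y => ?_
    rw [show y ^ (12 : ℝ) = y ^ 12 by norm_cast]
    ring
  obtain ⟨Y', hY'⟩ := eventually_atTop.1 (ht.eventually_le_const hε)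
  refine ⟨max Y (max Y' 1), fun ζ h0 hζ hre => ?_⟩
  have h1 : 1 ≤ ζ.im := (le_max_right _ _).trans ((le_max_right _ _).trans hζ)
  have h2 := hY ζ.im ((le_max_left _ _).trans hζ) ⟨ζ, h0⟩ rfl
  refine le_trans ?_ (hY' ζ.im ((le_max_left _ _).trans ((le_max_right _ _).trans hζ)))
  rw [norm_mul, norm_pow, mul_comm, mul_left_comm]
  have h3 : ‖ζ + Complex.I‖ ≤ 3 * ζ.im := by
    refine (Complex.norm_le_abs_re_add_abs_im _).trans ?_
    simp only [Complex.add_re, Complex.I_re, add_zero, Complex.add_im, Complex.I_im]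
    rw [abs_of_pos (by linarith : 0 < ζ.im + 1)]; linarith
  have h4 : ‖discr ζ‖ ≤ |C| * Real.exp (-(2 * Real.pi) * ζ.im) := by
    have : discr ζ = CuspForm.discriminant ⟨ζ, h0⟩ := discr_coe ⟨ζ, h0⟩
    rw [this]
    refine h2.trans ?_
    rw [Real.norm_eq_abs, Real.abs_exp]
    have h5 : -2 * Real.pi * UpperHalfPlane.im ⟨ζ, h0⟩ / 1 = -(2 * Real.pi) * ζ.im := by
      change -2 * Real.pi * ζ.im / 1 = _; ring
    rw [h5]
    gcongr
    exact le_abs_self C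
  gcongr

/-- The function `(a τ + b) + i (c τ + d) = (c τ + d) (γ τ + i)`, a lift of the distance from `i`
to `γ τ`. -/
noncomputable def shiftCocycle (γ : SpecialLinearGroup (Fin 2) ℤ) (τ : ℂ) : ℂ :=
  (γ 0 0 : ℂ) * τ + γ 0 1 + Complex.I * cocycle γ τ

theorem shiftCocycle_eq (γ : SpecialLinearGroup (Fin 2) ℤ) {τ : ℂ} (hτ : τ ∈ upperHalf) :
    shiftCocycle γ τ = cocycle γ τ * (moebius γ τ + Complex.I) := by
  rw [shiftCocycle, ← moebius_mul_cocycle γ hτ]; ring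

theorem shiftCocycle_mul (γ δ : SpecialLinearGroup (Fin 2) ℤ) {τ : ℂ} (hτ : τ ∈ upperHalf) :
    shiftCocycle (γ * δ) τ = shiftCocycle γ (moebius δ τ) * cocycle δ τ := by
  rw [shiftCocycle_eq _ hτ, shiftCocycle_eq _ (moebius_mem δ hτ), cocycle_mul γ δ hτ,
    moebius_mul γ δ hτ]
  ring

/-- Both rows of `γ` contribute to `|shiftCocycle γ τ|`, so that it controls all entries of `γ`,
unlike `|c τ + d|`. This is why a Poincaré series over the whole modular group, and not only over
cosets, converges. -/
theorem normSq_shiftCocycle (γ : SpecialLinearGroup (Fin 2) ℤ) (τ : ℂ) :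
    Complex.normSq (shiftCocycle γ τ) =
      Complex.normSq ((γ 0 0 : ℂ) * τ + γ 0 1) + Complex.normSq (cocycle γ τ) + 2 * τ.im := by
  have h := congrArg Complex.re (det_eq γ)
  simp at h
  simp only [shiftCocycle, cocycle, Complex.normSq_apply, Complex.add_re, Complex.add_im,
    Complex.mul_re, Complex.mul_im, Complex.intCast_re, Complex.intCast_im, Complex.I_re,
    Complex.I_im]
  linear_combination 2 * τ.im * h

theorem one_le_norm_row (γ : SpecialLinearGroup (Fin 2) ℤ) (i : Fin 2) :
    1 ≤ ‖((γ : Matrix (Fin 2) (Fin 2) ℤ) i : Fin 2 → ℤ)‖ := by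
  have h : ((γ : Matrix (Fin 2) (Fin 2) ℤ) i : Fin 2 → ℤ) ≠ 0 := γ.row_ne_zero i
  rw [EisensteinSeries.norm_eq_max_natAbs]
  have : max ((γ : Matrix (Fin 2) (Fin 2) ℤ) i 0).natAbs ((γ : Matrix (Fin 2)
      (Fin 2) ℤ) i 1).natAbs ≠ 0 := by
    intro h0
    refine h (funext fun k => ?_)
    fin_cases k <;> simp <;> omega
  exact_mod_cast Nat.one_le_iff_ne_zero.2 this

/-- Locally uniformly in `τ`, the entries of `γ` are bounded by multiples of `|a τ + b|` and
`|c τ + d|`. -/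
theorem exists_rows_le {A B : ℝ} (hB : 0 < B) : ∃ r > 0, ∀ τ : ℂ, |τ.re| ≤ A → B ≤ τ.im →
    ∀ γ : SpecialLinearGroup (Fin 2) ℤ, r * ‖(γ : Matrix (Fin 2) (Fin 2) ℤ) 0‖ ≤ ‖(γ 0 0 : ℂ) * τ
        + γ 0 1‖ ∧
      r * ‖(γ : Matrix (Fin 2) (Fin 2) ℤ) 1‖ ≤ ‖cocycle γ τ‖ := by
  refine ⟨EisensteinSeries.r ⟨⟨A, B⟩, hB⟩, EisensteinSeries.r_pos _, fun τ hre him γ => ?_⟩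
  have hτ : 0 < τ.im := hB.trans_le him
  have h1 := EisensteinSeries.r_lower_bound_on_verticalStrip (⟨τ, hτ⟩ : UpperHalfPlane) hB ⟨hre,
      him⟩
  refine ⟨?_, ?_⟩
  · exact (mul_le_mul_of_nonneg_right h1 (norm_nonneg _)).trans
      (EisensteinSeries.r_mul_max_le (⟨τ, hτ⟩ : UpperHalfPlane) (γ.row_ne_zero 0))
  · exact (mul_le_mul_of_nonneg_right h1 (norm_nonneg _)).trans
      (EisensteinSeries.r_mul_max_le (⟨τ, hτ⟩ : UpperHalfPlane) (γ.row_ne_zero 1))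

/-- The product of the norms of the rows of `γ`. -/
noncomputable def rowNorm (γ : SpecialLinearGroup (Fin 2) ℤ) : ℝ :=
  ‖(γ : Matrix (Fin 2) (Fin 2) ℤ) 0‖ * ‖(γ : Matrix (Fin 2) (Fin 2) ℤ) 1‖

theorem one_le_rowNorm (γ : SpecialLinearGroup (Fin 2) ℤ) : 1 ≤ rowNorm γ :=
  one_le_mul_of_one_le_of_one_le (one_le_norm_row γ 0) (one_le_norm_row γ 1)

theorem exists_rowNorm_le {A B : ℝ} (hB : 0 < B) : ∃ c > 0, ∀ τ : ℂ, |τ.re| ≤ A → B ≤ τ.im →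
    ∀ γ : SpecialLinearGroup (Fin 2) ℤ, c * rowNorm γ ≤ ‖shiftCocycle γ τ‖ ^ 2 := by
  obtain ⟨r, hr, h⟩ := exists_rows_le (A := A) hB
  refine ⟨r ^ 2, by positivity, fun τ hre him γ => ?_⟩
  obtain ⟨h0, h1⟩ := h τ hre him γ
  rw [← Complex.normSq_eq_norm_sq, normSq_shiftCocycle, Complex.normSq_eq_norm_sq,
    Complex.normSq_eq_norm_sq]
  have h2 : 0 ≤ r * ‖(γ : Matrix (Fin 2) (Fin 2) ℤ) 0‖ := by positivity
  have h3 : 0 ≤ r * ‖(γ : Matrix (Fin 2) (Fin 2) ℤ) 1‖ := by positivity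
  have h4 := mul_le_mul h0 h1 h3 (norm_nonneg _)
  rw [rowNorm]
  nlinarith [sq_nonneg (‖(γ 0 0 : ℂ) * τ + γ 0 1‖ - ‖cocycle γ τ‖), norm_nonneg (cocycle γ τ),
    norm_nonneg ((γ 0 0 : ℂ) * τ + γ 0 1)]

theorem rows_injective : Function.Injective fun γ : SpecialLinearGroup (Fin 2) ℤ =>
    ((γ : Matrix (Fin 2) (Fin 2) ℤ) 0, (γ : Matrix (Fin 2) (Fin 2) ℤ) 1) := by
  intro γ δ h
  ext i j
  fin_cases i
  · exact congrFun (congrArg Prod.fst h) j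
  · exact congrFun (congrArg Prod.snd h) j

theorem summable_rowNorm : Summable fun γ : SpecialLinearGroup (Fin 2) ℤ => (rowNorm γ ^ 3)⁻¹ := by
  have h1 : Summable fun x : Fin 2 → ℤ => ‖x‖ ^ (-3 : ℝ) :=
    EisensteinSeries.summable_one_div_norm_rpow (by norm_num)
  have h2 := h1.mul_of_nonneg h1 (fun _ => by positivity) (fun _ => by positivity)
  refine (h2.comp_injective rows_injective).congr fun γ => ?_
  simp only [Function.comp, rowNorm]
  rw [← Real.mul_rpow (norm_nonneg _) (norm_nonneg _), Real.rpow_neg (by positivity)]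
  norm_cast

theorem finite_rows_le (R : ℝ) : {γ : SpecialLinearGroup (Fin 2) ℤ |
    ‖(γ : Matrix (Fin 2) (Fin 2) ℤ) 0‖ ≤ R ∧ ‖(γ : Matrix (Fin 2) (Fin 2) ℤ) 1‖ ≤ R}.Finite := by
  have hf : (Metric.closedBall (0 : Fin 2 → ℤ) R).Finite :=
    (isCompact_closedBall (0 : Fin 2 → ℤ) R).finite_of_discrete
  refine ((hf.prod hf).preimage rows_injective.injOn).subset fun γ hγ => ?_
  simpa using hγ

end Modular

/-! ### An equivariant partition of unity -/

section Partition

open Matrix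

theorem contDiffOn_real_of_holomorphic {f : ℂ → ℂ} {s : Set ℂ} (hs : IsOpen s)
    (hf : DifferentiableOn ℂ f s) : ContDiffOn ℝ ∞ f s :=
  (hf.contDiffOn hs).restrict_scalars ℝ

theorem contDiffOn_moebius (γ : SpecialLinearGroup (Fin 2) ℤ) :
    ContDiffOn ℝ ∞ (moebius γ) upperHalf :=
  contDiffOn_real_of_holomorphic isOpen_upperHalf fun _ hτ =>
    (hasDerivAt_moebius γ hτ).differentiableAt.differentiableWithinAt

/-- The rectangles `|Re ζ| ≤ 1`, `m + 1/4 ≤ Im ζ ≤ m + 7/4`, whose translates under the modular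
group cover the upper half plane. -/
def strip (m : ℕ) : Set ℂ := {ζ | |ζ.re| ≤ 1 ∧ m + 1 / 4 ≤ ζ.im ∧ ζ.im ≤ m + 7 / 4}

theorem isCompact_strip (m : ℕ) : IsCompact (strip m) := by
  have : strip m = Icc (-1 : ℝ) 1 ×ℂ Icc ((m : ℝ) + 1 / 4) (m + 7 / 4) := by
    ext ζ
    simp [strip, Complex.mem_reProdIm, abs_le]
  rw [this]
  exact isCompact_Icc.reProdIm isCompact_Icc

theorem strip_subset (m : ℕ) : strip m ⊆ upperHalf := fun ζ hζ => by
  have : (0 : ℝ) ≤ m := m.cast_nonneg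
  have := hζ.2.1
  change 0 < ζ.im
  linarith

/-- Only finitely many pairs `(m, γ)` are such that `γ τ` lies in the `m`-th rectangle, locally
uniformly in `τ`. -/
theorem exists_finset_strip {τ₀ : ℂ} (hτ₀ : τ₀ ∈ upperHalf) :
    ∃ V, IsOpen V ∧ τ₀ ∈ V ∧ V ⊆ upperHalf ∧ ∃ s : Finset (ℕ × SpecialLinearGroup (Fin 2) ℤ),
      ∀ τ ∈ V, ∀ i, moebius i.2 τ ∈ strip i.1 → i ∈ s := by
  have hpos : 0 < τ₀.im := hτ₀
  set A := |τ₀.re| + 1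
  set B := τ₀.im / 2
  set B' := τ₀.im + 1
  have hB : 0 < B := by positivity
  obtain ⟨r, hr, hrows⟩ := exists_rows_le (A := A) hB
  set R := max (2 * √B' / r) ((B' / r ^ 2 + 1) * (2 * √B') / r)
  have hV : IsOpen {τ : ℂ | |τ.re| < A ∧ B < τ.im ∧ τ.im < B'} :=
    (isOpen_lt (Complex.continuous_re.abs) continuous_const).inter
      ((isOpen_lt continuous_const Complex.continuous_im).inter
        (isOpen_lt Complex.continuous_im continuous_const))
  refine ⟨_, hV, ⟨by simp [A], by simp only [B]; linarith, by simp [B']⟩,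
    fun τ hτ => hB.trans hτ.2.1, ((finite_le_nat ⌈B' / r ^ 2⌉₊).prod (finite_rows_le R)).toFinset,
        ?_⟩
  rintro τ ⟨hre, him, him'⟩ ⟨m, γ⟩ ⟨hm1, hm2, hm3⟩
  have hτ : τ ∈ upperHalf := hB.trans him
  obtain ⟨h0, h1⟩ := hrows τ hre.le him.le γ
  have hB' : 0 < B' := by positivity
  have hcne := cocycle_ne_zero γ hτ
  have hcpos : 0 < ‖cocycle γ τ‖ := norm_pos_iff.2 hcne
  have hm0 : (0 : ℝ) ≤ m := m.cast_nonneg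
  dsimp only at hm1 hm2 hm3
  -- `Im (γ τ)` is at most `B' / r ^ 2`, and `|c τ + d|` is at most `2 √B'`
  have hrc : r ≤ ‖cocycle γ τ‖ :=
    le_trans (le_mul_of_one_le_right hr.le (one_le_norm_row γ 1)) h1
  have himγ : (moebius γ τ).im * ‖cocycle γ τ‖ ^ 2 = τ.im := by
    rw [moebius_im, Complex.normSq_eq_norm_sq]; field_simp
  have h3 : (moebius γ τ).im ≤ B' / r ^ 2 := by
    rw [le_div_iff₀ (by positivity)]
    have : r ^ 2 ≤ ‖cocycle γ τ‖ ^ 2 := by gcongr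
    have him0 : 0 < (moebius γ τ).im := moebius_mem γ hτ
    nlinarith
  have h4 : ‖cocycle γ τ‖ ≤ 2 * √B' := by
    rw [show 2 * √B' = √(4 * B') by
      rw [Real.sqrt_mul (by norm_num), show (4 : ℝ) = 2 ^ 2 by norm_num, Real.sqrt_sq
          (by norm_num)]]
    refine Real.le_sqrt_of_sq_le ?_
    nlinarith [sq_nonneg ‖cocycle γ τ‖]
  have h5 : ‖moebius γ τ‖ ≤ B' / r ^ 2 + 1 := by
    refine (Complex.norm_le_abs_re_add_abs_im _).trans ?_
    rw [abs_of_pos (show 0 < (moebius γ τ).im from moebius_mem γ hτ)]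
    linarith
  have h6 : ‖(γ 0 0 : ℂ) * τ + γ 0 1‖ ≤ (B' / r ^ 2 + 1) * (2 * √B') := by
    rw [← moebius_mul_cocycle γ hτ, norm_mul]
    gcongr
  simp only [Finite.mem_toFinset, mem_prod, mem_ofPred_eq]
  refine ⟨?_, ?_, ?_⟩
  · exact_mod_cast (show (m : ℝ) ≤ B' / r ^ 2 by linarith).trans (Nat.le_ceil _)
  · refine le_trans ?_ (le_max_right _ _)
    rw [le_div_iff₀ hr, mul_comm]; exact h0.trans h6
  · refine le_trans ?_ (le_max_left _ _)
    rw [le_div_iff₀ hr, mul_comm]; exact h1.trans h4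

/-- Bump functions supported in the rectangles `strip m`. -/
noncomputable def rawCutoff (m : ℕ) (ζ : ℂ) : ℝ :=
  (⟨1 / 2, 1, by norm_num, by norm_num⟩ : ContDiffBump (0 : ℝ)) ζ.re *
    (⟨1 / 2, 3 / 4, by norm_num, by norm_num⟩ : ContDiffBump (0 : ℝ)) (ζ.im - (m + 1))

theorem contDiff_rawCutoff (m : ℕ) : ContDiff ℝ ∞ (rawCutoff m) :=
  ((ContDiffBump.contDiff _).comp Complex.reCLM.contDiff).mul
    ((ContDiffBump.contDiff _).comp (Complex.imCLM.contDiff.sub contDiff_const))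

theorem rawCutoff_nonneg (m : ℕ) (ζ : ℂ) : 0 ≤ rawCutoff m ζ :=
  mul_nonneg (ContDiffBump.nonneg _) (ContDiffBump.nonneg _)

theorem rawCutoff_eq_zero {m : ℕ} {ζ : ℂ} (h : ζ ∉ strip m) : rawCutoff m ζ = 0 := by
  by_contra hne
  refine h ?_
  have h1 := left_ne_zero_of_mul hne
  have h2 := right_ne_zero_of_mul hne
  have h1' : |ζ.re| < 1 := by
    by_contra hle
    exact h1 (ContDiffBump.zero_of_le_dist _ (by simpa using hle))
  have h2' : |ζ.im - (m + 1)| < 3 / 4 := by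
    by_contra hle
    exact h2 (ContDiffBump.zero_of_le_dist _ (by simpa using hle))
  rw [abs_lt] at h2'
  exact ⟨h1'.le, by linarith, by linarith⟩

theorem exists_rawCutoff_eq_one {τ : ℂ} (hτ : τ ∈ upperHalf) :
    ∃ i : ℕ × SpecialLinearGroup (Fin 2) ℤ, rawCutoff i.1 (moebius i.2 τ) = 1 := by
  obtain ⟨γ, h1, h2⟩ := ModularGroup.exists_smul_mem_fd (⟨τ, hτ⟩ : UpperHalfPlane)
  have hc : ((γ • (⟨τ, hτ⟩ : UpperHalfPlane) : UpperHalfPlane) : ℂ) = moebius γ τ :=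
    coe_smul_eq_moebius γ ⟨τ, hτ⟩
  have h2' : |(moebius γ τ).re| ≤ 1 / 2 := by rw [← hc]; exact h2
  rw [hc] at h1
  have him : 0 < (moebius γ τ).im := moebius_mem γ hτ
  have him2 : 1 / 2 < (moebius γ τ).im := by
    rw [Complex.normSq_apply] at h1
    have := abs_le.1 h2'
    by_contra hle
    nlinarith
  refine ⟨(⌊(moebius γ τ).im - 1 / 2⌋₊, γ), ?_⟩
  have h3 := Nat.floor_le (show 0 ≤ (moebius γ τ).im - 1 / 2 by linarith)
  have h4 := Nat.lt_floor_add_one ((moebius γ τ).im - 1 / 2)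
  rw [rawCutoff, ContDiffBump.one_of_mem_closedBall, ContDiffBump.one_of_mem_closedBall, one_mul]
  · rw [Metric.mem_closedBall, Real.dist_eq, sub_zero, abs_le]
    constructor <;> simp <;> linarith
  · simpa using h2'

/-- The sum of the translates of all bump functions. -/
noncomputable def totalCutoff (τ : ℂ) : ℝ :=
  ∑' i : ℕ × SpecialLinearGroup (Fin 2) ℤ, rawCutoff i.1 (moebius i.2 τ)

theorem totalCutoff_eq_sum {V : Set ℂ} {s : Finset (ℕ × SpecialLinearGroup (Fin 2) ℤ)}
    (h : ∀ τ ∈ V, ∀ i : ℕ × SpecialLinearGroup (Fin 2) ℤ, moebius i.2 τ ∈ strip i.1 → i ∈ s)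
    {τ : ℂ} (hτ : τ ∈ V) : totalCutoff τ = ∑ i ∈ s, rawCutoff i.1 (moebius i.2 τ) :=
  tsum_eq_sum fun i hi => rawCutoff_eq_zero fun hm => hi (h τ hτ i hm)

theorem contDiffOn_totalCutoff : ContDiffOn ℝ ∞ totalCutoff upperHalf := by
  intro τ₀ hτ₀
  obtain ⟨V, hV, hmem, hsub, s, hs⟩ := exists_finset_strip hτ₀
  have h1 : ContDiffOn ℝ ∞ (fun τ => ∑ i ∈ s, rawCutoff i.1 (moebius i.2 τ)) V :=
    ContDiffOn.sum fun i _ => (contDiff_rawCutoff i.1).comp_contDiffOn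
      ((contDiffOn_moebius i.2).mono hsub)
  have h2 : ContDiffOn ℝ ∞ totalCutoff V := h1.congr fun τ hτ => totalCutoff_eq_sum hs hτ
  exact (h2.contDiffAt (hV.mem_nhds hmem)).contDiffWithinAt

theorem totalCutoff_pos {τ : ℂ} (hτ : τ ∈ upperHalf) : 0 < totalCutoff τ := by
  obtain ⟨V, hV, hmem, hsub, s, hs⟩ := exists_finset_strip hτ
  obtain ⟨i, hi⟩ := exists_rawCutoff_eq_one hτ
  rw [totalCutoff_eq_sum hs hmem]
  refine Finset.sum_pos' (fun _ _ => rawCutoff_nonneg _ _) ⟨i, hs τ hmem i ?_, by simp [hi]⟩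
  by_contra h
  rw [rawCutoff_eq_zero h] at hi
  exact zero_ne_one hi

theorem totalCutoff_moebius (δ : SpecialLinearGroup (Fin 2) ℤ) {τ : ℂ} (hτ : τ ∈ upperHalf) :
    totalCutoff (moebius δ τ) = totalCutoff τ := by
  rw [totalCutoff, totalCutoff, ← (Equiv.prodCongr (Equiv.refl ℕ) (Equiv.mulRight δ)).tsum_eq
    fun i => rawCutoff i.1 (moebius i.2 τ)]
  refine tsum_congr fun i => ?_
  simp [moebius_mul i.2 δ hτ]

/-- A partition of unity: the translates of these functions under the modular group sum up to `1`
on the upper half plane. -/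
noncomputable def cutoff (m : ℕ) (ζ : ℂ) : ℝ := rawCutoff m ζ / totalCutoff ζ

theorem cutoff_eq_zero {m : ℕ} {ζ : ℂ} (h : ζ ∉ strip m) : cutoff m ζ = 0 := by
  rw [cutoff, rawCutoff_eq_zero h, zero_div]

theorem contDiffOn_cutoff (m : ℕ) : ContDiffOn ℝ ∞ (cutoff m) upperHalf :=
  (contDiff_rawCutoff m).contDiffOn.div contDiffOn_totalCutoff fun _ hτ => (totalCutoff_pos hτ).ne'

theorem sum_cutoff {V : Set ℂ} {s : Finset (ℕ × SpecialLinearGroup (Fin 2) ℤ)}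
    (h : ∀ τ ∈ V, ∀ i : ℕ × SpecialLinearGroup (Fin 2) ℤ, moebius i.2 τ ∈ strip i.1 → i ∈ s)
    (hV : V ⊆ upperHalf) {τ : ℂ} (hτ : τ ∈ V) : ∑ i ∈ s, cutoff i.1 (moebius i.2 τ) = 1 := by
  have h1 : ∀ i : ℕ × SpecialLinearGroup (Fin 2) ℤ,
      cutoff i.1 (moebius i.2 τ) = rawCutoff i.1 (moebius i.2 τ) / totalCutoff τ := fun i => by
    rw [cutoff, totalCutoff_moebius i.2 (hV hτ)]
  simp_rw [h1]
  rw [← Finset.sum_div, ← totalCutoff_eq_sum h hτ, div_self (totalCutoff_pos (hV hτ)).ne']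

end Partition

/-! ### The equivariant solution operator for `∂/∂τ̄` -/

section Solution

open Matrix (SpecialLinearGroup)

universe u
variable {E : Type u} [NormedAddCommGroup E] [NormedSpace ℝ E]
  {F : Type u} [NormedAddCommGroup F] [NormedSpace ℝ F] [NormedSpace ℂ F] [IsScalarTower ℝ ℂ F]
  {U : Set E} {w : ℤ} {N : ℕ → ℕ}

/-- The scalar `φ_m Δ^N (ζ + i)^{12 N + w}` by which a form is multiplied before the Cauchy
transform is applied. -/
noncomputable def weightFun (w : ℤ) (N : ℕ → ℕ) (m : ℕ) (ζ : ℂ) : ℂ :=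
  (cutoff m ζ : ℂ) * (discr ζ ^ N m * (ζ + Complex.I) ^ (12 * N m + w))

/-- The automorphy factor `Δ(τ)^N ((c τ + d) (γ τ + i))^{12 N + w}` by which the Cauchy transform is
divided. -/
noncomputable def factor (w : ℤ) (N : ℕ → ℕ) (i : ℕ × SpecialLinearGroup (Fin 2) ℤ) (τ : ℂ) : ℂ :=
  discr τ ^ N i.1 * shiftCocycle i.2 τ ^ (12 * N i.1 + w)

/-- The term of index `(m, γ)` of the series that solves the `∂/∂τ̄`-equation. -/
noncomputable def solTerm (w : ℤ) (N : ℕ → ℕ) (i : ℕ × SpecialLinearGroup (Fin 2) ℤ) (f : ℂ → F)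
    (τ : ℂ) : F :=
  (factor w N i τ)⁻¹ • cauchyTransform (fun ζ => weightFun w N i.1 ζ • f ζ) (moebius i.2 τ)

/-- The solution operator for `∂/∂τ̄`, extended by zero outside of the upper half plane. The
exponents `N m` govern the convergence of the series near the cusp. -/
noncomputable def sol (w : ℤ) (N : ℕ → ℕ) (f : ℂ → F) (τ : ℂ) : F :=
  open Classical in if τ ∈ upperHalf then ∑' i, solTerm w N i f τ else 0

theorem add_I_ne_zero {τ : ℂ} (hτ : τ ∈ upperHalf) : τ + Complex.I ≠ 0 := by
  intro h
  have := congrArg Complex.im h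
  have h0 : 0 < τ.im := hτ
  simp at this
  linarith

theorem shiftCocycle_ne_zero (γ : SpecialLinearGroup (Fin 2) ℤ) {τ : ℂ} (hτ : τ ∈ upperHalf) :
    shiftCocycle γ τ ≠ 0 := by
  rw [shiftCocycle_eq γ hτ]
  exact mul_ne_zero (cocycle_ne_zero γ hτ) (add_I_ne_zero (moebius_mem γ hτ))

theorem factor_ne_zero (i : ℕ × SpecialLinearGroup (Fin 2) ℤ) {τ : ℂ} (hτ : τ ∈ upperHalf) :
    factor w N i τ ≠ 0 :=
  mul_ne_zero (pow_ne_zero _ (discr_ne_zero τ)) (zpow_ne_zero _ (shiftCocycle_ne_zero _ hτ))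

theorem differentiable_shiftCocycle (γ : SpecialLinearGroup (Fin 2) ℤ) :
    Differentiable ℂ (shiftCocycle γ) := by
  unfold shiftCocycle cocycle; fun_prop

theorem differentiableOn_factor (i : ℕ × SpecialLinearGroup (Fin 2) ℤ) :
    DifferentiableOn ℂ (factor w N i) upperHalf := fun τ hτ => by
  have h1 : DifferentiableAt ℂ (fun τ => shiftCocycle i.2 τ ^ (12 * N i.1 + w)) τ :=
    (differentiable_shiftCocycle i.2 τ).zpow (Or.inl (shiftCocycle_ne_zero _ hτ))
  exact ((differentiableOn_discr τ hτ).pow _).mul h1.differentiableWithinAt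

theorem contDiffOn_factor_inv (i : ℕ × SpecialLinearGroup (Fin 2) ℤ) :
    ContDiffOn ℝ ∞ (fun τ => (factor w N i τ)⁻¹) upperHalf :=
  contDiffOn_real_of_holomorphic isOpen_upperHalf
    ((differentiableOn_factor i).inv fun _ hτ => factor_ne_zero i hτ)

theorem weightFun_eq_zero {m : ℕ} {ζ : ℂ} (h : ζ ∉ strip m) : weightFun w N m ζ = 0 := by
  simp [weightFun, cutoff_eq_zero h]

theorem contDiffOn_weightFun (m : ℕ) : ContDiffOn ℝ ∞ (weightFun w N m) upperHalf := by
  refine (Complex.ofRealCLM.contDiff.comp_contDiffOn (contDiffOn_cutoff m)).mul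
    (contDiffOn_real_of_holomorphic isOpen_upperHalf fun τ hτ => ?_)
  have h1 : DifferentiableAt ℂ (fun τ : ℂ => (τ + Complex.I) ^ (12 * N m + w)) τ :=
    (by fun_prop : DifferentiableAt ℂ (fun τ : ℂ => τ + Complex.I) τ).zpow
      (Or.inl (add_I_ne_zero hτ))
  exact ((differentiableOn_discr τ hτ).pow _).mul h1.differentiableWithinAt

/-- The automorphy factor makes the terms of the series permute under the modular group, up to the
weight `w`. -/
theorem factor_mul (m : ℕ) (γ δ : SpecialLinearGroup (Fin 2) ℤ) {τ : ℂ} (hτ : τ ∈ upperHalf) :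
    factor w N (m, γ * δ) τ * cocycle δ τ ^ (-w) = factor w N (m, γ) (moebius δ τ) := by
  have h0 := cocycle_ne_zero δ hτ
  simp only [factor, shiftCocycle_mul γ δ hτ, discr_moebius δ hτ, mul_zpow, mul_pow]
  have h1 : cocycle δ τ ^ (12 * (N m : ℤ) + w) * cocycle δ τ ^ (-w) = (cocycle δ τ ^ 12) ^ N m := by
    rw [← zpow_add₀ h0, ← pow_mul, ← zpow_natCast]
    congr 1; push_cast; ring
  rw [← h1]
  ring

omit [IsScalarTower ℝ ℂ F] in
/-- The solution operator maps to functions of weight `w`, even if the right hand side has no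
transformation behaviour: the modular group permutes the terms of the series. -/
theorem sol_moebius (f : ℂ → F) (δ : SpecialLinearGroup (Fin 2) ℤ) {τ : ℂ} (hτ : τ ∈ upperHalf) :
    sol w N f (moebius δ τ) = cocycle δ τ ^ w • sol w N f τ := by
  have h0 := cocycle_ne_zero δ hτ
  rw [sol, sol, if_pos hτ, if_pos (moebius_mem δ hτ)]
  rw [← (Equiv.prodCongr (Equiv.refl ℕ) (Equiv.mulRight δ)).tsum_eq fun i => solTerm w N i f τ,
    ← tsum_const_smul'' (cocycle δ τ ^ w)]
  refine tsum_congr fun i => ?_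
  simp only [solTerm, Equiv.prodCongr_apply, Equiv.coe_refl, Prod.map_fst, Prod.map_snd,
    Equiv.coe_mulRight, moebius_mul i.2 δ hτ, smul_smul]
  congr 1
  have := factor_mul (w := w) (N := N) i.1 i.2 δ hτ
  rw [Prod.mk.eta] at this
  rw [← this, mul_inv, zpow_neg, inv_inv, mul_comm]
  simp [Prod.map]

omit [IsScalarTower ℝ ℂ F] in
theorem map_sol [CompleteSpace F] {G : Type u} [NormedAddCommGroup G] [NormedSpace ℝ G]
    [NormedSpace ℂ G] [CompleteSpace G] (Λ : F ≃L[ℂ] G) (f : ℂ → F) (τ : ℂ) :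
    sol w N (fun ζ => Λ (f ζ)) τ = Λ (sol w N f τ) := by
  by_cases hτ : τ ∈ upperHalf
  · rw [sol, sol, if_pos hτ, if_pos hτ, Λ.map_tsum]
    refine tsum_congr fun i => ?_
    rw [solTerm, solTerm, map_smul, cauchyTransform, cauchyTransform,
      ← ContinuousLinearEquiv.integral_comp_comm]
    simp
  · rw [sol, sol, if_neg hτ, if_neg hτ, map_zero]

theorem contDiffOn_weightFun_smul {f : ℂ × E → F} (hU : IsOpen U)
    (hf : ContDiffOn ℝ ∞ f (upperHalf ×ˢ U)) (m : ℕ) :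
    ContDiffOn ℝ ∞ (fun z : ℂ × E => weightFun w N m z.1 • f z) (univ ×ˢ U) := by
  rintro ⟨ζ, x⟩ ⟨-, hx⟩
  by_cases hζ : ζ ∈ upperHalf
  · have h1 : ContDiffOn ℝ ∞ (fun z : ℂ × E => weightFun w N m z.1 • f z) (upperHalf ×ˢ U) :=
      ((contDiffOn_weightFun m).comp contDiffOn_fst fun z hz => hz.1).smul hf
    exact (h1.contDiffAt ((isOpen_upperHalf.prod hU).mem_nhds ⟨hζ, hx⟩)).contDiffWithinAt
  · have h1 : (fun z : ℂ × E => weightFun w N m z.1 • f z) =ᶠ[𝓝 (ζ, x)] fun _ => 0 := by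
      have : ζ ∉ strip m := fun h => hζ (strip_subset m h)
      filter_upwards [((isCompact_strip m).isClosed.isOpen_compl.prod isOpen_univ).mem_nhds
        (⟨this, trivial⟩ : (ζ, x) ∈ (strip m)ᶜ ×ˢ univ)] with z hz
      rw [weightFun_eq_zero hz.1, zero_smul]
    exact (contDiffAt_const.congr_of_eventuallyEq h1).contDiffWithinAt

theorem contDiffOn_solTerm [CompleteSpace F] {f : ℂ × E → F} (hU : IsOpen U)
    (hf : ContDiffOn ℝ ∞ f (upperHalf ×ˢ U)) (i : ℕ × SpecialLinearGroup (Fin 2) ℤ) :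
    ContDiffOn ℝ ∞ (fun z : ℂ × E => solTerm w N i (fun ζ => f (ζ, z.2)) z.1) (upperHalf ×ˢ U) := by
  refine ((contDiffOn_factor_inv i).comp contDiffOn_fst fun z hz => hz.1).smul ?_
  refine (contDiffOn_cauchyTransform hU (isCompact_strip i.1)
    (contDiffOn_weightFun_smul hU hf i.1) fun ζ hζ x _ => by
      simp only [weightFun_eq_zero hζ, zero_smul]).comp
    (f := fun z : ℂ × E => (moebius i.2 z.1, z.2)) ?_ fun z hz => ⟨trivial, hz.2⟩
  exact ((contDiffOn_moebius i.2).comp contDiffOn_fst fun z hz => hz.1).prodMk contDiffOn_snd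

theorem hasFDerivAt_solTerm [CompleteSpace F] {f : ℂ × E → F} (hU : IsOpen U)
    (hf : ContDiffOn ℝ ∞ f (upperHalf ×ˢ U)) (i : ℕ × SpecialLinearGroup (Fin 2) ℤ) (τ : ℂ)
    {x : E} (hx : x ∈ U) :
    HasFDerivAt (fun y => solTerm w N i (fun ζ => f (ζ, y)) τ)
      (solTerm w N i (fun ζ => paramDeriv f (ζ, x)) τ) x := by
  have h := (hasFDerivAt_cauchyTransform hU (isCompact_strip i.1)
    (contDiffOn_weightFun_smul (w := w) (N := N) hU hf i.1) (fun ζ hζ x _ => by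
      simp only [weightFun_eq_zero hζ, zero_smul]) (moebius i.2 τ) hx).const_smul (factor w N i τ)⁻¹
  convert! h using 1
  rw [solTerm]
  congr 2
  funext ζ
  by_cases hζ : ζ ∈ upperHalf
  · have hd : DifferentiableAt ℝ (fun y => f (ζ, y)) x :=
      (differentiableAt_of_smooth isOpen_upperHalf hU hf (z := (ζ, x)) ⟨hζ, hx⟩).comp x
        (by fun_prop)
    exact (fderiv_fun_const_smul hd (weightFun w N i.1 ζ)).symm
  · have : ζ ∉ strip i.1 := fun h => hζ (strip_subset _ h)
    simp [weightFun_eq_zero this]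

theorem clm_apply_eq (D : ℂ →L[ℝ] F) (z : ℂ) :
    D z = (z.re : ℂ) • D 1 + (z.im : ℂ) • D Complex.I := by
  have hz : z = z.re • (1 : ℂ) + z.im • Complex.I := by simp
  conv_lhs => rw [hz, map_add, map_smul, map_smul]
  simp only [ofReal_smul_eq]

theorem dbar_smul_of_holomorphic {g : ℂ → ℂ} {f : ℂ → F} {τ : ℂ} (hg : DifferentiableAt ℂ g τ)
    (hf : DifferentiableAt ℝ f τ) : dbar (fun t => g t • f t) τ = g τ • dbar f τ := by
  have h1 : HasFDerivAt g ((fderiv ℂ g τ).restrictScalars ℝ) τ := hg.hasFDerivAt.restrictScalars ℝ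
  have h2 := (h1.smul hf.hasFDerivAt).fderiv
  have h3 : fderiv ℂ g τ Complex.I = Complex.I * fderiv ℂ g τ 1 := by
    rw [← smul_eq_mul, ← map_smul, smul_eq_mul, mul_one]
  rw [show (fun t => g t • f t) = g • f from rfl, dbar, h2, dbar]
  simp only [add_apply, smul_apply, ContinuousLinearMap.smulRight_apply,
    ContinuousLinearMap.coe_restrictScalars', h3]
  have hI : Complex.I * (Complex.I * fderiv ℂ g τ 1) = - fderiv ℂ g τ 1 := by
    rw [← mul_assoc, Complex.I_mul_I, neg_one_mul]
  simp only [smul_add, smul_smul, hI]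
  module

theorem dbar_comp_holomorphic {m : ℂ → ℂ} {m' : ℂ} {h : ℂ → F} {τ : ℂ} (hm : HasDerivAt m m' τ)
    (hh : DifferentiableAt ℝ h (m τ)) : dbar (fun t => h (m t)) τ = conj m' • dbar h (m τ) := by
  have h1 := (hh.hasFDerivAt.comp τ (hm.hasFDerivAt.restrictScalars ℝ)).fderiv
  rw [show (fun t => h (m t)) = h ∘ m from rfl, dbar, h1, dbar]
  simp only [ContinuousLinearMap.comp_apply, ContinuousLinearMap.coe_restrictScalars',
    ContinuousLinearMap.toSpanSingleton_apply, smul_eq_mul, one_mul]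
  rw [clm_apply_eq _ m', clm_apply_eq _ (Complex.I * m')]
  have hc : conj m' = m'.re - m'.im * Complex.I := by
    apply Complex.ext <;> simp
  simp only [Complex.I_mul_re, Complex.I_mul_im, hc, smul_add, smul_smul]
  push_cast
  match_scalars
  · ring
  · linear_combination ((m'.im : ℂ) / 2) * Complex.I_sq

/-- The equation solved by the single terms. -/
theorem dbar_solTerm [CompleteSpace F] {f : ℂ → F} (hf : ContDiffOn ℝ ∞ f upperHalf)
    (i : ℕ × SpecialLinearGroup (Fin 2) ℤ) {τ : ℂ} (hτ : τ ∈ upperHalf) :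
    dbar (solTerm w N i f) τ = ((factor w N i τ)⁻¹ * (conj (cocycle i.2 τ) ^ 2)⁻¹) •
      weightFun w N i.1 (moebius i.2 τ) • f (moebius i.2 τ) := by
  set ψ : ℂ → F := fun ζ => weightFun w N i.1 ζ • f ζ with hψdef
  have h0 : ∀ ζ ∉ strip i.1, ψ ζ = 0 := fun ζ hζ => by simp only [hψdef, weightFun_eq_zero hζ,
      zero_smul]
  have hψ : ContDiff ℝ 1 ψ := by
    have h1 := contDiffOn_weightFun_smul (w := w) (N := N) (E := F) (U := univ)
      (f := fun z : ℂ × F => f z.1) isOpen_univ (hf.comp contDiffOn_fst fun z hz => hz.1) i.1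
    have h2 : ContDiff ℝ ∞ ψ := contDiffOn_univ.1 (h1.comp (f := fun ζ : ℂ => (ζ, (0 : F)))
      (by fun_prop) fun _ _ => ⟨trivial, trivial⟩)
    exact h2.of_le (by simp)
  have hc : HasCompactSupport ψ := HasCompactSupport.intro (isCompact_strip i.1) h0
  have hK : Differentiable ℝ (cauchyTransform ψ) := fun σ =>
    (hc.hasFDerivAt_convolution_right (ContinuousLinearMap.lsmul ℝ ℂ)
      locallyIntegrable_cauchyKernel hψ σ).differentiableAt
  have hm := hasDerivAt_moebius i.2 hτ
  have hg : DifferentiableAt ℂ (fun τ => (factor w N i τ)⁻¹) τ :=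
    ((differentiableOn_factor i).differentiableAt (isOpen_upperHalf.mem_nhds hτ)).inv
      (factor_ne_zero i hτ)
  have h1 := dbar_smul_of_holomorphic hg
    ((hK (moebius i.2 τ)).comp τ (hm.differentiableAt.restrictScalars ℝ))
  refine h1.trans ?_
  have h2 := dbar_comp_holomorphic hm (hK (moebius i.2 τ))
  rw [show cauchyTransform ψ ∘ moebius i.2 = fun t => cauchyTransform ψ (moebius i.2 t) from rfl,
      h2,
    dbar_cauchyTransform hψ hc, smul_smul]
  simp [hψdef]

end Solution

/-! ### Convergence of the solution operator -/

section Convergence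

open Matrix (SpecialLinearGroup)

universe u
variable {E : Type u} [NormedAddCommGroup E] [NormedSpace ℝ E]
  {F : Type u} [NormedAddCommGroup F] [NormedSpace ℝ F] [NormedSpace ℂ F] [IsScalarTower ℝ ℂ F]
  {U : Set E} {w : ℤ} {N : ℕ → ℕ}

omit [IsScalarTower ℝ ℂ F] in
theorem dbar_eq_zero_iff {f : ℂ → F} {τ : ℂ} :
    dbar f τ = 0 ↔ fderiv ℝ f τ Complex.I = Complex.I • fderiv ℝ f τ 1 := by
  rw [dbar, smul_eq_zero_iff_right (by norm_num)]
  constructor <;> intro h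
  · have h1 := congrArg (Complex.I • ·) h
    simp only [smul_add, smul_smul, Complex.I_mul_I, smul_zero, neg_smul, one_smul] at h1
    rw [← sub_eq_add_neg, sub_eq_zero] at h1
    exact h1.symm
  · rw [h, smul_smul, Complex.I_mul_I, neg_smul, one_smul, add_neg_cancel]

omit [IsScalarTower ℝ ℂ F] in
theorem dbar_congr {f g : ℂ → F} {τ : ℂ} (h : f =ᶠ[𝓝 τ] g) : dbar f τ = dbar g τ := by
  rw [dbar, dbar, h.fderiv_eq]

omit [IsScalarTower ℝ ℂ F] in
theorem dbar_add {f g : ℂ → F} {τ : ℂ} (hf : DifferentiableAt ℝ f τ) (hg : DifferentiableAt ℝ g τ) :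
    dbar (fun t => f t + g t) τ = dbar f τ + dbar g τ := by
  rw [dbar, fderiv_fun_add hf hg, dbar, dbar]
  simp only [add_apply, smul_add]
  abel

omit [IsScalarTower ℝ ℂ F] in
theorem dbar_sum {ι : Type*} {s : Finset ι} {f : ι → ℂ → F} {τ : ℂ}
    (hf : ∀ i ∈ s, DifferentiableAt ℝ (f i) τ) :
    dbar (fun t => ∑ i ∈ s, f i t) τ = ∑ i ∈ s, dbar (f i) τ := by
  rw [dbar, fderiv_fun_sum hf]
  simp only [dbar, _root_.sum_apply, Finset.smul_sum, Finset.sum_add_distrib, smul_add]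

omit [NormedSpace ℂ F] [IsScalarTower ℝ ℂ F] in
theorem fderiv_slice {V : Set ℂ} {t : ℂ × E → F} (hV : IsOpen V) (hU : IsOpen U)
    (ht : ContDiffOn ℝ ∞ t (V ×ˢ U)) {z : ℂ × E} (hz : z ∈ V ×ˢ U) (v : ℂ) :
    fderiv ℝ (fun τ => t (τ, z.2)) z.1 v = fderiv ℝ t z (v, 0) := by
  have h1 := ((differentiableAt_of_smooth hV hU ht hz).hasFDerivAt.comp z.1
    (hasFDerivAt_prodMk_left (𝕜 := ℝ) z.1 z.2)).fderiv
  rw [show (fun τ => t (τ, z.2)) = t ∘ fun τ => (τ, z.2) from rfl, h1]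
  simp

/-- The growth condition on the exponents `N m` under which the solution operator converges on the
family `f`, together with all its derivatives along `U`. -/
def Admissible (w : ℤ) (N : ℕ → ℕ) (U : Set E) (f : ℂ × E → F) : Prop :=
  (∀ m, 6 ≤ 12 * (N m : ℤ) + w) ∧ ∃ δ : ℕ → ℝ, Tendsto δ atTop (𝓝 0) ∧ (∀ m, 0 ≤ δ m) ∧
    ∀ r : ℕ, ∀ x₀ ∈ U, ∃ ρ > 0, ∀ᶠ m in atTop, ∀ ζ ∈ strip m, ∀ x ∈ Metric.closedBall x₀ ρ,
      cauchyConst (strip m) * (‖weightFun w N m ζ‖ * ‖iteratedFDeriv ℝ r (fun y => f (ζ, y)) x‖)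
        ≤ δ m ^ N m * (1 / 2) ^ m

omit [NormedSpace ℂ F] [IsScalarTower ℝ ℂ F] in
theorem Admissible.paramDeriv {f : ℂ × E → F} (h : Admissible w N U f) :
    Admissible w N U (paramDeriv f) := by
  obtain ⟨h0, δ, hδ, hδ0, h1⟩ := h
  refine ⟨h0, δ, hδ, hδ0, fun r x₀ hx₀ => ?_⟩
  obtain ⟨ρ, hρ, h2⟩ := h1 (r + 1) x₀ hx₀
  refine ⟨ρ, hρ, h2.mono fun m hm ζ hζ x hx => ?_⟩
  have := hm ζ hζ x hx
  rwa [← norm_iteratedFDeriv_fderiv] at this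

/-- Derivatives along the parameter pass under the Cauchy transform. -/
theorem norm_iteratedFDeriv_solTerm_le [CompleteSpace F] (hU : IsOpen U) {f : ℂ × E → F}
    (hf : ContDiffOn ℝ ∞ f (upperHalf ×ˢ U)) (r : ℕ) (i : ℕ × SpecialLinearGroup (Fin 2) ℤ) (τ : ℂ)
    {x : E} (hx : x ∈ U) {b : ℝ} (hb0 : 0 ≤ b)
    (hb : ∀ ζ ∈ strip i.1,
      ‖weightFun w N i.1 ζ‖ * ‖iteratedFDeriv ℝ r (fun y => f (ζ, y)) x‖ ≤ b) :
    ‖iteratedFDeriv ℝ r (fun y => solTerm w N i (fun ζ => f (ζ, y)) τ) x‖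
      ≤ ‖factor w N i τ‖⁻¹ * (cauchyConst (strip i.1) * b) := by
  induction r generalizing F with
  | zero =>
    simp only [norm_iteratedFDeriv_zero] at hb ⊢
    rw [solTerm, norm_smul, norm_inv]
    gcongr
    refine norm_cauchyTransform_le (isCompact_strip i.1) (fun ζ => ?_) (fun ζ hζ => ?_) _
    · by_cases hζ : ζ ∈ strip i.1
      · rw [norm_smul]; exact hb ζ hζ
      · rw [weightFun_eq_zero hζ, zero_smul, norm_zero]; exact hb0
    · rw [weightFun_eq_zero hζ, zero_smul]
  | succ r ih =>
    rw [← norm_iteratedFDeriv_fderiv]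
    have h1 : fderiv ℝ (fun y => solTerm w N i (fun ζ => f (ζ, y)) τ) =ᶠ[𝓝 x]
        fun y => solTerm w N i (fun ζ => paramDeriv f (ζ, y)) τ := by
      filter_upwards [hU.mem_nhds hx] with y hy
      exact (hasFDerivAt_solTerm hU hf i τ hy).fderiv
    rw [h1.iteratedFDeriv ℝ r |>.eq_of_nhds]
    refine ih (contDiffOn_paramDeriv isOpen_upperHalf hU hf) fun ζ hζ => ?_
    have := hb ζ hζ
    rwa [← norm_iteratedFDeriv_fderiv] at this

omit [NormedSpace ℂ F] [IsScalarTower ℝ ℂ F] in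
theorem exists_norm_iteratedFDeriv_le (hU : IsOpen U) {f : ℂ × E → F}
    (hf : ContDiffOn ℝ ∞ f (upperHalf ×ˢ U)) (r : ℕ) {C : Set (ℂ × E)} (hC : IsCompact C)
    (hsub : C ⊆ upperHalf ×ˢ U) :
    ∃ D : ℝ, 0 ≤ D ∧ ∀ z ∈ C, ‖iteratedFDeriv ℝ r (fun y => f (z.1, y)) z.2‖ ≤ D := by
  induction r generalizing F with
  | zero =>
    obtain ⟨D, hD⟩ := hC.exists_bound_of_continuousOn (hf.continuousOn.mono hsub)
    exact ⟨max D 0, le_max_right _ _, fun z hz => by simpa using Or.inl (hD z hz)⟩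
  | succ r ih =>
    obtain ⟨D, hD0, hD⟩ := ih (contDiffOn_paramDeriv isOpen_upperHalf hU hf)
    refine ⟨D, hD0, fun z hz => ?_⟩
    rw [← norm_iteratedFDeriv_fderiv]
    exact hD z hz

/-- The exponent `12 N + w ≥ 6` leaves `rowNorm γ ^ (-3)`, which is summable over the modular group;
what is left of the automorphy factor grows at most geometrically in `N`. -/
theorem exists_norm_factor_inv_le (hN : ∀ m, 6 ≤ 12 * (N m : ℤ) + w) {C : Set ℂ}
    (hC : IsCompact C) (hsub : C ⊆ upperHalf) : ∃ K q : ℝ, 0 ≤ K ∧ 0 ≤ q ∧ ∀ τ ∈ C, ∀ i,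
      ‖factor w N i τ‖⁻¹ ≤ K * q ^ N i.1 * (rowNorm i.2 ^ 3)⁻¹ := by
  rcases C.eq_empty_or_nonempty with rfl | hne
  · exact ⟨0, 0, le_rfl, le_rfl, fun _ h => h.elim⟩
  obtain ⟨τ₁, hτ₁, hmin⟩ := hC.exists_isMinOn hne Complex.continuous_im.continuousOn
  obtain ⟨τ₂, hτ₂, hmin₂⟩ := hC.exists_isMinOn hne
    (differentiableOn_discr.continuousOn.mono hsub).norm
  obtain ⟨A, hA⟩ := hC.exists_bound_of_continuousOn Complex.continuous_re.continuousOn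
  obtain ⟨c₀, hc₀, hc⟩ := exists_rowNorm_le (A := A) (hsub hτ₁ : 0 < τ₁.im)
  set c := min c₀ 1
  have hc0 : 0 < c := lt_min hc₀ one_pos
  have hsc : 0 < √c := Real.sqrt_pos.2 hc0
  have hsc1 : √c ≤ 1 := Real.sqrt_le_one.2 (min_le_right _ _)
  set d := ‖discr τ₂‖
  have hd : 0 < d := norm_pos_iff.2 (discr_ne_zero _)
  refine ⟨(c ^ 3)⁻¹ * ((√c)⁻¹) ^ w.natAbs, d⁻¹ * ((√c)⁻¹) ^ 12, by positivity, by positivity,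
    fun τ hτ i => ?_⟩
  have hL := hc τ (hA τ hτ) (hmin hτ) i.2
  set L := ‖shiftCocycle i.2 τ‖
  have hrow := one_le_rowNorm i.2
  have hL1 : c * rowNorm i.2 ≤ L ^ 2 :=
    (mul_le_mul_of_nonneg_right (min_le_left _ _) (by positivity)).trans hL
  have hL2 : √c ≤ L := Real.sqrt_le_iff.2 ⟨norm_nonneg _, by nlinarith⟩
  obtain ⟨e, he⟩ := Int.eq_ofNat_of_zero_le (sub_nonneg.2 (hN i.1))
  have he' : e ≤ 12 * N i.1 + w.natAbs := by
    have := Int.le_natAbs (a := w)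
    omega
  rw [factor, norm_mul, norm_pow, norm_zpow, show 12 * (N i.1 : ℤ) + w = ((6 + e : ℕ) : ℤ) by
    push_cast; linarith, zpow_natCast, mul_inv]
  have h1 : (‖discr τ‖ ^ N i.1)⁻¹ ≤ (d⁻¹) ^ N i.1 := by
    rw [inv_pow]
    have : d ≤ ‖discr τ‖ := hmin₂ hτ
    gcongr
  have h2 : (L ^ (6 + e))⁻¹ ≤ (c ^ 3)⁻¹ * (rowNorm i.2 ^ 3)⁻¹ * ((√c)⁻¹) ^ (12 * N i.1
      + w.natAbs) := by
    rw [pow_add, mul_inv]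
    have h3 : (L ^ 6)⁻¹ ≤ (c ^ 3)⁻¹ * (rowNorm i.2 ^ 3)⁻¹ := by
      rw [← mul_inv, ← mul_pow, show L ^ 6 = (L ^ 2) ^ 3 by ring]
      gcongr
    have h4 : (L ^ e)⁻¹ ≤ ((√c)⁻¹) ^ (12 * N i.1 + w.natAbs) := by
      calc (L ^ e)⁻¹ ≤ ((√c) ^ e)⁻¹ := by gcongr
        _ = ((√c)⁻¹) ^ e := (inv_pow _ _).symm
        _ ≤ _ := pow_le_pow_right₀ (one_le_inv_iff₀.2 ⟨hsc, hsc1⟩) he'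
    gcongr
  refine (mul_le_mul h1 h2 (by positivity) (by positivity)).trans_eq ?_
  rw [mul_pow, pow_add, pow_mul]
  ring

theorem continuousOn_weightFun (m : ℕ) : ContinuousOn (weightFun w N m) (strip m) :=
  (contDiffOn_weightFun m).continuousOn.mono (strip_subset m)

/-- The terms of the solution operator are bounded by `q ^ N m κ m` times `rowNorm γ ^ (-3)`, where
`q` depends on the compact set containing `τ`, and `κ m` is at most `δ m ^ N m / 2 ^ m` for all but
finitely many `m`. As `δ m` tends to `0`, no value of `q` affects the convergence. -/
theorem locallySummable_solTerm [FiniteDimensional ℝ E] [CompleteSpace F] (hU : IsOpen U)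
    {f : ℂ × E → F} (hf : ContDiffOn ℝ ∞ f (upperHalf ×ˢ U)) (hadm : Admissible w N U f) :
    LocallySummable upperHalf U fun i z => solTerm w N i (fun ζ => f (ζ, z.2)) z.1 := by
  classical
  have : ProperSpace E := FiniteDimensional.proper ℝ E
  rintro r ⟨τ₀, x₀⟩ ⟨hτ₀, hx₀⟩
  obtain ⟨hN, δ, hδ, hδ0, h⟩ := hadm
  obtain ⟨ρ₁, hρ₁, hadm⟩ := h r x₀ hx₀
  obtain ⟨ρ₂, hρ₂, hsub₂⟩ := Metric.nhds_basis_closedBall.mem_iff.1 (isOpen_upperHalf.mem_nhds hτ₀)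
  obtain ⟨ρ₃, hρ₃, hsub₃⟩ := Metric.nhds_basis_closedBall.mem_iff.1 (hU.mem_nhds hx₀)
  set ρ := min ρ₁ (min ρ₂ ρ₃)
  have hρ : 0 < ρ := by positivity
  have hb₁ : Metric.closedBall x₀ ρ ⊆ Metric.closedBall x₀ ρ₁ :=
    Metric.closedBall_subset_closedBall (min_le_left _ _)
  have hb₂ : Metric.closedBall τ₀ ρ ⊆ upperHalf := (Metric.closedBall_subset_closedBall
    ((min_le_right _ _).trans (min_le_left _ _))).trans hsub₂
  have hb₃ : Metric.closedBall x₀ ρ ⊆ U := (Metric.closedBall_subset_closedBall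
    ((min_le_right _ _).trans (min_le_right _ _))).trans hsub₃
  obtain ⟨K, q, hK, hq, hfac⟩ := exists_norm_factor_inv_le hN (isCompact_closedBall τ₀ ρ) hb₂
  have hcomp : ∀ m, ∃ D : ℝ, 0 ≤ D ∧ ∀ ζ ∈ strip m, ∀ x ∈ Metric.closedBall x₀ ρ,
      ‖weightFun w N m ζ‖ * ‖iteratedFDeriv ℝ r (fun y => f (ζ, y)) x‖ ≤ D := by
    intro m
    obtain ⟨W, hW⟩ := (isCompact_strip m).exists_bound_of_continuousOn
      (continuousOn_weightFun (w := w) (N := N) m)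
    obtain ⟨D, hD0, hD⟩ := exists_norm_iteratedFDeriv_le hU hf r
      ((isCompact_strip m).prod (isCompact_closedBall x₀ ρ)) (prod_mono (strip_subset m) hb₃)
    refine ⟨max W 0 * D, by positivity, fun ζ hζ x hx => ?_⟩
    have h1 := hD (ζ, x) ⟨hζ, hx⟩
    have h2 := (hW ζ hζ).trans (le_max_left W 0)
    gcongr
  choose D hD0 hD using hcomp
  -- `κ m` bounds the Cauchy transform: the admissible bound where it holds, and some bound for the
  -- finitely many other `m`
  set good : ℕ → Prop := fun m => ∀ ζ ∈ strip m, ∀ x ∈ Metric.closedBall x₀ ρ₁,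
    cauchyConst (strip m) * (‖weightFun w N m ζ‖ * ‖iteratedFDeriv ℝ r (fun y => f (ζ, y)) x‖)
      ≤ δ m ^ N m * (1 / 2) ^ m
  set κ : ℕ → ℝ := fun m => if good m then δ m ^ N m * (1 / 2) ^ m
    else cauchyConst (strip m) * D m with hκ
  have hκ0 : ∀ m, 0 ≤ κ m := fun m => by
    have := hδ0 m
    have := hD0 m
    have := cauchyConst_nonneg (strip m)
    simp only [hκ]; split_ifs <;> positivity
  have hsumκ : Summable fun m => q ^ N m * κ m := by
    have hev : ∀ᶠ m in atTop, q * δ m ≤ 1 := by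
      have : Tendsto (fun m => q * δ m) atTop (𝓝 0) := by simpa using hδ.const_mul q
      exact this.eventually_le_const one_pos
    refine Summable.of_norm_bounded_eventually_nat (g := fun m => (1 / 2 : ℝ) ^ m)
      (summable_geometric_of_lt_one (by norm_num) (by norm_num)) ?_
    filter_upwards [hev, hadm] with m hm hm'
    have hg : good m := hm'
    simp only [hκ, if_pos hg]
    rw [Real.norm_of_nonneg (by have := hδ0 m; positivity), ← mul_assoc, ← mul_pow]
    have := hδ0 m
    exact mul_le_of_le_one_left (by positivity) (pow_le_one₀ (by positivity) hm)
  have hsum := hsumκ.mul_of_nonneg summable_rowNorm (fun m => mul_nonneg (pow_nonneg hq _) (hκ0 m))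
    fun γ => inv_nonneg.2 (pow_nonneg (zero_le_one.trans (one_le_rowNorm γ)) _)
  refine ⟨ρ, hρ, _, hsum.mul_left K, ?_⟩
  rintro i ⟨τ, x⟩ hz
  rw [← closedBall_prod_same] at hz
  obtain ⟨hτ, hx⟩ := hz
  have hrow : 0 ≤ (rowNorm i.2 ^ 3)⁻¹ :=
    inv_nonneg.2 (pow_nonneg (zero_le_one.trans (one_le_rowNorm i.2)) _)
  have hest : ‖iteratedFDeriv ℝ r (fun y => solTerm w N i (fun ζ => f (ζ, y)) τ) x‖
      ≤ ‖factor w N i τ‖⁻¹ * κ i.1 := by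
    by_cases hg : good i.1
    · simp only [hκ, if_pos hg]
      rcases (cauchyConst_nonneg (strip i.1)).eq_or_lt with h0 | hpos
      · refine (norm_iteratedFDeriv_solTerm_le hU hf r i τ (hb₃ hx) (hD0 i.1)
          fun ζ hζ => hD i.1 ζ hζ x hx).trans ?_
        rw [← h0, zero_mul]
        have := hδ0 i.1
        gcongr
        positivity
      · refine (norm_iteratedFDeriv_solTerm_le hU hf r i τ (hb₃ hx)
          (b := δ i.1 ^ N i.1 * (1 / 2) ^ i.1 / cauchyConst (strip i.1)) ?_ ?_).trans_eq ?_
        · have := hδ0 i.1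
          positivity
        · intro ζ hζ
          rw [le_div_iff₀ hpos, mul_comm]
          exact hg ζ hζ x (hb₁ hx)
        · rw [mul_div_cancel₀ _ hpos.ne']
    · simp only [hκ, if_neg hg]
      exact norm_iteratedFDeriv_solTerm_le hU hf r i τ (hb₃ hx) (hD0 i.1)
        fun ζ hζ => hD i.1 ζ hζ x hx
  refine hest.trans ((mul_le_mul_of_nonneg_right (hfac τ hτ i) (hκ0 _)).trans_eq ?_)
  ring

end Convergence

/-! ### Properties of the solution operator -/

section SolutionProperties

open Matrix (SpecialLinearGroup)

universe u
variable {E : Type u} [NormedAddCommGroup E] [NormedSpace ℝ E]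
  {F : Type u} [NormedAddCommGroup F] [NormedSpace ℝ F] [NormedSpace ℂ F] [IsScalarTower ℝ ℂ F]
  {U : Set E} {w : ℤ} {N : ℕ → ℕ}

omit [NormedSpace ℂ F] [IsScalarTower ℝ ℂ F] in
theorem contDiffOn_slice {V : Set ℂ} {f : ℂ × E → F} (hf : ContDiffOn ℝ ∞ f (V ×ˢ U)) {x : E}
    (hx : x ∈ U) : ContDiffOn ℝ ∞ (fun ζ => f (ζ, x)) V :=
  hf.comp (f := fun ζ => (ζ, x)) (by fun_prop) fun _ hζ => ⟨hζ, hx⟩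

/-- Where the cutoff vanishes at `γ τ`, the Cauchy transform is holomorphic there, hence so is the
term of the series. -/
theorem isHolFamily_solTerm [CompleteSpace F] (hU : IsOpen U) {f : ℂ × E → F}
    (hf : ContDiffOn ℝ ∞ f (upperHalf ×ˢ U)) {V : Set ℂ} (hVo : IsOpen V) (hV : V ⊆ upperHalf)
    {i : ℕ × SpecialLinearGroup (Fin 2) ℤ} (hi : ∀ τ ∈ V, moebius i.2 τ ∉ strip i.1) :
    IsHolFamily V U fun z => solTerm w N i (fun ζ => f (ζ, z.2)) z.1 := by
  have hs := (contDiffOn_solTerm (w := w) (N := N) hU hf i).mono (prod_mono hV Subset.rfl)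
  refine ⟨hs, fun z hz => ?_⟩
  rw [← fderiv_slice hVo hU hs hz, ← fderiv_slice hVo hU hs hz, ← dbar_eq_zero_iff]
  have := dbar_solTerm (w := w) (N := N) (contDiffOn_slice hf hz.2) i (hV hz.1)
  rw [weightFun_eq_zero (hi z.1 hz.1), zero_smul, smul_zero] at this
  exact this

/-- Near a point of the upper half plane, the series is the sum of finitely many terms and of a
series of terms that are holomorphic in `τ`. -/
theorem exists_sol_eq [FiniteDimensional ℝ E] [CompleteSpace F] (hU : IsOpen U)
    {f : ℂ × E → F} (hf : ContDiffOn ℝ ∞ f (upperHalf ×ˢ U)) (hadm : Admissible w N U f)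
    {τ₀ : ℂ} (hτ₀ : τ₀ ∈ upperHalf) : ∃ V, IsOpen V ∧ τ₀ ∈ V ∧ V ⊆ upperHalf ∧
      ∃ s : Finset (ℕ × SpecialLinearGroup (Fin 2) ℤ),
        (∀ τ ∈ V, ∀ i, moebius i.2 τ ∈ strip i.1 → i ∈ s) ∧
        (∀ i : {i // i ∉ s}, IsHolFamily V U fun z => solTerm w N i.1 (fun ζ => f (ζ, z.2)) z.1) ∧
        (LocallySummable V U fun (i : {i // i ∉ s}) z =>
          solTerm w N i.1 (fun ζ => f (ζ, z.2)) z.1) ∧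
        ∀ z ∈ V ×ˢ U, sol w N (fun ζ => f (ζ, z.2)) z.1 =
          ∑ i ∈ s, solTerm w N i (fun ζ => f (ζ, z.2)) z.1 +
            ∑' i : {i // i ∉ s}, solTerm w N i.1 (fun ζ => f (ζ, z.2)) z.1 := by
  obtain ⟨V, hVo, hτV, hV, s, hs⟩ := exists_finset_strip hτ₀
  have hls := locallySummable_solTerm hU hf hadm
  refine ⟨V, hVo, hτV, hV, s, hs, fun i => ?_, fun r z hz => ?_, fun z hz => ?_⟩
  · exact isHolFamily_solTerm hU hf hVo hV fun τ hτ h => i.2 (hs τ hτ _ h)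
  · obtain ⟨ρ, hρ, b, hb, hle⟩ := hls r z ⟨hV hz.1, hz.2⟩
    exact ⟨ρ, hρ, fun i => b i.1, hb.subtype _, fun i => hle i.1⟩
  · have hsum := hls.summable (z := z) ⟨hV hz.1, hz.2⟩
    rw [sol, if_pos (hV hz.1)]
    exact (hsum.sum_add_tsum_subtype_compl s).symm

theorem contDiffOn_sol [FiniteDimensional ℝ E] [CompleteSpace F] (hU : IsOpen U)
    {f : ℂ × E → F} (hf : ContDiffOn ℝ ∞ f (upperHalf ×ˢ U)) (hadm : Admissible w N U f) :
    ContDiffOn ℝ ∞ (fun z : ℂ × E => sol w N (fun ζ => f (ζ, z.2)) z.1) (upperHalf ×ˢ U) := by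
  rintro ⟨τ₀, x₀⟩ ⟨hτ₀, hx₀⟩
  obtain ⟨V, hVo, hτV, hV, s, -, hhol, hls, heq⟩ := exists_sol_eq hU hf hadm hτ₀
  have h1 : ContDiffOn ℝ ∞ (fun z : ℂ × E => sol w N (fun ζ => f (ζ, z.2)) z.1) (V ×ˢ U) :=
    ((ContDiffOn.sum fun i _ => (contDiffOn_solTerm hU hf i).mono (prod_mono hV Subset.rfl)).add
      (hls.contDiffOn_tsum hVo hU hhol)).congr heq
  exact (h1.contDiffAt ((hVo.prod hU).mem_nhds ⟨hτV, hx₀⟩)).contDiffWithinAt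

theorem hasFDerivAt_sol [FiniteDimensional ℝ E] [CompleteSpace F] (hU : IsOpen U)
    {f : ℂ × E → F} (hf : ContDiffOn ℝ ∞ f (upperHalf ×ˢ U)) (hadm : Admissible w N U f) {τ : ℂ}
    (hτ : τ ∈ upperHalf) {x : E} (hx : x ∈ U) :
    HasFDerivAt (fun y => sol w N (fun ζ => f (ζ, y)) τ)
      (sol w N (fun ζ => paramDeriv f (ζ, x)) τ) x := by
  obtain ⟨V, hVo, hτV, hV, s, -, hhol, hls, heq⟩ := exists_sol_eq hU hf hadm hτ
  have hd : ∀ i y, y ∈ U → HasFDerivAt (fun y => solTerm w N i (fun ζ => f (ζ, y)) τ)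
      (solTerm w N i (fun ζ => paramDeriv f (ζ, y)) τ) y :=
    fun i y hy => hasFDerivAt_solTerm hU hf i τ hy
  have h1 : HasFDerivAt (fun y => ∑ i ∈ s, solTerm w N i (fun ζ => f (ζ, y)) τ)
      (∑ i ∈ s, solTerm w N i (fun ζ => paramDeriv f (ζ, x)) τ) x :=
    HasFDerivAt.fun_sum fun i _ => hd i x hx
  have h2 : HasFDerivAt (fun y => ∑' i : {i // i ∉ s}, solTerm w N i.1 (fun ζ => f (ζ, y)) τ)
      (∑' i : {i // i ∉ s}, solTerm w N i.1 (fun ζ => paramDeriv f (ζ, x)) τ) x := by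
    have h3 := hls.paramDeriv_tsum hVo hU hhol (z := (τ, x)) ⟨hτV, hx⟩
    have h4 : ∀ i : {i // i ∉ s}, paramDeriv (fun z : ℂ × E =>
        solTerm w N i.1 (fun ζ => f (ζ, z.2)) z.1) (τ, x) =
        solTerm w N i.1 (fun ζ => paramDeriv f (ζ, x)) τ := fun i => (hd i.1 x hx).fderiv
    simp_rw [h4] at h3
    rw [← h3]
    exact ((hls.contDiffOn_tsum hVo hU hhol).comp (f := fun y => (τ, y)) (s := U)
      (by fun_prop) (fun y hy => ⟨hτV, hy⟩) |>.contDiffAt (hU.mem_nhds hx)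
      |>.differentiableAt (by simp)).hasFDerivAt
  have h5 : sol w N (fun ζ => paramDeriv f (ζ, x)) τ =
      ∑ i ∈ s, solTerm w N i (fun ζ => paramDeriv f (ζ, x)) τ +
        ∑' i : {i // i ∉ s}, solTerm w N i.1 (fun ζ => paramDeriv f (ζ, x)) τ := by
    have hsum := (locallySummable_solTerm hU (contDiffOn_paramDeriv isOpen_upperHalf hU hf)
      hadm.paramDeriv).summable (z := (τ, x)) ⟨hτ, hx⟩
    rw [sol, if_pos hτ]
    exact (hsum.sum_add_tsum_subtype_compl s).symm
  rw [h5]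
  refine (h1.add h2).congr_of_eventuallyEq ?_
  filter_upwards [hU.mem_nhds hx] with y hy using heq (τ, y) ⟨hτV, hy⟩

/-- The solution operator solves the `∂/∂τ̄`-equation for functions that transform like a modular
form of weight `w` times an antiholomorphic differential. -/
theorem dbar_sol [FiniteDimensional ℝ E] [CompleteSpace F] (hU : IsOpen U)
    {f : ℂ × E → F} (hf : ContDiffOn ℝ ∞ f (upperHalf ×ˢ U)) (hadm : Admissible w N U f) {τ : ℂ}
    (hτ : τ ∈ upperHalf) {x : E} (hx : x ∈ U)
    (hmod : ∀ γ, f (moebius γ τ, x) = (cocycle γ τ ^ w * conj (cocycle γ τ) ^ 2) • f (τ, x)) :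
    dbar (sol w N fun ζ => f (ζ, x)) τ = f (τ, x) := by
  obtain ⟨V, hVo, hτV, hV, s, hs, hhol, hls, heq⟩ := exists_sol_eq hU hf hadm hτ
  have h1 : (sol w N fun ζ => f (ζ, x)) =ᶠ[𝓝 τ] fun t =>
      ∑ i ∈ s, solTerm w N i (fun ζ => f (ζ, x)) t +
        ∑' i : {i // i ∉ s}, solTerm w N i.1 (fun ζ => f (ζ, x)) t := by
    filter_upwards [hVo.mem_nhds hτV] with t ht using heq (t, x) ⟨ht, hx⟩
  have hd1 : ∀ i, DifferentiableAt ℝ (fun t => solTerm w N i (fun ζ => f (ζ, x)) t) τ := fun i =>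
    ((contDiffOn_slice (contDiffOn_solTerm hU hf i) hx).contDiffAt
      (isOpen_upperHalf.mem_nhds hτ)).differentiableAt (by simp)
  have hh := hls.isHolFamily_tsum hVo hU hhol
  have hd2 := ((contDiffOn_slice hh.smooth hx).contDiffAt (hVo.mem_nhds hτV)).differentiableAt
      (by simp)
  -- only the finitely many terms whose cutoff does not vanish near `τ` contribute
  have h3 : dbar (fun t => ∑' i : {i // i ∉ s}, solTerm w N i.1 (fun ζ => f (ζ, x)) t) τ = 0 := by
    have hz : (τ, x) ∈ V ×ˢ U := ⟨hτV, hx⟩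
    have := hh.hol (τ, x) hz
    rw [← fderiv_slice hVo hU hh.smooth hz, ← fderiv_slice hVo hU hh.smooth hz] at this
    exact dbar_eq_zero_iff.2 this
  rw [dbar_congr h1, dbar_add (by fun_prop (disch := exact fun i _ => hd1 i)) hd2, h3, add_zero,
    dbar_sum fun i _ => hd1 i]
  have h4 : ∀ i ∈ s, dbar (fun t => solTerm w N i (fun ζ => f (ζ, x)) t) τ =
      (cutoff i.1 (moebius i.2 τ) : ℂ) • f (τ, x) := by
    intro i _
    rw [show (fun t => solTerm w N i (fun ζ => f (ζ, x)) t) = solTerm w N i fun ζ => f (ζ, x)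
      from rfl, dbar_solTerm (contDiffOn_slice hf hx) i hτ, hmod, smul_smul, smul_smul]
    congr 1
    have hc := cocycle_ne_zero i.2 hτ
    have hc' : conj (cocycle i.2 τ) ≠ 0 := by simpa using hc
    have hL := shiftCocycle_ne_zero i.2 hτ
    have hm := add_I_ne_zero (moebius_mem i.2 hτ)
    have hδ := discr_ne_zero τ
    rw [weightFun, factor, discr_moebius i.2 hτ, shiftCocycle_eq i.2 hτ, mul_zpow, mul_pow,
      zpow_add₀ hc, ← pow_mul]
    have hp : cocycle i.2 τ ^ (12 * (N i.1 : ℤ)) = cocycle i.2 τ ^ (12 * N i.1) := by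
      rw [← zpow_natCast]; push_cast; rfl
    rw [hp]
    have hq := zpow_ne_zero (12 * (N i.1 : ℤ) + w) hm
    have hq' := zpow_ne_zero w hc
    field_simp
  -- the cutoffs at the points `γ τ` sum up to `1`
  rw [Finset.sum_congr rfl h4, ← Finset.sum_smul, ← Complex.ofReal_sum, sum_cutoff hs hV hτV,
    Complex.ofReal_one, one_smul]

/-- A continuous linear map that annihilates the right hand side annihilates the solution. Applied
to alternatization, this shows that the solution operator preserves closed forms. -/
theorem map_sol_eq_zero [CompleteSpace F] {G : Type u} [NormedAddCommGroup G] [NormedSpace ℝ G]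
    [NormedSpace ℂ G] [IsScalarTower ℝ ℂ G] [CompleteSpace G] (Λ : F →L[ℂ] G) {f : ℂ → F}
    (hf : ContDiffOn ℝ ∞ f upperHalf) {τ : ℂ} (hsum : Summable fun i => solTerm w N i f τ)
    (h0 : ∀ ζ ∈ upperHalf, Λ (f ζ) = 0) : Λ (sol w N f τ) = 0 := by
  by_cases hτ : τ ∈ upperHalf
  · rw [sol, if_pos hτ, Λ.map_tsum hsum]
    refine (tsum_congr fun i => ?_).trans tsum_zero
    have hz : ∀ ζ ∉ strip i.1, weightFun w N i.1 ζ • f ζ = 0 := fun ζ hζ => by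
      rw [weightFun_eq_zero hζ, zero_smul]
    have hc : HasCompactSupport fun ζ => weightFun w N i.1 ζ • f ζ :=
      HasCompactSupport.intro (isCompact_strip i.1) hz
    have hcont : Continuous fun ζ => weightFun w N i.1 ζ • f ζ := by
      rw [continuous_iff_continuousAt]
      intro ζ
      by_cases hζ : ζ ∈ upperHalf
      · exact (((contDiffOn_weightFun i.1).smul hf).continuousOn).continuousAt
          (isOpen_upperHalf.mem_nhds hζ)
      · have hev : (fun ζ => weightFun w N i.1 ζ • f ζ) =ᶠ[𝓝 ζ] fun _ => 0 := by
          filter_upwards [(isCompact_strip i.1).isClosed.isOpen_compl.mem_nhds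
            fun h => hζ (strip_subset _ h)] with y hy using hz y hy
        exact continuousAt_const.congr hev.symm
    rw [solTerm, map_smul, map_cauchyTransform Λ hcont hc]
    have : (fun z => Λ (weightFun w N i.1 z • f z)) = fun _ => 0 := by
      funext z
      by_cases hz' : z ∈ upperHalf
      · rw [map_smul, h0 z hz', smul_zero]
      · rw [weightFun_eq_zero fun h => hz' (strip_subset _ h), zero_smul, map_zero]
    rw [this, cauchyTransform]
    simp
  · rw [sol, if_neg hτ, map_zero]

theorem exists_norm_discr_strip_le : ∃ e : ℕ → ℝ, Tendsto e atTop (𝓝 0) ∧ (∀ m, 0 ≤ e m) ∧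
    ∀ m, ∀ ζ ∈ strip m, ‖discr ζ * (ζ + Complex.I) ^ 12‖ ≤ e m := by
  have hcont : ∀ m, ContinuousOn (fun ζ : ℂ => ‖discr ζ * (ζ + Complex.I) ^ 12‖) (strip m) :=
    fun m => ((differentiableOn_discr.continuousOn.mono (strip_subset m)).mul
      (by fun_prop)).norm
  refine ⟨fun m => sSup ((fun ζ : ℂ => ‖discr ζ * (ζ + Complex.I) ^ 12‖) '' strip m),
    ?_, fun m => Real.sSup_nonneg ?_, fun m ζ hζ => ?_⟩
  · rw [Metric.tendsto_atTop]
    intro ε hε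
    obtain ⟨Y, hY⟩ := exists_norm_discr_le (half_pos hε)
    refine ⟨⌈Y⌉₊, fun m hm => ?_⟩
    rw [Real.dist_eq, sub_zero, abs_of_nonneg (Real.sSup_nonneg ?_)]
    · refine (Real.sSup_le ?_ (half_pos hε).le).trans_lt (half_lt_self hε)
      rintro _ ⟨ζ, hζ, rfl⟩
      refine hY ζ (strip_subset m hζ) ?_ hζ.1
      have : Y ≤ m := (Nat.le_ceil Y).trans (by exact_mod_cast hm)
      linarith [hζ.2.1]
    · rintro _ ⟨ζ, -, rfl⟩; positivity
  · rintro _ ⟨ζ, -, rfl⟩; positivity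
  · exact le_csSup ((isCompact_strip m).image_of_continuousOn (hcont m)).bddAbove ⟨ζ, hζ, rfl⟩

omit [NormedSpace ℂ F] [IsScalarTower ℝ ℂ F] in
/-- For countably many families there are exponents under which the solution operator converges on
all of them. This is where the absence of growth conditions at the cusp is overcome: the power
`N m` of `Δ` is chosen in terms of the size of the families on the `m`-th rectangle. -/
theorem exists_admissible [FiniteDimensional ℝ E] (w : ℤ) {f : ℕ → ℂ × E → F} {U : ℕ → Set E}
    {c : ℕ → E} {R : ℕ → ℝ} (hU : ∀ i, IsOpen (U i))
    (hf : ∀ i, ContDiffOn ℝ ∞ (f i) (upperHalf ×ˢ U i))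
    (hsub : ∀ i, Metric.closedBall (c i) (R i) ⊆ U i) :
    ∃ N, ∀ i, Admissible w N (Metric.ball (c i) (R i)) (f i) := by
  have : ProperSpace E := FiniteDimensional.proper ℝ E
  obtain ⟨e, he, he0, hele⟩ := exists_norm_discr_strip_le
  have hD : ∀ m i r, ∃ D : ℝ, 0 ≤ D ∧ ∀ ζ ∈ strip m, ∀ x ∈ Metric.closedBall (c i) (R i),
      ‖iteratedFDeriv ℝ r (fun y => f i (ζ, y)) x‖ ≤ D := fun m i r => by
    obtain ⟨D, hD0, hD⟩ := exists_norm_iteratedFDeriv_le (hU i) (hf i) r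
      ((isCompact_strip m).prod (isCompact_closedBall (c i) (R i)))
      (prod_mono (strip_subset m) (hsub i))
    exact ⟨D, hD0, fun ζ hζ x hx => hD (ζ, x) ⟨hζ, hx⟩⟩
  choose D hD0 hD using hD
  have hB : ∀ m, ∃ B : ℝ, 0 ≤ B ∧ ∀ ζ ∈ strip m,
      ‖(cutoff m ζ : ℂ) * (ζ + Complex.I) ^ w‖ ≤ B := fun m => by
    have hcont : ContinuousOn (fun ζ : ℂ => (cutoff m ζ : ℂ) * (ζ + Complex.I) ^ w) (strip m) :=
      (Complex.continuous_ofReal.comp_continuousOn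
        ((contDiffOn_cutoff m).continuousOn.mono (strip_subset m))).mul
        (ContinuousOn.zpow₀ (by fun_prop) _ fun ζ hζ => Or.inl (add_I_ne_zero (strip_subset m hζ)))
    obtain ⟨B, hB⟩ := (isCompact_strip m).exists_bound_of_continuousOn hcont
    exact ⟨max B 0, le_max_right _ _, fun ζ hζ => (hB ζ hζ).trans (le_max_left _ _)⟩
  choose B hB0 hB using hB
  -- a diagonal choice: the `m`-th exponent deals with the derivatives of order `r ≤ m` of the
  -- families with index `i ≤ m`
  set A : ℕ → ℝ := fun m => cauchyConst (strip m) * (B m *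
    ∑ i ∈ Finset.range (m + 1), ∑ r ∈ Finset.range (m + 1), D m i r) with hA
  have hN : ∀ m, ∃ N : ℕ, 6 ≤ 12 * (N : ℤ) + w ∧ A m * (1 / 2) ^ N ≤ (1 / 2) ^ m := fun m => by
    have h1 : Tendsto (fun N : ℕ => A m * (1 / 2 : ℝ) ^ N) atTop (𝓝 0) := by
      simpa using (tendsto_pow_atTop_nhds_zero_of_lt_one (r := (1 / 2 : ℝ)) (by norm_num)
        (by norm_num)).const_mul (A m)
    obtain ⟨N, h2, h3⟩ := ((h1.eventually_le_const (by positivity : (0 : ℝ) < (1 / 2) ^ m)).and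
      (eventually_ge_atTop (6 + w.natAbs))).exists
    exact ⟨N, by omega, h2⟩
  choose N hN6 hN using hN
  -- the factor `2` in `δ m = 2 * e m` pays for the factor `(1 / 2) ^ N m` that absorbs `A m`
  refine ⟨N, fun i => ⟨hN6, fun m => 2 * e m, by simpa using he.const_mul 2,
    fun m => by have := he0 m; positivity, fun r x₀ hx₀ => ?_⟩⟩
  obtain ⟨ρ, hρ, hρsub⟩ := Metric.nhds_basis_closedBall.mem_iff.1 (Metric.isOpen_ball.mem_nhds hx₀)
  refine ⟨ρ, hρ, ?_⟩
  filter_upwards [eventually_ge_atTop i, eventually_ge_atTop r] with m hmi hmr ζ hζ x hx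
  have h1 := hD m i r ζ hζ x (Metric.ball_subset_closedBall (hρsub hx))
  have h2 : D m i r ≤ ∑ i ∈ Finset.range (m + 1), ∑ r ∈ Finset.range (m + 1), D m i r :=
    (Finset.single_le_sum (f := fun r => D m i r) (fun _ _ => hD0 _ _ _)
      (Finset.mem_range.2 (by omega : r < m + 1))).trans
      (Finset.single_le_sum (f := fun i => ∑ r ∈ Finset.range (m + 1), D m i r)
        (fun _ _ => Finset.sum_nonneg fun _ _ => hD0 _ _ _)
        (Finset.mem_range.2 (by omega : i < m + 1)))
  have h3 : ‖weightFun w N m ζ‖ ≤ B m * e m ^ N m := by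
    have hm := add_I_ne_zero (strip_subset m hζ)
    have : weightFun w N m ζ = ((cutoff m ζ : ℂ) * (ζ + Complex.I) ^ w) *
        (discr ζ * (ζ + Complex.I) ^ 12) ^ N m := by
      rw [weightFun, zpow_add₀ hm, mul_pow, ← pow_mul,
        show 12 * (N m : ℤ) = ((12 * N m : ℕ) : ℤ) by push_cast; rfl, zpow_natCast]
      ring
    rw [this, norm_mul, norm_pow]
    have := hB m ζ hζ
    have := hB0 m
    have := hele m ζ hζ
    gcongr
  have hc := cauchyConst_nonneg (strip m)
  have := hB0 m
  have := he0 m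
  calc cauchyConst (strip m) * (‖weightFun w N m ζ‖ * ‖iteratedFDeriv ℝ r (fun y => f i (ζ, y)) x‖)
      ≤ cauchyConst (strip m) * ((B m * e m ^ N m) *
        ∑ i ∈ Finset.range (m + 1), ∑ r ∈ Finset.range (m + 1), D m i r) := by
        gcongr
        exact h1.trans h2
    _ = (A m * (1 / 2) ^ N m) * (2 * e m) ^ N m := by
        rw [hA, mul_pow, div_pow, one_pow]
        field_simp
    _ ≤ (1 / 2) ^ m * (2 * e m) ^ N m := by
        gcongr
        exact hN m
    _ = _ := mul_comm _ _

end SolutionProperties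

/-! ### Smooth families of differential forms -/

section FormCalculus

variable {E : Type*} [NormedAddCommGroup E] [NormedSpace ℝ E]
  {M : Type*} [TopologicalSpace M] [ChartedSpace E M]
  {V : Type*} [NormedAddCommGroup V] [NormedSpace ℝ V] {j : ℕ}

/-- On a finite-dimensional space, alternating forms depend smoothly on a parameter as soon as all
their values do. -/
theorem contDiffOn_alt_iff [FiniteDimensional ℝ E] {n : WithTop ℕ∞} {f : V → Alt E ℂ j}
    {s : Set V} : ContDiffOn ℝ n f s ↔ ∀ v, ContDiffOn ℝ n (fun z => f z v) s := by
  refine ⟨fun h v => ((ContinuousAlternatingMap.apply ℝ E ℂ v).contDiff).comp_contDiffOn h,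
    fun h => ?_⟩
  set b := Module.finBasis ℝ E
  let T : Alt E ℂ j →ₗ[ℝ] ((Fin j → Fin (Module.finrank ℝ E)) → ℂ) :=
    { toFun := fun β σ => β fun i => b (σ i)
      map_add' := fun _ _ => rfl
      map_smul' := fun _ _ => rfl }
  have hT : LinearMap.ker T = ⊥ := by
    rw [LinearMap.ker_eq_bot]
    intro β β' hβ
    refine ContinuousAlternatingMap.toAlternatingMap_injective
      (b.ext_alternating fun σ _ => congrFun hβ σ)
  obtain ⟨L, hL⟩ := T.exists_leftInverse_of_injective hT
  have h1 : ContDiffOn ℝ n (fun z => T (f z)) s := contDiffOn_pi.2 fun σ => h _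
  refine ((L.toContinuousLinearMap.contDiff).comp_contDiffOn h1).congr fun z _ => ?_
  exact (LinearMap.congr_fun hL (f z)).symm

theorem contDiffOn_compAlt [FiniteDimensional ℝ E] {n : WithTop ℕ∞} {β : V → Alt E ℂ j}
    {A : V → E →L[ℝ] E} {s : Set V} (hβ : ContDiffOn ℝ n β s) (hA : ContDiffOn ℝ n A s) :
    ContDiffOn ℝ n (fun z => (β z).compContinuousLinearMap (A z)) s := by
  rw [contDiffOn_alt_iff]
  intro v
  have h1 : ContDiffOn ℝ n (fun z => (β z).toContinuousMultilinearMap) s :=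
    (ContinuousAlternatingMap.toContinuousMultilinearMapLI
      (𝕜 := ℝ) (E := E) (F := ℂ) (ι := Fin j)).contDiff.comp_contDiffOn hβ
  have h2 : ContDiffOn ℝ n (fun z =>
      ContinuousMultilinearMap.compContinuousLinearMapContinuousMultilinear
      ℝ (fun _ : Fin j => E) (fun _ : Fin j => E) ℂ fun _ => A z) s :=
    (ContinuousMultilinearMap.contDiff _).comp_contDiffOn (contDiffOn_pi.2 fun _ => hA)
  exact (ContinuousMultilinearMap.apply ℝ (fun _ : Fin j => E) ℂ v).contDiff.comp_contDiffOn
    (h2.clm_apply h1)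

theorem compAlt_comp (β : Alt E ℂ j) (A B : E →L[ℝ] E) :
    (β.compContinuousLinearMap A).compContinuousLinearMap B =
      β.compContinuousLinearMap (A.comp B) := rfl

theorem compAlt_id (β : Alt E ℂ j) :
    β.compContinuousLinearMap (ContinuousLinearMap.id ℝ E) = β := rfl

variable (E) in
/-- Pullback of complex-valued alternating forms along a linear map, as a complex linear map. -/
noncomputable def pullAlt (j : ℕ) (A : E →L[ℝ] E) : Alt E ℂ j →L[ℂ] Alt E ℂ j where
  toFun β := β.compContinuousLinearMap A
  map_add' _ _ := rfl
  map_smul' _ _ := rfl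
  cont := (ContinuousAlternatingMap.compContinuousLinearMapCLM (𝕜 := ℝ) (F := ℂ)
      (ι := Fin j) A).cont

variable (E) in
/-- Alternatization, as a complex linear map. -/
noncomputable def alternatize (j : ℕ) : (E →L[ℝ] Alt E ℂ j) →L[ℂ] Alt E ℂ (j + 1) where
  toFun f := ContinuousAlternatingMap.alternatizeUncurryFinCLM ℝ E ℂ f
  map_add' := map_add _
  map_smul' c f := by
    ext v
    simp [ContinuousAlternatingMap.alternatizeUncurryFinCLM_apply,
      ContinuousAlternatingMap.alternatizeUncurryFin_apply, Finset.mul_sum]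
  cont := (ContinuousAlternatingMap.alternatizeUncurryFinCLM ℝ E ℂ).cont

theorem extDeriv_eq_alternatize (β : E → Alt E ℂ j) (y : E) :
    extDeriv β y = alternatize E j (fderiv ℝ β y) := rfl

variable [IsManifold 𝓘(ℝ, E) ∞ M]

theorem chartDeriv_comp_chartSymmDeriv (x₀ : M) {y : E} (hy : y ∈ (chartAt E x₀).target) :
    (chartDeriv (chartAt E x₀) ((chartAt E x₀).symm y)).comp (chartSymmDeriv (chartAt E x₀) y) =
      ContinuousLinearMap.id ℝ E :=
  have : IsManifold 𝓘(ℝ, E) 1 M := IsManifold.of_le (n := ∞) (by simp)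
  (mdifferentiable_chart (I := 𝓘(ℝ, E)) x₀).comp_symm_deriv hy

theorem chartSymmDeriv_comp_chartDeriv (x₀ : M) {x : M} (hx : x ∈ (chartAt E x₀).source) :
    (chartSymmDeriv (chartAt E x₀) (chartAt E x₀ x)).comp (chartDeriv (chartAt E x₀) x) =
      ContinuousLinearMap.id ℝ E :=
  have : IsManifold 𝓘(ℝ, E) 1 M := IsManifold.of_le (n := ∞) (by simp)
  (mdifferentiable_chart (I := 𝓘(ℝ, E)) x₀).symm_comp_deriv hx

theorem eq_compAlt_localRep (x₀ : M) (α : FormField E M j) {x : M}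
    (hx : x ∈ (chartAt E x₀).source) :
    α x = (localRep (chartAt E x₀) α (chartAt E x₀ x)).compContinuousLinearMap
      (chartDeriv (chartAt E x₀) x) := by
  rw [localRep, compAlt_comp, chartSymmDeriv_comp_chartDeriv x₀ hx, compAlt_id,
    (chartAt E x₀).left_inv hx]

theorem localRep_eq_of_eq (x₀ : M) {α : FormField E M j} {β : Alt E ℂ j} {y : E}
    (hy : y ∈ (chartAt E x₀).target)
    (h : α ((chartAt E x₀).symm y) = β.compContinuousLinearMap
      (chartDeriv (chartAt E x₀) ((chartAt E x₀).symm y))) :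
    localRep (chartAt E x₀) α y = β := by
  rw [localRep, h, compAlt_comp, chartDeriv_comp_chartSymmDeriv x₀ hy, compAlt_id]

/-- The transition map between two charts. -/
def chartTrans (x₀ x₁ : M) (y : E) : E := chartAt E x₁ ((chartAt E x₀).symm y)

theorem contDiffOn_chartTrans (x₀ x₁ : M) : ContDiffOn ℝ ∞ (chartTrans (E := E) x₀ x₁)
    ((chartAt E x₀).target ∩ (chartAt E x₀).symm ⁻¹' (chartAt E x₁).source) := by
  have h := contDiffOn_ext_coord_change (I := 𝓘(ℝ, E)) (n := ∞) (M := M) x₁ x₀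
  simp only [mfld_simps, Function.comp_def] at h
  exact h

omit [NormedSpace ℝ E] [IsManifold 𝓘(ℝ, E) ∞ M] in
theorem isOpen_overlap (x₀ x₁ : M) : IsOpen
    ((chartAt E x₀).target ∩ (chartAt E x₀).symm ⁻¹' (chartAt E x₁).source) :=
  (chartAt E x₀).isOpen_inter_preimage_symm (chartAt E x₁).open_source

theorem fderiv_chartTrans (x₀ x₁ : M) {y : E} (hy : y ∈ (chartAt E x₀).target)
    (hy' : (chartAt E x₀).symm y ∈ (chartAt E x₁).source) :
    fderiv ℝ (chartTrans x₀ x₁) y =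
      (chartDeriv (chartAt E x₁) ((chartAt E x₀).symm y)).comp (chartSymmDeriv
          (chartAt E x₀) y) := by
  have : IsManifold 𝓘(ℝ, E) 1 M := IsManifold.of_le (n := ∞) (by simp)
  rw [← mfderiv_eq_fderiv]
  exact mfderiv_comp y ((mdifferentiable_chart (I := 𝓘(ℝ, E)) x₁).mdifferentiableAt hy')
    ((mdifferentiable_chart (I := 𝓘(ℝ, E)) x₀).mdifferentiableAt_symm hy)

theorem localRep_chartTrans (x₀ x₁ : M) (α : FormField E M j) {y : E}
    (hy : y ∈ (chartAt E x₀).target) (hy' : (chartAt E x₀).symm y ∈ (chartAt E x₁).source) :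
    localRep (chartAt E x₀) α y =
      (localRep (chartAt E x₁) α (chartTrans x₀ x₁ y)).compContinuousLinearMap
        (fderiv ℝ (chartTrans x₀ x₁) y) := by
  refine localRep_eq_of_eq x₀ hy ?_
  rw [fderiv_chartTrans x₀ x₁ hy hy', compAlt_comp, ContinuousLinearMap.comp_assoc]
  rw [show (chartSymmDeriv (chartAt E x₀) y).comp (chartDeriv (chartAt E x₀)
    ((chartAt E x₀).symm y)) = ContinuousLinearMap.id ℝ E from ?_]
  · exact eq_compAlt_localRep x₁ α hy'
  · conv_lhs => rw [← (chartAt E x₀).right_inv hy, (chartAt E x₀).left_inv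
      ((chartAt E x₀).map_target hy)]
    exact chartSymmDeriv_comp_chartDeriv x₀ ((chartAt E x₀).map_target hy)

/-- Smoothness of a family of forms may be checked near each point of `M`, in one chart. -/
theorem mem_smoothForms_of_local [FiniteDimensional ℝ E] {P : Set V}
    {α : FormFamily E M V j} (h0 : ∀ p ∉ P, α p = 0)
    (h : ∀ x : M, ∃ x₁ : M, x ∈ (chartAt E x₁).source ∧ ∃ U : Set E, IsOpen U ∧
      chartAt E x₁ x ∈ U ∧
      ContDiffOn ℝ ∞ (fun q : V × E => localRep (chartAt E x₁) (α q.1) q.2) (P ×ˢ U)) :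
    α ∈ smoothForms E M P j := by
  refine ⟨h0, fun x₀ => ?_⟩
  rintro ⟨p, y⟩ ⟨hp, hy⟩
  obtain ⟨x₁, hx₁, U, hU, hxU, hs⟩ := h ((chartAt E x₀).symm y)
  set O := (chartAt E x₀).target ∩ (chartAt E x₀).symm ⁻¹' (chartAt E x₁).source
  have hO : IsOpen O := isOpen_overlap x₀ x₁
  have htr := contDiffOn_chartTrans (E := E) x₀ x₁
  have hO' : IsOpen (O ∩ chartTrans x₀ x₁ ⁻¹' U) := htr.continuousOn.isOpen_inter_preimage hO hU
  have h1 : ContDiffOn ℝ ∞ (fun q : V × E => localRep (chartAt E x₁) (α q.1)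
      (chartTrans x₀ x₁ q.2)) (P ×ˢ (O ∩ chartTrans x₀ x₁ ⁻¹' U)) :=
    hs.comp (f := fun q : V × E => (q.1, chartTrans x₀ x₁ q.2))
      (contDiffOn_fst.prodMk ((htr.mono inter_subset_left).comp contDiffOn_snd fun q hq => hq.2))
      fun q hq => ⟨hq.1, hq.2.2⟩
  have h2 : ContDiffOn ℝ ∞ (fun q : V × E => fderiv ℝ (chartTrans x₀ x₁) q.2)
      (P ×ˢ (O ∩ chartTrans x₀ x₁ ⁻¹' U)) :=
    ((htr.fderiv_of_isOpen hO (by simp)).mono inter_subset_left).comp contDiffOn_snd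
      fun q hq => hq.2
  have h3 := (contDiffOn_compAlt h1 h2).congr fun q hq => localRep_chartTrans x₀ x₁
      (α q.1) hq.2.1.1 hq.2.1.2
  refine (h3 (p, y) ⟨hp, ⟨hy, hx₁⟩, hxU⟩).mono_of_mem_nhdsWithin ?_
  rw [nhdsWithin_prod_eq]
  refine Filter.prod_mem_prod self_mem_nhdsWithin (mem_nhdsWithin_of_mem_nhds ?_)
  exact hO'.mem_nhds ⟨⟨hy, hx₁⟩, hxU⟩

/-- The exterior derivative is the coordinate exterior derivative in every chart. -/
theorem localRep_extD {α : FormField E M j} (x₀ : M) {y : E} (hy : y ∈ (chartAt E x₀).target)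
    (hα : DifferentiableAt ℝ (localRep (chartAt E ((chartAt E x₀).symm y)) α)
      (chartAt E ((chartAt E x₀).symm y) ((chartAt E x₀).symm y))) :
    localRep (chartAt E x₀) (extD α) y = extDeriv (localRep (chartAt E x₀) α) y := by
  set x := (chartAt E x₀).symm y with hx
  have hxs : x ∈ (chartAt E x).source := mem_chart_source E x
  have htr := (contDiffOn_chartTrans (E := E) x₀ x).contDiffAt
    ((isOpen_overlap x₀ x).mem_nhds ⟨hy, hxs⟩)
  have h1 : localRep (chartAt E x₀) α =ᶠ[𝓝 y] fun y =>
      (localRep (chartAt E x) α (chartTrans x₀ x y)).compContinuousLinearMap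
        (fderiv ℝ (chartTrans x₀ x) y) := by
    filter_upwards [(isOpen_overlap x₀ x).mem_nhds ⟨hy, hxs⟩] with z hz
    exact localRep_chartTrans x₀ x α hz.1 hz.2
  have hr : minSmoothness ℝ 2 ≤ ∞ := by
    simpa using (WithTop.coe_le_coe.2 le_top : ((2 : ℕ∞) : WithTop ℕ∞) ≤ ∞)
  have hα' : DifferentiableAt ℝ (localRep (chartAt E x) α) (chartTrans x₀ x y) := hα
  rw [h1.extDeriv_eq, extDeriv_pullback hα' htr hr, localRep_chartTrans x₀ x (extD α) hy hxs]
  congr 1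
  have hxx : (chartAt E x).symm (chartTrans x₀ x y) = x := (chartAt E x).left_inv hxs
  exact localRep_eq_of_eq x (mem_chart_target E x) (by rw [hxx]; rfl)

end FormCalculus

/-! ### Operations on families of forms -/

section PartialDerivatives

variable {V : Type*} [NormedAddCommGroup V] [NormedSpace ℝ V]
  {E : Type*} [NormedAddCommGroup E] [NormedSpace ℝ E]
  {F : Type*} [NormedAddCommGroup F] [NormedSpace ℝ F] {P : Set V} {U : Set E}

theorem fderiv_partial_right {t : V × E → F} {p : V} {y : E} (h : DifferentiableAt ℝ t (p, y)) :
    fderiv ℝ (fun y => t (p, y)) y = (fderiv ℝ t (p, y)).comp (ContinuousLinearMap.inr ℝ V E) :=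
  (h.hasFDerivAt.comp y (hasFDerivAt_prodMk_right (𝕜 := ℝ) p y)).fderiv

theorem fderiv_partial_left {t : V × E → F} {p : V} {y : E} (h : DifferentiableAt ℝ t (p, y)) :
    fderiv ℝ (fun p => t (p, y)) p = (fderiv ℝ t (p, y)).comp (ContinuousLinearMap.inl ℝ V E) :=
  (h.hasFDerivAt.comp p (hasFDerivAt_prodMk_left (𝕜 := ℝ) p y)).fderiv

/-- Partial derivatives in the two factors commute. -/
theorem fderiv_partial_comm (hP : IsOpen P) (hU : IsOpen U) {t : V × E → F}
    (ht : ContDiffOn ℝ ∞ t (P ×ˢ U)) {p : V} (hp : p ∈ P) {y : E} (hy : y ∈ U) (v : V) :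
    fderiv ℝ (fun y => fderiv ℝ (fun p => t (p, y)) p v) y =
      fderiv ℝ (fun p => fderiv ℝ (fun y => t (p, y)) y) p v := by
  have hO := hP.prod hU
  have hd : ∀ q ∈ P ×ˢ U, DifferentiableAt ℝ t q := fun q hq =>
    (ht.contDiffAt (hO.mem_nhds hq)).differentiableAt (by simp)
  have hd2 : DifferentiableAt ℝ (fderiv ℝ t) (p, y) :=
    ((ht.fderiv_of_isOpen hO (m := ∞) (by simp)).contDiffAt
      (hO.mem_nhds ⟨hp, hy⟩)).differentiableAt (by simp)
  have h1 : (fun y => fderiv ℝ (fun p => t (p, y)) p v) =ᶠ[𝓝 y] fun y =>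
      fderiv ℝ t (p, y) (v, 0) := by
    filter_upwards [hU.mem_nhds hy] with z hz
    rw [fderiv_partial_left (hd (p, z) ⟨hp, hz⟩)]; simp
  have h2 : (fun p => fderiv ℝ (fun y => t (p, y)) y) =ᶠ[𝓝 p] fun p =>
      (fderiv ℝ t (p, y)).comp (ContinuousLinearMap.inr ℝ V E) := by
    filter_upwards [hP.mem_nhds hp] with q hq
    rw [fderiv_partial_right (hd (q, y) ⟨hq, hy⟩)]
  have hsymm := ((ht.contDiffAt (hO.mem_nhds (⟨hp, hy⟩ : (p, y) ∈ P ×ˢ U))).isSymmSndFDerivAt (by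
    simpa using (WithTop.coe_le_coe.2 le_top : ((2 : ℕ∞) : WithTop ℕ∞) ≤ ∞))).eq
  rw [h1.fderiv_eq, h2.fderiv_eq]
  have h3 := ((hd2.hasFDerivAt.comp y (hasFDerivAt_prodMk_right (𝕜 := ℝ) p y)).clm_apply
    (hasFDerivAt_const (v, (0 : E)) y)).fderiv
  have h4 := ((hd2.hasFDerivAt.comp p (hasFDerivAt_prodMk_left (𝕜 := ℝ) p y)).clm_comp
    (hasFDerivAt_const (ContinuousLinearMap.inr ℝ V E) p)).fderiv
  refine ContinuousLinearMap.ext fun w => ?_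
  refine (congrArg (fun L : E →L[ℝ] F => L w) h3).trans
    (Eq.trans ?_ (congrArg (fun L : V →L[ℝ] (E →L[ℝ] F) => L v w) h4).symm)
  simpa using hsymm (0, w) (v, 0)

theorem fderiv_map_apply [NormedSpace ℂ F] [IsScalarTower ℝ ℂ F] {G : Type*} [NormedAddCommGroup G]
    [NormedSpace ℝ G] [NormedSpace ℂ G] [IsScalarTower ℝ ℂ G] (Λ : F →L[ℂ] G) {g : V → F} {p : V}
    (hg : DifferentiableAt ℝ g p) (v : V) :
    fderiv ℝ (fun p => Λ (g p)) p v = Λ (fderiv ℝ g p v) :=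
  congrArg (fun L : V →L[ℝ] G => L v)
    (((Λ.restrictScalars ℝ).hasFDerivAt.comp p hg.hasFDerivAt).fderiv)

end PartialDerivatives

section FormOperations

variable {E : Type*} [NormedAddCommGroup E] [NormedSpace ℝ E]
  {M : Type*} [TopologicalSpace M] [ChartedSpace E M]
  {V : Type*} [NormedAddCommGroup V] [NormedSpace ℝ V]
  {V' : Type*} [NormedAddCommGroup V'] [NormedSpace ℝ V'] {j : ℕ} {P : Set V} {P' : Set V'}

theorem localRep_apply (e : OpenPartialHomeomorph M E) (α : FormField E M j) (y : E) :
    localRep e α y = pullAlt E j (chartSymmDeriv e y) (α (e.symm y)) := rfl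

theorem extD_apply (α : FormField E M j) (x : M) :
    extD α x = pullAlt E (j + 1) (chartDeriv (chartAt E x) x)
      (alternatize E j (fderiv ℝ (localRep (chartAt E x) α) (chartAt E x x))) := rfl

theorem localRep_zero (e : OpenPartialHomeomorph M E) :
    localRep e (0 : FormField E M j) = 0 := by
  funext y; rw [localRep_apply, Pi.zero_apply, map_zero]; rfl

theorem extD_zero : extD (0 : FormField E M j) = 0 := by
  funext x
  rw [extD_apply, localRep_zero, fderiv_zero]
  simp

theorem contDiffOn_localRep {α : FormFamily E M V j} (hα : α ∈ smoothForms E M P j) (p : V)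
    (x₀ : M) : ContDiffOn ℝ ∞ (localRep (chartAt E x₀) (α p)) (chartAt E x₀).target := by
  by_cases hp : p ∈ P
  · exact (hα.2 x₀).comp (f := fun y : E => (p, y)) (by fun_prop) fun y hy => ⟨hp, hy⟩
  · rw [hα.1 p hp, localRep_zero]; exact contDiffOn_const

section Smooth

variable [IsManifold 𝓘(ℝ, E) ∞ M]

theorem contDiffOn_apply {α : FormFamily E M V j} (hα : α ∈ smoothForms E M P j) (x : M) :
    ContDiffOn ℝ ∞ (fun p => α p x) P := by
  have h1 : ContDiffOn ℝ ∞ (fun p => localRep (chartAt E x) (α p) (chartAt E x x)) P :=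
    (hα.2 x).comp (f := fun p : V => (p, chartAt E x x)) (by fun_prop)
      fun p hp => ⟨hp, mem_chart_target E x⟩
  exact (((pullAlt E j (chartDeriv (chartAt E x) x)).restrictScalars ℝ).contDiff.comp_contDiffOn
    h1).congr fun p _ => eq_compAlt_localRep x (α p) (mem_chart_source E x)

theorem differentiableAt_apply (hP : IsOpen P) {α : FormFamily E M V j}
    (hα : α ∈ smoothForms E M P j) (x : M) {p : V} (hp : p ∈ P) :
    DifferentiableAt ℝ (fun p => α p x) p :=
  ((contDiffOn_apply hα x).contDiffAt (hP.mem_nhds hp)).differentiableAt (by simp)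

theorem localRep_extD_of_smooth {α : FormFamily E M V j} (hα : α ∈ smoothForms E M P j) (p : V)
    (x₀ : M) {y : E} (hy : y ∈ (chartAt E x₀).target) :
    localRep (chartAt E x₀) (extD (α p)) y = extDeriv (localRep (chartAt E x₀) (α p)) y :=
  localRep_extD x₀ hy (differentiableAt_localRep hα p _)

theorem extD_mem_smoothForms (hP : IsOpen P) {α : FormFamily E M V j}
    (hα : α ∈ smoothForms E M P j) : (fun p => extD (α p)) ∈ smoothForms E M P (j + 1) := by
  refine ⟨fun p hp => by simp only [hα.1 p hp, extD_zero], fun x₀ => ?_⟩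
  have hO := hP.prod (chartAt E x₀).open_target
  have h1 : ContDiffOn ℝ ∞ (fderiv ℝ fun q : V × E => localRep (chartAt E x₀) (α q.1) q.2)
      (P ×ˢ (chartAt E x₀).target) := (hα.2 x₀).fderiv_of_isOpen hO (by simp)
  refine (((alternatize E j).restrictScalars ℝ).contDiff.comp_contDiffOn
    (h1.clm_comp (contDiffOn_const (c := ContinuousLinearMap.inr ℝ V E)))).congr ?_
  rintro ⟨p, y⟩ ⟨hp, hy⟩
  rw [localRep_extD_of_smooth hα p x₀ hy, extDeriv_eq_alternatize]
  exact congrArg (alternatize E j) (fderiv_partial_right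
    (((hα.2 x₀).contDiffAt (hO.mem_nhds ⟨hp, hy⟩)).differentiableAt (by simp)))

theorem extD_extD {α : FormFamily E M V j} (hα : α ∈ smoothForms E M P j) (p : V) :
    extD (extD (α p)) = 0 := by
  funext x
  have h1 : localRep (chartAt E x) (extD (α p)) =ᶠ[𝓝 (chartAt E x x)]
      extDeriv (localRep (chartAt E x) (α p)) := by
    filter_upwards [(chartAt E x).open_target.mem_nhds (mem_chart_target E x)] with y hy
    exact localRep_extD_of_smooth hα p x hy
  rw [extD, h1.extDeriv_eq, extDeriv_extDeriv_apply (r := ∞)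
    ((contDiffOn_localRep hα p x).contDiffAt
      ((chartAt E x).open_target.mem_nhds (mem_chart_target E x))) (by
    simpa using (WithTop.coe_le_coe.2 le_top : ((2 : ℕ∞) : WithTop ℕ∞) ≤ ∞))]
  rfl

/-- The directional derivative of a family of forms, along a vector field on the parameter
space. -/
noncomputable def dirDeriv (P : Set V) (ξ : V → V) (α : FormFamily E M V j) : FormFamily E M V j :=
  fun p x => open Classical in if p ∈ P then fderiv ℝ (fun p => α p x) p (ξ p) else 0

theorem localRep_dirDeriv (hP : IsOpen P) (ξ : V → V) {α : FormFamily E M V j}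
    (hα : α ∈ smoothForms E M P j) {p : V} (hp : p ∈ P) (e : OpenPartialHomeomorph M E) (y : E) :
    localRep e (dirDeriv P ξ α p) y = fderiv ℝ (fun p => localRep e (α p) y) p (ξ p) := by
  rw [localRep_apply, dirDeriv, if_pos hp]
  exact (fderiv_map_apply (pullAlt E j (chartSymmDeriv e y))
    (differentiableAt_apply hP hα (e.symm y) hp) (ξ p)).symm

theorem dirDeriv_mem_smoothForms (hP : IsOpen P) {ξ : V → V} (hξ : ContDiffOn ℝ ∞ ξ P)
    {α : FormFamily E M V j} (hα : α ∈ smoothForms E M P j) :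
    dirDeriv P ξ α ∈ smoothForms E M P j := by
  refine ⟨fun p hp => funext fun _ => if_neg hp, fun x₀ => ?_⟩
  have hO := hP.prod (chartAt E x₀).open_target
  have h1 : ContDiffOn ℝ ∞ (fderiv ℝ fun q : V × E => localRep (chartAt E x₀) (α q.1) q.2)
      (P ×ˢ (chartAt E x₀).target) := (hα.2 x₀).fderiv_of_isOpen hO (by simp)
  refine (h1.clm_apply ((hξ.comp contDiffOn_fst fun q hq => hq.1).prodMk
    (contDiffOn_const (c := (0 : E))))).congr ?_
  rintro ⟨p, y⟩ ⟨hp, hy⟩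
  rw [localRep_dirDeriv hP ξ hα hp, fderiv_partial_left
    (t := fun q : V × E => localRep (chartAt E x₀) (α q.1) q.2)
    (((hα.2 x₀).contDiffAt (hO.mem_nhds ⟨hp, hy⟩)).differentiableAt (by simp))]
  simp

theorem extD_dirDeriv (hP : IsOpen P) (ξ : V → V) {α : FormFamily E M V j}
    (hα : α ∈ smoothForms E M P j) (p : V) :
    extD (dirDeriv P ξ α p) = dirDeriv P ξ (fun p => extD (α p)) p := by
  funext x
  by_cases hp : p ∈ P
  · set y := chartAt E x x
    have hy : y ∈ (chartAt E x).target := mem_chart_target E x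
    have hO := hP.prod (chartAt E x).open_target
    have h1 : localRep (chartAt E x) (dirDeriv P ξ α p) = fun y =>
        fderiv ℝ (fun p => localRep (chartAt E x) (α p) y) p (ξ p) :=
      funext fun y => localRep_dirDeriv hP ξ hα hp _ y
    have h2 := fderiv_partial_comm hP (chartAt E x).open_target (hα.2 x) hp hy (ξ p)
    have hd : DifferentiableAt ℝ (fun p => fderiv ℝ (localRep (chartAt E x) (α p)) y) p := by
      have h3 : ContDiffOn ℝ ∞ (fderiv ℝ fun q : V × E => localRep (chartAt E x) (α q.1) q.2)
        (P ×ˢ (chartAt E x).target) := (hα.2 x).fderiv_of_isOpen hO (by simp)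
      have h4 : ContDiffOn ℝ ∞ (fun p => fderiv ℝ (localRep (chartAt E x) (α p)) y) P :=
        ((h3.clm_comp (contDiffOn_const (c := ContinuousLinearMap.inr ℝ V E))).comp
          (f := fun p : V => (p, y)) (by fun_prop) fun p hp => ⟨hp, hy⟩).congr fun q hq =>
          fderiv_partial_right (t := fun q : V × E => localRep (chartAt E x) (α q.1) q.2)
            (((hα.2 x).contDiffAt (hO.mem_nhds ⟨hq, hy⟩)).differentiableAt (by simp))
      exact (h4.contDiffAt (hP.mem_nhds hp)).differentiableAt (by simp)
    rw [extD_apply, h1, h2, dirDeriv, if_pos hp]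
    exact (fderiv_map_apply (F := E →L[ℝ] Alt E ℂ j) ((pullAlt E (j + 1) (chartDeriv
        (chartAt E x) x)).comp
      (alternatize E j)) hd (ξ p)).symm
  · have h1 : dirDeriv P ξ α p = 0 := funext fun _ => if_neg hp
    rw [h1, extD_zero, dirDeriv, if_neg hp]; rfl

end Smooth

/-- The pullback of a family of forms along a map `φ` of parameter spaces, multiplied by a function
`c` of the parameter. -/
noncomputable def reparam (P' : Set V') (c : V' → ℂ) (φ : V' → V) (α : FormFamily E M V j) :
    FormFamily E M V' j :=
  fun p x => open Classical in if p ∈ P' then c p • α (φ p) x else 0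

omit [TopologicalSpace M] [ChartedSpace E M] [NormedAddCommGroup V] [NormedSpace ℝ V]
  [NormedAddCommGroup V'] [NormedSpace ℝ V'] in
theorem reparam_eq (c : V' → ℂ) (φ : V' → V) (α : FormFamily E M V j) {p : V'} (hp : p ∈ P') :
    reparam P' c φ α p = c p • α (φ p) := funext fun _ => if_pos hp

omit [TopologicalSpace M] [ChartedSpace E M] [NormedAddCommGroup V] [NormedSpace ℝ V]
  [NormedAddCommGroup V'] [NormedSpace ℝ V'] in
theorem reparam_eq_zero (c : V' → ℂ) (φ : V' → V) (α : FormFamily E M V j) {p : V'} (hp : p ∉ P') :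
    reparam P' c φ α p = 0 := funext fun _ => if_neg hp

theorem reparam_mem_smoothForms {c : V' → ℂ} {φ : V' → V} {α : FormFamily E M V j}
    (hα : α ∈ smoothForms E M P j) (hc : ContDiffOn ℝ ∞ c P') (hφ : ContDiffOn ℝ ∞ φ P')
    (hmaps : MapsTo φ P' P) : reparam P' c φ α ∈ smoothForms E M P' j := by
  refine ⟨fun p hp => reparam_eq_zero c φ α hp, fun x₀ => ?_⟩
  have h1 : ContDiffOn ℝ ∞ (fun q : V' × E => localRep (chartAt E x₀) (α (φ q.1)) q.2)
      (P' ×ˢ (chartAt E x₀).target) :=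
    (hα.2 x₀).comp (f := fun q : V' × E => (φ q.1, q.2))
      ((hφ.comp contDiffOn_fst fun q hq => hq.1).prodMk contDiffOn_snd)
      fun q hq => ⟨hmaps hq.1, hq.2⟩
  refine ((hc.comp contDiffOn_fst fun q hq => hq.1).smul h1).congr fun q hq => ?_
  rw [reparam_eq c φ α hq.1]
  simp only [localRep_apply, Pi.smul_apply, map_smul]
  rfl

omit [NormedAddCommGroup V'] [NormedSpace ℝ V'] in
theorem extD_reparam {c : V' → ℂ} {φ : V' → V} {α : FormFamily E M V j}
    (hα : α ∈ smoothForms E M P j) (p : V') :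
    extD (reparam P' c φ α p) = reparam P' c φ (fun p => extD (α p)) p := by
  by_cases hp : p ∈ P'
  · rw [reparam_eq c φ α hp, reparam_eq c φ _ hp,
      extD_smul _ fun x => differentiableAt_localRep hα (φ p) x]
  · rw [reparam_eq_zero c φ α hp, reparam_eq_zero c φ _ hp, extD_zero]

end FormOperations

/-! ### Equivariant solution of the `∂/∂τ̄`-equation for families of forms -/

section DbarForms

theorem dbar_map {F : Type*} [NormedAddCommGroup F] [NormedSpace ℝ F] [NormedSpace ℂ F]
    [IsScalarTower ℝ ℂ F] {G : Type*} [NormedAddCommGroup G]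
    [NormedSpace ℝ G] [NormedSpace ℂ G] [IsScalarTower ℝ ℂ G] (Λ : F →L[ℂ] G) {g : ℂ → F} {τ : ℂ}
    (hg : DifferentiableAt ℝ g τ) : dbar (fun t => Λ (g t)) τ = Λ (dbar g τ) := by
  rw [dbar, fderiv_map_apply Λ hg, fderiv_map_apply Λ hg, dbar, map_smul, map_add, map_smul]

universe u v
variable {E : Type u} [NormedAddCommGroup E] [NormedSpace ℝ E]
  {M : Type v} [TopologicalSpace M] [ChartedSpace E M] [IsManifold 𝓘(ℝ, E) ∞ M] {j : ℕ}

theorem chartSymmDeriv_comp_chartDeriv_symm (x₀ : M) {y : E} (hy : y ∈ (chartAt E x₀).target) :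
    (chartSymmDeriv (chartAt E x₀) y).comp (chartDeriv (chartAt E x₀) ((chartAt E x₀).symm y)) =
      ContinuousLinearMap.id ℝ E := by
  have h := chartSymmDeriv_comp_chartDeriv x₀ ((chartAt E x₀).map_target hy)
  rwa [(chartAt E x₀).right_inv hy] at h

/-- Passage to the coordinate representative, at a point of a chart. -/
noncomputable def localRepEquiv (j : ℕ) (x₀ : M) {y : E} (hy : y ∈ (chartAt E x₀).target) :
    Alt E ℂ j ≃L[ℂ] Alt E ℂ j :=
  ContinuousLinearEquiv.equivOfInverse (pullAlt E j (chartSymmDeriv (chartAt E x₀) y))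
    (pullAlt E j (chartDeriv (chartAt E x₀) ((chartAt E x₀).symm y)))
    (fun β => (congrArg β.compContinuousLinearMap
      (chartSymmDeriv_comp_chartDeriv_symm x₀ hy)).trans (compAlt_id β))
    (fun β => (congrArg β.compContinuousLinearMap
      (chartDeriv_comp_chartSymmDeriv x₀ hy)).trans (compAlt_id β))

/-- The solution operator, applied pointwise to a family of forms. -/
noncomputable def solForm (w : ℤ) (N : ℕ → ℕ) (α : FormFamily E M ℂ j) : FormFamily E M ℂ j :=
  fun τ x => sol w N (fun ζ => α ζ x) τ

theorem localRep_solForm (w : ℤ) (N : ℕ → ℕ) (α : FormFamily E M ℂ j) (x₀ : M) {y : E}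
    (hy : y ∈ (chartAt E x₀).target) (τ : ℂ) :
    localRep (chartAt E x₀) (solForm w N α τ) y =
      sol w N (fun ζ => localRep (chartAt E x₀) (α ζ) y) τ :=
  (map_sol (localRepEquiv j x₀ hy) (fun ζ => α ζ ((chartAt E x₀).symm y)) τ).symm

/-- The exponents `N` are such that the solution operator converges on `α`, near every point
of `M`. -/
def FormAdmissible (w : ℤ) (N : ℕ → ℕ) (α : FormFamily E M ℂ j) : Prop :=
  ∀ x : M, ∃ x₁ : M, x ∈ (chartAt E x₁).source ∧ ∃ U : Set E, IsOpen U ∧ chartAt E x₁ x ∈ U ∧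
    U ⊆ (chartAt E x₁).target ∧
    Admissible w N U fun z : ℂ × E => localRep (chartAt E x₁) (α z.1) z.2

variable [FiniteDimensional ℝ E]

omit [IsManifold 𝓘(ℝ, E) ∞ M] in
/-- A manifold is covered by countably many coordinate balls, and a common sequence of exponents
serves all of them. -/
theorem exists_formAdmissible [SecondCountableTopology M] (w : ℤ) {α : FormFamily E M ℂ j}
    (hα : α ∈ smoothForms E M upperHalf j) : ∃ N, FormAdmissible w N α := by
  rcases isEmpty_or_nonempty M with hM | hM
  · exact ⟨0, fun x => hM.elim x⟩
  have hR : ∀ x : M, ∃ R > 0, Metric.closedBall (chartAt E x x) R ⊆ (chartAt E x).target :=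
    fun x => Metric.nhds_basis_closedBall.mem_iff.1
      ((chartAt E x).open_target.mem_nhds (mem_chart_target E x))
  choose R hR0 hR using hR
  obtain ⟨s, hs, hcov⟩ := TopologicalSpace.countable_cover_nhds (α := M)
    (f := fun x => (chartAt E x).source ∩ chartAt E x ⁻¹' Metric.ball (chartAt E x x) (R x))
    fun x => ((chartAt E x).isOpen_inter_preimage Metric.isOpen_ball).mem_nhds
      ⟨mem_chart_source E x, Metric.mem_ball_self (hR0 x)⟩
  have hne : s.Nonempty := by
    obtain ⟨x⟩ := hM
    have hx : x ∈ ⋃ y ∈ s, (chartAt E y).source ∩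
      chartAt E y ⁻¹' Metric.ball (chartAt E y y) (R y) := hcov ▸ mem_univ x
    simp only [mem_iUnion] at hx
    obtain ⟨y, hy, -⟩ := hx
    exact ⟨y, hy⟩
  obtain ⟨c, rfl⟩ := hs.exists_eq_range hne
  obtain ⟨N, hN⟩ := exists_admissible w
    (f := fun i (z : ℂ × E) => localRep (chartAt E (c i)) (α z.1) z.2)
    (U := fun i => (chartAt E (c i)).target) (c := fun i => chartAt E (c i) (c i))
    (R := fun i => R (c i)) (fun i => (chartAt E (c i)).open_target) (fun i => hα.2 (c i))
    fun i => hR (c i)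
  refine ⟨N, fun x => ?_⟩
  have hx : x ∈ ⋃ y ∈ range c, (chartAt E y).source ∩
    chartAt E y ⁻¹' Metric.ball (chartAt E y y) (R y) := hcov ▸ mem_univ x
  simp only [mem_iUnion, mem_range, exists_prop, exists_exists_eq_and] at hx
  obtain ⟨i, hx1, hx2⟩ := hx
  exact ⟨c i, hx1, _, Metric.isOpen_ball, hx2, Metric.ball_subset_closedBall.trans (hR (c i)), hN i⟩

section Solution

variable {w : ℤ} {N : ℕ → ℕ} {α : FormFamily E M ℂ j} (hα : α ∈ smoothForms E M upperHalf j)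
  (hN : FormAdmissible w N α)
include hα hN

theorem solForm_mem_smoothForms : solForm w N α ∈ smoothForms E M upperHalf j := by
  refine mem_smoothForms_of_local (fun τ hτ => funext fun x => if_neg hτ) fun x => ?_
  obtain ⟨x₁, hx₁, U, hU, hxU, hsub, hadm⟩ := hN x
  refine ⟨x₁, hx₁, U, hU, hxU, (contDiffOn_sol hU ((hα.2 x₁).mono (prod_mono Subset.rfl hsub))
    hadm).congr fun z hz => localRep_solForm w N α x₁ (hsub hz.2) z.1⟩

theorem dbar_solForm {τ : ℂ} (hτ : τ ∈ upperHalf) (hmod : ∀ γ,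
    α (moebius γ τ) = (cocycle γ τ ^ w * conj (cocycle γ τ) ^ 2) • α τ) (x : M) :
    dbar (fun t => solForm w N α t x) τ = α τ x := by
  obtain ⟨x₁, hx₁, U, hU, hxU, hsub, hadm⟩ := hN x
  have hs := (hα.2 x₁).mono (prod_mono (Subset.refl upperHalf) hsub)
  have h1 := dbar_sol hU hs hadm hτ hxU fun γ => by
    simp only [hmod γ, localRep_apply, Pi.smul_apply, map_smul]
  have h2 : DifferentiableAt ℝ (sol w N fun ζ => localRep (chartAt E x₁) (α ζ)
      (chartAt E x₁ x)) τ :=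
    ((contDiffOn_slice (contDiffOn_sol hU hs hadm) hxU).contDiffAt
      (isOpen_upperHalf.mem_nhds hτ)).differentiableAt (by simp)
  have h3 : (fun t => solForm w N α t x) = fun t => pullAlt E j (chartDeriv (chartAt E x₁) x)
      (sol w N (fun ζ => localRep (chartAt E x₁) (α ζ) (chartAt E x₁ x)) t) := by
    funext t
    rw [← localRep_solForm w N α x₁ (hsub hxU)]
    exact eq_compAlt_localRep x₁ _ hx₁
  rw [h3, dbar_map _ h2, h1]
  exact (eq_compAlt_localRep x₁ (α τ) hx₁).symm

/-- The solution operator preserves closed forms. -/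
theorem extD_solForm_eq_zero (h0 : ∀ τ, extD (α τ) = 0) (τ : ℂ) :
    extD (solForm w N α τ) = 0 := by
  by_cases hτ : τ ∈ upperHalf
  · funext x
    obtain ⟨x₁, hx₁, U, hU, hxU, hsub, hadm⟩ := hN x
    have hs := (hα.2 x₁).mono (prod_mono (Subset.refl upperHalf) hsub)
    set f : ℂ × E → Alt E ℂ j := fun z => localRep (chartAt E x₁) (α z.1) z.2 with hf
    have hpd := contDiffOn_paramDeriv isOpen_upperHalf hU hs
    have h1 : localRep (chartAt E x₁) (solForm w N α τ) =ᶠ[𝓝 (chartAt E x₁ x)] fun y =>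
        sol w N (fun ζ => f (ζ, y)) τ := by
      filter_upwards [hU.mem_nhds hxU] with y hy using localRep_solForm w N α x₁ (hsub hy) τ
    rw [eq_compAlt_localRep x₁ (extD (solForm w N α τ)) hx₁,
      localRep_extD_of_smooth (solForm_mem_smoothForms hα hN) τ x₁ (hsub hxU), h1.extDeriv_eq,
      extDeriv_eq_alternatize, (hasFDerivAt_sol hU hs hadm hτ hxU).fderiv,
      map_sol_eq_zero (alternatize E j) (contDiffOn_slice hpd hxU)
        ((locallySummable_solTerm hU hpd hadm.paramDeriv).summable
          (z := (τ, chartAt E x₁ x)) ⟨hτ, hxU⟩)]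
    · rfl
    · intro ζ _
      have h2 := localRep_extD_of_smooth hα ζ x₁ (hsub hxU)
      rw [h0 ζ, localRep_zero] at h2
      exact h2.symm
  · rw [(solForm_mem_smoothForms hα hN).1 τ hτ, extD_zero]

end Solution

omit [TopologicalSpace M] [ChartedSpace E M] [IsManifold 𝓘(ℝ, E) ∞ M] [FiniteDimensional ℝ E] in
theorem solForm_moebius (w : ℤ) (N : ℕ → ℕ) (α : FormFamily E M ℂ j)
    (γ : Matrix.SpecialLinearGroup (Fin 2) ℤ) {τ : ℂ} (hτ : τ ∈ upperHalf) :
    solForm w N α (moebius γ τ) = cocycle γ τ ^ w • solForm w N α τ :=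
  funext fun _ => sol_moebius _ γ hτ

end DbarForms

/-! ### Integration along the volume -/

section Primitive

theorem contDiffOn_intervalIntegral_param {Y F : Type*} [NormedAddCommGroup Y] [NormedSpace ℝ Y]
    [NormedAddCommGroup F] [NormedSpace ℝ F] [CompleteSpace F] {h : Y → ℝ → F} {O : Set Y}
    (hO : IsOpen O) (hh : ContDiffOn ℝ ∞ (fun q : Y × ℝ => h q.1 q.2) (O ×ˢ univ)) :
    ContDiffOn ℝ ∞ (fun y => ∫ t in (0 : ℝ)..1, h y t) O := by
  -- the integral is the value at `0` of the convolution with an indicator function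
  let b : ContDiffBump (0 : ℝ) := ⟨1, 2, by norm_num, by norm_num⟩
  have hb : ∀ y ∈ O, ∀ t ∉ Metric.closedBall (0 : ℝ) 2, b t • h y t = 0 := fun y _ t ht => by
    rw [b.zero_of_le_dist (not_le.1 ht).le, zero_smul]
  have hg : ContDiffOn ℝ ∞ (Function.uncurry fun y t => b t • h y t) (O ×ˢ univ) :=
    (b.contDiff.comp contDiff_snd).contDiffOn.smul hh
  have hf : LocallyIntegrable (indicator (Icc (-1 : ℝ) 0) fun _ => (1 : ℝ)) volume :=
    ((locallyIntegrable_const (1 : ℝ)).indicator measurableSet_Icc)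
  have key := contDiffOn_convolution_right_with_param_comp (𝕜 := ℝ) (μ := volume) (n := ⊤)
    (ContinuousLinearMap.lsmul ℝ ℝ (E := F)) (contDiffOn_const (c := (0 : ℝ))) hO
    (isCompact_closedBall (0 : ℝ) 2) (fun y t hy => hb y hy t) hf hg
  refine key.congr fun y _ => ?_
  rw [convolution_def]
  have h1 : (fun t : ℝ => ContinuousLinearMap.lsmul ℝ ℝ (indicator (Icc (-1 : ℝ) 0) (fun _ => 1) t)
      (b (0 - t) • h y (0 - t))) = indicator (Icc (-1 : ℝ) 0) fun t => h y (-t) := by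
    funext t
    by_cases ht : t ∈ Icc (-1 : ℝ) 0
    · have : b (-t) = 1 := b.one_of_mem_closedBall (by
        rw [Metric.mem_closedBall, Real.dist_eq, sub_zero, abs_neg, abs_le]
        exact ⟨ht.1, ht.2.trans zero_le_one⟩)
      simp [ht, this]
    · simp [ht]
  rw [h1, integral_indicator measurableSet_Icc, integral_Icc_eq_integral_Ioc,
    ← intervalIntegral.integral_of_le (by norm_num), intervalIntegral.integral_comp_neg]
  simp

theorem contDiffOn_primitive {Y F : Type*} [NormedAddCommGroup Y] [NormedSpace ℝ Y]
    [NormedAddCommGroup F] [NormedSpace ℝ F] [CompleteSpace F] {f : ℝ → Y → F} {O : Set Y}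
    (hO : IsOpen O) (hf : ContDiffOn ℝ ∞ (fun q : ℝ × Y => f q.1 q.2) (Ioi 0 ×ˢ O)) :
    ContDiffOn ℝ ∞ (fun q : ℝ × Y => ∫ s in (1 : ℝ)..q.1, f s q.2) (Ioi 0 ×ˢ O) := by
  have hlog : ContDiffOn ℝ ∞ (fun q : (ℝ × Y) × ℝ => q.2 * Real.log q.1.1)
      ((Ioi 0 ×ˢ O) ×ˢ univ) := by
    refine contDiffOn_snd.mul ((Real.contDiffOn_log.mono (fun x hx => ne_of_gt hx)).comp
      (contDiff_fst.fst).contDiffOn fun q hq => hq.1.1)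
  have hexp := Real.contDiff_exp.comp_contDiffOn hlog
  have h1 := contDiffOn_intervalIntegral_param (isOpen_Ioi.prod hO)
    (h := fun (q : ℝ × Y) t => (Real.exp (t * Real.log q.1) * Real.log q.1) •
      f (Real.exp (t * Real.log q.1)) q.2) (by
    refine (hexp.mul ?_).smul (hf.comp (f := fun q : (ℝ × Y) × ℝ =>
      (Real.exp (q.2 * Real.log q.1.1), q.1.2)) (hexp.prodMk contDiff_fst.snd.contDiffOn)
        fun q hq => ⟨Real.exp_pos _, hq.1.2⟩)
    exact (Real.contDiffOn_log.mono (fun x hx => ne_of_gt hx)).comp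
      (contDiff_fst.fst).contDiffOn fun q hq => hq.1.1)
  refine h1.congr ?_
  -- the substitution `s = v ^ t`
  rintro ⟨v, y⟩ ⟨hv, hy⟩
  have hcont : ContinuousOn (fun s => f s y) (Ioi 0) :=
    hf.continuousOn.comp (f := fun s : ℝ => (s, y)) (by fun_prop) fun s hs => ⟨hs, hy⟩
  have h2 := intervalIntegral.integral_deriv_smul_comp' (a := 0) (b := 1)
    (f := fun t => Real.exp (t * Real.log v)) (f' := fun t => Real.exp
        (t * Real.log v) * Real.log v)
    (g := fun s => f s y) (fun t _ => by
      simpa using ((hasDerivAt_id t).mul_const (Real.log v)).exp) (by fun_prop)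
    (hcont.mono (by rintro _ ⟨t, -, rfl⟩; exact Real.exp_pos _))
  simp only [zero_mul, Real.exp_zero, one_mul, Real.exp_log (show 0 < v from hv)] at h2
  exact h2.symm

end Primitive

theorem isOpen_torSet : IsOpen torSet :=
  (isOpen_lt continuous_const (Complex.continuous_im.comp continuous_fst)).inter
    (isOpen_lt continuous_const continuous_snd)

section VolumePrimitive

variable {E : Type*} [NormedAddCommGroup E] [NormedSpace ℝ E]
  {M : Type*} [TopologicalSpace M] [ChartedSpace E M] {j : ℕ}

/-- The primitive of a family of forms in the second parameter that vanishes at `1`. -/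
noncomputable def primForm (α : FormFamily E M (ℂ × ℝ) j) : FormFamily E M (ℂ × ℝ) j :=
  fun q x => open Classical in if q ∈ torSet then ∫ s in (1 : ℝ)..q.2, α (q.1, s) x else 0

omit [TopologicalSpace M] [ChartedSpace E M] in
theorem primForm_one (α : FormFamily E M (ℂ × ℝ) j) (τ : ℂ) : primForm α (τ, 1) = 0 := by
  funext x
  simp [primForm]

variable [IsManifold 𝓘(ℝ, E) ∞ M]

theorem continuousOn_snd_apply {α : FormFamily E M (ℂ × ℝ) j} (hα : α ∈ smoothForms E M torSet j)
    {τ : ℂ} (hτ : 0 < τ.im) (x : M) : ContinuousOn (fun s => α (τ, s) x) (Ioi 0) :=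
  (contDiffOn_apply hα x).continuousOn.comp (f := fun s : ℝ => (τ, s)) (by fun_prop)
    fun _ hs => ⟨hτ, hs⟩

theorem intervalIntegrable_snd_apply {α : FormFamily E M (ℂ × ℝ) j}
    (hα : α ∈ smoothForms E M torSet j) {τ : ℂ} (hτ : 0 < τ.im) (x : M) {v : ℝ} (hv : 0 < v) :
    IntervalIntegrable (fun s => α (τ, s) x) volume 1 v :=
  ((continuousOn_snd_apply hα hτ x).mono fun _ hs =>
    (lt_min one_pos hv).trans_le hs.1).intervalIntegrable

theorem primForm_mem_smoothForms {α : FormFamily E M (ℂ × ℝ) j}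
    (hα : α ∈ smoothForms E M torSet j) : primForm α ∈ smoothForms E M torSet j := by
  refine ⟨fun q hq => funext fun x => if_neg hq, fun x₀ => ?_⟩
  have hO : IsOpen (upperHalf ×ˢ (chartAt E x₀).target) :=
    isOpen_upperHalf.prod (chartAt E x₀).open_target
  have h1 := contDiffOn_primitive hO
    (f := fun s (z : ℂ × E) => localRep (chartAt E x₀) (α (z.1, s)) z.2)
    ((hα.2 x₀).comp (f := fun q : ℝ × (ℂ × E) => ((q.2.1, q.1), q.2.2)) (by fun_prop)
      fun q hq => ⟨⟨hq.2.1, hq.1⟩, hq.2.2⟩)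
  refine (h1.comp (f := fun q : (ℂ × ℝ) × E => (q.1.2, (q.1.1, q.2))) (by fun_prop)
    fun q hq => ⟨hq.1.2, hq.1.1, hq.2⟩).congr ?_
  rintro ⟨⟨τ, v⟩, y⟩ ⟨⟨hτ, hv⟩, hy⟩
  have h2 : primForm α (τ, v) ((chartAt E x₀).symm y) =
      ∫ s in (1 : ℝ)..v, α (τ, s) ((chartAt E x₀).symm y) := if_pos ⟨hτ, hv⟩
  rw [localRep_apply, h2]
  exact (((pullAlt E j (chartSymmDeriv (chartAt E x₀) y)).restrictScalars
      ℝ).intervalIntegral_comp_comm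
    (intervalIntegrable_snd_apply hα hτ _ hv)).symm

theorem deriv_snd_apply {α : FormFamily E M (ℂ × ℝ) j} (hα : α ∈ smoothForms E M torSet j)
    {q : ℂ × ℝ} (hq : q ∈ torSet) (x : M) :
    HasDerivAt (fun v => α (q.1, v) x) (dirDeriv torSet (fun _ => (0, 1)) α q x) q.2 := by
  have h := (differentiableAt_apply isOpen_torSet hα x hq).hasFDerivAt.comp_hasDerivAt q.2
    ((hasDerivAt_const q.2 q.1).prodMk (hasDerivAt_id q.2))
  rw [dirDeriv, if_pos hq]
  exact h

theorem dirDeriv_primForm {α : FormFamily E M (ℂ × ℝ) j} (hα : α ∈ smoothForms E M torSet j) :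
    dirDeriv torSet (fun _ => (0, 1)) (primForm α) = α := by
  funext q x
  by_cases hq : q ∈ torSet
  · have h1 := deriv_snd_apply (primForm_mem_smoothForms hα) hq x
    have hev : (fun v => primForm α (q.1, v) x) =ᶠ[𝓝 q.2] fun v => ∫ s in (1 : ℝ)..v, α (q.1,
        s) x := by
      filter_upwards [isOpen_Ioi.mem_nhds hq.2] with v hv using if_pos ⟨hq.1, hv⟩
    have hcont := continuousOn_snd_apply hα hq.1 x
    have h2 := intervalIntegral.integral_hasDerivAt_right
      (intervalIntegrable_snd_apply hα hq.1 x hq.2)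
      (hcont.stronglyMeasurableAtFilter isOpen_Ioi _ hq.2)
      (hcont.continuousAt (isOpen_Ioi.mem_nhds hq.2))
    exact h1.unique (h2.congr_of_eventuallyEq hev)
  · rw [dirDeriv, if_neg hq, hα.1 q hq]; rfl

/-- A family of forms is determined by its derivative in the second parameter and by its
restriction to the value `1` of that parameter. -/
theorem eq_of_dirDeriv_eq {α β : FormFamily E M (ℂ × ℝ) j} (hα : α ∈ smoothForms E M torSet j)
    (hβ : β ∈ smoothForms E M torSet j)
    (h : dirDeriv torSet (fun _ => (0, 1)) α = dirDeriv torSet (fun _ => (0, 1)) β)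
    (h1 : ∀ τ ∈ upperHalf, α (τ, 1) = β (τ, 1)) : α = β := by
  funext q x
  by_cases hq : q ∈ torSet
  · have hd := fun {γ : FormFamily E M (ℂ × ℝ) j} (hγ : γ ∈ smoothForms E M torSet j) v
      (hv : v ∈ Ioi (0 : ℝ)) => deriv_snd_apply hγ (q := (q.1, v)) ⟨hq.1, hv⟩ x
    exact isOpen_Ioi.eqOn_of_deriv_eq (f := fun v => α (q.1, v) x) (g := fun v => β (q.1, v) x)
      isPreconnected_Ioi
      (fun v hv => (hd hα v hv).differentiableAt.differentiableWithinAt)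
      (fun v hv => (hd hβ v hv).differentiableAt.differentiableWithinAt)
      (fun v hv => (hd hα v hv).deriv.trans (by rw [h]; exact (hd hβ v hv).deriv.symm))
      (mem_Ioi.2 one_pos) (congrFun (h1 q.1 hq.1) x) hq.2
  · rw [hα.1 q hq, hβ.1 q hq]

end VolumePrimitive

/-! ### Forms with values in modular forms -/

section ModularForms

open Matrix (SpecialLinearGroup)

variable {E : Type*} [NormedAddCommGroup E] [NormedSpace ℝ E]
  {M : Type*} [TopologicalSpace M] [ChartedSpace E M] {j : ℕ}

variable (E) in
/-- Evaluation of alternating forms on vectors, as a complex linear map. -/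
noncomputable def evalAlt (v : Fin j → E) : Alt E ℂ j →L[ℂ] ℂ where
  toFun β := β v
  map_add' _ _ := rfl
  map_smul' _ _ := rfl
  cont := (ContinuousAlternatingMap.apply ℝ E ℂ v).cont

theorem dbar_eq_zero_of_holomorphic {f : ℂ → ℂ} {τ : ℂ} (hf : DifferentiableAt ℂ f τ) :
    dbar f τ = 0 := by
  rw [dbar_eq_zero_iff, (hf.hasFDerivAt.restrictScalars ℝ).fderiv]
  simp only [ContinuousLinearMap.coe_restrictScalars']
  rw [← map_smul, smul_eq_mul, mul_one]

theorem moebius_one_smul (q : ℂ × ℝ) :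
    (moebius 1 q.1, ‖cocycle 1 q.1‖ * q.2) = q := by
  rw [moebius_one, cocycle_one, norm_one, one_mul]

theorem moebius_smul_mem (γ : SpecialLinearGroup (Fin 2) ℤ) {q : ℂ × ℝ} (hq : q ∈ torSet) :
    (moebius γ q.1, ‖cocycle γ q.1‖ * q.2) ∈ torSet :=
  ⟨moebius_mem γ hq.1, mul_pos (norm_pos_iff.2 (cocycle_ne_zero γ hq.1)) hq.2⟩

theorem exists_sq_eq (z : ℂ) : ∃ ε : ℂ, ε ^ 2 = z :=
  IsAlgClosed.exists_pow_nat_eq z two_pos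

theorem zpow_neg_of_even {ε J : ℂ} (h : ε ^ 2 = J) {k : ℤ} (hk : Even k) :
    ε ^ (-k) = J ^ (-(k / 2)) := by
  obtain ⟨m, rfl⟩ := hk
  rw [← h, ← zpow_natCast, ← zpow_mul, show (m + m) / 2 = m by omega]
  congr 1
  push_cast; ring

/-- A form-valued function on the upper half plane transforms like a modular form of weight
`(w, m)`. -/
def Transforms (w : ℤ) (m : ℕ) (α : FormFamily E M ℂ j) : Prop :=
  ∀ τ ∈ upperHalf, ∀ γ, α (moebius γ τ) = (cocycle γ τ ^ w * conj (cocycle γ τ) ^ m) • α τ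

section Smooth
variable [IsManifold 𝓘(ℝ, E) ∞ M]

/-- Values in modular forms, as conditions on the form itself instead of its values on tangent
vectors. -/
theorem mem_formsIn_mf_iff {k l : ℤ} {α : FormFamily E M (ℂ × ℝ) j} :
    α ∈ formsIn E M torSet (mf k l) j ↔ α ∈ smoothForms E M torSet j ∧
      ∀ q ∈ torSet, ∀ (γ : SpecialLinearGroup (Fin 2) ℤ) (ε : ℂ), ε ^ 2 = cocycle γ q.1 →
        α (moebius γ q.1, ‖cocycle γ q.1‖ * q.2) = (ε ^ (-k) * conj ε ^ (-l)) • α q := by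
  refine ⟨fun h => ⟨h.1, fun q hq γ ε hε => ?_⟩, fun h => ⟨h.1, fun x v => ⟨fun q hq => ?_, ?_,
    fun q hq γ ε hε => ?_⟩⟩⟩
  · funext x
    ext v
    exact (h.2 x v).2.2 q hq γ ε hε
  · exact congrArg (fun β : FormField E M j => β x v) (h.1.1 q hq)
  · exact (ContinuousAlternatingMap.apply ℝ E ℂ v).contDiff.comp_contDiffOn (contDiffOn_apply h.1 x)
  · exact congrArg (fun β : FormField E M j => β x v) (h.2 q hq γ ε hε)

/-- There are no nonzero forms with values in modular forms of odd weight. -/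
theorem eq_zero_of_odd {k l : ℤ} (hk : Odd k) (hl : Even l) {α : FormFamily E M (ℂ × ℝ) j}
    (hα : α ∈ formsIn E M torSet (mf k l) j) : α = 0 := by
  rw [mem_formsIn_mf_iff] at hα
  funext q x
  by_cases hq : q ∈ torSet
  · -- both square roots `1` and `-1` of the automorphy factor of the identity matrix are allowed
    have h := hα.2 q hq 1 (-1) (by rw [cocycle_one]; norm_num)
    rw [moebius_one_smul, hk.neg.neg_one_zpow, map_neg, map_one, hl.neg.neg_one_zpow] at h
    rw [mul_one, neg_smul, one_smul] at h
    ext v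
    exact self_eq_neg.1 (congrArg (fun β : FormField E M j => β x v) h)
  · rw [hα.1.1 q hq]; rfl

/-- Values in weak modular forms, as conditions on the form itself instead of its values on tangent
vectors. -/
theorem mem_formsIn_MFgraded_iff {k : ℤ} {α : FormFamily E M ℂ j} :
    α ∈ formsIn E M upperHalf (MFgraded k) j ↔ α ∈ smoothForms E M upperHalf j ∧
      (∀ τ ∈ upperHalf, ∀ x, dbar (fun t => α t x) τ = 0) ∧ Transforms (-(k / 2)) 0 α ∧
      (Odd k → α = 0) := by
  have hd : α ∈ smoothForms E M upperHalf j → ∀ τ ∈ upperHalf, ∀ x,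
      DifferentiableAt ℝ (fun t => α t x) τ := fun h τ hτ x =>
    differentiableAt_apply isOpen_upperHalf h x hτ
  rcases Int.even_or_odd k with hk | hk
  · rw [MFgraded, if_pos hk]
    refine ⟨fun h => ⟨h.1, fun τ hτ x => ?_, fun τ hτ γ => ?_,
      fun h' => absurd hk (Int.not_even_iff_odd.2 h')⟩, fun h => ⟨h.1, fun x v => ⟨fun τ hτ => ?_,
      fun τ hτ => ?_, fun τ hτ γ => ?_⟩⟩⟩
    · ext v
      have h1 := dbar_map (evalAlt E v) (hd h.1 τ hτ x)
      refine h1.symm.trans ?_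
      exact dbar_eq_zero_of_holomorphic
        (((h.2 x v).2.1 τ hτ).differentiableAt (isOpen_upperHalf.mem_nhds hτ))
    · funext x
      ext v
      rw [pow_zero, mul_one]
      exact (h.2 x v).2.2 τ hτ γ
    · exact congrArg (fun β : FormField E M j => β x v) (h.1.1 τ hτ)
    · have h1 := dbar_map (evalAlt E v) (hd h.1 τ hτ x)
      rw [h.2.1 τ hτ x, map_zero, dbar_eq_zero_iff] at h1
      exact (differentiableAt_complex_of_real
        (((evalAlt E v).restrictScalars ℝ).differentiableAt.comp τ
          (hd h.1 τ hτ x)) h1).1.differentiableWithinAt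
    · have h1 := h.2.2.1 τ hτ γ
      rw [pow_zero, mul_one] at h1
      exact congrArg (fun β : FormField E M j => β x v) h1
  · rw [MFgraded, if_neg (Int.not_even_iff_odd.2 hk)]
    refine ⟨fun h => ?_, fun h => ?_⟩
    · have h0 : α = 0 := by
        funext τ x
        ext v
        exact congrFun ((Submodule.mem_bot ℂ).1 (h.2 x v)) τ
      subst h0
      exact ⟨h.1, fun τ _ x => by simp [dbar], fun τ _ γ => by simp, fun _ => rfl⟩
    · rw [h.2.2.2 hk]; exact zero_mem _

/-! ### The Wirtinger derivative of families of forms -/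

/-- The Wirtinger derivative along the upper half plane. -/
noncomputable def dbarForm (α : FormFamily E M ℂ j) : FormFamily E M ℂ j :=
  fun τ x => open Classical in if τ ∈ upperHalf then dbar (fun t => α t x) τ else 0

omit [IsManifold 𝓘(ℝ, E) ∞ M] [TopologicalSpace M] [ChartedSpace E M] in
theorem dbarForm_eq (α : FormFamily E M ℂ j) : dbarForm α =
    (1 / 2 : ℂ) • (dirDeriv upperHalf (fun _ => 1) α +
      Complex.I • dirDeriv upperHalf (fun _ => Complex.I) α) := by
  funext τ x
  by_cases hτ : τ ∈ upperHalf
  · simp only [dbarForm, if_pos hτ, dbar, Pi.smul_apply, Pi.add_apply, dirDeriv]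
  · simp [dbarForm, dirDeriv, hτ]

theorem dbarForm_mem_smoothForms {α : FormFamily E M ℂ j} (hα : α ∈ smoothForms E M upperHalf j) :
    dbarForm α ∈ smoothForms E M upperHalf j := by
  rw [dbarForm_eq]
  exact Submodule.smul_mem _ _ (add_mem (dirDeriv_mem_smoothForms isOpen_upperHalf contDiffOn_const
      hα)
    (Submodule.smul_mem _ _ (dirDeriv_mem_smoothForms isOpen_upperHalf contDiffOn_const hα)))

theorem extD_dbarForm {α : FormFamily E M ℂ j} (hα : α ∈ smoothForms E M upperHalf j) (τ : ℂ) :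
    extD (dbarForm α τ) = dbarForm (fun τ => extD (α τ)) τ := by
  have h1 := dirDeriv_mem_smoothForms isOpen_upperHalf (ξ := fun _ => 1) contDiffOn_const hα
  have h2 := dirDeriv_mem_smoothForms isOpen_upperHalf (ξ := fun _ => Complex.I) contDiffOn_const hα
  have d := fun {β : FormFamily E M ℂ j} (hβ : β ∈ smoothForms E M upperHalf j) x =>
    differentiableAt_localRep hβ τ x
  have h3 := Submodule.smul_mem _ Complex.I h2
  rw [dbarForm_eq, dbarForm_eq]
  simp only [Pi.smul_apply, Pi.add_apply]
  rw [extD_smul (α := _ + Complex.I • _) _ (d (add_mem h1 h3)), extD_add (β := Complex.I • _)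
      (d h1) (d h3),
    extD_smul _ (d h2), extD_dirDeriv isOpen_upperHalf _ hα, extD_dirDeriv isOpen_upperHalf _ hα]

/-- The Wirtinger derivative of a form of weight `w` has weight `(w, 2)`. -/
theorem Transforms.dbarForm {w : ℤ} {α : FormFamily E M ℂ j}
    (hα : α ∈ smoothForms E M upperHalf j) (h : Transforms w 0 α) :
    Transforms w 2 (dbarForm α) := by
  intro τ hτ γ
  funext x
  have hγ := moebius_mem γ hτ
  have hJ := cocycle_ne_zero γ hτ
  have h1 := dbar_comp_holomorphic (hasDerivAt_moebius γ hτ)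
    (differentiableAt_apply isOpen_upperHalf hα x hγ)
  have h2 : (fun t => α (moebius γ t) x) =ᶠ[𝓝 τ] fun t => cocycle γ t ^ w • α t x := by
    filter_upwards [isOpen_upperHalf.mem_nhds hτ] with t ht
    rw [h t ht γ, pow_zero, mul_one]; rfl
  have h3 : DifferentiableAt ℂ (fun t => cocycle γ t ^ w) τ :=
    (by unfold cocycle; fun_prop : DifferentiableAt ℂ (cocycle γ) τ).zpow (Or.inl hJ)
  rw [dbar_congr h2, dbar_smul_of_holomorphic h3 (differentiableAt_apply isOpen_upperHalf hα x hτ)]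
    at h1
  simp only [SuperTori.dbarForm, if_pos hτ, if_pos hγ, Pi.smul_apply]
  rw [mul_comm, mul_smul, h1, smul_smul, map_inv₀, map_pow, mul_inv_cancel₀ (by simpa using hJ),
    one_smul]

end Smooth

end ModularForms

/-! ### The volume as a coordinate -/

section VolumeCoordinate

open Matrix (SpecialLinearGroup)

/-- The change of parameters from `(τ, ℓ)` to `(τ, v)`, with `v = ℓ² Im τ` the volume. -/
def toVol (q : ℂ × ℝ) : ℂ × ℝ := (q.1, q.2 ^ 2 * q.1.im)

/-- The change of parameters from `(τ, v)` to `(τ, ℓ)`. -/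
noncomputable def ofVol (q : ℂ × ℝ) : ℂ × ℝ := (q.1, √(q.2 / q.1.im))

theorem toVol_mem {q : ℂ × ℝ} (hq : q ∈ torSet) : toVol q ∈ torSet :=
  ⟨hq.1, mul_pos (pow_pos hq.2 2) hq.1⟩

theorem ofVol_mem {q : ℂ × ℝ} (hq : q ∈ torSet) : ofVol q ∈ torSet :=
  ⟨hq.1, Real.sqrt_pos.2 (div_pos hq.2 hq.1)⟩

theorem mem_torSet_one {τ : ℂ} (hτ : τ ∈ upperHalf) : (τ, (1 : ℝ)) ∈ torSet := ⟨hτ, one_pos⟩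

theorem ofVol_toVol {q : ℂ × ℝ} (hq : q ∈ torSet) : ofVol (toVol q) = q := by
  have h1 : 0 < q.1.im := hq.1
  refine Prod.ext rfl ?_
  simp only [ofVol, toVol]
  rw [mul_div_cancel_right₀ _ h1.ne', Real.sqrt_sq hq.2.le]

theorem toVol_ofVol {q : ℂ × ℝ} (hq : q ∈ torSet) : toVol (ofVol q) = q := by
  have h1 : 0 < q.1.im := hq.1
  refine Prod.ext rfl ?_
  simp only [ofVol, toVol]
  rw [Real.sq_sqrt (div_pos hq.2 h1).le, div_mul_cancel₀ _ h1.ne']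

theorem contDiff_toVol : ContDiff ℝ ∞ toVol :=
  contDiff_fst.prodMk ((contDiff_snd.pow 2).mul (Complex.imCLM.contDiff.comp contDiff_fst))

theorem contDiffOn_ofVol : ContDiffOn ℝ ∞ ofVol torSet := by
  refine contDiffOn_fst.prodMk (ContDiffOn.sqrt ?_ fun q hq => (div_pos hq.2 hq.1).ne')
  exact contDiffOn_snd.div (Complex.imCLM.contDiff.comp contDiff_fst).contDiffOn
    fun q hq => (show 0 < q.1.im from hq.1).ne'

theorem contDiffOn_ofVol_one : ContDiffOn ℝ ∞ (fun τ : ℂ => ofVol (τ, 1)) upperHalf :=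
  contDiffOn_ofVol.comp (f := fun τ : ℂ => (τ, (1 : ℝ))) (by fun_prop) fun _ hτ => mem_torSet_one hτ

theorem toVol_moebius (γ : SpecialLinearGroup (Fin 2) ℤ) {q : ℂ × ℝ} (hq : q ∈ torSet) :
    toVol (moebius γ q.1, ‖cocycle γ q.1‖ * q.2) = (moebius γ q.1, (toVol q).2) := by
  have h0 := norm_pos_iff.2 (cocycle_ne_zero γ hq.1)
  refine Prod.ext rfl ?_
  simp only [toVol, moebius_im, Complex.normSq_eq_norm_sq]
  field_simp

theorem ofVol_moebius (γ : SpecialLinearGroup (Fin 2) ℤ) {q : ℂ × ℝ} (hq : q ∈ torSet) :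
    ofVol (moebius γ q.1, q.2) = (moebius γ q.1, ‖cocycle γ q.1‖ * (ofVol q).2) := by
  have h := toVol_moebius γ (ofVol_mem hq)
  rw [toVol_ofVol hq] at h
  have h2 := ofVol_toVol (moebius_smul_mem γ (ofVol_mem hq))
  rw [h] at h2
  exact h2

end VolumeCoordinate

/-! ### Operations on inhomogeneous families -/

section TotalOperations

variable {E : Type*} [NormedAddCommGroup E] [NormedSpace ℝ E]
  {M : Type*} [TopologicalSpace M] [ChartedSpace E M]
  {V : Type*} [NormedAddCommGroup V] [NormedSpace ℝ V]
  {V' : Type*} [NormedAddCommGroup V'] [NormedSpace ℝ V'] {P : Set V} {P' : Set V'}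

theorem mem_totalForms_top {T : TotalFamily E M V} (hT : ∀ j, T j ∈ smoothForms E M P j) (n : ℤ) :
    T ∈ totalForms E M P (fun _ => ⊤) n := fun j => ⟨hT j, fun _ _ => Submodule.mem_top⟩

theorem dTotal_sub {T S : TotalFamily E M V} (hT : ∀ j, T j ∈ smoothForms E M P j)
    (hS : ∀ j, S j ∈ smoothForms E M P j) : dTotal (T - S) = dTotal T - dTotal S := by
  have h1 := mem_totalForms_top hT 0
  have h2 := mem_totalForms_top hS 0
  have h3 := dTotal_add (sub_mem h1 h2) h2
  rw [sub_add_cancel] at h3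
  exact eq_sub_of_add_eq h3.symm

omit [NormedAddCommGroup V'] [NormedSpace ℝ V'] in
theorem dTotal_reparam {c : V' → ℂ} {φ : V' → V} {T : TotalFamily E M V}
    (hT : ∀ j, T j ∈ smoothForms E M P j) :
    dTotal (fun j => reparam P' c φ (T j)) = fun j => reparam P' c φ (dTotal T j) := by
  funext j p
  cases j with
  | zero => funext x; simp [dTotal, reparam]
  | succ j => exact extD_reparam (hT j) p

variable [IsManifold 𝓘(ℝ, E) ∞ M]

theorem dTotal_mem_smoothForms (hP : IsOpen P) {T : TotalFamily E M V}
    (hT : ∀ j, T j ∈ smoothForms E M P j) (j : ℕ) : dTotal T j ∈ smoothForms E M P j := by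
  cases j with
  | zero => exact zero_mem _
  | succ j => exact extD_mem_smoothForms hP (hT j)

theorem dTotal_dTotal {T : TotalFamily E M V} (hT : ∀ j, T j ∈ smoothForms E M P j) :
    dTotal (dTotal T) = 0 := by
  funext j p
  cases j with
  | zero => rfl
  | succ j =>
    cases j with
    | zero => exact extD_zero
    | succ j => exact extD_extD (hT j) p

theorem dTotal_dirDeriv (hP : IsOpen P) (ξ : V → V) {T : TotalFamily E M V}
    (hT : ∀ j, T j ∈ smoothForms E M P j) :
    dTotal (fun j => dirDeriv P ξ (T j)) = fun j => dirDeriv P ξ (dTotal T j) := by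
  funext j p
  cases j with
  | zero => funext x; simp [dTotal, dirDeriv]
  | succ j => exact extD_dirDeriv hP ξ (hT j) p

theorem dTotal_dbarForm {T : TotalFamily E M ℂ} (hT : ∀ j, T j ∈ smoothForms E M upperHalf j) :
    dTotal (fun j => dbarForm (T j)) = fun j => dbarForm (dTotal T j) := by
  funext j p
  cases j with
  | zero => funext x; simp [dTotal, dbarForm, dbar]
  | succ j => exact extD_dbarForm (hT j) p

theorem dirDeriv_add (hP : IsOpen P) (ξ : V → V) {j : ℕ} {α β : FormFamily E M V j}
    (hα : α ∈ smoothForms E M P j) (hβ : β ∈ smoothForms E M P j) :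
    dirDeriv P ξ (α + β) = dirDeriv P ξ α + dirDeriv P ξ β := by
  funext p x
  by_cases hp : p ∈ P
  · have h := fderiv_fun_add (differentiableAt_apply hP hα x hp) (differentiableAt_apply hP hβ x hp)
    simp only [dirDeriv, if_pos hp, Pi.add_apply]
    rw [h]; rfl
  · simp [dirDeriv, hp]

end TotalOperations

/-! ### Restriction to unit volume -/

section UnitVolume

open Matrix (SpecialLinearGroup)

variable {E : Type*} [NormedAddCommGroup E] [NormedSpace ℝ E]
  {M : Type*} [TopologicalSpace M] [ChartedSpace E M] {j : ℕ}

/-- A family of forms, as a function of `(τ, v)`. -/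
noncomputable def volForm (α : FormFamily E M (ℂ × ℝ) j) : FormFamily E M (ℂ × ℝ) j :=
  reparam torSet (fun _ => 1) ofVol α

/-- The restriction of a family of forms to lattices of volume `1`. -/
noncomputable def unitVol (α : FormFamily E M (ℂ × ℝ) j) : FormFamily E M ℂ j :=
  reparam upperHalf (fun _ => 1) (fun τ => ofVol (τ, 1)) α

omit [TopologicalSpace M] [ChartedSpace E M] in
theorem volForm_eq (α : FormFamily E M (ℂ × ℝ) j) {q : ℂ × ℝ} (hq : q ∈ torSet) :
    volForm α q = α (ofVol q) := by rw [volForm, reparam_eq _ _ _ hq, one_smul]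

omit [TopologicalSpace M] [ChartedSpace E M] in
theorem unitVol_eq (α : FormFamily E M (ℂ × ℝ) j) {τ : ℂ} (hτ : τ ∈ upperHalf) :
    unitVol α τ = α (ofVol (τ, 1)) := by rw [unitVol, reparam_eq _ _ _ hτ, one_smul]

omit [TopologicalSpace M] [ChartedSpace E M] in
theorem pullTau_eq (W : TotalFamily E M ℂ) :
    pullTau W = fun j => reparam torSet (fun _ => 1) Prod.fst (W j) := by
  funext j q x
  by_cases hq : q ∈ torSet
  · simp [pullTau, reparam, hq]
  · simp [pullTau, reparam, hq]

omit [TopologicalSpace M] [ChartedSpace E M] in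
theorem pullTau_of_mem (W : TotalFamily E M ℂ) (j : ℕ) {q : ℂ × ℝ} (hq : q ∈ torSet) :
    pullTau W j q = W j q.1 := if_pos hq

theorem volForm_mem_smoothForms {α : FormFamily E M (ℂ × ℝ) j}
    (hα : α ∈ smoothForms E M torSet j) : volForm α ∈ smoothForms E M torSet j :=
  reparam_mem_smoothForms hα contDiffOn_const contDiffOn_ofVol fun _ hq => ofVol_mem hq

theorem unitVol_mem_smoothForms {α : FormFamily E M (ℂ × ℝ) j}
    (hα : α ∈ smoothForms E M torSet j) : unitVol α ∈ smoothForms E M upperHalf j :=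
  reparam_mem_smoothForms hα contDiffOn_const contDiffOn_ofVol_one
    fun _ hτ => ofVol_mem (mem_torSet_one hτ)

theorem pullTau_mem_smoothForms {W : TotalFamily E M ℂ} (hW : W j ∈ smoothForms E M upperHalf j) :
    pullTau W j ∈ smoothForms E M torSet j := by
  rw [pullTau_eq]
  exact reparam_mem_smoothForms hW contDiffOn_const contDiffOn_fst fun _ hq => hq.1

theorem unitVol_pullTau {W : TotalFamily E M ℂ} (hW : W j ∈ smoothForms E M upperHalf j) :
    unitVol (pullTau W j) = W j := by
  funext τ
  by_cases hτ : τ ∈ upperHalf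
  · rw [unitVol_eq _ hτ, pullTau_of_mem _ _ (ofVol_mem (mem_torSet_one hτ))]
    rfl
  · rw [unitVol, reparam_eq_zero _ _ _ hτ, hW.1 τ hτ]

variable [IsManifold 𝓘(ℝ, E) ∞ M]

theorem unitVol_transforms {k l : ℤ} {m : ℕ} (hk : Even k) (hl : l = -(2 * m))
    {α : FormFamily E M (ℂ × ℝ) j} (hα : α ∈ formsIn E M torSet (mf k l) j) :
    Transforms (-(k / 2)) m (unitVol α) := by
  intro τ hτ γ
  obtain ⟨ε, hε⟩ := exists_sq_eq (cocycle γ τ)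
  have h := (mem_formsIn_mf_iff.1 hα).2 (ofVol (τ, 1)) (ofVol_mem (mem_torSet_one hτ)) γ ε hε
  rw [unitVol_eq _ hτ, unitVol_eq _ (moebius_mem γ hτ)]
  have h1 := ofVol_moebius γ (mem_torSet_one hτ)
  rw [h1]
  refine h.trans ?_
  rw [zpow_neg_of_even hε hk, hl, neg_neg, ← hε, map_pow, ← pow_mul, ← zpow_natCast]
  push_cast
  rfl

theorem pullTau_mem_formsIn {k : ℤ} {W : TotalFamily E M ℂ}
    (hW : W j ∈ smoothForms E M upperHalf j) (htr : Transforms (-(k / 2)) 0 (W j))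
    (hodd : Odd k → W j = 0) : pullTau W j ∈ formsIn E M torSet (mf k 0) j := by
  rw [mem_formsIn_mf_iff]
  refine ⟨pullTau_mem_smoothForms hW, fun q hq γ ε hε => ?_⟩
  rw [pullTau_of_mem _ _ hq, pullTau_of_mem _ _ (moebius_smul_mem γ hq)]
  rcases Int.even_or_odd k with hk | hk
  · rw [htr q.1 hq.1 γ, zpow_neg_of_even hε hk, pow_zero, neg_zero, zpow_zero]
  · rw [hodd hk]; simp

theorem volForm_dVol {Z : TotalFamily E M (ℂ × ℝ)} (hZ : Z j ∈ smoothForms E M torSet j) :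
    volForm (dVol Z j) = dirDeriv torSet (fun _ => (0, 1)) (volForm (Z j)) := by
  funext q x
  by_cases hq : q ∈ torSet
  · have h1 := deriv_snd_apply (volForm_mem_smoothForms hZ) hq x
    rw [volForm_eq _ hq, dVol, if_pos (ofVol_mem hq), ← h1.deriv]
    have h2 : (ofVol q).2 ^ 2 * (ofVol q).1.im = q.2 := congrArg Prod.snd (toVol_ofVol hq)
    rw [h2]
    refine Filter.EventuallyEq.deriv_eq ?_
    filter_upwards [isOpen_Ioi.mem_nhds hq.2] with v hv
    rw [volForm_eq _ (show (q.1, v) ∈ torSet from ⟨hq.1, hv⟩)]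
    rfl
  · simp [volForm, reparam, dirDeriv, hq]

omit [IsManifold 𝓘(ℝ, E) ∞ M] in
omit [TopologicalSpace M] [ChartedSpace E M] in
theorem unitVol_dTauBar {Z : TotalFamily E M (ℂ × ℝ)} :
    unitVol (dTauBar Z j) = dbarForm (unitVol (Z j)) := by
  funext τ x
  by_cases hτ : τ ∈ upperHalf
  · have hq := mem_torSet_one hτ
    rw [unitVol_eq _ hτ, dTauBar, if_pos (ofVol_mem hq), dbarForm, if_pos hτ]
    have h2 : (ofVol (τ, 1)).2 ^ 2 * (ofVol (τ, 1)).1.im = 1 := congrArg Prod.snd (toVol_ofVol hq)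
    rw [h2]
    refine dbar_congr ?_
    filter_upwards [isOpen_upperHalf.mem_nhds hτ] with t ht
    rw [unitVol_eq _ ht]
    rfl
  · simp [unitVol, reparam, dbarForm, hτ]

/-- The primitive of `Z_v` in the volume, as a function of `(τ, ℓ)`. -/
noncomputable def volPrim (α : FormFamily E M (ℂ × ℝ) j) : FormFamily E M (ℂ × ℝ) j :=
  reparam torSet (fun _ => 1) toVol (primForm (volForm α))

theorem volPrim_mem_formsIn {k l : ℤ} {α : FormFamily E M (ℂ × ℝ) j}
    (hα : α ∈ formsIn E M torSet (mf k l) j) : volPrim α ∈ formsIn E M torSet (mf k l) j := by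
  rw [mem_formsIn_mf_iff] at hα ⊢
  refine ⟨reparam_mem_smoothForms (primForm_mem_smoothForms (volForm_mem_smoothForms hα.1))
    contDiffOn_const contDiff_toVol.contDiffOn fun _ hq => toVol_mem hq, fun q hq γ ε hε => ?_⟩
  have hγ := moebius_smul_mem γ hq
  rw [volPrim, reparam_eq _ _ _ hq, reparam_eq _ _ _ hγ, one_smul, one_smul, toVol_moebius γ hq]
  funext x
  have h2 : (moebius γ q.1, (toVol q).2) ∈ torSet := ⟨hγ.1, (toVol_mem hq).2⟩
  rw [Pi.smul_apply, primForm, if_pos h2, primForm, if_pos (toVol_mem hq),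
    ← intervalIntegral.integral_smul]
  refine intervalIntegral.integral_congr fun s hs => ?_
  have hs0 : 0 < s := (lt_min one_pos (toVol_mem hq).2).trans_le hs.1
  have hqs : (q.1, s) ∈ torSet := ⟨hq.1, hs0⟩
  have hqs' : (moebius γ q.1, s) ∈ torSet := ⟨hγ.1, hs0⟩
  have h3 := hα.2 (ofVol (q.1, s)) (ofVol_mem hqs) γ ε hε
  have h4 := ofVol_moebius γ hqs
  change volForm α (moebius γ q.1, s) x = (ε ^ (-k) * conj ε ^ (-l)) • volForm α (q.1, s) x
  rw [volForm_eq _ hqs, volForm_eq _ hqs', h4]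
  exact congrFun h3 x

/-- If `∂_v Z = dZ_v`, then `Z` differs from the pullback of its restriction to unit volume by an
exact form. -/
theorem eq_pullTau_unitVol_add {Z Zv : TotalFamily E M (ℂ × ℝ)}
    (hZ : ∀ j, Z j ∈ smoothForms E M torSet j) (hZv : ∀ j, Zv j ∈ smoothForms E M torSet j)
    (h : dVol Z = dTotal Zv) :
    Z = pullTau (fun j => unitVol (Z j)) + dTotal fun j => volPrim (Zv j) := by
  have hvol := fun j => volForm_mem_smoothForms (hZv j)
  have hprim := fun j => primForm_mem_smoothForms (hvol j)
  have hd := dTotal_mem_smoothForms isOpen_torSet hprim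
  have hpull := fun j => pullTau_mem_smoothForms (W := fun j => unitVol (Z j))
    (unitVol_mem_smoothForms (hZ j))
  have key : ∀ j, volForm (Z j) = pullTau (fun j => unitVol (Z j)) j +
      dTotal (fun j => primForm (volForm (Zv j))) j := by
    intro j
    refine eq_of_dirDeriv_eq (volForm_mem_smoothForms (hZ j)) (add_mem (hpull j) (hd j)) ?_ ?_
    · rw [dirDeriv_add isOpen_torSet _ (hpull j) (hd j)]
      have h1 : dirDeriv torSet (fun _ => (0, 1)) (pullTau (fun j => unitVol (Z j)) j) = 0 := by
        funext q x
        by_cases hq : q ∈ torSet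
        · have h2 := deriv_snd_apply (hpull j) hq x
          refine h2.unique ((hasDerivAt_const q.2
            (unitVol (Z j) q.1 x)).congr_of_eventuallyEq ?_)
          filter_upwards [isOpen_Ioi.mem_nhds hq.2] with v hv
          rw [pullTau_of_mem _ _ (show (q.1, v) ∈ torSet from ⟨hq.1, hv⟩)]
        · simp [dirDeriv, hq]
      have h2 := congrFun (dTotal_dirDeriv isOpen_torSet (fun _ => ((0 : ℂ), (1 : ℝ))) hprim) j
      simp only [dirDeriv_primForm (hvol _)] at h2
      have h3 := congrFun (dTotal_reparam (P' := torSet) (c := fun _ => 1) (φ := ofVol) hZv) j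
      rw [h1, zero_add, ← h2, ← volForm_dVol (hZ j), h]
      exact h3.symm
    · intro τ hτ
      have h4 : dTotal (fun j => primForm (volForm (Zv j))) j (τ, 1) = 0 := by
        cases j with
        | zero => rfl
        | succ j => simp only [dTotal, primForm_one, extD_zero]
      rw [Pi.add_apply, h4, add_zero, volForm_eq _ (mem_torSet_one hτ), 
        pullTau_of_mem _ _ (mem_torSet_one hτ), unitVol_eq _ hτ]
  funext j q
  by_cases hq : q ∈ torSet
  · have h1 := congrFun (key j) (toVol q)
    have h2 := congrFun (dTotal_reparam (P' := torSet) (c := fun _ => 1) (φ := toVol) hprim) j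
    rw [volForm_eq _ (toVol_mem hq), ofVol_toVol hq] at h1
    rw [h1, Pi.add_apply, Pi.add_apply, Pi.add_apply, 
      pullTau_of_mem _ _ (toVol_mem hq), pullTau_of_mem _ _ hq]
    congr 1
    refine Eq.trans ?_ (congrFun h2 q).symm
    rw [reparam_eq _ _ _ hq, one_smul]
  · have h1 := hZ j
    have h2 := dTotal_mem_smoothForms (T := fun j => volPrim (Zv j)) isOpen_torSet
      (fun j => reparam_mem_smoothForms (hprim j) contDiffOn_const contDiff_toVol.contDiffOn
        fun _ hq => toVol_mem hq) j
    rw [h1.1 q hq, Pi.add_apply, Pi.add_apply, (hpull j).1 q hq, h2.1 q hq, add_zero]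

end UnitVolume

/-! ### The holomorphic representative -/

section HolomorphicRepresentative

universe u v
variable {E : Type u} [NormedAddCommGroup E] [NormedSpace ℝ E] [FiniteDimensional ℝ E]
  {M : Type v} [TopologicalSpace M] [ChartedSpace E M] [IsManifold 𝓘(ℝ, E) ∞ M]
  [SecondCountableTopology M]

omit [FiniteDimensional ℝ E] [SecondCountableTopology M] in
theorem dbarForm_sub {j : ℕ} {α β : FormFamily E M ℂ j} (hα : α ∈ smoothForms E M upperHalf j)
    (hβ : β ∈ smoothForms E M upperHalf j) : dbarForm (α - β) = dbarForm α - dbarForm β := by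
  funext τ x
  by_cases hτ : τ ∈ upperHalf
  · have h1 := fderiv_fun_sub (differentiableAt_apply isOpen_upperHalf hα x hτ)
      (differentiableAt_apply isOpen_upperHalf hβ x hτ)
    simp only [dbarForm, if_pos hτ, dbar, Pi.sub_apply]
    rw [h1]
    simp only [sub_apply, smul_sub, smul_add]
    abel
  · simp [dbarForm, hτ]

omit [FiniteDimensional ℝ E] [TopologicalSpace M] [ChartedSpace E M] [IsManifold 𝓘(ℝ,
  E) ∞ M] [SecondCountableTopology M] in
theorem Transforms.sub {j : ℕ} {w : ℤ} {m : ℕ} {α β : FormFamily E M ℂ j} (hα : Transforms w m α)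
    (hβ : Transforms w m β) : Transforms w m (α - β) := fun τ hτ γ => by
  rw [Pi.sub_apply, Pi.sub_apply, hα τ hτ γ, hβ τ hτ γ, smul_sub]

/-- The `∂/∂τ̄`-equation can be solved for forms that transform with weight `(w, 2)`, compatibly
with the exterior derivative along `M`. -/
theorem exists_dbarForm_eq (w : ℤ) {j : ℕ} {S : FormFamily E M ℂ j}
    (hS : S ∈ smoothForms E M upperHalf j) (htr : Transforms w 2 S) :
    ∃ T ∈ smoothForms E M upperHalf j, Transforms w 0 T ∧ dbarForm T = S ∧
      ((∀ τ, extD (S τ) = 0) → ∀ τ, extD (T τ) = 0) ∧ (S = 0 → T = 0) := by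
  by_cases h0 : S = 0
  · refine ⟨0, zero_mem _, fun τ _ γ => by simp, ?_, fun _ _ => extD_zero, fun _ => rfl⟩
    rw [h0]
    funext τ x
    simp [dbarForm, dbar]
  · obtain ⟨N, hN⟩ := exists_formAdmissible w hS
    refine ⟨solForm w N S, solForm_mem_smoothForms hS hN, fun τ hτ γ => ?_, ?_,
      fun h => extD_solForm_eq_zero hS hN h, fun h => absurd h h0⟩
    · rw [solForm_moebius w N S γ hτ, pow_zero, mul_one]
    · funext τ x
      by_cases hτ : τ ∈ upperHalf
      · rw [dbarForm, if_pos hτ, dbar_solForm hS hN hτ (htr τ hτ) x]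
      · rw [dbarForm, if_neg hτ, hS.1 τ hτ]; rfl

omit [FiniteDimensional ℝ E] [SecondCountableTopology M] in
omit [TopologicalSpace M] [ChartedSpace E M] [IsManifold 𝓘(ℝ, E) ∞ M] in
theorem dbarForm_eq_zero_iff {j : ℕ} {α : FormFamily E M ℂ j} :
    dbarForm α = 0 ↔ ∀ τ ∈ upperHalf, ∀ x, dbar (fun t => α t x) τ = 0 := by
  refine ⟨fun h τ hτ x => ?_, fun h => ?_⟩
  · have := congrFun (congrFun h τ) x
    rwa [dbarForm, if_pos hτ] at this
  · funext τ x
    by_cases hτ : τ ∈ upperHalf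
    · rw [dbarForm, if_pos hτ, h τ hτ x]; rfl
    · rw [dbarForm, if_neg hτ]; rfl

omit [FiniteDimensional ℝ E] [SecondCountableTopology M] in
omit [IsManifold 𝓘(ℝ, E) ∞ M] in
theorem Transforms.dTotal {n : ℤ} {m : ℕ} {T : TotalFamily E M ℂ}
    (hs : ∀ j, T j ∈ smoothForms E M upperHalf j)
    (hT : ∀ j : ℕ, Transforms (-((n - 1 - j) / 2)) m (T j)) (j : ℕ) :
    Transforms (-((n - j) / 2)) m (dTotal T j) := by
  intro τ hτ γ
  cases j with
  | zero => simp [SuperTori.dTotal]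
  | succ j =>
    have h := hT j τ hτ γ
    rw [show n - 1 - (j : ℤ) = n - ((j + 1 : ℕ) : ℤ) by push_cast; ring] at h
    simp only [SuperTori.dTotal]
    rw [h, extD_smul _ fun x => differentiableAt_localRep (hs j) τ x]

/-- The restriction of `Z` to unit volume can be corrected by an exact form so that it becomes
holomorphic in `τ`. -/
theorem exists_closedForms_MFgraded {n : ℤ} {t : Triple E M} (ht : IsTorusTriple n t) :
    ∃ W ∈ closedForms E M upperHalf MFgraded n,
      pullTau W - t.1 ∈ exactForms E M torSet (fun k => mf k 0) n := by
  have hZ := fun j => (ht.mem_Z j).1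
  have hZv := fun j => (ht.mem_Zv j).1
  have hZτ := fun j => (ht.mem_Zτ j).1
  -- `T` solves `∂T/∂τ̄ = Z_{τ̄}` at unit volume
  have hT : ∀ j : ℕ, ∃ T ∈ smoothForms E M upperHalf j,
      Transforms (-((n - 1 - j) / 2)) 0 T ∧ dbarForm T = unitVol (t.2.2 j) ∧
        (Odd (n - 1 - (j : ℤ)) → T = 0) := by
    intro j
    rcases Int.even_or_odd (n - 1 - (j : ℤ)) with hk | hk
    · obtain ⟨T, h1, h2, h3, -, -⟩ := exists_dbarForm_eq (-((n - 1 - (j : ℤ)) / 2))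
        (unitVol_mem_smoothForms (hZτ j)) (unitVol_transforms hk (by norm_num) (ht.mem_Zτ j))
      exact ⟨T, h1, h2, h3, fun h => absurd hk (Int.not_even_iff_odd.2 h)⟩
    · have h0 := eq_zero_of_odd hk (by decide) (ht.mem_Zτ j)
      refine ⟨0, zero_mem _, fun τ _ γ => by simp, ?_, fun _ => rfl⟩
      rw [h0]
      funext τ x
      simp [dbarForm, dbar, unitVol, reparam]
  choose T hTs hTtr hTd hTodd using hT
  have hY := fun j => unitVol_mem_smoothForms (hZ j)
  have hdT := dTotal_mem_smoothForms isOpen_upperHalf hTs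
  set Y : TotalFamily E M ℂ := fun j => unitVol (t.1 j)
  have hdY : dTotal Y = 0 := by
    rw [show dTotal Y = fun j => unitVol (dTotal t.1 j) from dTotal_reparam hZ, ht.closed]
    funext j τ x
    simp [unitVol, reparam]
  have hodd : ∀ j : ℕ, Odd (n - (j : ℤ)) → (Y - dTotal T) j = 0 := by
    intro j hj
    have h1 : Y j = 0 := by
      simp only [Y, eq_zero_of_odd hj (by decide) (ht.mem_Z j)]
      funext τ x
      simp [unitVol, reparam]
    have h2 : dTotal T j = 0 := by
      cases j with
      | zero => rfl
      | succ j =>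
        have h3 := hTodd j (by
          rwa [show n - 1 - (j : ℤ) = n - ((j + 1 : ℕ) : ℤ) by push_cast; ring])
        funext τ
        simp only [dTotal, h3, Pi.zero_apply, extD_zero]
    rw [Pi.sub_apply, h1, h2, sub_zero]
  refine ⟨Y - dTotal T, ⟨fun j => mem_formsIn_MFgraded_iff.2 ⟨sub_mem (hY j) (hdT j), ?_, ?_,
    hodd j⟩, ?_⟩, ?_⟩
  · rw [← dbarForm_eq_zero_iff, Pi.sub_apply, dbarForm_sub (hY j) (hdT j)]
    have h1 := congrFun (dTotal_dbarForm hTs) j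
    have h2 : dbarForm (Y j) = unitVol (dTauBar t.1 j) := unitVol_dTauBar.symm
    have h3 : dTotal (fun j => unitVol (t.2.2 j)) = fun j => unitVol (dTotal t.2.2 j) :=
      dTotal_reparam hZτ
    simp only [hTd, h3] at h1
    rw [h2, ht.dTauBar_eq, ← h1, sub_self]
  · rcases Int.even_or_odd (n - (j : ℤ)) with hk | hk
    · exact (unitVol_transforms hk (by norm_num) (ht.mem_Z j)).sub (Transforms.dTotal hTs hTtr j)
    · rw [hodd j hk]; intro τ _ γ; simp
  · rw [dTotal_sub hY hdT, hdY, dTotal_dTotal hTs, sub_zero]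
  · -- the difference is the differential of minus the primitive of `Z_v` minus the pullback of `T`
    have hprim := fun j => volPrim_mem_formsIn (ht.mem_Zv j)
    have hpT := fun j : ℕ => pullTau_mem_formsIn (k := n - 1 - (j : ℤ)) (hTs j) (hTtr j) (hTodd j)
    have hm₁ : (fun j => volPrim (t.2.1 j)) ∈ totalForms E M torSet (fun k => mf k 0) (n - 1) :=
      fun j => hprim j
    have hm₂ : pullTau T ∈ totalForms E M torSet (fun k => mf k 0) (n - 1) := fun j => hpT j
    refine ⟨-((fun j => volPrim (t.2.1 j)) + pullTau T), neg_mem (add_mem hm₁ hm₂), ?_⟩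
    have h1 := eq_pullTau_unitVol_add hZ hZv ht.dVol_eq
    have h2 : dTotal (pullTau T) = pullTau (dTotal T) := by
      rw [pullTau_eq, pullTau_eq]; exact dTotal_reparam hTs
    have h3 : pullTau (Y - dTotal T) = pullTau Y - pullTau (dTotal T) := by
      funext j q x
      by_cases hq : q ∈ torSet <;> simp [pullTau, hq]
    have h4 := dTotal_add hm₁ hm₂
    have h5 := dTotal_smul (-1) (add_mem hm₁ hm₂)
    rw [neg_one_smul, neg_one_smul] at h5
    rw [h5, h4, h2, h3]
    conv_lhs => rw [h1]
    abel

/-- A closed form with values in weak modular forms that is exact among forms with values in `mf`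
is exact among forms with values in weak modular forms. -/
theorem mem_exactForms_MFgraded {n : ℤ} {W : TotalFamily E M ℂ}
    (hW : W ∈ closedForms E M upperHalf MFgraded n)
    (hex : pullTau W ∈ exactForms E M torSet (fun k => mf k 0) n) :
    W ∈ exactForms E M upperHalf MFgraded n := by
  obtain ⟨T, hT, hWT⟩ := hex
  have hTs := fun j => (hT j).1
  have hWs := fun j => (mem_formsIn_MFgraded_iff.1 (hW.1 j)).1
  have hY := fun j => unitVol_mem_smoothForms (hTs j)
  have hYtr : ∀ j : ℕ, Transforms (-((n - 1 - j) / 2)) 0 (unitVol (T j)) := by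
    intro j
    rcases Int.even_or_odd (n - 1 - (j : ℤ)) with hk | hk
    · exact unitVol_transforms hk (by norm_num) (hT j)
    · rw [eq_zero_of_odd hk (by decide) (hT j)]
      intro τ _ γ
      funext x
      simp [unitVol, reparam]
  have hdY : dTotal (fun j => unitVol (T j)) = W := by
    rw [show dTotal (fun j => unitVol (T j)) = fun j => unitVol (dTotal T j) from
      dTotal_reparam hTs, ← hWT]
    funext j
    exact unitVol_pullTau (hWs j)
  have hdS : dTotal (fun j => dbarForm (unitVol (T j))) = 0 := by
    rw [dTotal_dbarForm hY, hdY]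
    funext j
    exact dbarForm_eq_zero_iff.2 (mem_formsIn_MFgraded_iff.1 (hW.1 j)).2.1
  -- correct the restriction of `T` to unit volume by a closed form, to make it holomorphic
  have hU := fun j : ℕ => exists_dbarForm_eq (-((n - 1 - j) / 2)) (dbarForm_mem_smoothForms (hY j))
    ((hYtr j).dbarForm (hY j))
  choose U hUs hUtr hUd hUc hU0 using hU
  have hdU : dTotal U = 0 := by
    funext j
    cases j with
    | zero => rfl
    | succ j =>
      funext τ
      exact hUc j (fun τ => congrFun (congrFun hdS (j + 1)) τ) τ
  refine ⟨fun j => unitVol (T j) - U j, fun j => mem_formsIn_MFgraded_iff.2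
    ⟨sub_mem (hY j) (hUs j), ?_, (hYtr j).sub (hUtr j), fun hk => ?_⟩, ?_⟩
  · rw [← dbarForm_eq_zero_iff, dbarForm_sub (hY j) (hUs j), hUd j, sub_self]
  · have h1 : unitVol (T j) = 0 := by
      rw [eq_zero_of_odd hk (by decide) (hT j)]
      funext τ x
      simp [unitVol, reparam]
    have h2 : U j = 0 := hU0 j (by rw [h1]; funext τ x; simp [dbarForm, dbar])
    exact (congrArg₂ (· - ·) h1 h2).trans (sub_zero 0)
  · exact (by rw [show (fun j => unitVol (T j) - U j) = (fun j => unitVol (T j)) - U from rfl,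
      dTotal_sub hY hUs, hdY, hdU, sub_zero] : dTotal (fun j => unitVol (T j) - U j) = W).symm

/-- There is exactly one class of holomorphic forms whose pullback is the class of `Z`. -/
theorem existsUnique_class {n : ℤ} {t : Triple E M} (ht : IsTorusTriple n t) :
    ∃! c : DeRham E M upperHalf MFgraded n, ∃ W : closedForms E M upperHalf MFgraded n,
      Submodule.Quotient.mk W = c ∧
        pullTau W.1 - t.1 ∈ exactForms E M torSet (fun k => mf k 0) n := by
  obtain ⟨W, hW, hex⟩ := exists_closedForms_MFgraded ht
  refine ⟨Submodule.Quotient.mk ⟨W, hW⟩, ⟨⟨W, hW⟩, rfl, hex⟩, ?_⟩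
  rintro _ ⟨W', rfl, hex'⟩
  rw [Submodule.Quotient.eq]
  refine mem_exactForms_MFgraded (W := W'.1 - W) (sub_mem W'.2 hW) ?_
  have h1 : pullTau (W'.1 - W) = (pullTau W'.1 - t.1) - (pullTau W - t.1) := by
    funext j q x
    by_cases hq : q ∈ torSet <;> simp [pullTau, hq]
  rw [h1]
  exact sub_mem hex' hex

end HolomorphicRepresentative

/-! ### Invariance under super translations -/

section Translation

variable {E : Type*} [NormedAddCommGroup E] [NormedSpace ℝ E]
  {M : Type*} [TopologicalSpace M] [ChartedSpace E M]

theorem scaleC_eq (p : Fin 2 → ℂ) :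
    scaleC p = ⟨1, 0, 0, 0, (latDisc p)⁻¹ * p 1, -((latDisc p)⁻¹ * p 0)⟩ := by
  rw [scaleC, nuC, sub_eq_add_neg, sub_eq_add_neg]
  ext <;> simp [Coeff.η, Coeff.lam, Coeff.mul_def, Coeff.smul_def, Coeff.neg_def, Coeff.one_def,
    Coeff.add_def]

theorem scaleC_pow (p : Fin 2 → ℂ) (j : ℕ) :
    scaleC p ^ j = ⟨1, 0, 0, 0, j * ((latDisc p)⁻¹ * p 1), -(j * ((latDisc p)⁻¹ * p 0))⟩ := by
  induction j with
  | zero => rw [pow_zero]; ext <;> simp [Coeff.one_def]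
  | succ j ih =>
    rw [pow_succ, ih, scaleC_eq]
    ext <;> simp [Coeff.mul_def]
    all_goals ring

theorem latticeShift_eq (w : ℂ) (p : Fin 2 → ℂ) (i : Fin 2) :
    latticeShift w p i = (2 : ℂ) • (Coeff.η * Coeff.lam i) := by
  have h1 : latticeShift w p i = ((superTranslation w).zb + (superLattice p i).zb
      + Coeff.η * Coeff.lam i + -(superTranslation w).zb + (Coeff.η + Coeff.lam i) * -Coeff.η)
      - (superLattice p i).zb := rfl
  have h2 : (Coeff.η + Coeff.lam i) * -Coeff.η = Coeff.η * Coeff.lam i := by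
    fin_cases i <;> ext <;>
      simp [Coeff.η, Coeff.lam, Coeff.mul_def, Coeff.neg_def, Coeff.add_def]
  rw [h1, h2, two_smul]
  abel

theorem shiftC_eq (w : ℂ) (p : Fin 2 → ℂ) : ∃ r s : ℂ, shiftC w p = ⟨0, -1, r, s, 0, 0⟩ := by
  refine ⟨_, _, Coeff.ext ?_ ?_ rfl rfl ?_ ?_⟩ <;>
    simp [shiftC, kappaC, nuC, sub_eq_add_neg, Coeff.η, Coeff.lam, Coeff.smul_def, Coeff.neg_def,
      Coeff.add_def]

theorem eta_mul_lam (i : Fin 2) :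
    Coeff.η * Coeff.lam i = ![⟨0, 0, 0, 0, 1, 0⟩, ⟨0, 0, 0, 0, 0, 1⟩] i := by
  fin_cases i <;> ext <;> simp [Coeff.η, Coeff.lam, Coeff.mul_def]

/-- The defect of translation invariance at `η λᵢ`. -/
noncomputable def residual (F : SuperFun E M) (i : Fin 2) (j : ℕ)
    (p : Fin 2 → ℂ) : FormField E M j :=
  dTotal (F.2 i) j p + (2 : ℂ) • dbarLat i F.1 j p
    + (j * (latDisc p)⁻¹ * ![p 1, -p 0] i) • F.1 j p

/-- The expansion of the action map in the generators of `Coeff`. -/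
theorem pullAct_eq (w : ℂ) (p : Fin 2 → ℂ) (F : SuperFun E M) (j : ℕ) (x : M) :
    pullAct w p F j x = pullProj p F j x + shiftC w p ⊗ₜ[ℂ] dTotal F.1 j p x
      + ∑ i, (Coeff.η * Coeff.lam i) ⊗ₜ[ℂ] residual F i j p x := by
  obtain ⟨r, s, hrs⟩ := shiftC_eq w p
  have h1 : ∀ k, scaleC p ^ k * shiftC w p = shiftC w p := fun k => by
    rw [scaleC_pow, hrs]; ext <;> simp [Coeff.mul_def]
  have h2 : ∀ i k, Coeff.η * Coeff.lam i * scaleC p ^ k = Coeff.η * Coeff.lam i := fun i k => by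
    rw [scaleC_pow, eta_mul_lam]; fin_cases i <;> ext <;> simp [Coeff.mul_def]
  have h3 : ∀ i, Coeff.η * Coeff.lam i * shiftC w p = 0 := fun i => by
    rw [hrs, eta_mul_lam]; fin_cases i <;> ext <;> simp [Coeff.mul_def, Coeff.zero_def]
  have h4 : ∀ i k, Coeff.lam i * scaleC p ^ k = Coeff.lam i := fun i k => by
    rw [scaleC_pow]; fin_cases i <;> ext <;> simp [Coeff.mul_def, Coeff.lam]
  have h5 : ∀ i, Coeff.lam i * shiftC w p = Coeff.η * Coeff.lam i := fun i => by
    rw [hrs, eta_mul_lam]; fin_cases i <;> ext <;> simp [Coeff.mul_def, Coeff.lam]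
  have h6 : ∀ i k, Coeff.lam i * (Coeff.η * Coeff.lam k) = 0 := fun i k => by
    rw [eta_mul_lam]
    fin_cases i <;> fin_cases k <;> ext <;> simp [Coeff.mul_def, Coeff.lam, Coeff.zero_def]
  have h7 : scaleC p ^ j = 1 + ∑ i, (j * (latDisc p)⁻¹ * ![p 1, -p 0] i) •
      (Coeff.η * Coeff.lam i) := by
    rw [scaleC_pow]
    simp only [eta_mul_lam, Fin.sum_univ_two]
    ext <;> simp [Coeff.one_def, Coeff.smul_def, Coeff.neg_def,
      Coeff.add_def]
    all_goals ring
  simp only [pullAct, pullProj, pullForm, residual, latticeShift_eq, one_mul, smul_mul_assoc,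
    mul_smul_comm, h1, h2, h3, h4, h5, h6, zero_mul, smul_zero,
    TensorProduct.zero_tmul, Finset.sum_const_zero, add_zero]
  simp only [h7, Fin.sum_univ_two, TensorProduct.add_tmul, TensorProduct.tmul_add,
    TensorProduct.smul_tmul, Pi.add_apply, Pi.smul_apply, TensorProduct.tmul_smul]
  abel

/-- A linear functional on coefficients, applied to forms with coefficients. -/
noncomputable def coordForm (φ : Coeff →ₗ[ℂ] ℂ) (j : ℕ) : Coeff ⊗[ℂ] Alt E ℂ j →ₗ[ℂ] Alt E ℂ j :=
  TensorProduct.lift ((LinearMap.lsmul ℂ (Alt E ℂ j)).comp φ)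

theorem coordForm_tmul (φ : Coeff →ₗ[ℂ] ℂ) {j : ℕ} (c : Coeff) (α : Alt E ℂ j) :
    coordForm φ j (c ⊗ₜ[ℂ] α) = φ c • α := rfl

/-- A function on the space of nearly constant supertori is translation invariant at a lattice if
and only if its component `F₀` is closed and the two residuals vanish. -/
theorem pullAct_eq_pullProj_iff (w : ℂ) (p : Fin 2 → ℂ) (F : SuperFun E M) (j : ℕ) (x : M) :
    pullAct w p F j x = pullProj p F j x ↔
      dTotal F.1 j p x = 0 ∧ ∀ i, residual F i j p x = 0 := by
  obtain ⟨r, s, hrs⟩ := shiftC_eq w p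
  rw [pullAct_eq, add_assoc, add_eq_left]
  constructor
  · intro h
    let φe : Coeff →ₗ[ℂ] ℂ := ⟨⟨Coeff.e, fun _ _ => rfl⟩, fun _ _ => rfl⟩
    let φ₁ : Coeff →ₗ[ℂ] ℂ := ⟨⟨Coeff.e₁, fun _ _ => rfl⟩, fun _ _ => rfl⟩
    let φ₂ : Coeff →ₗ[ℂ] ℂ := ⟨⟨Coeff.e₂, fun _ _ => rfl⟩, fun _ _ => rfl⟩
    have h1 := congrArg (coordForm φe j) h
    have h2 := congrArg (coordForm φ₁ j) h
    have h3 := congrArg (coordForm φ₂ j) h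
    simp only [map_add, map_zero, Fin.sum_univ_two, coordForm_tmul, eta_mul_lam, hrs,
      LinearMap.coe_mk, AddHom.coe_mk, φe, φ₁, φ₂] at h1 h2 h3
    refine ⟨by simpa using h1, fun i => ?_⟩
    fin_cases i
    · simpa using h2
    · simpa using h3
  · rintro ⟨h1, h2⟩
    simp [h1, h2]

end Translation

/-! ### Rotations of lattices -/

section Rotations

variable {E : Type*} [NormedAddCommGroup E] [NormedSpace ℝ E]
  {M : Type*} [TopologicalSpace M] [ChartedSpace E M] {j : ℕ}

/-- The based lattice `(ℓ τ, ℓ)`. -/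
noncomputable def latOf (q : ℂ × ℝ) : Fin 2 → ℂ := ![q.2 * q.1, q.2]

/-- The parameters `(τ, ℓ)` of the rotation of a lattice whose second generator is positive. -/
noncomputable def torOf (p : Fin 2 → ℂ) : ℂ × ℝ := (p 0 / p 1, ‖p 1‖)

/-- The direction of the second generator of a lattice. -/
noncomputable def latDir (p : Fin 2 → ℂ) : ℂ := p 1 / ‖p 1‖

theorem isOpen_latSet : IsOpen latSet := by
  refine isOpen_lt continuous_const ?_
  fun_prop

theorem ne_zero_of_mem_latSet {p : Fin 2 → ℂ} (hp : p ∈ latSet) : p 1 ≠ 0 := by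
  intro h
  have : (0 : ℝ) < (p 0 * conj (p 1)).im := hp
  simp [h] at this

theorem latOf_mem {q : ℂ × ℝ} (hq : q ∈ torSet) : latOf q ∈ latSet := by
  have h1 : 0 < q.1.im := hq.1
  have h2 : 0 < q.2 := hq.2
  change (0 : ℝ) < ((q.2 : ℂ) * q.1 * conj (q.2 : ℂ)).im
  simp
  positivity

theorem torOf_mem {p : Fin 2 → ℂ} (hp : p ∈ latSet) : torOf p ∈ torSet := by
  have h0 := ne_zero_of_mem_latSet hp
  refine ⟨?_, norm_pos_iff.2 h0⟩
  have h1 : (0 : ℝ) < (p 0 * conj (p 1)).im := hp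
  have h2 : p 0 / p 1 = ((Complex.normSq (p 1))⁻¹ : ℝ) * (p 0 * conj (p 1)) := by
    rw [div_eq_mul_inv, Complex.inv_def]; push_cast; ring
  change 0 < (p 0 / p 1).im
  rw [h2, Complex.im_ofReal_mul]
  exact mul_pos (inv_pos.2 (Complex.normSq_pos.2 h0)) h1

theorem latDir_ne_zero {p : Fin 2 → ℂ} (hp : p ∈ latSet) : latDir p ≠ 0 :=
  div_ne_zero (ne_zero_of_mem_latSet hp)
    (Complex.ofReal_ne_zero.2 (norm_ne_zero_iff.2 (ne_zero_of_mem_latSet hp)))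

theorem norm_latDir {p : Fin 2 → ℂ} (hp : p ∈ latSet) : ‖latDir p‖ = 1 := by
  rw [latDir, norm_div, Complex.norm_real, norm_norm,
    div_self (norm_ne_zero_iff.2 (ne_zero_of_mem_latSet hp))]

theorem latDir_mul_latOf {p : Fin 2 → ℂ} (hp : p ∈ latSet) :
    (fun i => latDir p * latOf (torOf p) i) = p := by
  have h0 := ne_zero_of_mem_latSet hp
  have h1 : (‖p 1‖ : ℂ) ≠ 0 := Complex.ofReal_ne_zero.2 (norm_ne_zero_iff.2 h0)
  funext i
  fin_cases i <;> simp [latDir, latOf, torOf] <;> field_simp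

theorem torOf_latOf {q : ℂ × ℝ} (hq : q ∈ torSet) : torOf (latOf q) = q := by
  have h2 : 0 < q.2 := hq.2
  have h3 : (q.2 : ℂ) ≠ 0 := Complex.ofReal_ne_zero.2 h2.ne'
  refine Prod.ext ?_ ?_
  · simp [torOf, latOf, h3]
  · simp [torOf, latOf, abs_of_pos h2]

theorem latDir_latOf {q : ℂ × ℝ} (hq : q ∈ torSet) : latDir (latOf q) = 1 := by
  have h2 : 0 < q.2 := hq.2
  have h3 : (q.2 : ℂ) ≠ 0 := Complex.ofReal_ne_zero.2 h2.ne'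
  simp [latDir, latOf, abs_of_pos h2, h3]

theorem norm_circle_sq_mul (u : Circle) (z : ℂ) : ‖(u : ℂ) ^ 2 * z‖ = ‖z‖ := by
  rw [norm_mul, norm_pow, Circle.norm_coe, one_pow, one_mul]

theorem torOf_rotate (u : Circle) (p : Fin 2 → ℂ) :
    torOf (fun i => (u : ℂ) ^ 2 * p i) = torOf p := by
  refine Prod.ext ?_ ?_
  · exact mul_div_mul_left _ _ (pow_ne_zero 2 (Circle.coe_ne_zero u))
  · exact norm_circle_sq_mul u (p 1)

theorem latDir_rotate (u : Circle) (p : Fin 2 → ℂ) :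
    latDir (fun i => (u : ℂ) ^ 2 * p i) = (u : ℂ) ^ 2 * latDir p := by
  rw [latDir, norm_circle_sq_mul, latDir, mul_div_assoc]

theorem rotate_mem (u : Circle) {p : Fin 2 → ℂ} (hp : p ∈ latSet) :
    (fun i => (u : ℂ) ^ 2 * p i) ∈ latSet := by
  have h1 : (u : ℂ) ^ 2 * p 0 * conj ((u : ℂ) ^ 2 * p 1) = p 0 * conj (p 1) := by
    have h2 : (u : ℂ) * conj (u : ℂ) = 1 := by rw [Complex.mul_conj]; simp
    rw [map_mul, map_pow]
    linear_combination (((u : ℂ) * conj (u : ℂ)) + 1) * p 0 * conj (p 1) * h2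
  change (0 : ℝ) < ((u : ℂ) ^ 2 * p 0 * conj ((u : ℂ) ^ 2 * p 1)).im
  rw [h1]
  exact hp

theorem exists_circle_sq {z : ℂ} (hz : ‖z‖ = 1) : ∃ u : Circle, (u : ℂ) ^ 2 = z := by
  obtain ⟨ε, hε⟩ := exists_sq_eq z
  have h1 : ‖ε‖ = 1 := by
    have h := congrArg norm hε
    rw [norm_pow, hz] at h
    exact (pow_eq_one_iff_of_nonneg (norm_nonneg ε) two_ne_zero).1 h
  exact ⟨⟨ε, mem_sphere_zero_iff_norm.2 h1⟩, hε⟩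

/-- Every lattice is a rotation of a lattice of the form `(ℓ τ, ℓ)`. -/
theorem exists_rotate_latOf {p : Fin 2 → ℂ} (hp : p ∈ latSet) :
    ∃ u : Circle, ∃ q ∈ torSet, p = fun i => (u : ℂ) ^ 2 * latOf q i := by
  obtain ⟨u, hu⟩ := exists_circle_sq (norm_latDir hp)
  refine ⟨u, torOf p, torOf_mem hp, ?_⟩
  rw [hu, latDir_mul_latOf hp]

theorem contDiff_latOf : ContDiff ℝ ∞ latOf := by
  rw [contDiff_pi]
  intro i
  have h : ContDiff ℝ ∞ fun q : ℂ × ℝ => (q.2 : ℂ) := Complex.ofRealCLM.contDiff.comp contDiff_snd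
  fin_cases i
  · exact h.mul contDiff_fst
  · exact h

theorem contDiffOn_eval (i : Fin 2) (P : Set (Fin 2 → ℂ)) :
    ContDiffOn ℝ ∞ (fun p : Fin 2 → ℂ => p i) P := (contDiff_apply ℝ ℂ i).contDiffOn

theorem contDiffOn_norm_one : ContDiffOn ℝ ∞ (fun p : Fin 2 → ℂ => ‖p 1‖) latSet :=
  ContDiffOn.norm ℂ (contDiffOn_eval 1 _) fun _ hp => ne_zero_of_mem_latSet hp

theorem contDiffOn_torOf : ContDiffOn ℝ ∞ torOf latSet := by
  refine ContDiffOn.prodMk ?_ contDiffOn_norm_one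
  simp only [div_eq_mul_inv]
  exact (contDiffOn_eval 0 _).mul ((contDiffOn_eval 1 _).inv fun _ hp => ne_zero_of_mem_latSet hp)

theorem contDiffOn_latDir_zpow (k : ℤ) : ContDiffOn ℝ ∞ (fun p => latDir p ^ k) latSet := by
  have h : ContDiffOn ℝ ∞ latDir latSet := by
    have h1 : ContDiffOn ℝ ∞ (fun p : Fin 2 → ℂ => (‖p 1‖ : ℂ)) latSet :=
      Complex.ofRealCLM.contDiff.comp_contDiffOn contDiffOn_norm_one
    have h2 := (contDiffOn_eval 1 latSet).mul (h1.inv fun p hp =>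
      Complex.ofReal_ne_zero.2 (norm_ne_zero_iff.2 (ne_zero_of_mem_latSet hp)))
    refine h2.congr fun p _ => ?_
    exact div_eq_mul_inv _ _
  cases k with
  | ofNat k => simpa using h.pow k
  | negSucc k =>
    simp only [zpow_negSucc]
    exact (h.pow (k + 1)).inv fun p hp => pow_ne_zero _ (latDir_ne_zero hp)

/-! ### Equivariance under rotations -/

/-- A family of forms on which `u ∈ Spin(2)` acts by `u ^ m`. -/
def SpinWeight (m : ℤ) (α : FormFamily E M (Fin 2 → ℂ) j) : Prop :=
  ∀ u : Circle, ∀ p ∈ latSet, α (fun i => (u : ℂ) ^ 2 * p i) = (u : ℂ) ^ m • α p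

omit [TopologicalSpace M] [ChartedSpace E M] in
theorem SpinWeight.eq_of_latOf {m : ℤ} {α β : FormFamily E M (Fin 2 → ℂ) j}
    (hα : SpinWeight m α) (hβ : SpinWeight m β) (hα0 : ∀ p ∉ latSet, α p = 0)
    (hβ0 : ∀ p ∉ latSet, β p = 0) (h : ∀ q ∈ torSet, α (latOf q) = β (latOf q)) : α = β := by
  funext p
  by_cases hp : p ∈ latSet
  · obtain ⟨u, q, hq, rfl⟩ := exists_rotate_latOf hp
    rw [hα u _ (latOf_mem hq), hβ u _ (latOf_mem hq), h q hq]
  · rw [hα0 p hp, hβ0 p hp]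

/-- The extension of a family of forms over `ℍ × ℝ_{>0}` to all lattices, on which `u ∈ Spin(2)`
acts by `u ^ m`. It is used only when `m` is even or the family vanishes. -/
noncomputable def latExt (m : ℤ) (β : FormFamily E M (ℂ × ℝ) j) : FormFamily E M (Fin 2 → ℂ) j :=
  reparam latSet (fun p => latDir p ^ (m / 2)) torOf β

omit [TopologicalSpace M] [ChartedSpace E M] in
theorem latExt_latOf (m : ℤ) (β : FormFamily E M (ℂ × ℝ) j) {q : ℂ × ℝ} (hq : q ∈ torSet) :
    latExt m β (latOf q) = β q := by
  rw [latExt, reparam_eq _ _ _ (latOf_mem hq), latDir_latOf hq, one_zpow, one_smul, torOf_latOf hq]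

omit [TopologicalSpace M] [ChartedSpace E M] in
theorem latExt_spinWeight {m : ℤ} {β : FormFamily E M (ℂ × ℝ) j} (hβ : Odd m → β = 0) :
    SpinWeight m (latExt m β) := by
  intro u p hp
  rw [latExt, reparam_eq _ _ _ hp, reparam_eq _ _ _ (rotate_mem u hp), torOf_rotate,
    latDir_rotate]
  rcases Int.even_or_odd m with hm | hm
  · obtain ⟨k, rfl⟩ := hm
    rw [smul_smul, mul_zpow, ← zpow_natCast, ← zpow_mul]
    congr 3
    push_cast
    omega
  · rw [hβ hm]; simp

theorem latExt_mem_smoothForms (m : ℤ) {β : FormFamily E M (ℂ × ℝ) j}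
    (hβ : β ∈ smoothForms E M torSet j) : latExt m β ∈ smoothForms E M latSet j :=
  reparam_mem_smoothForms hβ (contDiffOn_latDir_zpow _) contDiffOn_torOf fun _ hp => torOf_mem hp

omit [TopologicalSpace M] [ChartedSpace E M] in
theorem atTorus_of_mem (α : TotalFamily E M (Fin 2 → ℂ)) (j : ℕ) {q : ℂ × ℝ} (hq : q ∈ torSet) :
    atTorus α j q = α j (latOf q) := funext fun _ => if_pos hq

end Rotations

/-! ### Derivatives with respect to the lattice -/

section LatticeDerivatives

variable {E : Type*} [NormedAddCommGroup E] [NormedSpace ℝ E]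
  {M : Type*} [TopologicalSpace M] [ChartedSpace E M] {j : ℕ}

section Equivariant
variable {F : Type*} [NormedAddCommGroup F] [NormedSpace ℝ F] [NormedSpace ℂ F]
  [IsScalarTower ℝ ℂ F] {f : (Fin 2 → ℂ) → F} {p : Fin 2 → ℂ}

omit [NormedSpace ℂ F] [IsScalarTower ℝ ℂ F] in
/-- A partial derivative is the value of the total derivative at a coordinate vector. -/
theorem fderiv_update (hf : DifferentiableAt ℝ f p) (i : Fin 2) (h : ℂ) :
    fderiv ℝ (fun z => f (Function.update p i z)) (p i) h = fderiv ℝ f p (Pi.single i h) := by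
  have h1 : HasFDerivAt (Function.update p i)
      (ContinuousLinearMap.pi (Pi.single i (ContinuousLinearMap.id ℝ ℂ))) (p i) :=
    hasFDerivAt_update p (p i)
  have h2 : HasFDerivAt f (fderiv ℝ f p) (Function.update p i (p i)) := by
    rw [Function.update_eq_self]; exact hf.hasFDerivAt
  refine (congrArg (fun L : ℂ →L[ℝ] F => L h) (h2.comp (p i) h1).fderiv).trans ?_
  refine congrArg (fderiv ℝ f p) (funext fun k => ?_)
  by_cases hk : k = i
  · subst hk; simp
  · simp [hk]

/-- The conjugate-linear part of the derivative is given by the Wirtinger derivatives. -/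
theorem fderiv_single_add (hf : DifferentiableAt ℝ f p) (i : Fin 2) (c : ℂ) :
    fderiv ℝ f p (Pi.single i c) + Complex.I • fderiv ℝ f p (Pi.single i (Complex.I * c)) =
      (2 * conj c) • dbar (fun z => f (Function.update p i z)) (p i) := by
  obtain ⟨a, b, rfl⟩ : ∃ a b : ℝ, c = a + b * Complex.I := ⟨c.re, c.im, (Complex.re_add_im c).symm⟩
  have h1 : ∀ a b : ℝ, fderiv ℝ f p (Pi.single i ((a : ℂ) + b * Complex.I)) =
      (a : ℂ) • fderiv ℝ f p (Pi.single i 1) + (b : ℂ) • fderiv ℝ f p (Pi.single i Complex.I) := by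
    intro a b
    have : (Pi.single i ((a : ℂ) + b * Complex.I) : Fin 2 → ℂ) =
        a • (Pi.single i 1 : Fin 2 → ℂ) + b • (Pi.single i Complex.I : Fin 2 → ℂ) := by
      rw [← Pi.single_smul, ← Pi.single_smul, ← Pi.single_add]; simp
    rw [this, map_add, map_smul, map_smul]
    exact congrArg₂ _ (algebraMap_smul ℂ a _).symm (algebraMap_smul ℂ b _).symm
  have h2 : Complex.I * (a + b * Complex.I) = ((-b : ℝ) : ℂ) + (a : ℝ) * Complex.I := by
    push_cast; linear_combination (b : ℂ) * Complex.I_mul_I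
  rw [h2, h1, h1, dbar, fderiv_update hf, fderiv_update hf]
  simp only [map_add, map_mul, Complex.conj_ofReal, Complex.conj_I, Complex.ofReal_neg]
  match_scalars
  · ring
  · linear_combination (b : ℂ) * Complex.I_mul_I

/-- The derivative along the rotation of an equivariant function. -/
theorem fderiv_rotate {m : ℤ} (hf : DifferentiableAt ℝ f p)
    (h : ∀ u : Circle, f (fun i => (u : ℂ) ^ 2 * p i) = (u : ℂ) ^ m • f p) :
    fderiv ℝ f p (fun i => Complex.I * p i) = (Complex.I * (m / 2)) • f p := by
  have h1 : ∀ k : ℂ, HasDerivAt (fun t : ℝ => Complex.exp (t * (k * Complex.I)))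
      (k * Complex.I) 0 := by
    intro k
    have h2 := ((Complex.ofRealCLM.hasDerivAt (x := (0 : ℝ))).mul_const (k * Complex.I)).cexp
    simpa using h2
  have h3 : HasDerivAt (fun t : ℝ => fun i => Complex.exp (t * (1 * Complex.I)) * p i)
      (fun i => Complex.I * p i) 0 := by
    rw [hasDerivAt_pi]
    intro i
    simpa using (h1 1).mul_const (p i)
  have h4 : HasFDerivAt f (fderiv ℝ f p) (fun i => Complex.exp ((0 : ℝ) *
      (1 * Complex.I)) * p i) := by
    simpa using hf.hasFDerivAt
  have h5 := h4.comp_hasDerivAt (0 : ℝ) h3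
  have h6 := (h1 (m / 2)).smul_const (f p)
  have h7 : (f ∘ fun t : ℝ => fun i => Complex.exp (t * (1 * Complex.I)) * p i) =
      fun t : ℝ => Complex.exp (t * ((m / 2 : ℂ) * Complex.I)) • f p := by
    funext t
    have h8 := h (Circle.exp (t / 2))
    rw [Circle.coe_exp, ← Complex.exp_nat_mul, ← Complex.exp_int_mul] at h8
    have e1 : ((2 : ℕ) : ℂ) * (((t / 2 : ℝ) : ℂ) * Complex.I) = t * (1 * Complex.I) := by
      push_cast; ring
    have e2 : (m : ℂ) * (((t / 2 : ℝ) : ℂ) * Complex.I) = t * ((m / 2 : ℂ) * Complex.I) := by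
      push_cast; ring
    rw [e1, e2] at h8
    exact h8
  rw [h7] at h5
  rw [h5.unique h6, mul_comm]

/-- Euler's formula for an equivariant function: as rotations are known, the derivative along
dilations is determined by the Wirtinger derivatives. -/
theorem fderiv_dilate {m : ℤ} (hf : DifferentiableAt ℝ f p)
    (h : ∀ u : Circle, f (fun i => (u : ℂ) ^ 2 * p i) = (u : ℂ) ^ m • f p) :
    fderiv ℝ f p p = (m / 2 : ℂ) • f p + ∑ i, (2 * conj (p i)) •
      dbar (fun z => f (Function.update p i z)) (p i) := by
  have h1 := fderiv_rotate hf h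
  have h2 := fderiv_single_add hf 0 (p 0)
  have h3 := fderiv_single_add hf 1 (p 1)
  have h4 : p = Pi.single 0 (p 0) + Pi.single 1 (p 1) := by
    funext i; fin_cases i <;> simp
  have h5 : (fun i => Complex.I * p i) =
      Pi.single 0 (Complex.I * p 0) + Pi.single 1 (Complex.I * p 1) := by
    funext i; fin_cases i <;> simp
  rw [Fin.sum_univ_two, ← h2, ← h3]
  have h6 : fderiv ℝ f p p = fderiv ℝ f p (Pi.single 0 (p 0)) + fderiv ℝ f p (Pi.single 1
      (p 1)) := by
    rw [← map_add, ← h4]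
  rw [h5, map_add] at h1
  have h7 := congrArg (Complex.I • ·) h1
  simp only [smul_add, smul_smul, ← mul_assoc, Complex.I_mul_I] at h7
  have h8 : (m / 2 : ℂ) • f p = -(Complex.I • fderiv ℝ f p (Pi.single 0 (Complex.I * p 0)) +
      Complex.I • fderiv ℝ f p (Pi.single 1 (Complex.I * p 1))) := by
    rw [h7]; module
  rw [h6, h8]
  abel

end Equivariant

/-! ### Derivatives with respect to the modulus and the volume -/

/-- The normalising factors `ℓ ^ a (2 Im τ) ^ b`. -/
noncomputable def coef (a b : ℝ) (q : ℂ × ℝ) : ℝ := q.2 ^ a * (2 * q.1.im) ^ b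

theorem coef_pos (a b : ℝ) {q : ℂ × ℝ} (hq : q ∈ torSet) : 0 < coef a b q := by
  have h1 : 0 < q.1.im := hq.1
  have h2 : 0 < q.2 := hq.2
  unfold coef
  positivity

theorem contDiffOn_coef (a b : ℝ) : ContDiffOn ℝ ∞ (coef a b) torSet := by
  refine (contDiffOn_snd.rpow_const_of_ne fun q hq => ne_of_gt hq.2).mul
    (ContDiffOn.rpow_const_of_ne ?_ fun q hq => ?_)
  · exact contDiffOn_const.mul (Complex.imCLM.contDiff.comp contDiff_fst).contDiffOn
  · have h1 : 0 < q.1.im := hq.1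
    positivity

/-- The derivative of the normalising factor. -/
theorem hasFDerivAt_coef (a b : ℝ) {q : ℂ × ℝ} (hq : q ∈ torSet) :
    HasFDerivAt (coef a b) (coef a b q • ((a / q.2) • ContinuousLinearMap.snd ℝ ℂ ℝ +
      (b / q.1.im) • Complex.imCLM.comp (ContinuousLinearMap.fst ℝ ℂ ℝ))) q := by
  have hy : 0 < q.1.im := hq.1
  have hl : 0 < q.2 := hq.2
  have h1 : HasFDerivAt (fun q : ℂ × ℝ => q.2) (ContinuousLinearMap.snd ℝ ℂ ℝ) q := hasFDerivAt_snd
  have h2 : HasFDerivAt (fun q : ℂ × ℝ => 2 * q.1.im)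
      ((2 : ℝ) • Complex.imCLM.comp (ContinuousLinearMap.fst ℝ ℂ ℝ)) q :=
    ((Complex.imCLM.hasFDerivAt.comp q hasFDerivAt_fst).const_mul 2)
  have h3 := (h1.rpow_const (p := a) (Or.inl hl.ne')).mul
    (h2.rpow_const (p := b) (Or.inl (by positivity)))
  refine h3.congr_fderiv ?_
  refine ContinuousLinearMap.ext fun v => ?_
  simp only [Real.rpow_sub_one hl.ne', Real.rpow_sub_one (show 2 * q.1.im ≠ 0 by positivity), coef,
    add_apply, smul_apply, ContinuousLinearMap.coe_snd', ContinuousLinearMap.comp_apply,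
    ContinuousLinearMap.coe_fst', Complex.imCLM_apply, smul_eq_mul]
  field_simp
  ring

theorem hasFDerivAt_latOf (q : ℂ × ℝ) : HasFDerivAt latOf (fderiv ℝ latOf q) q :=
  (contDiff_latOf.differentiable (by simp) q).hasFDerivAt

theorem fderiv_latOf (q v : ℂ × ℝ) :
    fderiv ℝ latOf q v = ![v.2 * q.1 + q.2 * v.1, v.2] := by
  have h1 : HasFDerivAt (fun q : ℂ × ℝ => (q.2 : ℂ))
      (Complex.ofRealCLM.comp (ContinuousLinearMap.snd ℝ ℂ ℝ)) q :=
    Complex.ofRealCLM.hasFDerivAt.comp q hasFDerivAt_snd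
  have h2 : HasFDerivAt (fun q : ℂ × ℝ => q.1) (ContinuousLinearMap.fst ℝ ℂ ℝ) q := hasFDerivAt_fst
  have h3 := h1.mul h2
  have h4 := hasFDerivAt_pi'.1 (hasFDerivAt_latOf q)
  funext i
  fin_cases i
  · refine (congrArg (fun L : ℂ × ℝ →L[ℝ] ℂ => L v) ((h4 0).unique h3)).trans ?_
    simp [add_comm, mul_comm]
  · exact congrArg (fun L : ℂ × ℝ →L[ℝ] ℂ => L v) ((h4 1).unique h1)

end LatticeDerivatives

/-! ### Derivatives of the form `Z` -/

section FormZ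

variable {E : Type*} [NormedAddCommGroup E] [NormedSpace ℝ E]
  {M : Type*} [TopologicalSpace M] [ChartedSpace E M] [IsManifold 𝓘(ℝ, E) ∞ M]
  {j : ℕ} {n : ℤ} {F : SuperFun E M}

/-- The normalising factor of `Z`. -/
noncomputable abbrev coefZ (n : ℤ) (j : ℕ) (q : ℂ × ℝ) : ℝ :=
  coef (-((n : ℝ) + j) / 2) (-(j : ℝ) / 2) q

omit [IsManifold 𝓘(ℝ, E) ∞ M] in
omit [TopologicalSpace M] [ChartedSpace E M] in
theorem formZ_of_mem (n : ℤ) (F : SuperFun E M) (j : ℕ) {q : ℂ × ℝ} (hq : q ∈ torSet) :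
    formZ n F j q = (coefZ n j q : ℂ) • F.1 j (latOf q) := by
  rw [← atTorus_of_mem F.1 j hq]; rfl

theorem hasFDerivAt_formZ (hF : F.1 j ∈ smoothForms E M latSet j) {q : ℂ × ℝ} (hq : q ∈ torSet)
    (x : M) : ∃ D : ℂ × ℝ →L[ℝ] Alt E ℂ j, HasFDerivAt (fun q => formZ n F j q x) D q ∧
      ∀ h s, D (h, s) = (coefZ n j q : ℂ) •
        (((-((n : ℝ) + j) / 2 / q.2 * s + -(j : ℝ) / 2 / q.1.im * h.im : ℝ) : ℂ) •
            F.1 j (latOf q) x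
          + fderiv ℝ (fun p => F.1 j p x) (latOf q) ![s * q.1 + q.2 * h, s]) := by
  have h1 := differentiableAt_apply isOpen_latSet hF x (latOf_mem hq)
  have h2 := h1.hasFDerivAt.comp q (hasFDerivAt_latOf q)
  have h3 := (hasFDerivAt_coef (-((n : ℝ) + j) / 2) (-(j : ℝ) / 2) hq).smul h2
  refine ⟨_, h3.congr_of_eventuallyEq ?_, fun h s => ?_⟩
  · filter_upwards [isOpen_torSet.mem_nhds hq] with q' hq'
    rw [formZ_of_mem n F j hq']
    exact algebraMap_smul ℂ (coefZ n j q') _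
  · have h4 : ∀ (a : ℝ) (β : Alt E ℂ j), (a : ℂ) • β = a • β := fun a β => algebraMap_smul ℂ a β
    simp only [h4, add_apply, smul_apply, ContinuousLinearMap.comp_apply, Function.comp_apply,
      fderiv_latOf, ContinuousLinearMap.smulRight_apply, ContinuousLinearMap.coe_snd',
      ContinuousLinearMap.coe_fst', Complex.imCLM_apply, smul_eq_mul, smul_add, smul_smul]
    rw [add_comm]
    congr 2
    ring

/-- Euler's formula for `F₀` at the lattice `(ℓ τ, ℓ)`: the derivative with respect to `ℓ` at fixed
`τ` is determined by the Wirtinger derivatives. -/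
theorem fderiv_latOf_dilate (hF : F.1 j ∈ smoothForms E M latSet j) {m : ℤ}
    (hspin : SpinWeight m (F.1 j)) {q : ℂ × ℝ} (hq : q ∈ torSet) (x : M) (s : ℝ) :
    fderiv ℝ (fun p => F.1 j p x) (latOf q) ![s * q.1, s] = (s / q.2 : ℂ) •
      ((m / 2 : ℂ) • F.1 j (latOf q) x + (2 * (q.2 : ℂ)) • (conj q.1 • dbarLat 0 F.1 j (latOf q) x
        + dbarLat 1 F.1 j (latOf q) x)) := by
  have hl : (q.2 : ℂ) ≠ 0 := Complex.ofReal_ne_zero.2 (ne_of_gt hq.2)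
  have h1 := fderiv_dilate (differentiableAt_apply isOpen_latSet hF x (latOf_mem hq))
    fun u => congrFun (hspin u _ (latOf_mem hq)) x
  have h2 : (![s * q.1, s] : Fin 2 → ℂ) = (s / q.2) • latOf q := by
    funext i
    fin_cases i
    · simp [latOf]; field_simp
    · simp [latOf]; field_simp
  rw [h2, map_smul, h1, ← algebraMap_smul ℂ (s / q.2), Fin.sum_univ_two]
  have h3 : algebraMap ℝ ℂ (s / q.2) = (s : ℂ) / q.2 := Complex.ofReal_div s q.2
  have h4 : ∀ i, dbar (fun z => F.1 j (Function.update (latOf q) i z) x) (latOf q i) =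
    dbarLat i F.1 j (latOf q) x := fun _ => rfl
  rw [h3, h4, h4]
  congr 2
  simp only [latOf, Matrix.cons_val_zero, Matrix.cons_val_one, map_mul, Complex.conj_ofReal]
  module

/-- The derivative of `Z` in the direction of the volume. -/
theorem dVol_formZ (hF : F.1 j ∈ smoothForms E M latSet j)
    (hspin : SpinWeight (n - j) (F.1 j)) {q : ℂ × ℝ} (hq : q ∈ torSet) (x : M) :
    dVol (formZ n F) j q x = (coefZ n j q / (2 * q.2 * q.1.im) : ℂ) •
      ((2 : ℂ) • (conj q.1 • dbarLat 0 F.1 j (latOf q) x + dbarLat 1 F.1 j (latOf q) x)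
        - (j / q.2 : ℂ) • F.1 j (latOf q) x) := by
  have hy : 0 < q.1.im := hq.1
  have hl : 0 < q.2 := hq.2
  have hlC : (q.2 : ℂ) ≠ 0 := Complex.ofReal_ne_zero.2 hl.ne'
  have hyC : (q.1.im : ℂ) ≠ 0 := Complex.ofReal_ne_zero.2 hy.ne'
  obtain ⟨D, hD, hDv⟩ := hasFDerivAt_formZ (n := n) hF hq x
  have hs : √(q.2 ^ 2 * q.1.im / q.1.im) = q.2 := by
    rw [mul_div_cancel_right₀ _ hy.ne', Real.sqrt_sq hl.le]
  have h1 : HasDerivAt (fun v : ℝ => (q.1, √(v / q.1.im))) ((0 : ℂ), 1 / (2 * q.2 * q.1.im))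
      (q.2 ^ 2 * q.1.im) := by
    refine (hasDerivAt_const _ _).prodMk ?_
    have h2 := ((hasDerivAt_id (q.2 ^ 2 * q.1.im)).div_const q.1.im).sqrt (by
      simp only [id]; positivity)
    simp only [id, hs] at h2
    refine h2.congr_deriv ?_
    field_simp
  have h3 : HasFDerivAt (fun q => formZ n F j q x) D (q.1, √(q.2 ^ 2 * q.1.im / q.1.im)) := by
    rw [hs]; exact hD
  rw [dVol, if_pos hq]
  refine (HasFDerivAt.comp_hasDerivAt (f := fun v : ℝ => (q.1, √(v / q.1.im)))
    (q.2 ^ 2 * q.1.im) h3 h1).deriv.trans ?_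
  rw [hDv]
  have h4 := fderiv_latOf_dilate hF hspin hq x (1 / (2 * q.2 * q.1.im))
  rw [mul_zero, add_zero, h4]
  simp only [Complex.zero_im, mul_zero, add_zero]
  push_cast
  match_scalars <;> field_simp <;> ring

/-- The derivative of `Z` in the direction of `τ̄`, at fixed volume. -/
theorem dTauBar_formZ (hF : F.1 j ∈ smoothForms E M latSet j)
    (hspin : SpinWeight (n - j) (F.1 j)) {q : ℂ × ℝ} (hq : q ∈ torSet) (x : M) :
    dTauBar (formZ n F) j q x = (-Complex.I * coefZ n j q * q.2 / (2 * q.1.im) : ℂ) •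
      (q.1 • dbarLat 0 F.1 j (latOf q) x + dbarLat 1 F.1 j (latOf q) x) := by
  have hy : 0 < q.1.im := hq.1
  have hl : 0 < q.2 := hq.2
  have hlC : (q.2 : ℂ) ≠ 0 := Complex.ofReal_ne_zero.2 hl.ne'
  have hyC : (q.1.im : ℂ) ≠ 0 := Complex.ofReal_ne_zero.2 hy.ne'
  obtain ⟨D, hD, hDv⟩ := hasFDerivAt_formZ (n := n) hF hq x
  have hs : √(q.2 ^ 2 * q.1.im / q.1.im) = q.2 := by
    rw [mul_div_cancel_right₀ _ hy.ne', Real.sqrt_sq hl.le]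
  have h1 : HasFDerivAt (fun t : ℂ => (t, √(q.2 ^ 2 * q.1.im / t.im)))
      ((ContinuousLinearMap.id ℝ ℂ).prod ((-q.2 / (2 * q.1.im)) • Complex.imCLM)) q.1 := by
    refine (hasFDerivAt_id q.1).prodMk ?_
    have h2 : HasDerivAt (fun y : ℝ => √(q.2 ^ 2 * q.1.im / y)) (-q.2 / (2 * q.1.im)) q.1.im := by
      have h3 := ((hasDerivAt_const q.1.im (q.2 ^ 2 * q.1.im)).div (hasDerivAt_id q.1.im)
        hy.ne').sqrt (by simp only [id, Pi.div_apply]; positivity)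
      simp only [id, hs, Pi.div_apply] at h3
      refine h3.congr_deriv ?_
      field_simp
      ring
    exact h2.comp_hasFDerivAt q.1 Complex.imCLM.hasFDerivAt
  have h3 : HasFDerivAt (fun q => formZ n F j q x) D (q.1, √(q.2 ^ 2 * q.1.im / q.1.im)) := by
    rw [hs]; exact hD
  rw [dTauBar, if_pos hq, dbar]
  have h4 := (h3.comp q.1 h1).fderiv
  have h5 : ∀ h : ℂ, fderiv ℝ (fun t : ℂ => formZ n F j (t, √(q.2 ^ 2 * q.1.im / t.im)) x) q.1 h =
      D (h, -q.2 / (2 * q.1.im) * h.im) := fun h =>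
    congrArg (fun L : ℂ →L[ℝ] Alt E ℂ j => L h) h4
  have h6 : ∀ (s : ℝ) (h : ℂ), fderiv ℝ (fun p => F.1 j p x) (latOf q) ![s * q.1 + q.2 * h, s] =
      fderiv ℝ (fun p => F.1 j p x) (latOf q) ![s * q.1, s] +
        fderiv ℝ (fun p => F.1 j p x) (latOf q) (Pi.single 0 (q.2 * h)) := by
    intro s h
    rw [← map_add]
    congr 1
    funext i
    fin_cases i <;> simp
  have h7 := fderiv_single_add (differentiableAt_apply isOpen_latSet hF x (latOf_mem hq)) 0
      (q.2 : ℂ)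
  rw [Complex.conj_ofReal, mul_comm Complex.I] at h7
  have h8 : dbar (fun z => F.1 j (Function.update (latOf q) 0 z) x) (latOf q 0) =
    dbarLat 0 F.1 j (latOf q) x := rfl
  rw [h8] at h7
  rw [h5, h5, hDv, hDv, h6, h6, fderiv_latOf_dilate hF hspin hq, fderiv_latOf_dilate hF hspin hq,
    mul_one, eq_sub_of_add_eq h7]
  have h9 : conj q.1 = q.1 - 2 * q.1.im * Complex.I := by
    apply Complex.ext <;> simp
    ring
  rw [h9]
  simp only [Complex.one_im, Complex.I_im, mul_zero, add_zero, mul_one]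
  push_cast
  match_scalars <;> field_simp <;> ring_nf <;> simp only [Complex.I_sq] <;> ring

end FormZ

/-! ### Translation invariance in terms of the triple -/

section Equations

variable {E : Type*} [NormedAddCommGroup E] [NormedSpace ℝ E]
  {M : Type*} [TopologicalSpace M] [ChartedSpace E M]
  {j : ℕ} {n : ℤ} {F : SuperFun E M}

/-- Smooth functions `F` on which `u ∈ Spin(2)` acts by `u ^ n`. -/
structure IsSpinFun (n : ℤ) (F : SuperFun E M) : Prop where
  smooth₀ : ∀ j, F.1 j ∈ smoothForms E M latSet j
  smooth : ∀ i j, F.2 i j ∈ smoothForms E M latSet j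
  spin₀ : ∀ j : ℕ, SpinWeight (n - j) (F.1 j)
  spin : ∀ i, ∀ j : ℕ, SpinWeight (n - j + 1) (F.2 i j)

theorem conj_circle (u : Circle) : conj (u : ℂ) = (u : ℂ)⁻¹ := by
  rw [← Circle.coe_inv_eq_conj, Circle.coe_inv]

omit [TopologicalSpace M] [ChartedSpace E M] in
theorem spinWeight_iff {m k : ℤ} {α : FormFamily E M (Fin 2 → ℂ) j} {n : ℤ} (h : n = m + k) :
    SpinWeight m α ↔ ∀ u : Circle, ∀ p ∈ latSet,
      ((u : ℂ) ^ k) • α (fun i => (u : ℂ) ^ 2 * p i) = (u : ℂ) ^ n • α p := by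
  refine forall₃_congr fun u p _ => ?_
  have hu := Circle.coe_ne_zero u
  rw [h, add_comm, zpow_add₀ hu, mul_smul, smul_right_inj (zpow_ne_zero k hu)]

theorem IsPfaffianSection.isSpinFun (h : IsPfaffianSection n F) : IsSpinFun n F := by
  refine ⟨h.smooth₀, h.smooth, fun j => ?_, fun i j => ?_⟩
  · rw [spinWeight_iff (k := j) (n := n) (by ring)]
    intro u p hp
    rw [← h.spin_weight₀ u p hp j, conj_circle, inv_zpow', neg_neg]
  · rw [spinWeight_iff (k := j - 1) (n := n) (by ring)]
    intro u p hp
    rw [← h.spin_weight u p hp i j, conj_circle, inv_zpow', neg_neg,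
      zpow_sub_one₀ (Circle.coe_ne_zero u), mul_comm]

/-- The coefficient of `Z_v` in degree `j`, compared with that of `Z` in the degree `j + 1` of
`d Z_v`. -/
theorem coef_succ (n : ℤ) (j : ℕ) {q : ℂ × ℝ} (hq : q ∈ torSet) :
    coef (-((n : ℝ) + j + 3) / 2) (-((j : ℝ) + 3) / 2) q =
      coefZ n (j + 1) q / (q.2 * (2 * q.1.im)) := by
  have hy : 0 < q.1.im := hq.1
  have hl : 0 < q.2 := hq.2
  have e1 : -((n : ℝ) + j + 3) / 2 = -((n : ℝ) + (j + 1 : ℕ)) / 2 - 1 := by push_cast; ring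
  have e2 : -((j : ℝ) + 3) / 2 = -((j + 1 : ℕ) : ℝ) / 2 - 1 := by push_cast; ring
  rw [coefZ, coef, coef, e1, e2, Real.rpow_sub_one hl.ne',
    Real.rpow_sub_one (show 2 * q.1.im ≠ 0 by positivity)]
  field_simp

/-- The coefficient of `Z_{τ̄}` in degree `j`, compared with that of `Z` in the degree `j + 1` of
`d Z_{τ̄}`. -/
theorem coef_succ' (n : ℤ) (j : ℕ) {q : ℂ × ℝ} (hq : q ∈ torSet) :
    coef (-((n : ℝ) + j - 1) / 2) (-((j : ℝ) + 3) / 2) q =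
      coefZ n (j + 1) q * q.2 / (2 * q.1.im) := by
  have hy : 0 < q.1.im := hq.1
  have hl : 0 < q.2 := hq.2
  have e1 : -((n : ℝ) + j - 1) / 2 = -((n : ℝ) + (j + 1 : ℕ)) / 2 + 1 := by push_cast; ring
  have e2 : -((j : ℝ) + 3) / 2 = -((j + 1 : ℕ) : ℝ) / 2 - 1 := by push_cast; ring
  rw [coefZ, coef, coef, e1, e2, Real.rpow_add_one hl.ne',
    Real.rpow_sub_one (show 2 * q.1.im ≠ 0 by positivity)]
  field_simp

omit [TopologicalSpace M] [ChartedSpace E M] in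
theorem formZv_of_mem (n : ℤ) (F : SuperFun E M) (j : ℕ) {q : ℂ × ℝ} (hq : q ∈ torSet) :
    formZv n F j q = (-coef (-((n : ℝ) + j + 3) / 2) (-((j : ℝ) + 3) / 2) q : ℂ) •
      (conj q.1 • F.2 0 j (latOf q) + F.2 1 j (latOf q)) := by
  rw [← atTorus_of_mem (F.2 0) j hq, ← atTorus_of_mem (F.2 1) j hq]; rfl

omit [TopologicalSpace M] [ChartedSpace E M] in
theorem formZτ_of_mem (n : ℤ) (F : SuperFun E M) (j : ℕ) {q : ℂ × ℝ} (hq : q ∈ torSet) :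
    formZτ n F j q = (Complex.I / 2 * coef (-((n : ℝ) + j - 1) / 2) (-((j : ℝ) + 3) / 2) q : ℂ) •
      (q.1 • F.2 0 j (latOf q) + F.2 1 j (latOf q)) := by
  rw [← atTorus_of_mem (F.2 0) j hq, ← atTorus_of_mem (F.2 1) j hq]; rfl

omit [TopologicalSpace M] [ChartedSpace E M] in
theorem formZ_of_notMem (n : ℤ) (F : SuperFun E M) (j : ℕ) {q : ℂ × ℝ} (hq : q ∉ torSet) :
    formZ n F j q = 0 := by funext x; simp [formZ, atTorus, hq]

omit [TopologicalSpace M] [ChartedSpace E M] in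
theorem formZv_of_notMem (n : ℤ) (F : SuperFun E M) (j : ℕ) {q : ℂ × ℝ} (hq : q ∉ torSet) :
    formZv n F j q = 0 := by funext x; simp [formZv, atTorus, hq]

omit [TopologicalSpace M] [ChartedSpace E M] in
theorem formZτ_of_notMem (n : ℤ) (F : SuperFun E M) (j : ℕ) {q : ℂ × ℝ} (hq : q ∉ torSet) :
    formZτ n F j q = 0 := by funext x; simp [formZτ, atTorus, hq]

theorem dTotal_succ {V : Type*} (T : TotalFamily E M V) (j : ℕ) (p : V) :
    dTotal T (j + 1) p = extD (T j p) := rfl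

theorem dTotal_of_eq_zero {V : Type*} {T : TotalFamily E M V} {p : V} (h : ∀ j, T j p = 0) (j : ℕ) :
    dTotal T j p = 0 := by
  cases j with
  | zero => rfl
  | succ j => rw [dTotal_succ, h j, extD_zero]

omit [TopologicalSpace M] [ChartedSpace E M] in
theorem dVol_of_notMem (Z : TotalFamily E M (ℂ × ℝ)) {q : ℂ × ℝ} (hq : q ∉ torSet) :
    dVol Z j q = 0 := funext fun _ => if_neg hq

omit [TopologicalSpace M] [ChartedSpace E M] in
theorem dTauBar_of_notMem (Z : TotalFamily E M (ℂ × ℝ)) {q : ℂ × ℝ} (hq : q ∉ torSet) :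
    dTauBar Z j q = 0 := funext fun _ => if_neg hq

theorem extD_lin {P : Set (Fin 2 → ℂ)} {α β : FormFamily E M (Fin 2 → ℂ) j}
    (hα : α ∈ smoothForms E M P j) (hβ : β ∈ smoothForms E M P j) (p : Fin 2 → ℂ) (c d : ℂ) :
    extD (d • (c • α p + β p)) = d • (c • extD (α p) + extD (β p)) := by
  have h1 := Submodule.smul_mem _ c hα
  have e1 := extD_smul d fun x => differentiableAt_localRep (add_mem h1 hβ) p x
  have e2 := extD_add (fun x => differentiableAt_localRep h1 p x)
    fun x => differentiableAt_localRep hβ p x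
  have e3 := extD_smul c fun x => differentiableAt_localRep hα p x
  simp only [Pi.add_apply, Pi.smul_apply] at e1 e2 e3
  rw [e1, e2, e3]

theorem dTotal_formZv (hF : IsSpinFun n F) (j : ℕ) {q : ℂ × ℝ} (hq : q ∈ torSet) :
    dTotal (formZv n F) j q = (-(coefZ n j q / (q.2 * (2 * q.1.im))) : ℂ) •
      (conj q.1 • dTotal (F.2 0) j (latOf q) + dTotal (F.2 1) j (latOf q)) := by
  cases j with
  | zero => simp [dTotal]
  | succ j =>
    rw [dTotal_succ, formZv_of_mem n F j hq, extD_lin (hF.smooth 0 j) (hF.smooth 1 j),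
        coef_succ n j hq]
    push_cast
    rfl

theorem dTotal_formZτ (hF : IsSpinFun n F) (j : ℕ) {q : ℂ × ℝ} (hq : q ∈ torSet) :
    dTotal (formZτ n F) j q = (Complex.I / 2 * (coefZ n j q * q.2 / (2 * q.1.im)) : ℂ) •
      (q.1 • dTotal (F.2 0) j (latOf q) + dTotal (F.2 1) j (latOf q)) := by
  cases j with
  | zero => simp [dTotal]
  | succ j =>
    rw [dTotal_succ, formZτ_of_mem n F j hq, extD_lin (hF.smooth 0 j) (hF.smooth 1 j),
        coef_succ' n j hq]
    push_cast
    rfl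

theorem latDisc_latOf (q : ℂ × ℝ) : latDisc (latOf q) = (q.2 : ℂ) ^ 2 *
    (2 * q.1.im * Complex.I) := by
  have h9 : conj q.1 = q.1 - 2 * q.1.im * Complex.I := by
    apply Complex.ext <;> simp
    ring
  simp only [latDisc, latOf, Matrix.cons_val_zero, Matrix.cons_val_one, map_mul,
    Complex.conj_ofReal, h9]
  ring

/-- The vectors `(τ, 1)` and `(τ̄, 1)` are linearly independent. -/
theorem pair_eq_zero_iff {A : Type*} [AddCommGroup A] [Module ℂ A] {τ : ℂ} (hτ : τ ∈ upperHalf)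
    {x y : A} : conj τ • x + y = 0 ∧ τ • x + y = 0 ↔ x = 0 ∧ y = 0 := by
  refine ⟨fun ⟨h1, h2⟩ => ?_, fun ⟨h1, h2⟩ => by simp [h1, h2]⟩
  have h0 : τ - conj τ ≠ 0 := by
    rw [Complex.sub_conj]
    exact mul_ne_zero (by exact_mod_cast mul_ne_zero two_ne_zero (ne_of_gt hτ)) Complex.I_ne_zero
  have h3 : x = 0 := by
    refine (smul_eq_zero_iff_right h0).1 ?_
    calc (τ - conj τ) • x = (τ • x + y) - (conj τ • x + y) := by module
      _ = 0 := by rw [h1, h2, sub_zero]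
  refine ⟨h3, ?_⟩
  rw [h3, smul_zero, zero_add] at h2
  exact h2

section Smooth
variable [IsManifold 𝓘(ℝ, E) ∞ M]

omit [IsManifold 𝓘(ℝ, E) ∞ M] in
theorem dTotal_formZ (hF : IsSpinFun n F) (j : ℕ) {q : ℂ × ℝ} (hq : q ∈ torSet) :
    dTotal (formZ n F) j q = (coefZ n (j - 1) q : ℂ) • dTotal F.1 j (latOf q) := by
  cases j with
  | zero => simp [dTotal]
  | succ j =>
    rw [dTotal_succ, formZ_of_mem n F j hq,
      extD_smul _ fun x => differentiableAt_localRep (hF.smooth₀ j) (latOf q) x]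
    rfl

/-- The defect of `∂_v Z = d Z_v` is a combination of the residuals. -/
theorem dVol_sub_dTotal (hF : IsSpinFun n F) (j : ℕ) {q : ℂ × ℝ} (hq : q ∈ torSet) :
    dVol (formZ n F) j q - dTotal (formZv n F) j q = (coefZ n j q / (2 * q.2 * q.1.im) : ℂ) •
      (conj q.1 • residual F 0 j (latOf q) + residual F 1 j (latOf q)) := by
  have hlC : (q.2 : ℂ) ≠ 0 := Complex.ofReal_ne_zero.2 (ne_of_gt hq.2)
  have hyC : (q.1.im : ℂ) ≠ 0 := Complex.ofReal_ne_zero.2 (ne_of_gt hq.1)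
  funext x
  have h9 : conj q.1 = q.1 - 2 * q.1.im * Complex.I := by
    apply Complex.ext <;> simp
    ring
  rw [Pi.sub_apply, dVol_formZ (hF.smooth₀ j) (hF.spin₀ j) hq x, dTotal_formZv hF j hq]
  simp only [residual, latDisc_latOf]
  simp only [Pi.add_apply, Pi.smul_apply, latOf, Matrix.cons_val_zero, Matrix.cons_val_one, h9]
  match_scalars <;> field_simp <;> ring

/-- The defect of `∂_{τ̄} Z = d Z_{τ̄}` is a combination of the residuals. -/
theorem dTauBar_sub_dTotal (hF : IsSpinFun n F) (j : ℕ) {q : ℂ × ℝ} (hq : q ∈ torSet) :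
    dTauBar (formZ n F) j q - dTotal (formZτ n F) j q =
      (-Complex.I * coefZ n j q * q.2 / (4 * q.1.im) : ℂ) •
        (q.1 • residual F 0 j (latOf q) + residual F 1 j (latOf q)) := by
  have hlC : (q.2 : ℂ) ≠ 0 := Complex.ofReal_ne_zero.2 (ne_of_gt hq.2)
  have hyC : (q.1.im : ℂ) ≠ 0 := Complex.ofReal_ne_zero.2 (ne_of_gt hq.1)
  funext x
  rw [Pi.sub_apply, dTauBar_formZ (hF.smooth₀ j) (hF.spin₀ j) hq x, dTotal_formZτ hF j hq]
  simp only [residual, Pi.add_apply, Pi.smul_apply, latOf, Matrix.cons_val_zero,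
    Matrix.cons_val_one]
  match_scalars <;> field_simp <;> ring

omit [IsManifold 𝓘(ℝ, E) ∞ M] in
theorem dTotal_rotate {T : TotalFamily E M (Fin 2 → ℂ)} (hT : ∀ j, T j ∈ smoothForms E M latSet j)
    {m : ℤ} (hspin : ∀ j : ℕ, SpinWeight (m - j) (T j)) (j : ℕ) :
    SpinWeight (m - j + 1) (dTotal T j) := by
  intro u p hp
  cases j with
  | zero => simp [dTotal]
  | succ j =>
    rw [dTotal_succ, dTotal_succ, hspin j u p hp, extD_smul _ fun x => differentiableAt_localRep
        (hT j) p x]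
    congr 2
    push_cast
    ring

/-- A rotation by `u` multiplies lattices by `u²`, hence their conjugates by `u⁻²`; so `∂/∂ℓ̄ᵢ`
raises the spin by `2`. -/
theorem dbarLat_rotate {T : TotalFamily E M (Fin 2 → ℂ)} (hT : T j ∈ smoothForms E M latSet j)
    {m : ℤ} (hspin : SpinWeight m (T j)) (i : Fin 2) : SpinWeight (m + 2) (dbarLat i T j) := by
  intro u p hp
  funext x
  have hu := Circle.coe_ne_zero u
  have hd : ∀ p ∈ latSet, DifferentiableAt ℝ (fun z => T j (Function.update p i z) x) (p i) := by
    intro p hp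
    have h1 : DifferentiableAt ℝ (fun p => T j p x) (Function.update p i (p i)) := by
      rw [Function.update_eq_self]
      exact differentiableAt_apply isOpen_latSet hT x hp
    exact h1.comp (p i) (hasFDerivAt_update p (p i)).differentiableAt
  have h1 : HasDerivAt (fun z : ℂ => (u : ℂ) ^ 2 * z) ((u : ℂ) ^ 2) (p i) := by
    simpa using (hasDerivAt_id (p i)).const_mul ((u : ℂ) ^ 2)
  have h2 := dbar_comp_holomorphic (h := fun z =>
    T j (Function.update (fun i => (u : ℂ) ^ 2 * p i) i z) x) h1 (hd _ (rotate_mem u hp))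
  have h3 : (fun z => T j (Function.update (fun i => (u : ℂ) ^ 2 * p i) i ((u : ℂ) ^ 2 * z)) x)
      =ᶠ[𝓝 (p i)] fun z => (u : ℂ) ^ m • T j (Function.update p i z) x := by
    have h4 : ∀ᶠ z in 𝓝 (p i), Function.update p i z ∈ latSet := by
      have h5 : ContinuousAt (Function.update p i) (p i) :=
        (hasFDerivAt_update (𝕜 := ℝ) p (p i)).continuousAt
      refine h5.eventually_mem ?_
      rw [Function.update_eq_self]
      exact isOpen_latSet.mem_nhds hp
    filter_upwards [h4] with z hz
    rw [← Pi.smul_apply, ← hspin u _ hz]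
    congr 1
    funext k
    by_cases hk : k = i
    · subst hk; simp
    · simp [hk]
  rw [dbar_congr h3, dbar_smul_of_holomorphic (differentiableAt_const _) (hd p hp)] at h2
  have h6 : conj ((u : ℂ) ^ 2) = ((u : ℂ) ^ 2)⁻¹ := by rw [map_pow, conj_circle, inv_pow]
  rw [h6] at h2
  have h7 := congrArg ((u : ℂ) ^ 2 • ·) h2
  simp only [smul_smul, mul_inv_cancel₀ (pow_ne_zero 2 hu), one_smul] at h7
  rw [zpow_add₀ hu, mul_comm ((u : ℂ) ^ m)]
  exact h7.symm

/-- All terms of the residual have the same spin, so that it vanishes at all lattices once it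
vanishes at the lattices `(ℓ τ, ℓ)`. -/
theorem residual_rotate (hF : IsSpinFun n F) (i : Fin 2) (j : ℕ) :
    SpinWeight (n - j + 2) (residual F i j) := by
  intro u p hp
  have hu := Circle.coe_ne_zero u
  have h1 := dTotal_rotate (hF.smooth i) (m := n + 1) (fun j => by
    rw [show n + 1 - (j : ℤ) = n - j + 1 by ring]; exact hF.spin i j) j u p hp
  have h2 := dbarLat_rotate (hF.smooth₀ j) (hF.spin₀ j) i u p hp
  have h3 : latDisc (fun i => (u : ℂ) ^ 2 * p i) = latDisc p := by
    have h2 : (u : ℂ) * conj (u : ℂ) = 1 := by rw [Complex.mul_conj]; simp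
    simp only [latDisc, map_mul, map_pow]
    linear_combination (((u : ℂ) * conj (u : ℂ)) + 1) * (p 0 * conj (p 1) - conj (p 0) * p 1) * h2
  have h4 : ![(u : ℂ) ^ 2 * p 1, -((u : ℂ) ^ 2 * p 0)] i = (u : ℂ) ^ (2 : ℤ) * ![p 1, -p 0] i := by
    fin_cases i
    · rfl
    · exact (mul_neg _ _).symm
  rw [residual, residual, h1, h2, hF.spin₀ j u p hp, h3, h4,
    show n + 1 - (j : ℤ) + 1 = n - j + 2 by ring, zpow_add₀ hu]
  module

/-- For functions of the right spin, translation invariance is equivalent to the differential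
equations of the triple. -/
theorem translation_invariant_iff (hF : IsSpinFun n F) :
    (∀ w : ℂ, ∀ p ∈ latSet, ∀ j x, pullAct w p F j x = pullProj p F j x) ↔
      dTotal (formZ n F) = 0 ∧ dVol (formZ n F) = dTotal (formZv n F) ∧
        dTauBar (formZ n F) = dTotal (formZτ n F) := by
  simp only [pullAct_eq_pullProj_iff]
  constructor
  · intro h
    refine ⟨?_, ?_, ?_⟩ <;> funext j q <;> by_cases hq : q ∈ torSet
    · rw [dTotal_formZ hF j hq, show dTotal F.1 j (latOf q) = 0 from
        funext fun x => (h 0 _ (latOf_mem hq) j x).1, smul_zero]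
      rfl
    · exact dTotal_of_eq_zero (fun j => formZ_of_notMem n F j hq) j
    · have hr : ∀ i, residual F i j (latOf q) = 0 := fun i =>
        funext fun x => (h 0 _ (latOf_mem hq) j x).2 i
      rw [← sub_eq_zero, dVol_sub_dTotal hF j hq, hr, hr]
      simp
    · rw [dVol_of_notMem _ hq, dTotal_of_eq_zero (fun j => formZv_of_notMem n F j hq) j]
    · have hr : ∀ i, residual F i j (latOf q) = 0 := fun i =>
        funext fun x => (h 0 _ (latOf_mem hq) j x).2 i
      rw [← sub_eq_zero, dTauBar_sub_dTotal hF j hq, hr, hr]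
      simp
    · rw [dTauBar_of_notMem _ hq, dTotal_of_eq_zero (fun j => formZτ_of_notMem n F j hq) j]
  · rintro ⟨h1, h2, h3⟩ w p hp j x
    obtain ⟨u, q, hq, rfl⟩ := exists_rotate_latOf hp
    have hlC : (q.2 : ℂ) ≠ 0 := Complex.ofReal_ne_zero.2 (ne_of_gt hq.2)
    have hyC : (q.1.im : ℂ) ≠ 0 := Complex.ofReal_ne_zero.2 (ne_of_gt hq.1)
    have hc : ∀ j, (coefZ n j q : ℂ) ≠ 0 := fun j =>
      Complex.ofReal_ne_zero.2 (coef_pos _ _ hq).ne'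
    have e1 : dTotal F.1 j (latOf q) = 0 := by
      have h := dTotal_formZ hF j hq
      rw [h1] at h
      exact (smul_eq_zero_iff_right (hc _)).1 h.symm
    have e2 := dVol_sub_dTotal hF j hq
    have e3 := dTauBar_sub_dTotal hF j hq
    rw [h2, sub_self] at e2
    rw [h3, sub_self] at e3
    have e4 := (smul_eq_zero_iff_right (div_ne_zero (hc j) (by
      exact mul_ne_zero (mul_ne_zero two_ne_zero hlC) hyC))).1 e2.symm
    have e5 := (smul_eq_zero_iff_right (div_ne_zero (mul_ne_zero (mul_ne_zero
      (neg_ne_zero.2 Complex.I_ne_zero) (hc j)) hlC) (mul_ne_zero (by norm_num) hyC))).1 e3.symm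
    obtain ⟨e6, e7⟩ := (pair_eq_zero_iff hq.1).1 ⟨e4, e5⟩
    refine ⟨?_, fun i => ?_⟩
    · rw [dTotal_rotate hF.smooth₀ hF.spin₀ j u _ (latOf_mem hq), e1, smul_zero]; rfl
    · rw [residual_rotate hF i j u _ (latOf_mem hq)]
      fin_cases i
      · simp [e6]
      · simp [e7]

end Smooth

end Equations

/-! ### Invariance under changes of basis in terms of the triple -/

section BaseChange

open Matrix (SpecialLinearGroup)

variable {E : Type*} [NormedAddCommGroup E] [NormedSpace ℝ E]
  {M : Type*} [TopologicalSpace M] [ChartedSpace E M]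
  {j : ℕ} {n : ℤ} {F : SuperFun E M}

/-- The unit complex number in the direction of `ε`. -/
noncomputable def unitDir (ε : ℂ) (hε : ε ≠ 0) : Circle :=
  ⟨ε / ‖ε‖, mem_sphere_zero_iff_norm.2 (by
    rw [norm_div, Complex.norm_real, norm_norm, div_self (norm_ne_zero_iff.2 hε)])⟩

theorem norm_mul_unitDir {ε : ℂ} (hε : ε ≠ 0) : (‖ε‖ : ℂ) * unitDir ε hε = ε :=
  mul_div_cancel₀ ε (Complex.ofReal_ne_zero.2 (norm_ne_zero_iff.2 hε))

theorem ne_zero_of_sq {γ : SpecialLinearGroup (Fin 2) ℤ} {q : ℂ × ℝ} (hq : q ∈ torSet) {ε : ℂ}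
    (hε : ε ^ 2 = cocycle γ q.1) : ε ≠ 0 := by
  rintro rfl
  exact cocycle_ne_zero γ hq.1 (by rw [← hε]; norm_num)

/-- A change of basis of the lattice `(ℓ τ, ℓ)` gives a rotation of the lattice `(ℓ' γτ, ℓ')`. -/
theorem baseChange_latOf (γ : SpecialLinearGroup (Fin 2) ℤ) {q : ℂ × ℝ} (hq : q ∈ torSet) {ε : ℂ}
    (hε : ε ^ 2 = cocycle γ q.1) : baseChange γ (latOf q) = fun i =>
      (unitDir ε (ne_zero_of_sq hq hε) : ℂ) ^ 2 * latOf (moebius γ q.1,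
          ‖cocycle γ q.1‖ * q.2) i := by
  have h0 := ne_zero_of_sq hq hε
  have h1 : (unitDir ε h0 : ℂ) ^ 2 * ‖cocycle γ q.1‖ = cocycle γ q.1 := by
    rw [← hε, norm_pow, Complex.ofReal_pow, ← mul_pow, mul_comm, norm_mul_unitDir]
  have h2 := moebius_mul_cocycle γ hq.1
  funext i
  fin_cases i
  · simp only [baseChange, latOf, Fin.sum_univ_two, Fin.zero_eta, Matrix.cons_val_zero,
      Matrix.cons_val_one, Complex.ofReal_mul]
    linear_combination (-(q.2 : ℂ)) * h2 - (q.2 : ℂ) * moebius γ q.1 * h1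
  · simp only [baseChange, latOf, Fin.sum_univ_two, Fin.mk_one, Matrix.cons_val_zero,
      Matrix.cons_val_one, Complex.ofReal_mul]
    have h3 : cocycle γ q.1 = γ 1 0 * q.1 + γ 1 1 := rfl
    linear_combination (-(q.2 : ℂ)) * h3 - (q.2 : ℂ) * h1

/-- Under `SL₂(ℤ)` the powers of `ℓ` and `im τ` contribute the absolute value of the automorphy
factor; its direction comes from the action of `Spin(2)`. -/
theorem coef_moebius {a b : ℝ} {k : ℤ} (hk : (k : ℝ) = 2 * a - 4 * b)
    (γ : SpecialLinearGroup (Fin 2) ℤ) {q : ℂ × ℝ} (hq : q ∈ torSet) {ε : ℂ}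
    (hε : ε ^ 2 = cocycle γ q.1) :
    coef a b (moebius γ q.1, ‖cocycle γ q.1‖ * q.2) = ‖ε‖ ^ k * coef a b q := by
  have hr : 0 < ‖ε‖ := norm_pos_iff.2 (ne_zero_of_sq hq hε)
  have hy : 0 < q.1.im := hq.1
  have hl : 0 < q.2 := hq.2
  have h1 : 2 * (q.1.im / (‖ε‖ ^ 2) ^ 2) = 2 * q.1.im * ‖ε‖ ^ (-4 : ℝ) := by
    rw [show (-4 : ℝ) = ((-4 : ℤ) : ℝ) by norm_num, Real.rpow_intCast, zpow_neg]
    have : ‖ε‖ ^ (4 : ℤ) = (‖ε‖ ^ 2) ^ 2 := by rw [← pow_mul]; norm_cast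
    rw [this]
    ring
  rw [coef, coef, moebius_im, Complex.normSq_eq_norm_sq, ← hε, norm_pow, h1,
    Real.mul_rpow (by positivity) hl.le, Real.mul_rpow (by positivity) (by positivity),
    ← Real.rpow_natCast ‖ε‖ 2, ← Real.rpow_mul hr.le, ← Real.rpow_mul hr.le, ← Real.rpow_intCast,
        hk,
    show 2 * a - 4 * b = (2 : ℕ) * a + -4 * b by push_cast; ring, Real.rpow_add hr]
  ring

theorem baseChange_rotate (γ : SpecialLinearGroup (Fin 2) ℤ) (z : ℂ) (p : Fin 2 → ℂ) :
    baseChange γ (fun i => z * p i) = fun i => z * baseChange γ p i := by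
  funext i
  simp only [baseChange, Finset.mul_sum]
  exact Finset.sum_congr rfl fun k _ => by ring

theorem baseChange_latOf_mem (γ : SpecialLinearGroup (Fin 2) ℤ) {q : ℂ × ℝ} (hq : q ∈ torSet) :
    baseChange γ (latOf q) ∈ latSet := by
  obtain ⟨ε, hε⟩ := exists_sq_eq (cocycle γ q.1)
  rw [baseChange_latOf γ hq hε]
  exact rotate_mem _ (latOf_mem (moebius_smul_mem γ hq))

theorem smul_eq_smul_iff {A : Type*} [AddCommGroup A] [Module ℂ A] {s t w : ℂ} (ht : t ≠ 0)
    (h : s = t * w) {x y : A} : s • x = t • y ↔ w • x = y := by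
  rw [h, mul_smul, smul_right_inj ht]

/-- Invariance of `F₀` under `SL₂(ℤ)` means that `Z` has values in modular forms. -/
theorem sl_invariant₀_iff (hF : IsSpinFun n F) (j : ℕ) :
    (∀ (γ : SpecialLinearGroup (Fin 2) ℤ), ∀ p ∈ latSet, F.1 j (baseChange γ p) = F.1 j p) ↔
      ∀ q ∈ torSet, ∀ (γ : SpecialLinearGroup (Fin 2) ℤ) (ε : ℂ), ε ^ 2 = cocycle γ q.1 →
        formZ n F j (moebius γ q.1, ‖cocycle γ q.1‖ * q.2) =
          (ε ^ (-(n - j)) * conj ε ^ (-(0 : ℤ))) • formZ n F j q := by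
  have key : ∀ q ∈ torSet, ∀ (γ : SpecialLinearGroup (Fin 2) ℤ) (ε : ℂ), ε ^ 2 = cocycle γ q.1 →
      (formZ n F j (moebius γ q.1, ‖cocycle γ q.1‖ * q.2) =
          (ε ^ (-(n - j)) * conj ε ^ (-(0 : ℤ))) • formZ n F j q ↔
        F.1 j (baseChange γ (latOf q)) = F.1 j (latOf q)) := by
    intro q hq γ ε hε
    have h0 := ne_zero_of_sq hq hε
    have hr : (‖ε‖ : ℂ) ≠ 0 := Complex.ofReal_ne_zero.2 (norm_ne_zero_iff.2 h0)
    have hc : (coefZ n j q : ℂ) ≠ 0 := Complex.ofReal_ne_zero.2 (coef_pos _ _ hq).ne'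
    have hq' := moebius_smul_mem γ hq
    have hz : coefZ n j (moebius γ q.1, ‖cocycle γ q.1‖ * q.2) = ‖ε‖ ^ (-(n - j)) * coefZ n j q :=
      coef_moebius (by push_cast; ring) γ hq hε
    rw [baseChange_latOf γ hq hε, hF.spin₀ j _ _ (latOf_mem hq'), formZ_of_mem n F j hq,
      formZ_of_mem n F j hq', hz, smul_smul]
    refine smul_eq_smul_iff (mul_ne_zero (mul_ne_zero (zpow_ne_zero _ h0) (by simp)) hc) ?_
    have hεu := (norm_mul_unitDir h0).symm
    generalize unitDir ε h0 = u at hεu ⊢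
    have hu := Circle.coe_ne_zero u
    rw [Complex.ofReal_mul, Complex.ofReal_zpow, neg_zero, zpow_zero, mul_one]
    generalize ‖ε‖ = r at hr hεu ⊢
    rw [hεu, mul_zpow, zpow_neg (u : ℂ)]
    field_simp
  constructor
  · intro h q hq γ ε hε
    exact (key q hq γ ε hε).2 (h γ _ (latOf_mem hq))
  · intro h γ p hp
    obtain ⟨u, q, hq, rfl⟩ := exists_rotate_latOf hp
    obtain ⟨ε, hε⟩ := exists_sq_eq (cocycle γ q.1)
    rw [baseChange_rotate, hF.spin₀ j u _ (baseChange_latOf_mem γ hq), hF.spin₀ j u _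
        (latOf_mem hq),
      (key q hq γ ε hε).1 (h q hq γ ε hε)]

/-- Invariance of `F₁, F₂` under `SL₂(ℤ)` means that `Z_v` and `Z_{τ̄}` have values in modular
forms. The two laws are equivalent only jointly, as `SL₂(ℤ)` mixes `F₁` and `F₂`. -/
theorem sl_invariant_iff (hF : IsSpinFun n F) (j : ℕ) :
    (∀ (γ : SpecialLinearGroup (Fin 2) ℤ), ∀ p ∈ latSet, ∀ k,
        ∑ i, (γ i k : ℂ) • F.2 i j (baseChange γ p) = F.2 k j p) ↔
      ∀ q ∈ torSet, ∀ (γ : SpecialLinearGroup (Fin 2) ℤ) (ε : ℂ), ε ^ 2 = cocycle γ q.1 →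
        formZv n F j (moebius γ q.1, ‖cocycle γ q.1‖ * q.2) =
          (ε ^ (-(n - 1 - j)) * conj ε ^ (-(0 : ℤ))) • formZv n F j q ∧
        formZτ n F j (moebius γ q.1, ‖cocycle γ q.1‖ * q.2) =
          (ε ^ (-(n - 1 - j)) * conj ε ^ (-(-4 : ℤ))) • formZτ n F j q := by
  have key : ∀ q ∈ torSet, ∀ (γ : SpecialLinearGroup (Fin 2) ℤ) (ε : ℂ), ε ^ 2 = cocycle γ q.1 →
      ((formZv n F j (moebius γ q.1, ‖cocycle γ q.1‖ * q.2) =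
          (ε ^ (-(n - 1 - j)) * conj ε ^ (-(0 : ℤ))) • formZv n F j q ∧
        formZτ n F j (moebius γ q.1, ‖cocycle γ q.1‖ * q.2) =
          (ε ^ (-(n - 1 - j)) * conj ε ^ (-(-4 : ℤ))) • formZτ n F j q) ↔
        ∀ k, ∑ i, (γ i k : ℂ) • F.2 i j (baseChange γ (latOf q)) = F.2 k j (latOf q)) := by
    intro q hq γ ε hε
    have h0 := ne_zero_of_sq hq hε
    have hr : (‖ε‖ : ℂ) ≠ 0 := Complex.ofReal_ne_zero.2 (norm_ne_zero_iff.2 h0)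
    have hq' := moebius_smul_mem γ hq
    set u := unitDir ε h0 with hudef
    have hu := Circle.coe_ne_zero u
    have hεu : ε = ‖ε‖ * u := (norm_mul_unitDir h0).symm
    have hconj : conj ε = ‖ε‖ * (u : ℂ)⁻¹ := by
      rw [← conj_circle, ← Complex.conj_ofReal ‖ε‖, ← map_mul, ← hεu]
    have hJ : cocycle γ q.1 = γ 1 0 * q.1 + γ 1 1 := rfl
    have hm := moebius_mul_cocycle γ hq.1
    have hJ' := congrArg conj hJ
    have hm' := congrArg conj hm
    simp only [map_add, map_mul, map_intCast] at hJ' hm'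
    set A₀ := F.2 0 j (latOf (moebius γ q.1, ‖cocycle γ q.1‖ * q.2))
    set A₁ := F.2 1 j (latOf (moebius γ q.1, ‖cocycle γ q.1‖ * q.2))
    have hA : ∀ i, F.2 i j (baseChange γ (latOf q)) = (u : ℂ) ^ (n - j + 1) • ![A₀, A₁] i := by
      intro i
      rw [baseChange_latOf γ hq hε, hF.spin i j _ _ (latOf_mem hq')]
      fin_cases i <;> rfl
    -- the transformation laws are combinations of the two equations to be shown
    have e1 : formZv n F j (moebius γ q.1, ‖cocycle γ q.1‖ * q.2) =
          (ε ^ (-(n - 1 - j)) * conj ε ^ (-(0 : ℤ))) • formZv n F j q ↔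
        conj q.1 • ((u : ℂ) ^ (n - j + 1) • ((γ 0 0 : ℂ) • A₀ + (γ 1 0 : ℂ) • A₁) - F.2 0 j
            (latOf q))
          + ((u : ℂ) ^ (n - j + 1) • ((γ 0 1 : ℂ) • A₀ + (γ 1 1 : ℂ) • A₁) - F.2 1 j (latOf q))
              = 0 := by
      have hc : (coef (-((n : ℝ) + j + 3) / 2) (-((j : ℝ) + 3) / 2) q : ℂ) ≠ 0 :=
        Complex.ofReal_ne_zero.2 (coef_pos _ _ hq).ne'
      rw [formZv_of_mem n F j hq, formZv_of_mem n F j hq',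
        coef_moebius (k := -(n - j - 3)) (by push_cast; ring) γ hq hε, smul_smul,
        smul_eq_smul_iff (w := (u : ℂ) ^ (n - j + 1) * conj (cocycle γ q.1))
          (mul_ne_zero (mul_ne_zero (zpow_ne_zero _ h0) (by simp)) (neg_ne_zero.2 hc)),
              ← sub_eq_zero]
      · have h4 : ((u : ℂ) ^ (n - j + 1) * conj (cocycle γ q.1)) • (conj (moebius γ q.1) • A₀ + A₁)
            - (conj q.1 • F.2 0 j (latOf q) + F.2 1 j (latOf q)) =
          conj q.1 • ((u : ℂ) ^ (n - j + 1) • ((γ 0 0 : ℂ) • A₀ + (γ 1 0 : ℂ) • A₁)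
            - F.2 0 j (latOf q)) + ((u : ℂ) ^ (n - j + 1) • ((γ 0 1 : ℂ) • A₀ + (γ 1 1 : ℂ) • A₁)
            - F.2 1 j (latOf q)) := by
          match_scalars
          · linear_combination (u : ℂ) ^ (n - j + 1) * hm'
          · linear_combination (u : ℂ) ^ (n - j + 1) * hJ'
          · ring
          · ring
        rw [h4]
      · rw [← hε, map_pow, hconj]
        generalize ‖ε‖ = r at hr hεu ⊢
        rw [hεu]
        rw [mul_zpow, neg_zero, zpow_zero, show -(n - j - 3) = -(n - 1 - j) + 2 by ring,
          show n - j + 1 = (n - 1 - j) + 2 by ring, Complex.ofReal_mul, Complex.ofReal_zpow,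
          zpow_add₀ hr, zpow_add₀ hu, zpow_neg (u : ℂ)]
        field_simp
    have e2 : formZτ n F j (moebius γ q.1, ‖cocycle γ q.1‖ * q.2) =
          (ε ^ (-(n - 1 - j)) * conj ε ^ (-(-4 : ℤ))) • formZτ n F j q ↔
        q.1 • ((u : ℂ) ^ (n - j + 1) • ((γ 0 0 : ℂ) • A₀ + (γ 1 0 : ℂ) • A₁) - F.2 0 j (latOf q))
          + ((u : ℂ) ^ (n - j + 1) • ((γ 0 1 : ℂ) • A₀ + (γ 1 1 : ℂ) • A₁) - F.2 1 j (latOf q))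
              = 0 := by
      have hc : (coef (-((n : ℝ) + j - 1) / 2) (-((j : ℝ) + 3) / 2) q : ℂ) ≠ 0 :=
        Complex.ofReal_ne_zero.2 (coef_pos _ _ hq).ne'
      have hc0 : conj ε ≠ 0 := (map_ne_zero _).2 h0
      rw [formZτ_of_mem n F j hq, formZτ_of_mem n F j hq',
        coef_moebius (k := -(n - j - 7)) (by push_cast; ring) γ hq hε, smul_smul,
        smul_eq_smul_iff (w := (u : ℂ) ^ (n - j + 1) * cocycle γ q.1)
          (mul_ne_zero (mul_ne_zero (zpow_ne_zero _ h0) (zpow_ne_zero _ hc0))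
            (mul_ne_zero (div_ne_zero Complex.I_ne_zero two_ne_zero) hc)), ← sub_eq_zero]
      · have h4 : ((u : ℂ) ^ (n - j + 1) * cocycle γ q.1) • (moebius γ q.1 • A₀ + A₁)
            - (q.1 • F.2 0 j (latOf q) + F.2 1 j (latOf q)) =
          q.1 • ((u : ℂ) ^ (n - j + 1) • ((γ 0 0 : ℂ) • A₀ + (γ 1 0 : ℂ) • A₁)
            - F.2 0 j (latOf q)) + ((u : ℂ) ^ (n - j + 1) • ((γ 0 1 : ℂ) • A₀ + (γ 1 1 : ℂ) • A₁)
            - F.2 1 j (latOf q)) := by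
          match_scalars
          · linear_combination (u : ℂ) ^ (n - j + 1) * hm
          · linear_combination (u : ℂ) ^ (n - j + 1) * hJ
          · ring
          · ring
        rw [h4]
      · rw [← hε, hconj]
        generalize ‖ε‖ = r at hr hεu ⊢
        rw [hεu]
        rw [mul_zpow, mul_zpow, neg_neg, show -(n - j - 7) = -(n - 1 - j) + 6 by ring,
          show n - j + 1 = (n - 1 - j) + 2 by ring, Complex.ofReal_mul, Complex.ofReal_zpow,
          zpow_add₀ hr, zpow_add₀ hu, zpow_neg (u : ℂ)]
        field_simp
    rw [e1, e2, pair_eq_zero_iff hq.1, Fin.forall_fin_two]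
    simp only [hA, Fin.sum_univ_two, Matrix.cons_val_zero, Matrix.cons_val_one, sub_eq_zero,
      smul_add, smul_comm _ ((u : ℂ) ^ (n - j + 1))]
  constructor
  · intro h q hq γ ε hε
    exact (key q hq γ ε hε).2 (h γ _ (latOf_mem hq))
  · intro h γ p hp k
    obtain ⟨u, q, hq, rfl⟩ := exists_rotate_latOf hp
    obtain ⟨ε, hε⟩ := exists_sq_eq (cocycle γ q.1)
    simp only [baseChange_rotate, hF.spin _ j u _ (baseChange_latOf_mem γ hq),
      hF.spin _ j u _ (latOf_mem hq), smul_comm _ ((u : ℂ) ^ (n - j + 1))]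
    rw [← Finset.smul_sum, (key q hq γ ε hε).1 (h q hq γ ε hε)]

end BaseChange

/-! ### The bijection between sections and triples -/

section Bijection

open Matrix (SpecialLinearGroup)

variable {E : Type*} [NormedAddCommGroup E] [NormedSpace ℝ E]
  {M : Type*} [TopologicalSpace M] [ChartedSpace E M] [IsManifold 𝓘(ℝ, E) ∞ M]
  {n : ℤ} {F : SuperFun E M}

omit [IsManifold 𝓘(ℝ, E) ∞ M] in
theorem IsSpinFun.isPfaffianSection (h : IsSpinFun n F)
    (htr : ∀ w : ℂ, ∀ p ∈ latSet, ∀ j x, pullAct w p F j x = pullProj p F j x)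
    (hsl₀ : ∀ j, ∀ (γ : SpecialLinearGroup (Fin 2) ℤ), ∀ p ∈ latSet,
      F.1 j (baseChange γ p) = F.1 j p)
    (hsl : ∀ j, ∀ (γ : SpecialLinearGroup (Fin 2) ℤ), ∀ p ∈ latSet, ∀ k,
      ∑ i, (γ i k : ℂ) • F.2 i j (baseChange γ p) = F.2 k j p) : IsPfaffianSection n F := by
  refine ⟨h.smooth₀, h.smooth, htr, fun γ p hp j => hsl₀ j γ p hp, fun γ p hp k j => hsl j γ p hp k,
    fun u p hp j => ?_, fun u p hp i j => ?_⟩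
  · rw [conj_circle, inv_zpow', neg_neg]
    exact (spinWeight_iff (k := j) (n := n) (by ring)).1 (h.spin₀ j) u p hp
  · rw [conj_circle, inv_zpow', neg_neg, mul_comm, ← zpow_sub_one₀ (Circle.coe_ne_zero u)]
    exact (spinWeight_iff (k := j - 1) (n := n) (by ring)).1 (h.spin i j) u p hp

theorem contDiffOn_ofReal_coef (a b : ℝ) :
    ContDiffOn ℝ ∞ (fun q => (coef a b q : ℂ)) torSet :=
  Complex.ofRealCLM.contDiff.comp_contDiffOn (contDiffOn_coef a b)

theorem contDiff_conj_fst : ContDiff ℝ ∞ fun q : ℂ × ℝ => conj q.1 :=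
  Complex.conjCLE.contDiff.comp contDiff_fst

omit [IsManifold 𝓘(ℝ, E) ∞ M] in
theorem formZ_mem_smoothForms (hF : IsSpinFun n F) (j : ℕ) :
    formZ n F j ∈ smoothForms E M torSet j := by
  have h := reparam_mem_smoothForms (hF.smooth₀ j) (contDiffOn_ofReal_coef (-((n : ℝ) + j) / 2)
    (-(j : ℝ) / 2)) contDiff_latOf.contDiffOn fun q hq => latOf_mem hq
  convert h using 1
  funext q
  by_cases hq : q ∈ torSet
  · rw [formZ_of_mem n F j hq, reparam_eq _ _ _ hq]
  · rw [formZ_of_notMem n F j hq, reparam_eq_zero _ _ _ hq]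

omit [IsManifold 𝓘(ℝ, E) ∞ M] in
theorem formZv_mem_smoothForms (hF : IsSpinFun n F) (j : ℕ) :
    formZv n F j ∈ smoothForms E M torSet j := by
  have hc := (contDiffOn_ofReal_coef (-((n : ℝ) + j + 3) / 2) (-((j : ℝ) + 3) / 2)).neg
  have h := add_mem (reparam_mem_smoothForms (hF.smooth 0 j) (hc.mul contDiff_conj_fst.contDiffOn)
    contDiff_latOf.contDiffOn fun q hq => latOf_mem hq)
    (reparam_mem_smoothForms (hF.smooth 1 j) hc contDiff_latOf.contDiffOn fun q hq => latOf_mem hq)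
  convert h using 1
  funext q
  by_cases hq : q ∈ torSet
  · rw [formZv_of_mem n F j hq, Pi.add_apply, reparam_eq _ _ _ hq, reparam_eq _ _ _ hq, smul_add,
      smul_smul]
  · rw [formZv_of_notMem n F j hq, Pi.add_apply, reparam_eq_zero _ _ _ hq, reparam_eq_zero _ _ _ hq,
      add_zero]

omit [IsManifold 𝓘(ℝ, E) ∞ M] in
theorem formZτ_mem_smoothForms (hF : IsSpinFun n F) (j : ℕ) :
    formZτ n F j ∈ smoothForms E M torSet j := by
  have hc := (contDiffOn_const (c := Complex.I / 2)).mul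
    (contDiffOn_ofReal_coef (-((n : ℝ) + j - 1) / 2) (-((j : ℝ) + 3) / 2))
  have h := add_mem (reparam_mem_smoothForms (hF.smooth 0 j) (hc.mul contDiffOn_fst)
    contDiff_latOf.contDiffOn fun q hq => latOf_mem hq)
    (reparam_mem_smoothForms (hF.smooth 1 j) hc contDiff_latOf.contDiffOn fun q hq => latOf_mem hq)
  convert h using 1
  funext q
  by_cases hq : q ∈ torSet
  · rw [formZτ_of_mem n F j hq, Pi.add_apply, reparam_eq _ _ _ hq, reparam_eq _ _ _ hq, smul_add,
      smul_smul]
  · rw [formZτ_of_notMem n F j hq, Pi.add_apply, reparam_eq_zero _ _ _ hq, reparam_eq_zero _ _ _ hq,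
      add_zero]

/-- A function of the right spin is a section if and only if its data form a triple. -/
theorem isPfaffianSection_iff (hF : IsSpinFun n F) :
    IsPfaffianSection n F ↔ IsTorusTriple n (torusData n F) := by
  constructor
  · intro h
    have h1 := (translation_invariant_iff hF).1 h.translation_invariant
    have h2 := fun j => (sl_invariant_iff hF j).1 fun γ p hp k => h.sl_invariant γ p hp k j
    exact ⟨fun j => mem_formsIn_mf_iff.2 ⟨formZ_mem_smoothForms hF j,
        (sl_invariant₀_iff hF j).1 fun γ p hp => h.sl_invariant₀ γ p hp j⟩,
      fun j => mem_formsIn_mf_iff.2 ⟨formZv_mem_smoothForms hF j,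
        fun q hq γ ε hε => (h2 j q hq γ ε hε).1⟩,
      fun j => mem_formsIn_mf_iff.2 ⟨formZτ_mem_smoothForms hF j,
        fun q hq γ ε hε => (h2 j q hq γ ε hε).2⟩, h1.1, h1.2.1, h1.2.2⟩
  · intro h
    exact hF.isPfaffianSection ((translation_invariant_iff hF).2 ⟨h.closed, h.dVol_eq,
        h.dTauBar_eq⟩)
      (fun j => (sl_invariant₀_iff hF j).2 (mem_formsIn_mf_iff.1 (h.mem_Z j)).2)
      (fun j => (sl_invariant_iff hF j).2 fun q hq γ ε hε =>
        ⟨(mem_formsIn_mf_iff.1 (h.mem_Zv j)).2 q hq γ ε hε,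
          (mem_formsIn_mf_iff.1 (h.mem_Zτ j)).2 q hq γ ε hε⟩)

omit [IsManifold 𝓘(ℝ, E) ∞ M] in
/-- Functions of the right spin are determined by their data. -/
theorem torusData_injOn {F' : SuperFun E M} (hF : IsSpinFun n F) (hF' : IsSpinFun n F')
    (h : torusData n F = torusData n F') : F = F' := by
  have h0 : formZ n F = formZ n F' := congrArg Prod.fst h
  have h1 : formZv n F = formZv n F' := congrArg (fun t : Triple E M => t.2.1) h
  have h2 : formZτ n F = formZτ n F' := congrArg (fun t : Triple E M => t.2.2) h
  have key : ∀ q ∈ torSet, ∀ j : ℕ, F.2 0 j (latOf q) - F'.2 0 j (latOf q) = 0 ∧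
      F.2 1 j (latOf q) - F'.2 1 j (latOf q) = 0 := by
    intro q hq j
    rw [← pair_eq_zero_iff hq.1]
    have e1 := congrFun (congrFun h1 j) q
    have e2 := congrFun (congrFun h2 j) q
    rw [formZv_of_mem n F j hq, formZv_of_mem n F' j hq, smul_right_inj
      (neg_ne_zero.2 (Complex.ofReal_ne_zero.2 (coef_pos _ _ hq).ne')), ← sub_eq_zero] at e1
    rw [formZτ_of_mem n F j hq, formZτ_of_mem n F' j hq, smul_right_inj
      (mul_ne_zero (div_ne_zero Complex.I_ne_zero two_ne_zero)
        (Complex.ofReal_ne_zero.2 (coef_pos _ _ hq).ne')), ← sub_eq_zero] at e2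
    constructor
    · rw [← e1]; module
    · rw [← e2]; module
  refine Prod.ext (funext fun j => ?_) (funext fun i => funext fun j => ?_)
  · refine (hF.spin₀ j).eq_of_latOf (hF'.spin₀ j) (hF.smooth₀ j).1 (hF'.smooth₀ j).1 fun q hq => ?_
    have e := congrFun (congrFun h0 j) q
    rwa [formZ_of_mem n F j hq, formZ_of_mem n F' j hq, smul_right_inj
      (Complex.ofReal_ne_zero.2 (coef_pos _ _ hq).ne')] at e
  · refine (hF.spin i j).eq_of_latOf (hF'.spin i j) (hF.smooth i j).1 (hF'.smooth i j).1
      fun q hq => ?_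
    fin_cases i
    · exact sub_eq_zero.1 (key q hq j).1
    · exact sub_eq_zero.1 (key q hq j).2

/-- The function on the space of nearly constant supertori with given data: `F₀` is a multiple of
`Z`, and `F₁, F₂` are found by solving the two linear equations that define `Z_v` and `Z_{τ̄}`. -/
theorem exists_isSpinFun {t : Triple E M} (ht : IsTorusTriple n t) :
    ∃ F : SuperFun E M, IsSpinFun n F ∧ torusData n F = t := by
  have hZ := fun j => (ht.mem_Z j).1
  have hZv := fun j => (ht.mem_Zv j).1
  have hZτ := fun j => (ht.mem_Zτ j).1
  have hmul : ∀ {j : ℕ} {c : ℂ × ℝ → ℂ} {α : FormFamily E M (ℂ × ℝ) j},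
      α ∈ smoothForms E M torSet j → ContDiffOn ℝ ∞ c torSet →
      reparam torSet c id α ∈ smoothForms E M torSet j := fun hα hc =>
    reparam_mem_smoothForms hα hc contDiffOn_id fun q hq => hq
  have hzero : ∀ {j : ℕ} (c : ℂ × ℝ → ℂ) {α : FormFamily E M (ℂ × ℝ) j}, α = 0 →
      reparam torSet c id α = 0 := by
    rintro j c α rfl
    funext q x
    simp [reparam]
  have hcoef : ∀ a b, ∀ q ∈ torSet, (coef a b q : ℂ) ≠ 0 := fun a b q hq =>
    Complex.ofReal_ne_zero.2 (coef_pos a b hq).ne'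
  have hdisc : ∀ q ∈ torSet, q.1 - conj q.1 ≠ 0 := fun q hq => by
    rw [Complex.sub_conj]
    exact mul_ne_zero (by exact_mod_cast mul_ne_zero two_ne_zero (ne_of_gt hq.1)) Complex.I_ne_zero
  have hdiscs : ContDiffOn ℝ ∞ (fun q : ℂ × ℝ => (q.1 - conj q.1)⁻¹) torSet :=
    (contDiff_fst.sub contDiff_conj_fst).contDiffOn.inv hdisc
  let c₀ : ℕ → ℂ × ℝ → ℂ := fun j q => (coefZ n j q : ℂ)⁻¹
  let a : ℕ → ℂ × ℝ → ℂ := fun j q => (q.1 - conj q.1)⁻¹ *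
    ((Complex.I / 2)⁻¹ * (coef (-((n : ℝ) + j - 1) / 2) (-((j : ℝ) + 3) / 2) q : ℂ)⁻¹)
  let b : ℕ → ℂ × ℝ → ℂ := fun j q => (q.1 - conj q.1)⁻¹ *
    (coef (-((n : ℝ) + j + 3) / 2) (-((j : ℝ) + 3) / 2) q : ℂ)⁻¹
  have hc₀ : ∀ j, ContDiffOn ℝ ∞ (c₀ j) torSet := fun j =>
    (contDiffOn_ofReal_coef _ _).inv (hcoef _ _)
  have ha : ∀ j, ContDiffOn ℝ ∞ (a j) torSet := fun j =>
    hdiscs.mul (contDiffOn_const.mul ((contDiffOn_ofReal_coef _ _).inv (hcoef _ _)))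
  have hb : ∀ j, ContDiffOn ℝ ∞ (b j) torSet := fun j =>
    hdiscs.mul ((contDiffOn_ofReal_coef _ _).inv (hcoef _ _))
  let β : (i : Fin 2) → (j : ℕ) → FormFamily E M (ℂ × ℝ) j := fun i j =>
    reparam torSet (fun q => ![1, -conj q.1] i * a j q) id (t.2.2 j) +
      reparam torSet (fun q => ![1, -q.1] i * b j q) id (t.2.1 j)
  have hβ : ∀ i j, β i j ∈ smoothForms E M torSet j := by
    intro i j
    refine add_mem (hmul (hZτ j) (ContDiffOn.mul ?_ (ha j))) (hmul (hZv j) (ContDiffOn.mul ?_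
        (hb j)))
    · fin_cases i
      · exact contDiffOn_const
      · exact contDiff_conj_fst.neg.contDiffOn
    · fin_cases i
      · exact contDiffOn_const
      · exact contDiffOn_fst.neg
  let F : SuperFun E M := (fun j => latExt (n - j) (reparam torSet (c₀ j) id (t.1 j)),
    fun i j => latExt (n - j + 1) (β i j))
  have hF : IsSpinFun n F := by
    refine ⟨fun j => latExt_mem_smoothForms _ (hmul (hZ j) (hc₀ j)),
      fun i j => latExt_mem_smoothForms _ (hβ i j), fun j => latExt_spinWeight fun hodd => ?_,
      fun i j => latExt_spinWeight fun hodd => ?_⟩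
    · exact hzero _ (eq_zero_of_odd hodd (by decide) (ht.mem_Z j))
    · have hodd' : Odd (n - 1 - (j : ℤ)) := by
        rw [show n - 1 - (j : ℤ) = n - j + 1 - 2 by ring]
        exact hodd.sub_even even_two
      have e1 := hzero (fun q => ![1, -conj q.1] i * a j q)
        (eq_zero_of_odd hodd' (by decide) (ht.mem_Zτ j))
      have e2 := hzero (fun q => ![1, -q.1] i * b j q)
        (eq_zero_of_odd hodd' (by decide) (ht.mem_Zv j))
      exact (congrArg₂ (· + ·) e1 e2).trans (add_zero _)
  have hF0 : ∀ j, ∀ q ∈ torSet, F.1 j (latOf q) = c₀ j q • t.1 j q := fun j q hq =>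
    (latExt_latOf _ _ hq).trans (reparam_eq _ _ _ hq)
  have hFi : ∀ i j, ∀ q ∈ torSet, F.2 i j (latOf q) =
      (![1, -conj q.1] i * a j q) • t.2.2 j q + (![1, -q.1] i * b j q) • t.2.1 j q :=
    fun i j q hq => (latExt_latOf _ _ hq).trans
      (congrArg₂ (· + ·) (reparam_eq _ _ _ hq) (reparam_eq _ _ _ hq))
  refine ⟨F, hF, Prod.ext ?_ (Prod.ext ?_ ?_)⟩ <;> funext j q <;> by_cases hq : q ∈ torSet
  · change formZ n F j q = _
    rw [formZ_of_mem n F j hq, hF0 j q hq, smul_smul, mul_inv_cancel₀ (hcoef _ _ q hq), one_smul]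
  · exact (formZ_of_notMem n F j hq).trans ((hZ j).1 q hq).symm
  · change formZv n F j q = _
    have e1 := hcoef (-((n : ℝ) + j + 3) / 2) (-((j : ℝ) + 3) / 2) q hq
    have e2 := hdisc q hq
    rw [formZv_of_mem n F j hq, hFi 0 j q hq, hFi 1 j q hq]
    simp only [Matrix.cons_val_zero, Matrix.cons_val_one, b]
    generalize coef (-((n : ℝ) + j + 3) / 2) (-((j : ℝ) + 3) / 2) q = c at e1 ⊢
    match_scalars
    · ring
    · field_simp
      ring
  · exact (formZv_of_notMem n F j hq).trans ((hZv j).1 q hq).symm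
  · change formZτ n F j q = _
    have e1 := hcoef (-((n : ℝ) + j - 1) / 2) (-((j : ℝ) + 3) / 2) q hq
    have e2 := hdisc q hq
    rw [formZτ_of_mem n F j hq, hFi 0 j q hq, hFi 1 j q hq]
    simp only [Matrix.cons_val_zero, Matrix.cons_val_one, a]
    generalize coef (-((n : ℝ) + j - 1) / 2) (-((j : ℝ) + 3) / 2) q = c at e1 ⊢
    match_scalars
    · field_simp
      ring
    · ring
  · exact (formZτ_of_notMem n F j hq).trans ((hZτ j).1 q hq).symm

theorem bijOn_torusData (n : ℤ) : BijOn (torusData n) {F : SuperFun E M | IsPfaffianSection n F}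
    {t : Triple E M | IsTorusTriple n t} := by
  refine ⟨fun F hF => (isPfaffianSection_iff (IsPfaffianSection.isSpinFun hF)).1 hF,
    fun F hF F' hF' h => torusData_injOn (IsPfaffianSection.isSpinFun hF)
      (IsPfaffianSection.isSpinFun hF') h, fun t ht => ?_⟩
  obtain ⟨F, hF, rfl⟩ := exists_isSpinFun ht
  exact ⟨F, (isPfaffianSection_iff hF).2 ht, rfl⟩

end Bijection

end SuperTori

theorem mainTheorem10 {E : Type*} [NormedAddCommGroup E] [NormedSpace ℝ E] [FiniteDimensional ℝ E]
    {M : Type*} [TopologicalSpace M] [ChartedSpace E M] [IsManifold 𝓘(ℝ, E) ∞ M] [T2Space M]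
    [SecondCountableTopology M] (n : ℤ) :
    Set.BijOn (SuperTori.torusData n)
      {F : SuperTori.SuperFun E M | SuperTori.IsPfaffianSection n F}
      {t : SuperTori.Triple E M | SuperTori.IsTorusTriple n t} ∧
    ∀ F : SuperTori.SuperFun E M, SuperTori.IsPfaffianSection n F →
      SuperTori.formZ n F
        ∈ SuperTori.closedForms E M SuperTori.torSet (fun k => SuperTori.mf k 0) n ∧
      SuperTori.dVol (SuperTori.formZ n F)
        ∈ SuperTori.exactForms E M SuperTori.torSet (fun k => SuperTori.mf k 0) n ∧
      SuperTori.dTauBar (SuperTori.formZ n F)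
        ∈ SuperTori.exactForms E M SuperTori.torSet (fun k => SuperTori.mf k (-4)) n ∧
      ∃! c : SuperTori.DeRham E M SuperTori.upperHalf SuperTori.MFgraded n,
        ∃ W : SuperTori.closedForms E M SuperTori.upperHalf SuperTori.MFgraded n,
          Submodule.Quotient.mk W = c ∧
          SuperTori.pullTau W.1 - SuperTori.formZ n F
            ∈ SuperTori.exactForms E M SuperTori.torSet (fun k => SuperTori.mf k 0) n := by
  refine ⟨SuperTori.bijOn_torusData n, fun F hF => ?_⟩
  have ht : SuperTori.IsTorusTriple n (SuperTori.torusData n F) :=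
    (SuperTori.bijOn_torusData n).mapsTo hF
  exact ⟨⟨ht.mem_Z, ht.closed⟩, ⟨_, ht.mem_Zv, ht.dVol_eq⟩, ⟨_, ht.mem_Zτ, ht.dTauBar_eq⟩,
    SuperTori.existsUnique_class ht⟩
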